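/- Let $F$ be a non-archimedean local field of characteristic $p>0$, with ring of integers $\mathcal O_F$, maximal ideal $\mathfrak p$, uniformizer $\varpi$ and residue field of cardinality $q$; its coefficient field is $\mathbb F_q\subset\mathcal O_F$. Let $\overline F$ be a separable closure of $F$, ${\bf C}$ its completion, $\widehat F^{\rm ur}\subset {\bf C}$ the completion of the maximal unramified extension of $F$, $\mathbb F$ the residue field of $\widehat F^{\rm ur}$, and $v$ the valuation on ${\bf C}$ with $v(\varpi)=1$. Let $\mathscr F_0$ be the one-dimensional formal $\mathcal O_F$-module over $\mathbb F$ with additive group law, $[\varpi]_{\mathscr F_0}(X)=X^{q^2}$ and $[a]_{\mathscr F_0}(X)=aX$ for $a\in\mathbb F_q$. For an integer $k\ge 2$ let $R(\mathfrak p^k)$ represent the functor which sends a complete noetherian local $\mathcal O_{\widehat F^{\rm ur}}$-algebra $A$ with residue field $\mathbb F$ to the set of isomorphism classes of triples $(\mathscr F_A,\rho,\phi)$, where $\mathscr F_A$ is a formal $\mathcal O_F$-module over $A$, $\rho\colon\mathscr F_0\to\mathscr F_A\otimes_A\mathbb F$ is an isomorphism, and $\phi\colon(\mathcal O_F/\mathfrak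 p^k)^2\to\mathscr F_A[\mathfrak p^k](A)$ is a Drinfeld level $\mathfrak p^k$-structure, i.e. an $\mathcal O_F$-homomorphism such that $\prod_x(X-\phi(x))$ divides $[\varpi'^k]_{\mathscr F_A}(X)$ in $A[[X]]$ for every prime element $\varpi'$ of $F$. Let the coordinate of the universal formal module over $R(\mathfrak p^k)$ be chosen such that its group law is additive, $[\varpi](X)=X^{q^2}+uX^q+\varpi X$ for some $u\in R(\mathfrak p^k)$, and $[a](X)=aX$ for $a\in\mathbb F_q$. Let $X_k,Y_k\in R(\mathfrak p^k)$ be the images of the standard basis vectors under the universal level structure. Let $\zeta\in\mathbb F_{q^2}\setminus\mathbb F_q$. Let $\varpi_k\in\overline F$ be a primitive $\varpi^k$-torsion point of the formal module with additive group law and $[\varpi](X)=X^{q^2}+\varpi X$: the $k$-fold iterate of $X\mapsto X^{q^2}+\varpi X$ kills $\varpi_k$, and the $(k-1)$-fold iterate does not. Put $K_k=\widehat F^{\rm ur}(\varpi_k)$, $S_k=X_k-\varpi_k$, $T_k=Y_k-\zeta\varpi_k$, $U_k=\zeta^qS_k-T_k$, $m=\lfloor (k+1)/2\rfloor$ and $h=1/(q^2-1)$.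 Let ${\bf X}_{k,k,\zeta,\varpi_k,K_k}$ be the affinoid subdomain of the Lubin–Tate curve $(\operatorname{Spf}R(\mathfrak p^k))^{\rm rig}$, base changed to $K_k$, which is defined by $$v(u)\ge\begin{cases}m & (k\text{ even})\\ m-\frac1{q+1} & (k\text{ odd}),\end{cases}\qquad v(S_k)\ge h/q^{k-1},\qquad v(U_k)\ge h.$$ Let $A_k$ be its affinoid algebra, $A_k^\circ$ the ring of power-bounded elements of $A_k$, and $A_k^{\circ\circ}$ the ideal of topologically nilpotent elements of $A_k^\circ$. Then the residue field of $\mathcal O_{K_k}$ is $\mathbb F$, and the following hold. 1. The formal scheme $\operatorname{Spf}A_k^\circ\to\operatorname{Spf}\mathcal O_{K_k}$ is smoothly algebraizable: it is topologically finitely presented, and there is a scheme which is smooth, separated and of finite type over $\mathcal O_{K_k}$ and whose formal completion along its special fibre is isomorphic to $\operatorname{Spf}A_k^\circ$ over $\operatorname{Spf}\mathcal O_{K_k}$. 2. The canonical map $A_k^\circ\to A_k^\circ\otimes_{\mathcal O_{K_k}}\mathbb F$ induces an isomorphism $\overline{A_k}=A_k^\circ/A_k^{\circ\circ}\simeq A_k^\circ\otimes_{\mathcal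 O_{K_k}}\mathbb F$, and $$A_k^\circ\otimes_{\mathcal O_{K_k}}\mathbb F\;\simeq\;\mathbb F[X,Y]\Big/\Big(X^{q^2}-X-\big(Y^{q(q+1)}-Y^{q+1}\big)^{q^{k-1}}\Big)$$ as $\mathbb F$-algebras. So the canonical reduction $\operatorname{Spec}\overline{A_k}$ is the affine curve $X^{q^2}-X=(Y^{q(q+1)}-Y^{q+1})^{q^{k-1}}$ over $\mathbb F$. -/

import Mathlib

open scoped TensorProduct
open AlgebraicGeometry CategoryTheory

universe u

noncomputable section

namespace LubinTateCurve

/-! ### Valuation rings, and the fields `F^ur`, its completion, and `K_k` -/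

section Fields

/-- The valuation ring `𝒪_K = {x | ‖x‖ ≤ 1}` of a non-archimedean normed field. -/
abbrev integers (K : Type*) [NormedField K] [IsUltrametricDist K] : ValuationSubring K :=
  (NormedField.valuation (K := K)).valuationSubring

lemma mem_integers {K : Type*} [NormedField K] [IsUltrametricDist K] (x : K) :
    x ∈ integers K ↔ ‖x‖ ≤ 1 := by
  rw [Valuation.mem_valuationSubring_iff, NormedField.valuation_apply, ← NNReal.coe_le_coe]
  simp

/-- The map of valuation rings induced by a norm preserving homomorphism of fields. -/
def integersMap {K L : Type*} [NormedField K] [IsUltrametricDist K] [NormedField L]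
    [IsUltrametricDist L] (f : K →+* L) (hf : ∀ x, ‖f x‖ = ‖x‖) : integers K →+* integers L :=
  (f.comp (integers K).subtype).codRestrict (integers L) fun x => by
    rw [mem_integers]
    simpa [hf] using (mem_integers _).1 x.2

instance instUltrametricCompletion (L : Type*) [NormedField L] [IsUltrametricDist L] :
    IsUltrametricDist (UniformSpace.Completion L) :=
  IsUltrametricDist.isUltrametricDist_of_isNonarchimedean_norm fun x y => by
    induction x, y using UniformSpace.Completion.induction_on₂ with
    | hp => exact isClosed_le (by fun_prop) (by fun_prop)
    | ih x y =>
      simpa only [← UniformSpace.Completion.coe_add, UniformSpace.Completion.norm_coe] using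
        IsUltrametricDist.isNonarchimedean_norm x y

instance instUltrametricSubfield (L : Type*) [NormedField L] [IsUltrametricDist L]
    (S : Subfield L) : IsUltrametricDist S :=
  IsUltrametricDist.subtype _

variable (F Fbar : Type*) [NontriviallyNormedField F] [IsUltrametricDist F]
  [NormedField Fbar] [NormedAlgebra F Fbar] [IsUltrametricDist Fbar]

/-- The maximal unramified extension `F^ur` of a local field `F` inside `Fbar`: the compositum of
all finite subextensions with ramification index one, i.e. with the same value group as `F`
(the residue fields of a local field being finite, residue extensions are separable). -/
def maximalUnramified : IntermediateField F Fbar :=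
  sSup {L | FiniteDimensional F L ∧ ∀ x ∈ L, ∃ y : F, ‖y‖ = ‖x‖}

/-- The completion of `F^ur`, as its closure in the completion `C` of `Fbar`. -/
def completedUnramified : Subfield (UniformSpace.Completion Fbar) :=
  ((maximalUnramified F Fbar).toSubfield.map
    (UniformSpace.Completion.coeRingHom : Fbar →+* UniformSpace.Completion Fbar)).topologicalClosure

/-- The inclusion of `F` into the completion of `F^ur`. -/
def toCompletedUnramified : F →+* completedUnramified F Fbar :=
  ((UniformSpace.Completion.coeRingHom : Fbar →+* UniformSpace.Completion Fbar).comp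
    (algebraMap F Fbar)).codRestrict (completedUnramified F Fbar) fun x =>
      Subfield.le_topologicalClosure _
        ⟨algebraMap F Fbar x, (maximalUnramified F Fbar).algebraMap_mem x, rfl⟩

set_option linter.unusedSectionVars false in
lemma norm_toCompletedUnramified (x : F) : ‖toCompletedUnramified F Fbar x‖ = ‖x‖ := by
  change ‖((algebraMap F Fbar x : Fbar) : UniformSpace.Completion Fbar)‖ = ‖x‖
  rw [UniformSpace.Completion.norm_coe, norm_algebraMap']

/-- The inclusion of `𝒪_F` into the valuation ring of the completion of `F^ur`. -/
def integersToCompletedUnramified : integers F →+* integers (completedUnramified F Fbar) :=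
  integersMap (toCompletedUnramified F Fbar) (norm_toCompletedUnramified F Fbar)

/-- The extension of the completion of `F^ur` generated by an element of `Fbar`. -/
abbrev extensionBy (x : Fbar) :
    IntermediateField (completedUnramified F Fbar) (UniformSpace.Completion Fbar) :=
  IntermediateField.adjoin (completedUnramified F Fbar) {(x : UniformSpace.Completion Fbar)}

end Fields

/-! ### Formal modules and their level structures -/

section FormalModules

open MvPowerSeries in
/-- A one-dimensional (commutative) formal `𝒪`-module over `A`, where `A` is an `𝒪`-algebra through
`i`: a commutative formal group law `G` with a ring homomorphism `a ↦ [a]` from `𝒪` to `End G` such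
that `[a](X) = i(a) X + ⋯`. -/
structure FormalModule {𝒪 A : Type*} [CommRing 𝒪] [CommRing A] (i : 𝒪 →+* A) where
  /-- the formal group law -/
  group : FormalGroup A
  comm : group.IsComm
  /-- the power series `[a](X)` -/
  act : 𝒪 → PowerSeries A
  act_constantCoeff : ∀ a, (act a).constantCoeff = 0
  act_coeff_one : ∀ a, (act a).coeff 1 = i a
  act_group : ∀ a, (act a).subst group.toPowerSeries =
    group.toPowerSeries.subst
      ![(act a).subst (X 0 : MvPowerSeries (Fin 2) A), (act a).subst (X 1 : MvPowerSeries (Fin 2) A)]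
  act_one : act 1 = PowerSeries.X
  act_mul : ∀ a b, act (a * b) = (act a).subst (act b)
  act_add : ∀ a b, act (a + b) = group.toPowerSeries.subst ![act a, act b]

variable {𝒪 A B : Type*} [CommRing 𝒪] [CommRing A] [CommRing B]

lemma map_vec (h : A →+* B) {σ : Type*} (f g : MvPowerSeries σ A) :
    (fun s => MvPowerSeries.map h (![f, g] s)) =
      ![MvPowerSeries.map h f, MvPowerSeries.map h g] := by
  ext1 s; fin_cases s <;> rfl

lemma hasSubst_vec {σ : Type*} {f g : MvPowerSeries σ A} (hf : f.constantCoeff = 0)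
    (hg : g.constantCoeff = 0) : MvPowerSeries.HasSubst ![f, g] :=
  MvPowerSeries.hasSubst_of_constantCoeff_zero fun s => by fin_cases s <;> simpa

lemma constantCoeff_subst_zero {σ : Type*} {f : MvPowerSeries σ A} (hf : f.constantCoeff = 0)
    {g : PowerSeries A} (hg : g.constantCoeff = 0) :
    MvPowerSeries.constantCoeff (g.subst f) = 0 :=
  PowerSeries.constantCoeff_subst_eq_zero hf g hg

/-- Base change of a formal module along a ring homomorphism. -/
def FormalModule.map {i : 𝒪 →+* A} (M : FormalModule i) (h : A →+* B) {i' : 𝒪 →+* B}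
    (hi : ∀ a, h (i a) = i' a) : FormalModule i' where
  group := M.group.map h
  comm := ⟨by
    have e := congrArg (MvPowerSeries.map h) M.comm.comm
    rw [MvPowerSeries.map_subst (hasSubst_vec (by simp) (by simp)), map_vec, MvPowerSeries.map_X,
      MvPowerSeries.map_X] at e
    exact e⟩
  act a := (M.act a).map h
  act_constantCoeff a := by
    rw [← PowerSeries.coeff_zero_eq_constantCoeff_apply, PowerSeries.coeff_map,
      PowerSeries.coeff_zero_eq_constantCoeff_apply, M.act_constantCoeff, map_zero]
  act_coeff_one a := by
    rw [PowerSeries.coeff_map, M.act_coeff_one, hi]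
  act_group a := by
    have hs : ∀ s : Fin 2, PowerSeries.HasSubst (MvPowerSeries.X s : MvPowerSeries (Fin 2) A) :=
      fun s => PowerSeries.HasSubst.of_constantCoeff_zero (by simp)
    have e := congrArg (MvPowerSeries.map h) (M.act_group a)
    rw [PowerSeries.map_subst (PowerSeries.HasSubst.of_constantCoeff_zero
        M.group.zero_constantCoeff),
      MvPowerSeries.map_subst (hasSubst_vec
        (constantCoeff_subst_zero (by simp) (M.act_constantCoeff a))
        (constantCoeff_subst_zero (by simp) (M.act_constantCoeff a))), map_vec,
      PowerSeries.map_subst (hs 0), PowerSeries.map_subst (hs 1), MvPowerSeries.map_X,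
      MvPowerSeries.map_X] at e
    exact e
  act_one := by rw [M.act_one, PowerSeries.map_X]
  act_mul a b := by
    rw [M.act_mul]
    exact PowerSeries.map_subst
      (PowerSeries.HasSubst.of_constantCoeff_zero' (M.act_constantCoeff b)) _
  act_add a b := by
    rw [M.act_add]
    refine (MvPowerSeries.map_subst
      (hasSubst_vec (M.act_constantCoeff a) (M.act_constantCoeff b)) _).trans ?_
    rw [map_vec]
    rfl

open MvPowerSeries in
/-- The power series `f` is an isomorphism of formal `𝒪`-modules from `M` to `N`. -/
structure FormalModule.IsIso {i i' : 𝒪 →+* A} (M : FormalModule i) (N : FormalModule i')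
    (f : PowerSeries A) : Prop where
  constantCoeff : f.constantCoeff = 0
  isUnit_coeff_one : IsUnit (f.coeff 1)
  group : f.subst M.group.toPowerSeries = N.group.toPowerSeries.subst
    ![f.subst (X 0 : MvPowerSeries (Fin 2) A), f.subst (X 1 : MvPowerSeries (Fin 2) A)]
  act : ∀ a, f.subst (M.act a) = (N.act a).subst f

/-- The formal module `M` has the additive group law `X + Y`, with `[ϖ](X) = f(X)` and
`[a](X) = a X` for all `a` in the set `{a ∈ 𝒪 | a ^ q = a}`. If `𝒪` is the valuation ring of a local
field of positive characteristic with residue field of cardinality `q`, this set is the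
coefficient field `𝔽_q` of `𝒪`. -/
structure FormalModule.HasStandardForm {i : 𝒪 →+* A} (M : FormalModule i) (q : ℕ) (ϖ : 𝒪)
    (f : PowerSeries A) : Prop where
  group : M.group = FormalGroup.𝔾ₐ
  act_uniformizer : M.act ϖ = f
  act_coefficient : ∀ a : 𝒪, a ^ q = a → M.act a = PowerSeries.C (i a) * PowerSeries.X

/-- `f(x) = y` in the complete local ring `A`, for `x` in the maximal ideal: the partial sums of
`f(x)` converge to `y`. -/
def EvaluatesTo [IsLocalRing A] (f : PowerSeries A) (x y : A) : Prop :=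
  ∀ n : ℕ, y - ∑ i ∈ Finset.range n, f.coeff i * x ^ i ∈ IsLocalRing.maximalIdeal A ^ n

/-- `G(x, y) = z` in the complete local ring `A`, for `x`, `y` in the maximal ideal. -/
def EvaluatesTo₂ [IsLocalRing A] (G : MvPowerSeries (Fin 2) A) (x y z : A) : Prop :=
  ∀ n : ℕ, z - ∑ i ∈ Finset.range n, ∑ j ∈ Finset.range n,
    G.coeff (Finsupp.single 0 i + Finsupp.single 1 j) * x ^ i * y ^ j ∈
      IsLocalRing.maximalIdeal A ^ n

end FormalModules

section Deformations

open IsLocalRing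

/-- The category of complete noetherian local `W`-algebras whose residue field is that of `W`. -/
class IsCoefficientAlgebra (W A : Type*) [CommRing W] [IsLocalRing W] [CommRing A] [IsLocalRing A]
    [Algebra W A] : Prop where
  isNoetherianRing : IsNoetherianRing A
  isAdicComplete : IsAdicComplete (maximalIdeal A) A
  isLocalHom : IsLocalHom (algebraMap W A)
  residue_surjective : Function.Surjective ((residue A).comp (algebraMap W A))

instance (W A : Type*) [CommRing W] [IsLocalRing W] [CommRing A] [IsLocalRing A]
    [Algebra W A] [h : IsCoefficientAlgebra W A] : IsLocalHom (algebraMap W A) :=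
  h.isLocalHom

variable {𝒪 W : Type*} [CommRing 𝒪] [IsLocalRing 𝒪] [CommRing W] [IsLocalRing W]
  {j : 𝒪 →+* W} (F₀ : FormalModule ((residue W).comp j)) (n : ℕ)

/-- A deformation of the formal `𝒪`-module `F₀` to `A` with a Drinfeld level `𝔭ⁿ`-structure: a
formal `𝒪`-module `M` over `A`, an isomorphism `ρ` from `F₀` to the reduction of `M`, and an
`𝒪`-homomorphism `φ` from `(𝒪/𝔭ⁿ)²` to the points of `M` with values in the maximal ideal of `A`
such that `∏ (X - φ(x))` divides `[ϖⁿ](X)` for every prime element `ϖ` of `𝒪`. -/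
structure LevelDeformation (A : Type*) [CommRing A] [IsLocalRing A] [Algebra W A]
    [IsCoefficientAlgebra W A] where
  /-- the formal module over `A` -/
  M : FormalModule ((algebraMap W A).comp j)
  /-- the isomorphism, with coefficients in the residue field of `W`, which is that of `A` -/
  ρ : PowerSeries (ResidueField W)
  isIso : (F₀.map (ResidueField.map (algebraMap W A))
      (i' := (residue A).comp ((algebraMap W A).comp j)) (fun _ => rfl)).IsIso
    (M.map (residue A) (i' := (residue A).comp ((algebraMap W A).comp j)) (fun _ => rfl))
    (ρ.map (ResidueField.map (algebraMap W A)))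
  /-- the level structure -/
  φ : (Fin 2 → 𝒪 ⧸ maximalIdeal 𝒪 ^ n) → A
  φ_mem : ∀ x, φ x ∈ maximalIdeal A
  φ_add : ∀ x y, EvaluatesTo₂ M.group.toPowerSeries (φ x) (φ y) (φ (x + y))
  φ_smul : ∀ (a : 𝒪) x, EvaluatesTo (M.act a) (φ x) (φ (a • x))
  drinfeld : ∀ ϖ : 𝒪, Irreducible ϖ →
    ∏ᶠ x, (PowerSeries.X - PowerSeries.C (φ x)) ∣ M.act (ϖ ^ n)

variable {F₀ n}

/-- The base change of `T` along `h` is isomorphic to `T'`. -/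
def LevelDeformation.BaseChangeIso {A B : Type*} [CommRing A] [IsLocalRing A] [Algebra W A]
    [IsCoefficientAlgebra W A] [CommRing B] [IsLocalRing B] [Algebra W B]
    [IsCoefficientAlgebra W B] (T : LevelDeformation F₀ n A) (h : A →ₐ[W] B)
    (T' : LevelDeformation F₀ n B) : Prop :=
  ∃ f : PowerSeries B,
    (T.M.map (h : A →+* B) (i' := (algebraMap W B).comp j) (fun a => h.commutes (j a))).IsIso T'.M f ∧
    (f.map (residue B)).subst (T.ρ.map (ResidueField.map (algebraMap W B))) =
      T'.ρ.map (ResidueField.map (algebraMap W B)) ∧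
    ∀ x, EvaluatesTo f (h (T.φ x)) (T'.φ x)

/-- `(R, T)` represents the functor that takes `A` to the set of isomorphism classes of
deformations of `F₀` to `A` with Drinfeld level `𝔭ⁿ`-structure. (Homomorphisms between
coefficient algebras are automatically local, hence continuous.) -/
def LevelDeformation.IsUniversal {𝒪 W : Type u} [CommRing 𝒪] [IsLocalRing 𝒪] [CommRing W]
    [IsLocalRing W] {j : 𝒪 →+* W} {F₀ : FormalModule ((residue W).comp j)} {n : ℕ}
    {R : Type u} [CommRing R] [IsLocalRing R] [Algebra W R] [IsCoefficientAlgebra W R]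
    (T : LevelDeformation F₀ n R) : Prop :=
  ∀ (A : Type u) [CommRing A] [IsLocalRing A] [Algebra W A] [IsCoefficientAlgebra W A]
    (T' : LevelDeformation F₀ n A), ∃! h : R →ₐ[W] A, T.BaseChangeIso h T'

end Deformations

/-! ### Affinoid subdomains of the generic fibre, and their reductions -/

section PowerBounded

variable {K : Type*} [NormedField K] [IsUltrametricDist K] {A : Type*} [CommRing A] [Algebra K A]
  (A₀ : Subalgebra (integers K) A)

/-- The power-bounded elements `A°` of a `K`-algebra `A` whose topology is given by the open and
bounded subring `A₀`: the elements all of whose powers lie in `c⁻¹ A₀` for one `c ≠ 0` in `K`. -/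
def powerBounded : Subalgebra (integers K) A where
  carrier := {x | ∃ c : K, c ≠ 0 ∧ ∀ n : ℕ, c • x ^ n ∈ A₀}
  mul_mem' := by
    rintro x y ⟨c, hc, hx⟩ ⟨d, hd, hy⟩
    refine ⟨c * d, mul_ne_zero hc hd, fun n => ?_⟩
    rw [mul_pow, ← smul_mul_smul_comm]
    exact mul_mem (hx n) (hy n)
  add_mem' := by
    rintro x y ⟨c, hc, hx⟩ ⟨d, hd, hy⟩
    refine ⟨c * d, mul_ne_zero hc hd, fun n => ?_⟩
    rw [add_pow, Finset.smul_sum]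
    refine sum_mem fun i _ => ?_
    rw [← smul_mul_assoc, ← smul_mul_smul_comm]
    exact mul_mem (mul_mem (hx _) (hy _)) (natCast_mem _ _)
  algebraMap_mem' r :=
    ⟨1, one_ne_zero, fun n => by
      rw [one_smul]
      exact pow_mem (A₀.algebraMap_mem r) n⟩

/-- The ideal `A°°` of `A°` of the topologically nilpotent elements: those whose powers converge
to zero, i.e. are eventually contained in `c⁻¹ A₀` for every `c` in `K`. -/
def topologicallyNilpotent : Ideal (powerBounded A₀) where
  carrier := {x | ∀ c : K, ∃ N : ℕ, ∀ n ≥ N, c • (x : A) ^ n ∈ A₀}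
  zero_mem' c := ⟨1, fun n hn => by
    simp [zero_pow (Nat.one_le_iff_ne_zero.1 hn), zero_mem]⟩
  add_mem' := by
    rintro ⟨x, a, ha, hx⟩ ⟨y, b, hb, hy⟩ hx' hy' c
    obtain ⟨N, hN⟩ := hx' (c / b)
    obtain ⟨M, hM⟩ := hy' (c / a)
    refine ⟨N + M, fun n hn => ?_⟩
    change c • (x + y) ^ n ∈ A₀
    rw [add_pow, Finset.smul_sum]
    refine sum_mem fun i hi => ?_
    rw [← smul_mul_assoc]
    refine mul_mem ?_ (natCast_mem _ _)
    rcases le_or_gt N i with h | h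
    · have e : c • (x ^ i * y ^ (n - i)) = ((c / b) • x ^ i) * (b • y ^ (n - i)) := by
        rw [smul_mul_smul_comm, div_mul_cancel₀ _ hb]
      rw [e]
      exact mul_mem (hN i h) (hy _)
    · have e : c • (x ^ i * y ^ (n - i)) = (a • x ^ i) * ((c / a) • y ^ (n - i)) := by
        rw [smul_mul_smul_comm, mul_div_cancel₀ _ ha]
      rw [e]
      exact mul_mem (hx _) (hM _ (by omega))
  smul_mem' := by
    rintro ⟨x, a, ha, hx⟩ y hy c
    obtain ⟨N, hN⟩ := hy (c / a)
    refine ⟨N, fun n hn => ?_⟩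
    change c • (x * (y : A)) ^ n ∈ A₀
    have e : c • (x * (y : A)) ^ n = (a • x ^ n) * ((c / a) • (y : A) ^ n) := by
      rw [smul_mul_smul_comm, mul_div_cancel₀ _ ha, mul_pow]
    rw [e]
    exact mul_mem (hx n) (hN n hn)

end PowerBounded

section Affinoid

variable {E K R : Type*} [NormedField E] [IsUltrametricDist E] [NormedField K]
  [IsUltrametricDist K] [Algebra E K] [CommRing R] [Algebra (integers E) R]
  {ι : Type*} (f : ι → K ⊗[integers E] R) (r : ι → ℝ)

/-- The subring of the ring `K ⊗ R` of functions on the generic fibre over `K` of `Spf R` which is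
generated over `𝒪_K` by `R` and the elements `c⁻¹ f i` for `c ∈ K` with `|c| ≥ r i`. -/
def affinoidModel : Subalgebra (integers K) (K ⊗[integers E] R) :=
  Algebra.adjoin (integers K)
    (Set.range (fun x : R => (1 : K) ⊗ₜ[integers E] x) ∪
      {g | ∃ (i : ι) (c : K), c ≠ 0 ∧ r i ≤ ‖c‖ ∧ g = c⁻¹ • f i})

/-- The `𝔭_K`-adic completion of `affinoidModel f r`. -/
abbrev affinoidFormalModel : Type _ :=
  AdicCompletion ((IsLocalRing.maximalIdeal (integers K)).map
    (algebraMap (integers K) (affinoidModel f r))) (affinoidModel f r)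

/-- The affinoid algebra `Γ(X, 𝒪_X)` of the affinoid subdomain `X = {|f i| ≤ r i for all i}` of the
generic fibre over `K` of `Spf R`. This is the usual description of the affinoid algebra, when the
`r i` are absolute values of elements of `K` and the `f i` and `r i` are such that these
inequalities force the maximal ideal of `R` to be topologically nilpotent. -/
def affinoidAlgebra : Type _ :=
  K ⊗[integers K] affinoidFormalModel f r

instance : CommRing (affinoidAlgebra f r) :=
  inferInstanceAs (CommRing (K ⊗[integers K] affinoidFormalModel f r))

instance : Algebra K (affinoidAlgebra f r) :=
  inferInstanceAs (Algebra K (K ⊗[integers K] affinoidFormalModel f r))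

/-- The image of the formal model in the affinoid algebra, an open and bounded subring. -/
def affinoidLattice : Subalgebra (integers K) (affinoidAlgebra f r) :=
  (Algebra.TensorProduct.includeRight :
    affinoidFormalModel f r →ₐ[integers K] K ⊗[integers K] affinoidFormalModel f r).range

/-- The subring `A°` of the power-bounded elements of the affinoid algebra `A`. -/
abbrev affinoidPowerBounded : Subalgebra (integers K) (affinoidAlgebra f r) :=
  powerBounded (affinoidLattice f r)

/-- The ideal `A°°` of the topologically nilpotent elements in `A°`. -/
abbrev affinoidTopologicallyNilpotent : Ideal (affinoidPowerBounded f r) :=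
  topologicallyNilpotent (affinoidLattice f r)

end Affinoid

/-! ### Smoothly algebraizable formal schemes -/

section Algebraizable

open IsLocalRing

/-- `Spf A` is topologically finitely presented over `Spf 𝒪`: `A` is the quotient of the algebra
`𝒪⟨X₁, …, Xₙ⟩` of restricted power series by a finitely generated ideal. -/
def IsTopologicallyFinitelyPresented (𝒪 A : Type*) [CommRing 𝒪] [IsLocalRing 𝒪] [CommRing A]
    [Algebra 𝒪 A] : Prop :=
  ∃ (n : ℕ) (J : Ideal (AdicCompletion
      ((maximalIdeal 𝒪).map (algebraMap 𝒪 (MvPolynomial (Fin n) 𝒪))) (MvPolynomial (Fin n) 𝒪))),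
    J.FG ∧ Nonempty (A ≃ₐ[𝒪] (AdicCompletion
      ((maximalIdeal 𝒪).map (algebraMap 𝒪 (MvPolynomial (Fin n) 𝒪)))
      (MvPolynomial (Fin n) 𝒪) ⧸ J))

/-- The ideal `𝔭ⁿ A`. -/
abbrev powIdeal (𝒪 A : Type*) [CommRing 𝒪] [IsLocalRing 𝒪] [CommRing A] [Algebra 𝒪 A] (n : ℕ) :
    Ideal A :=
  (maximalIdeal 𝒪 ^ n).map (algebraMap 𝒪 A)

/-- The formal scheme `Spf A` (with the `𝔭`-adic topology) is smoothly algebraizable over `Spf 𝒪`: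
it is topologically finitely presented, and there is a scheme `X`, smooth, separated and of finite
type over `Spec 𝒪`, whose completion along the special fibre is isomorphic to `Spf A`.
Such an isomorphism is a compatible system of isomorphisms of `Spec (A/𝔭ⁿA)` with
`X ×_{Spec 𝒪} Spec (𝒪/𝔭ⁿ)`. -/
def IsSmoothlyAlgebraizable (𝒪 A : Type u) [CommRing 𝒪] [IsLocalRing 𝒪] [CommRing A]
    [Algebra 𝒪 A] : Prop :=
  IsTopologicallyFinitelyPresented 𝒪 A ∧
  ∃ (X : Scheme.{u}) (s : X ⟶ Spec (CommRingCat.of 𝒪)),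
    Smooth s ∧ IsSeparated s ∧ LocallyOfFiniteType s ∧ QuasiCompact s ∧
    ∃ e : ∀ n : ℕ, Spec (CommRingCat.of (A ⧸ powIdeal 𝒪 A n)) ⟶ X,
      (∀ n, IsPullback (e n)
        (Spec.map (CommRingCat.ofHom
          (Ideal.quotientMap (powIdeal 𝒪 A n) (algebraMap 𝒪 A) Ideal.le_comap_map)))
        s (Spec.map (CommRingCat.ofHom (Ideal.Quotient.mk (maximalIdeal 𝒪 ^ n))))) ∧
      ∀ n, Spec.map (CommRingCat.ofHom (Ideal.Quotient.factor
        (Ideal.map_mono (Ideal.pow_le_pow_right n.le_succ)))) ≫ e (n + 1) = e n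

end Algebraizable

/-! ### The affinoids near the points with complex multiplication by `𝒪_{F₂}` -/

section CM

/-- `x` is a primitive `ϖⁿ`-torsion point of the formal module with additive group law and
`[ϖ](X) = X ^ (q ^ 2) + ϖ X`. -/
def IsPrimitiveTorsion {L : Type*} [Field L] (q : ℕ) (ϖ : L) (n : ℕ) (x : L) : Prop :=
  (fun y => y ^ (q ^ 2) + ϖ * y)^[n] x = 0 ∧ (fun y => y ^ (q ^ 2) + ϖ * y)^[n - 1] x ≠ 0

/-- The functions `u`, `S = X - ϖₙ` and `U = ζ ^ q S - T`, where `T = Y - ζ ϖₙ`. -/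
def cmFunctions {E K R : Type*} [NormedField E] [IsUltrametricDist E] [NormedField K]
    [Algebra E K] [CommRing R] [Algebra (integers E) R] (q : ℕ) (ζ ϖn : K) (u X Y : R) :
    Fin 3 → K ⊗[integers E] R :=
  let S : K ⊗[integers E] R := 1 ⊗ₜ X - ϖn ⊗ₜ 1
  let T : K ⊗[integers E] R := 1 ⊗ₜ Y - (ζ * ϖn) ⊗ₜ 1
  ![1 ⊗ₜ u, S, ζ ^ q • S - T]

/-- The lower bounds for the valuations of `u`, `S`, `U`: with `m = ⌊(k + 1) / 2⌋` and
`h = 1 / (q ^ 2 - 1)`, these are `m` if `k` is even and `m - 1 / (q + 1)` if `k` is odd,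
`h / q ^ (k - 1)`, and `h`. -/
def cmValuations (q k : ℕ) : Fin 3 → ℝ :=
  let m : ℕ := (k + 1) / 2
  let h : ℝ := 1 / ((q : ℝ) ^ 2 - 1)
  ![if Even k then (m : ℝ) else m - 1 / ((q : ℝ) + 1), h / (q : ℝ) ^ (k - 1), h]

end CM

end LubinTateCurve

end

namespace LubinTateCurve

/-! ### Residue fields and Teichmüller representatives of ultrametric fields. -/

section Ultrametric

variable {L : Type*} [NormedField L] [IsUltrametricDist L]

/-! Let E be the completion of `F^ur`, π = ϖ_k and K = E(π). The value group of E is that of F, and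
climbing the torsion tower gives ‖π‖ ^ e = ‖ϖ‖ with e = (q² - 1) q^(2(k-1))
(`norm_of_isPrimitiveTorsion`). Hence K/E is totally ramified, π is a uniformizer of K, and the
residue fields agree.

Put X = π + S and Y = ζπ + ζ^q S - U. The affinoid is cut out by [ϖ^k](X) = [ϖ^k](Y) = 0. The k-th
iterate of z^(q²) + u z^q + ϖ z is a sum of powers z^(q^i); a scalar c in 𝔽_{q²} multiplies the part
with i even by c and the part with i odd by c^q. Therefore [ϖ^k](Y) - ζ [ϖ^k](X) involves only the
odd part at π, the even part at S, and U, while [ϖ^k](Y) - ζ^q [ϖ^k](X) involves only the even part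
at π, the odd part at S, and U (`ltOp_iterate_combination_one`, `ltOp_iterate_combination_two`).
Since π is killed at u = 0, its even part is of higher order in u.

Let ϖ₁ be the last non-zero iterate of π at u = 0, δ = ζ^q - ζ and Q = q^(k-1). Substitute u = c₀ a,
U = δ ϖ₁ x, S = π^Q y, where c₀ has the valuation in the definition of the affinoid. After division
by constants the two equations become, modulo π, a + α(y) = 0 and x^(q²) - x + a β(y) = 0 with αβ =
y^(Qq) (y^(Qq²) - y^Q) (`leadingTerms_even`, `leadingTerms_odd`; the parity of k decides which
factor is α). Eliminating a gives the asserted curve. The Jacobian in a and x is -1 modulo π, so its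
invertibility locus is a smooth 𝒪_K-scheme Spec C with this special fibre.

It remains to identify the formal model of the affinoid with the π-adic completion of C. The
equations hold on the generic fibre, because the constants divided out are invertible there; this
gives a map from C to the completed model. For a map back, the coordinates on the completion of C
have to define a point of R. A point of R with values in a complete ring is a parameter u and two
ϖ^k-torsion points whose non-trivial 𝒪-combinations are non-zero-divisors
(`LevelDeformation.IsUniversal.exists_algHom`): non-zero-divisor differences of the roots give the
Drinfeld divisibility, and rigidity of deformations matches the coordinates. On the curve every
non-trivial combination divides π^N times a unit, as ζ is not in 𝔽_q
(`levelPoint_mem_nonZeroDivisors`). Moreover ϖ, u, X, Y generate the maximal ideal of R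
(`LevelDeformation.IsUniversal.maximalIdeal_eq_span`), so the model is generated modulo π by the
coordinates a, x, y, as C is. The two maps then force the completions to coincide
(`isCompletionMap_of_retraction`).

Finally C/π is reduced, because the derivative of the Artin–Schreier equation in X is -1, and C is
flat. So the completion is exactly A°, A°° is generated by π, and A°/π is the stated algebra
(`IsLattice.canonicalReduction`). Smooth algebraizability holds because A° is the completion of a
smooth affine scheme. -/

lemma norm_sub_lt_of_lt {x y : L} {r : ℝ} (hx : ‖x‖ < r) (hy : ‖y‖ < r) : ‖x - y‖ < r := by
  rw [sub_eq_add_neg]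
  exact (IsUltrametricDist.norm_add_le_max x (-y)).trans_lt (by simp [hx, hy])

lemma norm_sub_le_of_le {x y : L} {r : ℝ} (hx : ‖x‖ ≤ r) (hy : ‖y‖ ≤ r) : ‖x - y‖ ≤ r := by
  rw [sub_eq_add_neg]
  exact (IsUltrametricDist.norm_add_le_max x (-y)).trans (by simp [hx, hy])

lemma norm_add_le_of_le {x y : L} {r : ℝ} (hx : ‖x‖ ≤ r) (hy : ‖y‖ ≤ r) : ‖x + y‖ ≤ r :=
  (IsUltrametricDist.norm_add_le_max x y).trans (max_le hx hy)

lemma norm_eq_of_norm_sub_lt {x y : L} (h : ‖x - y‖ < ‖x‖) : ‖y‖ = ‖x‖ := by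
  have h' : ‖x‖ ≠ ‖-(x - y)‖ := by rw [norm_neg]; exact h.ne'
  have := IsUltrametricDist.norm_add_eq_max_of_norm_ne_norm h'
  rwa [← sub_eq_add_neg, sub_sub_cancel, norm_neg, max_eq_left h.le] at this

lemma norm_eq_one_of_pow_eq_self {L : Type*} [NormedField L] {z : L} {n : ℕ} (hn : 2 ≤ n) (hz : z ^ n = z) (h0 : z ≠ 0) :
    ‖z‖ = 1 := by
  have h : z ^ (n - 1) = 1 := by
    have : z ^ (n - 1) * z = 1 * z := by rw [← pow_succ, one_mul, Nat.sub_add_cancel (by omega), hz]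
    exact mul_right_cancel₀ h0 this
  have h' : ‖z‖ ^ (n - 1) = 1 := by rw [← norm_pow, h, norm_one]
  exact (pow_eq_one_iff_of_nonneg (norm_nonneg z) (by omega)).1 h'

/-- The closed unit ball of a proper ultrametric field has finite residue ring. -/
lemma finite_residueField [ProperSpace L] : Finite (IsLocalRing.ResidueField (integers L)) := by
  have hc : IsCompact (Metric.closedBall (0 : L) 1) := isCompact_closedBall 0 1
  -- Residue classes are open balls of radius one inside the compact unit ball, so a finite cover by
  -- such balls bounds their number.
  obtain ⟨t, -, ht, hcov⟩ := hc.elim_finite_subcover_image (b := Set.univ)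
    (c := fun x => Metric.ball x 1)
    (fun x _ => Metric.isOpen_ball) (fun x _ => by
      simp only [Set.mem_iUnion]; exact ⟨x, Set.mem_univ _, Metric.mem_ball_self one_pos⟩)
  have key : ∀ z : IsLocalRing.ResidueField (integers L), ∃ y ∈ t, ∃ x : integers L,
      IsLocalRing.residue _ x = z ∧ ‖(x : L) - y‖ < 1 := by
    intro z
    obtain ⟨x, rfl⟩ := IsLocalRing.residue_surjective z
    have hx : (x : L) ∈ Metric.closedBall (0 : L) 1 := by
      simpa using (mem_integers _).1 x.2
    have := hcov hx
    simp only [Set.mem_iUnion] at this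
    obtain ⟨y, hy, hxy⟩ := this
    exact ⟨y, hy, x, rfl, by simpa [dist_eq_norm] using hxy⟩
  choose g hg x hx hxg using key
  have : Finite t := ht
  refine Finite.of_injective (fun z => (⟨g z, hg z⟩ : t)) fun z w hzw => ?_
  have e : g z = g w := congrArg Subtype.val hzw
  have h : ‖(x z : L) - x w‖ < 1 := by
    have := norm_sub_lt_of_lt (hxg z) (e ▸ hxg w)
    simpa using this
  rw [← hx z, ← hx w, ← sub_eq_zero, ← map_sub, IsLocalRing.residue_eq_zero_iff]
  rw [IsLocalRing.mem_maximalIdeal, mem_nonunits_iff]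
  intro hu
  obtain ⟨v, hv⟩ := hu.exists_right_inv
  have h1 : ‖((x z - x w : integers L) : L)‖ * ‖(v : L)‖ = 1 := by
    rw [← norm_mul, ← norm_one (α := L)]
    exact congrArg (fun y : integers L => ‖(y : L)‖) hv
  have h2 : ‖(v : L)‖ ≤ 1 := (mem_integers _).1 v.2
  have h3 : ‖((x z - x w : integers L) : L)‖ < 1 := h
  nlinarith [norm_nonneg ((x z - x w : integers L) : L), norm_nonneg (v : L)]

lemma mem_maximalIdeal_integers (x : integers L) :
    x ∈ IsLocalRing.maximalIdeal (integers L) ↔ ‖(x : L)‖ < 1 := by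
  rw [IsLocalRing.mem_maximalIdeal, mem_nonunits_iff]
  constructor
  · intro h
    refine lt_of_le_of_ne ((mem_integers _).1 x.2) fun h1 => h ?_
    have h0 : (x : L) ≠ 0 := fun h0 => by simp [h0] at h1
    refine IsUnit.of_mul_eq_one (⟨(x : L)⁻¹, (mem_integers _).2 (by simp [h1])⟩ : integers L) ?_
    exact Subtype.ext (mul_inv_cancel₀ h0)
  · intro h hu
    obtain ⟨v, hv⟩ := hu.exists_right_inv
    have h1 : ‖(x : L)‖ * ‖(v : L)‖ = 1 := by
      rw [← norm_mul, ← norm_one (α := L)]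
      exact congrArg (fun y : integers L => ‖(y : L)‖) hv
    have h2 : ‖(v : L)‖ ≤ 1 := (mem_integers _).1 v.2
    nlinarith [norm_nonneg (x : L), norm_nonneg (v : L)]

lemma isUnit_integers (x : integers L) : IsUnit x ↔ ‖(x : L)‖ = 1 := by
  rw [← not_iff_not, ← mem_nonunits_iff, ← IsLocalRing.mem_maximalIdeal, mem_maximalIdeal_integers]
  have := (mem_integers _).1 x.2
  exact ⟨fun h => h.ne, fun h => lt_of_le_of_ne this h⟩

lemma charP_residueField (p : ℕ) [Fact p.Prime] [CharP L p] : CharP (IsLocalRing.ResidueField (integers L)) p := by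
  have : CharP (integers L) p :=
    (RingHom.charP_iff (integers L).subtype Subtype.val_injective p).2 inferInstance
  have hp : (p : IsLocalRing.ResidueField (integers L)) = 0 := by
    rw [← map_natCast (IsLocalRing.residue (integers L)), CharP.cast_eq_zero, map_zero]
  exact (CharP.charP_iff_prime_eq_zero Fact.out).2 hp

lemma natCard_residueField (p : ℕ) [Fact p.Prime] [CharP L p] [ProperSpace L] :
    ∃ g, 1 ≤ g ∧ Nat.card (IsLocalRing.ResidueField (integers L)) = p ^ g := by
  have := finite_residueField (L := L)
  have := charP_residueField (L := L) p
  have := Fintype.ofFinite (IsLocalRing.ResidueField (integers L))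
  obtain ⟨n, -, h⟩ := FiniteField.card (IsLocalRing.ResidueField (integers L)) p
  exact ⟨n, n.2, by rw [Nat.card_eq_fintype_card, h]⟩

/-- Teichmüller representatives in equal characteristic. -/
lemma exists_teichmuller (p : ℕ) [Fact p.Prime] [CharP L p] [ProperSpace L] (x : L) (hx : ‖x‖ ≤ 1) :
    ∃ s : L, s ^ Nat.card (IsLocalRing.ResidueField (integers L)) = s ∧ ‖x - s‖ < 1 := by
  obtain ⟨g, hg, hQ⟩ := natCard_residueField (L := L) p
  set Q := Nat.card (IsLocalRing.ResidueField (integers L)) with hQdef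
  have hp : 2 ≤ p := (Fact.out : p.Prime).two_le
  have hQ2 : 2 ≤ Q := hQ ▸ hp.trans (Nat.le_self_pow (by omega) p)
  have hfrob : ∀ n (x y : L), (x - y) ^ Q ^ n = x ^ Q ^ n - y ^ Q ^ n := fun n x y => by
    rw [hQ, ← pow_mul]; exact sub_pow_char_pow x y _
  have h1 : ‖x ^ Q - x‖ < 1 := by
    have := finite_residueField (L := L)
    have := Fintype.ofFinite (IsLocalRing.ResidueField (integers L))
    let x' : integers L := ⟨x, (mem_integers _).2 hx⟩
    have : IsLocalRing.residue _ (x' ^ Q - x') = 0 := by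
      rw [map_sub, map_pow, hQdef, Nat.card_eq_fintype_card, FiniteField.pow_card, sub_self]
    rw [IsLocalRing.residue_eq_zero_iff, mem_maximalIdeal_integers] at this
    exact this
  set ρ := ‖x ^ Q - x‖
  -- By additivity of Frobenius the consecutive differences of x^(Q^n) are Q^n-th powers of x^Q - x,
  -- which has norm below one. The sequence is Cauchy and its limit is fixed by the Q-th power.
  have hd : ∀ n, ‖x ^ Q ^ (n + 1) - x ^ Q ^ n‖ ≤ ρ ^ (n + 1) := fun n => by
    have : x ^ Q ^ (n + 1) - x ^ Q ^ n = (x ^ Q - x) ^ Q ^ n := by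
      rw [hfrob, ← pow_mul, pow_succ' Q n]
    rw [this, norm_pow]
    exact pow_le_pow_of_le_one (norm_nonneg _) h1.le (Nat.lt_pow_self (by omega))
  have hcauchy : CauchySeq fun n => x ^ Q ^ n := by
    refine cauchySeq_of_le_geometric ρ ρ h1 fun n => ?_
    rw [dist_comm, dist_eq_norm, ← pow_succ']
    exact hd n
  obtain ⟨s, hs⟩ := cauchySeq_tendsto_of_complete hcauchy
  refine ⟨s, ?_, ?_⟩
  · refine tendsto_nhds_unique (hs.pow Q) ?_
    have := hs.comp (Filter.tendsto_add_atTop_nat 1)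
    refine this.congr fun n => ?_
    simp only [Function.comp, pow_succ Q n, pow_mul]
  · have hle : ∀ n, ‖x - x ^ Q ^ n‖ ≤ ρ := by
      intro n
      induction n with
      | zero => simp [ρ]
      | succ n ih =>
        have e : x - x ^ Q ^ (n + 1) = (x - x ^ Q ^ n) - (x ^ Q ^ (n + 1) - x ^ Q ^ n) := by ring
        rw [e]
        refine norm_sub_le_of_le ih ((hd n).trans ?_)
        exact (pow_le_pow_of_le_one (norm_nonneg _) h1.le (by omega : 1 ≤ n + 1)).trans
          (pow_one _).le
    refine lt_of_le_of_lt ?_ h1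
    exact le_of_tendsto ((tendsto_const_nhds.sub hs).norm) (Filter.Eventually.of_forall hle)

end Ultrametric

end LubinTateCurve

/-! ### The value group of the completed maximal unramified extension. -/

namespace LubinTateCurve

lemma norm_sum_lt_one {L ι : Type*} [NormedField L] [IsUltrametricDist L] (s : Finset ι)
    (f : ι → L) (hf : ∀ i ∈ s, ‖f i‖ < 1) : ‖∑ i ∈ s, f i‖ < 1 := by
  classical
  induction s using Finset.induction_on with
  | empty => simp
  | insert i s hi ih =>
    rw [Finset.sum_insert hi]
    exact (IsUltrametricDist.norm_add_le_max _ _).trans_lt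
      (max_lt (hf i (by simp)) (ih fun j hj => hf j (by simp [hj])))

section Unramified

variable {F Fbar : Type*} [NontriviallyNormedField F] [IsUltrametricDist F]
  [NormedField Fbar] [NormedAlgebra F Fbar] [IsUltrametricDist Fbar]

section Uniformizer

variable {ϖ : integers F}

lemma norm_uniformizer_lt_one (hϖ : Irreducible ϖ) : ‖(ϖ : F)‖ < 1 :=
  (mem_maximalIdeal_integers ϖ).1 hϖ.not_isUnit

lemma norm_uniformizer_pos (hϖ : Irreducible ϖ) : 0 < ‖(ϖ : F)‖ :=
  norm_pos_iff.2 fun h => hϖ.ne_zero (Subtype.ext h)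

/-- Otherwise ϖ = x · (ϖ / x) would be a factorization into two non-units. -/
lemma norm_le_uniformizer (hϖ : Irreducible ϖ) {x : F} (hx : ‖x‖ < 1) : ‖x‖ ≤ ‖(ϖ : F)‖ := by
  by_contra! h
  have h0 : 0 < ‖x‖ := (norm_nonneg _).trans_lt h
  have h0' : x ≠ 0 := norm_pos_iff.1 h0
  have hy : ‖(ϖ : F) / x‖ < 1 := by rw [norm_div, div_lt_one h0]; exact h
  let x' : integers F := ⟨x, (mem_integers _).2 hx.le⟩
  let y' : integers F := ⟨ϖ / x, (mem_integers _).2 hy.le⟩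
  have e : ϖ = x' * y' := Subtype.ext (mul_div_cancel₀ _ h0').symm
  rcases hϖ.isUnit_or_isUnit e with h1 | h1
  · exact ((isUnit_integers _).1 h1).not_lt hx
  · exact ((isUnit_integers _).1 h1).not_lt hy

/-- Every nonzero element of `F` has the norm of a power of the uniformizer. -/
lemma exists_zpow_norm_eq (hϖ : Irreducible ϖ) {x : F} (hx : x ≠ 0) :
    ∃ n : ℤ, ‖x‖ = ‖(ϖ : F)‖ ^ n := by
  have h0 := norm_uniformizer_pos hϖ
  have h1 := norm_uniformizer_lt_one hϖ
  -- Place ‖x‖ between consecutive powers of ‖ϖ‖; no norm lies strictly between ‖ϖ‖ and 1, so the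
  -- upper bound is attained.
  obtain ⟨n, hn, hn'⟩ := exists_mem_Ioc_zpow (norm_pos_iff.2 hx) (one_lt_inv_iff₀.2 ⟨h0, h1⟩)
  refine ⟨-(n + 1), ?_⟩
  have hϖ0 : (ϖ : F) ≠ 0 := norm_pos_iff.1 h0
  simp only [inv_zpow'] at hn hn'
  refine le_antisymm hn' (not_lt.1 fun h => ?_)
  have h2 : ‖x * (ϖ : F) ^ (n + 1)‖ < 1 := by
    rw [norm_mul, norm_zpow]
    have := mul_lt_mul_of_pos_right h (zpow_pos h0 (n + 1))
    rwa [← zpow_add₀ h0.ne', neg_add_cancel, zpow_zero] at this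
  have h3 := norm_le_uniformizer hϖ h2
  rw [norm_mul, norm_zpow] at h3
  have h4 := mul_lt_mul_of_pos_right hn (zpow_pos h0 (n + 1))
  rw [← zpow_add₀ h0.ne', neg_add_cancel_left, zpow_one] at h4
  exact h4.not_ge h3

end Uniformizer

/-- The norm of a combination over `F` of roots of unity of order prime to `p` (or zeros) is the
norm of an element of `F`. -/
lemma exists_norm_eq_of_sum (p : ℕ) [Fact p.Prime] [CharP F p] [ProperSpace F] (n : ℕ) :
    ∀ (a : Fin n → F) (z : Fin n → Fbar), (∀ i, ∃ g, 1 ≤ g ∧ z i ^ p ^ g = z i) →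
      ∃ y : F, ‖∑ i, algebraMap F Fbar (a i) * z i‖ = ‖y‖ := by
  have hp : 2 ≤ p := (Fact.out : p.Prime).two_le
  have : CharP Fbar p := charP_of_injective_ringHom (algebraMap F Fbar).injective p
  have hT : ∀ w : Fbar, (∃ g, 1 ≤ g ∧ w ^ p ^ g = w) → ∀ j, ∀ g, w ^ p ^ g = w →
      w ^ p ^ (g * j) = w := by
    intro w _ j g hw
    induction j with
    | zero => simp
    | succ j ih => rw [mul_add, mul_one, pow_add, pow_mul, ih, hw]
  have hnorm : ∀ w : Fbar, (∃ g, 1 ≤ g ∧ w ^ p ^ g = w) → w ≠ 0 → ‖w‖ = 1 := by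
    rintro w ⟨g, hg, hw⟩ h0
    exact norm_eq_one_of_pow_eq_self (hp.trans (Nat.le_self_pow (by omega) p)) hw h0
  induction n with
  | zero => intro a z _; exact ⟨0, by simp⟩
  | succ n ih =>
    intro a z hz
    obtain ⟨i₀, hi₀⟩ := Finite.exists_max fun i => ‖a i‖
    by_cases ha : a i₀ = 0
    · refine ⟨0, ?_⟩
      have : ∀ i, a i = 0 := fun i => by
        have := hi₀ i
        rw [ha, norm_zero] at this
        exact norm_le_zero_iff.1 this
      simp [this]
    have ha0 : 0 < ‖a i₀‖ := norm_pos_iff.2 ha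
    have hb : ∀ i, ‖a i / a i₀‖ ≤ 1 := fun i => by
      rw [norm_div, div_le_one ha0]; exact hi₀ i
    choose s hs hbs using fun i => exists_teichmuller p (a i / a i₀) (hb i)
    obtain ⟨G, hG, hQ⟩ := natCard_residueField (L := F) p
    rw [hQ] at hs
    choose g hg hzg using hz
    -- After division by the largest coefficient, the Teichmüller part t of the sum is again fixed
    -- by a power of Frobenius, so it is zero or of norm one.
    set t : Fbar := ∑ i, algebraMap F Fbar (s i) * z i with ht
    have htT : t ^ p ^ (G * ∏ i, g i) = t := by
      rw [ht, sum_pow_char_pow]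
      refine Finset.sum_congr rfl fun i _ => ?_
      have e1 : (algebraMap F Fbar (s i)) ^ p ^ (G * ∏ i, g i) = algebraMap F Fbar (s i) :=
        hT _ ⟨G, hG, by rw [← map_pow, hs]⟩ _ G (by rw [← map_pow, hs])
      have e2 : (z i) ^ p ^ (G * ∏ i, g i) = z i := by
        obtain ⟨c, hc⟩ := Finset.dvd_prod_of_mem g (Finset.mem_univ i)
        rw [hc, mul_left_comm]
        exact hT _ ⟨g i, hg i, hzg i⟩ _ _ (hzg i)
      rw [mul_pow, e1, e2]
    -- If t = 0, subtracting a multiple of this linear relation removes the term of index i₀ and the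
    -- induction applies. If t ≠ 0, then t dominates the remainder and the norm is that of the
    -- largest coefficient.
    by_cases ht0 : t = 0
    · have hs0 : s i₀ ≠ 0 := fun h => by
        have := hbs i₀
        rw [h, sub_zero, div_self ha, norm_one] at this
        exact lt_irrefl _ this
      obtain ⟨y, hy⟩ := ih (fun j => a (i₀.succAbove j) - a i₀ / s i₀ * s (i₀.succAbove j))
        (fun j => z (i₀.succAbove j)) (fun j => ⟨_, hg _, hzg _⟩)
      refine ⟨y, ?_⟩
      rw [← hy]
      congr 1
      have e : ∑ i, algebraMap F Fbar (a i) * z i =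
          ∑ i, algebraMap F Fbar (a i - a i₀ / s i₀ * s i) * z i := by
        simp only [map_sub, map_mul, sub_mul, Finset.sum_sub_distrib, mul_assoc]
        rw [← Finset.mul_sum, ← ht, ht0, mul_zero, sub_zero]
      rw [e, Fin.sum_univ_succAbove _ i₀, div_mul_cancel₀ _ hs0, sub_self, map_zero, zero_mul,
        zero_add]
    · refine ⟨a i₀, ?_⟩
      have h1 : ‖t‖ = 1 := hnorm t ⟨_, Nat.mul_pos hG (Finset.prod_pos fun i _ => hg i), htT⟩ ht0
      have e : ∑ i, algebraMap F Fbar (a i) * z i = algebraMap F Fbar (a i₀) *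
          (t - ∑ i, algebraMap F Fbar (s i - a i / a i₀) * z i) := by
        rw [ht, ← Finset.sum_sub_distrib, Finset.mul_sum]
        refine Finset.sum_congr rfl fun i _ => ?_
        rw [← sub_mul, ← map_sub, sub_sub_cancel, ← mul_assoc, ← map_mul, mul_div_cancel₀ _ ha]
      have h2 : ‖∑ i, algebraMap F Fbar (s i - a i / a i₀) * z i‖ < 1 := by
        refine norm_sum_lt_one _ _ fun i _ => ?_
        rw [norm_mul, norm_algebraMap', norm_sub_rev]
        have : ‖z i‖ ≤ 1 := by
          by_cases h : z i = 0
          · simp [h]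
          · exact (hnorm _ ⟨_, hg i, hzg i⟩ h).le
        exact (mul_le_of_le_one_right (norm_nonneg _) this).trans_lt (hbs i)
      rw [e, norm_mul, norm_algebraMap']
      rw [norm_eq_of_norm_sub_lt (x := t), h1, mul_one]
      rwa [sub_sub_cancel, h1]

/-- A finite unramified extension is spanned by the roots of unity of order prime to `p`. -/
lemma mem_span_of_unramified (p : ℕ) [Fact p.Prime] [CharP F p] [ProperSpace F] {ϖ : integers F}
    (hϖ : Irreducible ϖ) (L : IntermediateField F Fbar) [FiniteDimensional F L]
    (hL : ∀ x ∈ L, ∃ y : F, ‖y‖ = ‖x‖) (x : Fbar) (hx : x ∈ L) :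
    x ∈ Submodule.span F {z : Fbar | ∃ g, 1 ≤ g ∧ z ^ p ^ g = z} := by
  have : CharP L p := charP_of_injective_ringHom (algebraMap F L).injective p
  let nF : NormedField L := SubfieldClass.toNormedField L
  have : IsUltrametricDist L := instUltrametricSubfield Fbar L.toSubfield
  let nS : NormedSpace F L := (inferInstance : NormedSpace F L.toSubalgebra.toSubmodule)
  have : ProperSpace L := FiniteDimensional.proper F L
  obtain ⟨G, hG, hQ⟩ := natCard_residueField (L := L) p
  set V : Submodule F L := Submodule.span F {z : L | z ^ p ^ G = z} with hV
  have hϖ0 : (ϖ : F) ≠ 0 := norm_pos_iff.1 (norm_uniformizer_pos hϖ)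
  have hsmul : ∀ (c : F) (v : L), ‖c • v‖ = ‖c‖ * ‖v‖ := fun c v => norm_smul c v
  -- Successive approximation: after a Teichmüller representative is removed the error has norm
  -- below one, hence, L having the value group of F, it is divisible by ϖ.
  have happ : ∀ n (x : L), ‖x‖ ≤ 1 → ∃ v ∈ V, ‖x - v‖ ≤ ‖(ϖ : F)‖ ^ n := by
    intro n
    induction n with
    | zero => intro x hx; exact ⟨0, V.zero_mem, by simpa using hx⟩
    | succ n ih =>
      intro x hx
      obtain ⟨s, hs, hxs⟩ := exists_teichmuller p x hx
      rw [hQ] at hs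
      obtain ⟨y, hy⟩ := hL (x - s : L) (x - s).2
      have hle : ‖x - s‖ ≤ ‖(ϖ : F)‖ := by
        have hy' : ‖y‖ = ‖x - s‖ := hy
        rw [← hy']
        exact norm_le_uniformizer hϖ (by rwa [hy'])
      obtain ⟨v, hv, hxv⟩ := ih ((ϖ : F)⁻¹ • (x - s)) (by
        rw [hsmul, norm_inv, inv_mul_le_one₀ (norm_uniformizer_pos hϖ)]
        exact hle)
      refine ⟨s + (ϖ : F) • v, V.add_mem (Submodule.subset_span hs) (V.smul_mem _ hv), ?_⟩
      have e : x - (s + (ϖ : F) • v) = (ϖ : F) • ((ϖ : F)⁻¹ • (x - s) - v) := by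
        rw [smul_sub, smul_inv_smul₀ hϖ0, sub_sub]
      rw [e, hsmul, pow_succ']
      exact mul_le_mul_of_nonneg_left hxv (norm_nonneg _)
  -- Finite-dimensional subspaces are closed, so arbitrarily good approximation means membership.
  have hclosed : IsClosed (V : Set L) := V.closed_of_finiteDimensional
  have hunit : ∀ x : L, ‖x‖ ≤ 1 → x ∈ V := by
    intro x hx
    refine hclosed.closure_subset (Metric.mem_closure_iff.2 fun ε hε => ?_)
    obtain ⟨n, hn⟩ := exists_pow_lt_of_lt_one hε (norm_uniformizer_lt_one hϖ)
    obtain ⟨v, hv, hxv⟩ := happ n x hx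
    exact ⟨v, hv, by rw [dist_eq_norm]; exact hxv.trans_lt hn⟩
  have hall : (⟨x, hx⟩ : L) ∈ V := by
    obtain ⟨y, hy⟩ := hL x hx
    by_cases hy0 : y = 0
    · have : (⟨x, hx⟩ : L) = 0 := by
        rw [hy0, norm_zero] at hy
        exact Subtype.ext (norm_eq_zero.1 hy.symm)
      rw [this]; exact V.zero_mem
    · have := V.smul_mem y (hunit (y⁻¹ • ⟨x, hx⟩) (by
        rw [hsmul, norm_inv, inv_mul_le_one₀ (norm_pos_iff.2 hy0)]
        exact hy.ge))
      rwa [smul_inv_smul₀ hy0] at this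
  have := Submodule.mem_map_of_mem (f := L.val.toLinearMap) hall
  rw [hV, Submodule.map_span] at this
  refine Submodule.span_mono ?_ this
  rintro _ ⟨z, hz, rfl⟩
  exact ⟨G, hG, by simpa using congrArg (L.val) hz⟩

/-- The elements fixed by some power of Frobenius are closed under multiplication, so the F-algebra
they generate is their linear span. It is a field containing every finite unramified extension, and
`exists_norm_eq_of_sum` computes norms on it. -/
lemma norm_mem_of_mem_maximalUnramified (p : ℕ) [Fact p.Prime] [CharP F p] [ProperSpace F]
    {ϖ : integers F} (hϖ : Irreducible ϖ) (x : Fbar) (hx : x ∈ maximalUnramified F Fbar) :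
    ∃ y : F, ‖x‖ = ‖y‖ := by
  have : CharP Fbar p := charP_of_injective_ringHom (algebraMap F Fbar).injective p
  set Z : Set Fbar := {z : Fbar | ∃ g, 1 ≤ g ∧ z ^ p ^ g = z}
  have hp : 2 ≤ p := (Fact.out : p.Prime).two_le
  have halg : ∀ z ∈ Z, IsAlgebraic F z := by
    rintro z ⟨g, hg, hz⟩
    refine ⟨Polynomial.X ^ p ^ g - Polynomial.X,
      FiniteField.X_pow_card_pow_sub_X_ne_zero F (by omega) (by omega), by simp [hz]⟩
  have hadj : (Algebra.adjoin F Z).toSubmodule = Submodule.span F Z := by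
    rw [Algebra.adjoin_eq_span]
    congr 1
    refine le_antisymm ?_ Submonoid.subset_closure
    intro z hz
    induction hz using Submonoid.closure_induction with
    | mem z hz => exact hz
    | one => exact ⟨1, le_rfl, one_pow _⟩
    | mul x y _ _ hx hy =>
      obtain ⟨g, hg, hx⟩ := hx
      obtain ⟨g', hg', hy⟩ := hy
      have key : ∀ (w : Fbar) (a b : ℕ), w ^ p ^ a = w → w ^ p ^ (a * b) = w := by
        intro w a b hw
        induction b with
        | zero => simp
        | succ b ih => rw [mul_add, mul_one, pow_add, pow_mul, ih, hw]
      refine ⟨g * g', Nat.mul_pos hg hg', ?_⟩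
      rw [mul_pow, key x g g' hx, mul_comm g, key y g' g hy]
  have hle : maximalUnramified F Fbar ≤ IntermediateField.adjoin F Z := by
    refine sSup_le ?_
    rintro L ⟨hL, hL'⟩ y hy
    have := mem_span_of_unramified p hϖ L hL' y hy
    exact (Submodule.span_le (p := (IntermediateField.adjoin F Z).toSubalgebra.toSubmodule)).2
      (IntermediateField.subset_adjoin F Z) this
  have hx' : x ∈ Submodule.span F Z := by
    have h := hle hx
    rw [← hadj]
    rw [← IntermediateField.mem_toSubalgebra,
      IntermediateField.adjoin_toSubalgebra_of_isAlgebraic halg] at h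
    exact h
  obtain ⟨n, a, z, rfl⟩ := Submodule.mem_span_set'.1 hx'
  simp only [Algebra.smul_def]
  exact exists_norm_eq_of_sum p n a (fun i => (z i : Fbar)) fun i => (z i).2

/-- The value group of the completion of `F^ur` is generated by the norm of a uniformizer of `F`. -/
lemma exists_zpow_norm_eq_completedUnramified (p : ℕ) [Fact p.Prime] [CharP F p] [ProperSpace F]
    {ϖ : integers F} (hϖ : Irreducible ϖ) (x : completedUnramified F Fbar) (hx : x ≠ 0) :
    ∃ n : ℤ, ‖x‖ = ‖(ϖ : F)‖ ^ n := by
  have hx0 : (0 : ℝ) < ‖(x : UniformSpace.Completion Fbar)‖ :=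
    norm_pos_iff.2 fun h => hx (Subtype.ext h)
  have hmem : (x : UniformSpace.Completion Fbar) ∈ closure
      (((maximalUnramified F Fbar).toSubfield.map (UniformSpace.Completion.coeRingHom :
        Fbar →+* UniformSpace.Completion Fbar)) : Set (UniformSpace.Completion Fbar)) := x.2
  -- An approximation of x with error smaller than ‖x‖ has the same norm as x, so completion does
  -- not enlarge the value group.
  obtain ⟨_, ⟨y, hy, rfl⟩, hxy⟩ := Metric.mem_closure_iff.1 hmem _ hx0
  rw [dist_eq_norm] at hxy
  have h1 := norm_eq_of_norm_sub_lt hxy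
  obtain ⟨z, hz⟩ := norm_mem_of_mem_maximalUnramified p hϖ y hy
  have h2 : ‖((UniformSpace.Completion.coeRingHom : Fbar →+* UniformSpace.Completion Fbar) y)‖ =
    ‖z‖ := (UniformSpace.Completion.norm_coe y).trans hz
  have h3 : ‖x‖ = ‖z‖ := h1.symm.trans h2
  obtain ⟨n, hn⟩ := exists_zpow_norm_eq hϖ (x := z) (by
    rw [← norm_pos_iff, ← h3]; exact hx0)
  exact ⟨n, h3.trans hn⟩

end Unramified

end LubinTateCurve

namespace LubinTateCurve

/-! ### Primitive torsion points generate totally ramified extensions. -/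

section Torsion

open Polynomial

/-- Go backwards along the orbit of x: the last non-zero iterate satisfies y^(q² - 1) = -ϖ, and each
earlier point z satisfies ‖z‖^(q²) = ‖next point‖, because z^(q²) has to dominate ϖ z. -/
lemma norm_of_isPrimitiveTorsion {L : Type*} [NormedField L] [IsUltrametricDist L] {q k : ℕ}
    (hq : 2 ≤ q) (hk : 1 ≤ k) {ϖ x : L} (h0 : 0 < ‖ϖ‖) (h1 : ‖ϖ‖ < 1)
    (hx : IsPrimitiveTorsion q ϖ k x) : ‖x‖ ^ (q ^ (2 * (k - 1)) * (q ^ 2 - 1)) = ‖ϖ‖ := by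
  have hq2 : 4 ≤ q ^ 2 := by nlinarith
  set y : ℕ → L := fun n => (fun y => y ^ (q ^ 2) + ϖ * y)^[n] x with hy
  have hsucc : ∀ n, y (n + 1) = y n ^ q ^ 2 + ϖ * y n := fun n => by
    simp only [hy, Function.iterate_succ', Function.comp]
  have hk0 : y k = 0 := hx.1
  have hk1 : y (k - 1) ≠ 0 := hx.2
  have key : ∀ j, j ≤ k - 1 → ‖y (k - 1 - j)‖ ^ (q ^ (2 * j) * (q ^ 2 - 1)) = ‖ϖ‖ := by
    intro j
    induction j with
    | zero =>
      intro _
      have h := hsucc (k - 1)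
      rw [Nat.sub_add_cancel hk, hk0] at h
      have e : y (k - 1) * (y (k - 1) ^ (q ^ 2 - 1)) = y (k - 1) * (-ϖ) := by
        rw [← pow_succ', Nat.sub_add_cancel (by omega)]
        linear_combination -h
      have := congrArg norm (mul_left_cancel₀ hk1 e)
      rw [norm_pow, norm_neg] at this
      simpa using this
    | succ j ih =>
      intro hj
      have h := ih (by omega)
      set z := y (k - 1 - (j + 1))
      have hz : y (k - 1 - j) = z ^ q ^ 2 + ϖ * z := by
        rw [← hsucc]; congr 1; omega
      set M := q ^ (2 * j) * (q ^ 2 - 1) with hM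
      have hM1 : 1 ≤ M := Nat.mul_pos (by positivity) (by omega)
      -- If ϖ z dominated, the M-th powers of the norms would give ‖ϖ‖ ≤ ‖ϖ‖^M ‖z‖^M < ‖ϖ‖.
      have hlt : ‖ϖ * z‖ < ‖z ^ q ^ 2‖ := by
        by_contra! hle
        have hle' : ‖y (k - 1 - j)‖ ≤ ‖ϖ‖ * ‖z‖ := by
          rw [hz, ← norm_mul]
          exact norm_add_le_of_le hle le_rfl
        have hz1 : ‖z‖ < 1 := by
          by_contra! hge
          have : ‖z‖ ≤ ‖z‖ ^ q ^ 2 := le_self_pow₀ hge (by omega)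
          rw [norm_mul, norm_pow] at hle
          nlinarith
        have h2 : ‖y (k - 1 - j)‖ ^ M ≤ (‖ϖ‖ * ‖z‖) ^ M :=
          pow_le_pow_left₀ (norm_nonneg _) hle' _
        rw [h, mul_pow] at h2
        have h3 : ‖ϖ‖ ^ M ≤ ‖ϖ‖ := pow_le_of_le_one h0.le h1.le (by omega)
        have h4 : ‖z‖ ^ M < 1 := pow_lt_one₀ (norm_nonneg _) hz1 (by omega)
        nlinarith [pow_nonneg (norm_nonneg z) M]
      have hn : ‖y (k - 1 - j)‖ = ‖z‖ ^ q ^ 2 := by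
        rw [hz, IsUltrametricDist.norm_add_eq_max_of_norm_ne_norm hlt.ne', max_eq_left hlt.le,
          norm_pow]
      rw [hn, ← pow_mul] at h
      rw [← h]
      congr 1
      rw [hM]
      ring
  simpa [hy] using key (k - 1) le_rfl

variable {E C : Type*} [NormedField E] [NormedField C] [IsUltrametricDist C] [Algebra E C]

/-- Iterates of `X ^ (q ^ 2) + ϖ X` as polynomials. -/
lemma exists_monic_iterate (q : ℕ) (hq : 2 ≤ q) (ϖ : E) (x : C) (n : ℕ) :
    ∃ P : E[X], P.Monic ∧ P.natDegree = q ^ (2 * n) ∧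
      aeval x P = (fun y => y ^ (q ^ 2) + algebraMap E C ϖ * y)^[n] x := by
  have hq2 : 4 ≤ q ^ 2 := by nlinarith
  induction n with
  | zero => exact ⟨X, monic_X, by simp, by simp⟩
  | succ n ih =>
    obtain ⟨P, hP, hd, he⟩ := ih
    have hlt : (Polynomial.C ϖ * P).degree < (P ^ q ^ 2).degree := by
      refine lt_of_le_of_lt (smul_eq_C_mul (p := P) ϖ ▸ degree_smul_le ϖ P) ?_
      rw [degree_eq_natDegree hP.ne_zero, degree_eq_natDegree (hP.pow _).ne_zero,
        hP.natDegree_pow, hd, Nat.cast_lt]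
      have : 0 < q ^ (2 * n) := by positivity
      nlinarith
    refine ⟨P ^ q ^ 2 + Polynomial.C ϖ * P, (hP.pow _).add_of_left hlt, ?_, ?_⟩
    · rw [natDegree_add_eq_left_of_degree_lt hlt, hP.natDegree_pow, hd]
      ring
    · rw [Function.iterate_succ', Function.comp, ← he]
      simp

/-- Elements of the field generated by a primitive torsion point are polynomials in that point of
degree less than `q ^ (2 (k - 1)) (q ^ 2 - 1)`. -/
lemma exists_polynomial_of_mem_adjoin {q k : ℕ} (hq : 2 ≤ q) (hk : 1 ≤ k) {ϖ : E} {x : C}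
    (hx : IsPrimitiveTorsion q (algebraMap E C ϖ) k x) {z : C}
    (hz : z ∈ IntermediateField.adjoin E {x}) :
    ∃ P : E[X], P.degree < (q ^ (2 * (k - 1)) * (q ^ 2 - 1) : ℕ) ∧ aeval x P = z := by
  have hq2 : 4 ≤ q ^ 2 := by nlinarith
  obtain ⟨P, hP, hd, he⟩ := exists_monic_iterate q hq ϖ x (k - 1)
  have hpos : 0 < q ^ (2 * (k - 1)) * (q ^ 2 - 1) := Nat.mul_pos (by positivity) (by omega)
  have hlt : (Polynomial.C ϖ).degree < (P ^ (q ^ 2 - 1)).degree := by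
    refine lt_of_le_of_lt degree_C_le ?_
    rw [degree_eq_natDegree (hP.pow _).ne_zero, hP.natDegree_pow, hd, mul_comm]
    exact_mod_cast hpos
  -- Ψ is the k-th iterate divided by the (k-1)-st; it vanishes at x because the (k-1)-st iterate
  -- does not.
  set Ψ := P ^ (q ^ 2 - 1) + Polynomial.C ϖ with hΨ
  have hm : Ψ.Monic := (hP.pow _).add_of_left hlt
  have hdeg : Ψ.natDegree = q ^ (2 * (k - 1)) * (q ^ 2 - 1) := by
    rw [hΨ, natDegree_add_eq_left_of_degree_lt hlt, hP.natDegree_pow, hd, mul_comm]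
  have h0 : aeval x Ψ = 0 := by
    have h1 : aeval x P ≠ 0 := he ▸ hx.2
    have h2 := hx.1
    rw [← Nat.sub_add_cancel hk, Function.iterate_succ', Function.comp, ← he] at h2
    refine mul_left_cancel₀ h1 ?_
    rw [mul_zero, ← h2, hΨ, map_add, map_pow, aeval_C, mul_add, ← pow_succ',
      Nat.sub_add_cancel (by omega), mul_comm (aeval x P)]
  have hint : IsIntegral E x := ⟨Ψ, hm, h0⟩
  rw [← IntermediateField.mem_toSubalgebra,
    IntermediateField.adjoin_simple_toSubalgebra_of_isAlgebraic hint.isAlgebraic,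
    Algebra.adjoin_singleton_eq_range_aeval] at hz
  obtain ⟨r, rfl⟩ := hz
  refine ⟨r %ₘ Ψ, ?_, ?_⟩
  · have := degree_modByMonic_lt r hm
    rwa [degree_eq_natDegree hm.ne_zero, hdeg] at this
  · have h := congrArg (aeval x) (modByMonic_add_div r Ψ)
    rw [map_add, map_mul, h0, zero_mul, add_zero] at h
    exact h

/-- The norm of a polynomial of small degree in a generator of a totally ramified extension. -/
lemma norm_aeval_totallyRamified (hn : ∀ y : E, ‖algebraMap E C y‖ = ‖y‖) {ρ : ℝ} (h0 : 0 < ρ)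
    (h1 : ρ < 1) (hE : ∀ y : E, y ≠ 0 → ∃ n : ℤ, ‖y‖ = ρ ^ n) {x : C} {e : ℕ} (he : 0 < e)
    (hx : ‖x‖ ^ e = ρ) {P : E[X]} (hP : P.degree < e) :
    (∀ i ∈ P.support, ∃ n : ℤ, ‖algebraMap E C (P.coeff i) * x ^ i‖ = ‖x‖ ^ (e * n + i)) ∧
    (∀ i ∈ P.support, ‖algebraMap E C (P.coeff i) * x ^ i‖ ≤ ‖aeval x P‖) ∧
    (P ≠ 0 → ∃ i ∈ P.support, ‖aeval x P‖ = ‖algebraMap E C (P.coeff i) * x ^ i‖) := by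
  have hx0 : 0 < ‖x‖ := by
    rcases (norm_nonneg x).eq_or_lt with h | h
    · rw [← h, zero_pow he.ne'] at hx
      exact absurd hx h0.ne
    · exact h
  have hx1 : ‖x‖ < 1 := by
    by_contra! h
    exact (one_le_pow₀ h).not_gt (hx ▸ h1)
  have hterm : ∀ i ∈ P.support, ∃ n : ℤ,
      ‖algebraMap E C (P.coeff i) * x ^ i‖ = ‖x‖ ^ (e * n + i) := by
    intro i hi
    obtain ⟨n, hn'⟩ := hE _ (mem_support_iff.1 hi)
    refine ⟨n, ?_⟩
    rw [norm_mul, hn, hn', norm_pow, ← hx, zpow_add₀ hx0.ne', zpow_mul, zpow_natCast, zpow_natCast]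
  have hsum : aeval x P = ∑ i ∈ P.support, algebraMap E C (P.coeff i) * x ^ i := by
    rw [aeval_def, eval₂_eq_sum, Polynomial.sum]
  -- The exponents e n + i with 0 ≤ i < e are distinct modulo e, so the terms have pairwise distinct
  -- norms and the largest one is the norm of the sum.
  have hpair : Set.Pairwise (P.support : Set ℕ) fun i j =>
      ‖algebraMap E C (P.coeff i) * x ^ i‖ ≠ ‖algebraMap E C (P.coeff j) * x ^ j‖ := by
    intro i hi j hj hij heq
    obtain ⟨n, hn⟩ := hterm i hi
    obtain ⟨m, hm⟩ := hterm j hj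
    rw [hn, hm] at heq
    have h2 := zpow_right_injective₀ hx0 hx1.ne heq
    have hlt : ∀ i ∈ P.support, i < e := fun i hi =>
      Nat.cast_lt.1 ((le_degree_of_mem_supp i hi).trans_lt hP)
    have hi' := hlt i hi
    have hj' := hlt j hj
    have h3 : ((e : ℤ) * n + i) % e = (e * m + j) % e := congrArg (· % (e : ℤ)) h2
    rw [Int.mul_add_emod_self_left, Int.mul_add_emod_self_left,
      Int.emod_eq_of_lt (by omega) (by omega), Int.emod_eq_of_lt (by omega) (by omega)] at h3
    exact hij (by exact_mod_cast h3)
  refine ⟨hterm, fun i hi => ?_, fun hP0 => ?_⟩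
  · have hne : P.support.Nonempty := ⟨i, hi⟩
    rw [hsum, IsUltrametricDist.norm_sum_eq_sup'_of_pairwise_ne hne hpair]
    exact Finset.le_sup' (f := fun i => ‖algebraMap E C (P.coeff i) * x ^ i‖) hi
  · have hne : P.support.Nonempty := by simpa using hP0
    rw [hsum, IsUltrametricDist.norm_sum_eq_sup'_of_pairwise_ne hne hpair]
    exact Finset.exists_mem_eq_sup' hne _

/-- The value group of a totally ramified extension. -/
lemma exists_zpow_norm_eq_totallyRamified (hn : ∀ y : E, ‖algebraMap E C y‖ = ‖y‖) {q k : ℕ}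
    (hq : 2 ≤ q) (hk : 1 ≤ k) {ϖ : E} {x : C} (h0 : 0 < ‖ϖ‖) (h1 : ‖ϖ‖ < 1)
    (hE : ∀ y : E, y ≠ 0 → ∃ n : ℤ, ‖y‖ = ‖ϖ‖ ^ n)
    (hx : IsPrimitiveTorsion q (algebraMap E C ϖ) k x) {z : C}
    (hz : z ∈ IntermediateField.adjoin E {x}) (hz0 : z ≠ 0) : ∃ n : ℤ, ‖z‖ = ‖x‖ ^ n := by
  have hxn := norm_of_isPrimitiveTorsion hq hk (by rwa [hn]) (by rwa [hn]) hx
  rw [hn] at hxn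
  have hq2 : 4 ≤ q ^ 2 := by nlinarith
  have hpos : 0 < q ^ (2 * (k - 1)) * (q ^ 2 - 1) := Nat.mul_pos (by positivity) (by omega)
  obtain ⟨P, hP, rfl⟩ := exists_polynomial_of_mem_adjoin hq hk hx hz
  obtain ⟨h2, -, h3⟩ := norm_aeval_totallyRamified hn h0 h1 hE hpos hxn hP
  obtain ⟨i, hi, h⟩ := h3 (fun h => hz0 (by simp [h]))
  obtain ⟨n, hn'⟩ := h2 i hi
  exact ⟨_, h.trans hn'⟩

/-- A totally ramified extension has trivial residue extension. -/
lemma exists_norm_sub_lt_one_totallyRamified (hn : ∀ y : E, ‖algebraMap E C y‖ = ‖y‖) {q k : ℕ}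
    (hq : 2 ≤ q) (hk : 1 ≤ k) {ϖ : E} {x : C} (h0 : 0 < ‖ϖ‖) (h1 : ‖ϖ‖ < 1)
    (hE : ∀ y : E, y ≠ 0 → ∃ n : ℤ, ‖y‖ = ‖ϖ‖ ^ n)
    (hx : IsPrimitiveTorsion q (algebraMap E C ϖ) k x) {z : C}
    (hz : z ∈ IntermediateField.adjoin E {x}) (hz1 : ‖z‖ ≤ 1) :
    ∃ y : E, ‖y‖ ≤ 1 ∧ ‖z - algebraMap E C y‖ < 1 := by
  have hxn := norm_of_isPrimitiveTorsion hq hk (by rwa [hn]) (by rwa [hn]) hx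
  rw [hn] at hxn
  have hq2 : 4 ≤ q ^ 2 := by nlinarith
  set e := q ^ (2 * (k - 1)) * (q ^ 2 - 1)
  have hpos : 0 < e := Nat.mul_pos (by positivity) (by omega)
  obtain ⟨P, hP, rfl⟩ := exists_polynomial_of_mem_adjoin hq hk hx hz
  obtain ⟨h2, h3, -⟩ := norm_aeval_totallyRamified hn h0 h1 hE hpos hxn hP
  have hle : ∀ i ∈ P.support, ‖algebraMap E C (P.coeff i) * x ^ i‖ ≤ 1 := fun i hi =>
    (h3 i hi).trans hz1
  -- A term of index 0 < i < e has norm ‖x‖ to a power prime to being a multiple of e, so its norm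
  -- is not one; only the constant coefficient contributes to the residue.
  refine ⟨P.coeff 0, ?_, ?_⟩
  · by_cases hc : P.coeff 0 = 0
    · simp [hc]
    · simpa [hn] using hle 0 (mem_support_iff.2 hc)
  have hsum : aeval x P - algebraMap E C (P.coeff 0) =
      ∑ i ∈ P.support.erase 0, algebraMap E C (P.coeff i) * x ^ i := by
    have h4 : aeval x P = ∑ i ∈ P.support, algebraMap E C (P.coeff i) * x ^ i := by
      rw [aeval_def, eval₂_eq_sum, Polynomial.sum]
    rw [h4, sub_eq_iff_eq_add]
    by_cases hc : P.coeff 0 = 0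
    · rw [Finset.erase_eq_of_notMem (by simpa using hc), hc, map_zero, add_zero]
    · rw [← Finset.sum_erase_add _ _ (mem_support_iff.2 hc), pow_zero, mul_one]
  rw [hsum]
  refine norm_sum_lt_one _ _ fun i hi => ?_
  obtain ⟨hi0, hi⟩ := Finset.mem_erase.1 hi
  refine lt_of_le_of_ne (hle i hi) fun h => ?_
  obtain ⟨n, hn'⟩ := h2 i hi
  rw [h] at hn'
  have hx0 : 0 < ‖x‖ := by
    rcases (norm_nonneg x).eq_or_lt with h | h
    · rw [← h, zero_pow hpos.ne'] at hxn
      exact absurd hxn h0.ne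
    · exact h
  have hx1 : ‖x‖ ≠ 1 := fun h => by rw [h, one_pow] at hxn; exact h1.ne hxn.symm
  have h5 := (zpow_eq_one_iff_right₀ hx0.le hx1).1 hn'.symm
  have hilt : i < e := Nat.cast_lt.1 ((le_degree_of_mem_supp i hi).trans_lt hP)
  have h6 : ((e : ℤ) * n + i) % e = 0 := by rw [h5]; simp
  rw [Int.mul_add_emod_self_left, Int.emod_eq_of_lt (by omega) (by omega)] at h6
  exact hi0 (by exact_mod_cast h6)

end Torsion

end LubinTateCurve

namespace LubinTateCurve

/-! ### Iterates of `X ^ (q ^ 2) + u X ^ q + ϖ X` -/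

section Iterates

variable {P : Type*} [CommRing P]

/-- The operation `z ↦ z ^ (q ^ 2) + u z ^ q + ϖ z`. -/
def ltOp (q : ℕ) (ϖ u z : P) : P := z ^ q ^ 2 + u * z ^ q + ϖ * z

/-- The operation `z ↦ z ^ (q ^ 2) + ϖ z`. -/
def ltOpZero (q : ℕ) (ϖ z : P) : P := z ^ q ^ 2 + ϖ * z

/-- The components of the `n`-th iterate of `ltOp` consisting of the powers `z ^ (q ^ i)` with `i`
even and with `i` odd. -/
def ltParts (q : ℕ) (ϖ u z : P) : ℕ → P × P
  | 0 => (z, 0)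
  | n + 1 => (ltOpZero q ϖ (ltParts q ϖ u z n).1 + u * (ltParts q ϖ u z n).2 ^ q,
      ltOpZero q ϖ (ltParts q ϖ u z n).2 + u * (ltParts q ϖ u z n).1 ^ q)

variable {q : ℕ}

lemma add_pow_sq (hadd : ∀ x y : P, (x + y) ^ q = x ^ q + y ^ q) (x y : P) :
    (x + y) ^ q ^ 2 = x ^ q ^ 2 + y ^ q ^ 2 := by
  simp only [pow_two q, pow_mul, hadd]

lemma sub_pow_of_add_pow (hadd : ∀ x y : P, (x + y) ^ q = x ^ q + y ^ q) (x y : P) :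
    (x - y) ^ q = x ^ q - y ^ q := by
  rw [eq_sub_iff_add_eq, ← hadd, sub_add_cancel]

lemma ltOp_add (hadd : ∀ x y : P, (x + y) ^ q = x ^ q + y ^ q) (ϖ u x y : P) :
    ltOp q ϖ u (x + y) = ltOp q ϖ u x + ltOp q ϖ u y := by
  simp only [ltOp, add_pow_sq hadd, hadd]; ring

lemma ltOp_iterate_add (hadd : ∀ x y : P, (x + y) ^ q = x ^ q + y ^ q) (ϖ u x y : P) (n : ℕ) :
    (ltOp q ϖ u)^[n] (x + y) = (ltOp q ϖ u)^[n] x + (ltOp q ϖ u)^[n] y := by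
  induction n with
  | zero => rfl
  | succ n ih => simp only [Function.iterate_succ', Function.comp, ih, ltOp_add hadd]

lemma ltOp_iterate_sub (hadd : ∀ x y : P, (x + y) ^ q = x ^ q + y ^ q) (ϖ u x y : P) (n : ℕ) :
    (ltOp q ϖ u)^[n] (x - y) = (ltOp q ϖ u)^[n] x - (ltOp q ϖ u)^[n] y := by
  rw [eq_sub_iff_add_eq, ← ltOp_iterate_add hadd, sub_add_cancel]

lemma ltOpZero_sub (hadd : ∀ x y : P, (x + y) ^ q = x ^ q + y ^ q) (ϖ x y : P) :
    ltOpZero q ϖ (x - y) = ltOpZero q ϖ x - ltOpZero q ϖ y := by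
  simp only [ltOpZero, sub_pow_of_add_pow (add_pow_sq hadd)]; ring

lemma ltOp_iterate_eq_parts (hadd : ∀ x y : P, (x + y) ^ q = x ^ q + y ^ q) (ϖ u z : P) (n : ℕ) :
    (ltOp q ϖ u)^[n] z = (ltParts q ϖ u z n).1 + (ltParts q ϖ u z n).2 := by
  induction n with
  | zero => simp [ltParts]
  | succ n ih =>
    rw [Function.iterate_succ', Function.comp, ih, ltOp_add hadd]
    simp only [ltParts, ltOp, ltOpZero]
    ring

/-- For c in 𝔽_{q²} the powers c^(q^i) depend only on the parity of i. The two parts are the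
eigenspaces, with eigenvalues c and c^q, that separate the two equations. -/
lemma ltParts_mul (ϖ u z : P) {c : P} (hc : c ^ q ^ 2 = c) (n : ℕ) :
    (ltParts q ϖ u (c * z) n).1 = c * (ltParts q ϖ u z n).1 ∧
      (ltParts q ϖ u (c * z) n).2 = c ^ q * (ltParts q ϖ u z n).2 := by
  have hc' : (c ^ q) ^ q = c := by rw [← pow_mul, ← pow_two, hc]
  have hc2 : (c ^ q) ^ q ^ 2 = c ^ q := by rw [← pow_mul, mul_comm, pow_mul, hc]
  induction n with
  | zero => simp [ltParts]
  | succ n ih =>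
    simp only [ltParts, ltOpZero, ih.1, ih.2, mul_pow, hc, hc', hc2]
    constructor <;> ring

/-- With x the torsion point, the arguments are Y = ζx + ζ^q S - U and X = x + S. The part of the
iterate of Y on which ζ acts as ζ, namely even in x and odd in S, is cancelled by ζ times the
iterate of X. -/
lemma ltOp_iterate_combination_one (hadd : ∀ x y : P, (x + y) ^ q = x ^ q + y ^ q) (ϖ u x S U : P)
    {ζ : P} (hζ : ζ ^ q ^ 2 = ζ) (k : ℕ) :
    (ltOp q ϖ u)^[k] (ζ * x + (ζ ^ q * S - U)) - ζ * (ltOp q ϖ u)^[k] (x + S) =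
      (ζ ^ q - ζ) * ((ltParts q ϖ u x k).2 + (ltParts q ϖ u S k).1) - (ltOp q ϖ u)^[k] U := by
  have hζ' : (ζ ^ q) ^ q = ζ := by rw [← pow_mul, ← pow_two, hζ]
  have hζ2 : (ζ ^ q) ^ q ^ 2 = ζ ^ q := by rw [← pow_mul, mul_comm, pow_mul, hζ]
  rw [ltOp_iterate_add hadd, ltOp_iterate_add hadd, ltOp_iterate_sub hadd,
    ltOp_iterate_eq_parts hadd _ _ (ζ * x), ltOp_iterate_eq_parts hadd _ _ x,
    ltOp_iterate_eq_parts hadd _ _ (ζ ^ q * S), ltOp_iterate_eq_parts hadd _ _ S,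
    (ltParts_mul ϖ u x hζ k).1, (ltParts_mul ϖ u x hζ k).2,
    (ltParts_mul ϖ u S hζ2 k).1, (ltParts_mul ϖ u S hζ2 k).2, hζ']
  ring

/-- The complementary cancellation: the odd part at x and the even part at S disappear. -/
lemma ltOp_iterate_combination_two (hadd : ∀ x y : P, (x + y) ^ q = x ^ q + y ^ q) (ϖ u x S U : P)
    {ζ : P} (hζ : ζ ^ q ^ 2 = ζ) (k : ℕ) :
    (ltOp q ϖ u)^[k] (ζ * x + (ζ ^ q * S - U)) - ζ ^ q * (ltOp q ϖ u)^[k] (x + S) =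
      -((ζ ^ q - ζ) * ((ltParts q ϖ u x k).1 + (ltParts q ϖ u S k).2)) - (ltOp q ϖ u)^[k] U := by
  have h1 := ltOp_iterate_combination_one hadd ϖ u x S U hζ k
  have h2 := ltOp_iterate_eq_parts hadd ϖ u x k
  have h3 := ltOp_iterate_eq_parts hadd ϖ u S k
  have h4 := ltOp_iterate_add hadd ϖ u x S k
  linear_combination h1 + (ζ - ζ ^ q) * (h4 + h2 + h3)

/-! ### Growth of the iterates in powers of π. -/

variable {N e μ : ℕ} {π ϖ u : P}

lemma pow_dvd_of_dvd_of_le {a b : ℕ} {x : P} (h : π ^ b ∣ x) (hab : a ≤ b) : π ^ a ∣ x :=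
  (pow_dvd_pow π hab).trans h

lemma pow_dvd_pow_of_dvd' {a n b : ℕ} {x : P} (h : π ^ a ∣ x) (hb : b ≤ n * a) : π ^ b ∣ x ^ n := by
  refine pow_dvd_of_dvd_of_le (b := a * n) ?_ (by rwa [mul_comm])
  rw [pow_mul]
  exact pow_dvd_pow_of_dvd h n

lemma pow_dvd_mul_of_dvd {a b c : ℕ} {x y : P} (hx : π ^ a ∣ x) (hy : π ^ b ∣ y) (h : c ≤ a + b) :
    π ^ c ∣ x * y :=
  pow_dvd_of_dvd_of_le (pow_add π a b ▸ mul_dvd_mul hx hy) h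

/-- In what follows ϖ has π-order at least e and u at least μ. The number N with e + N = q² N is the
order at which z^(q²) and ϖ z balance: below N the power dominates, above N the linear term. -/
lemma pow_dvd_ltOpZero (hϖ : π ^ e ∣ ϖ) {n r : ℕ} {z : P} (hz : π ^ n ∣ z) (h1 : r ≤ q ^ 2 * n)
    (h2 : r ≤ e + n) : π ^ r ∣ ltOpZero q ϖ z :=
  dvd_add (pow_dvd_pow_of_dvd' hz h1) (pow_dvd_mul_of_dvd hϖ hz h2)

/-- Growth of the iterates of `z ^ (q ^ 2) + ϖ z` while the first term dominates. -/
lemma pow_dvd_iterate_of_small (hϖ : π ^ e ∣ ϖ) (he : e + N = q ^ 2 * N) (hq : 2 ≤ q)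
    {v : ℕ} {z : P} (hz : π ^ v ∣ z) (n : ℕ) (hn : ∀ j < n, v * q ^ (2 * j) ≤ N) :
    π ^ (v * q ^ (2 * n)) ∣ (ltOpZero q ϖ)^[n] z := by
  induction n with
  | zero => simpa using hz
  | succ n ih =>
    rw [Function.iterate_succ', Function.comp]
    have h := hn n (by omega)
    have e1 : v * q ^ (2 * (n + 1)) = q ^ 2 * (v * q ^ (2 * n)) := by ring
    refine pow_dvd_ltOpZero hϖ (ih fun j hj => hn j (by omega)) e1.le ?_
    rw [e1]
    have : 4 ≤ q ^ 2 := by nlinarith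
    obtain ⟨c, hc⟩ : ∃ c, q ^ 2 = c + 1 := ⟨q ^ 2 - 1, by omega⟩
    rw [hc] at he ⊢
    nlinarith

/-- As long as the order stays strictly below N, every term involving ϖ is of strictly higher order
than the pure power, and the errors grow at least as fast as the main term. -/
lemma pow_dvd_iterate_sub_pow (hadd : ∀ x y : P, (x + y) ^ q = x ^ q + y ^ q) (hϖ : π ^ e ∣ ϖ)
    (he : e + N = q ^ 2 * N) (hq : 2 ≤ q) {v : ℕ} {z : P} (hz : π ^ v ∣ z) (n : ℕ)
    (hn : ∀ j < n, v * q ^ (2 * j) < N) :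
    π ^ (v * q ^ (2 * n) + 1) ∣ (ltOpZero q ϖ)^[n] z - z ^ q ^ (2 * n) := by
  induction n with
  | zero => simp
  | succ n ih =>
    rw [Function.iterate_succ', Function.comp]
    have h := hn n (by omega)
    have h1 := pow_dvd_iterate_of_small hϖ he hq hz n fun j hj => (hn j (by omega)).le
    have h2 := ih fun j hj => hn j (by omega)
    have e1 : v * q ^ (2 * (n + 1)) = q ^ 2 * (v * q ^ (2 * n)) := by ring
    have : 4 ≤ q ^ 2 := by nlinarith
    have e2 : ltOpZero q ϖ ((ltOpZero q ϖ)^[n] z) - z ^ q ^ (2 * (n + 1)) =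
        ((ltOpZero q ϖ)^[n] z - z ^ q ^ (2 * n)) ^ q ^ 2 + ϖ * (ltOpZero q ϖ)^[n] z := by
      rw [sub_pow_of_add_pow (add_pow_sq hadd), ltOpZero, ← pow_mul, ← pow_add]
      ring_nf
    rw [e2]
    refine dvd_add (pow_dvd_pow_of_dvd' h2 ?_) (pow_dvd_mul_of_dvd hϖ h1 ?_)
    · rw [e1]; nlinarith
    · rw [e1]
      obtain ⟨c, hc⟩ : ∃ c, q ^ 2 = c + 1 := ⟨q ^ 2 - 1, by omega⟩
      rw [hc] at he this ⊢
      nlinarith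

/-- Growth of the iterates of `z ^ (q ^ 2) + ϖ z` once the second term dominates. -/
lemma pow_dvd_iterate_of_large (hϖ : π ^ e ∣ ϖ) (he : e + N = q ^ 2 * N) (hq : 2 ≤ q)
    {v : ℕ} {z : P} (hz : π ^ v ∣ z) (hv : N ≤ v) (n : ℕ) :
    π ^ (n * e + v) ∣ (ltOpZero q ϖ)^[n] z := by
  induction n with
  | zero => simpa using hz
  | succ n ih =>
    rw [Function.iterate_succ', Function.comp]
    have : 4 ≤ q ^ 2 := by nlinarith
    obtain ⟨c, hc⟩ : ∃ c, q ^ 2 = c + 1 := ⟨q ^ 2 - 1, by omega⟩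
    refine pow_dvd_ltOpZero hϖ ih ?_ (by linarith)
    rw [hc] at he ⊢
    nlinarith [Nat.zero_le (c * (n * e)), Nat.mul_le_mul_left c hv]

/-- Strictly above order N the q²-th power is negligible, so each further step multiplies by ϖ up to
higher order. -/
lemma pow_dvd_iterate_sub_mul (hϖ : π ^ e ∣ ϖ)
    (he : e + N = q ^ 2 * N) (hq : 2 ≤ q) {v : ℕ} {z : P} (hz : π ^ v ∣ z) (hv : N < v) (n : ℕ) :
    π ^ (n * e + v + 1) ∣ (ltOpZero q ϖ)^[n] z - ϖ ^ n * z := by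
  induction n with
  | zero => simp
  | succ n ih =>
    rw [Function.iterate_succ', Function.comp]
    have h1 := pow_dvd_iterate_of_large hϖ he hq hz hv.le n
    have : 4 ≤ q ^ 2 := by nlinarith
    obtain ⟨c, hc⟩ : ∃ c, q ^ 2 = c + 1 := ⟨q ^ 2 - 1, by omega⟩
    have e2 : ltOpZero q ϖ ((ltOpZero q ϖ)^[n] z) - ϖ ^ (n + 1) * z =
        ((ltOpZero q ϖ)^[n] z) ^ q ^ 2 + ϖ * ((ltOpZero q ϖ)^[n] z - ϖ ^ n * z) := by
      rw [ltOpZero]; ring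
    rw [e2]
    refine dvd_add (pow_dvd_pow_of_dvd' h1 ?_) (pow_dvd_mul_of_dvd hϖ ih (by linarith))
    rw [hc] at he this ⊢
    have : c * (N + 1) ≤ c * v := Nat.mul_le_mul_left c hv
    nlinarith [Nat.zero_le (c * (n * e))]

/-- The parts of the iterates up to second order in `u`. -/
lemma pow_dvd_ltParts (hadd : ∀ x y : P, (x + y) ^ q = x ^ q + y ^ q) (hϖ : π ^ e ∣ ϖ) (hq : 2 ≤ q)
    (hu : π ^ μ ∣ u) (hμ : μ ≤ q ^ 2 * μ) (z : P) (n : ℕ) :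
    π ^ μ ∣ (ltParts q ϖ u z n).2 ∧
      π ^ ((1 + q) * μ) ∣ (ltParts q ϖ u z n).1 - (ltOpZero q ϖ)^[n] z := by
  have h2 : 4 ≤ q ^ 2 := by nlinarith
  induction n with
  | zero => simp [ltParts]
  | succ n ih =>
    obtain ⟨h1, h3⟩ := ih
    refine ⟨?_, ?_⟩
    · exact dvd_add (pow_dvd_ltOpZero hϖ h1 hμ (by omega)) (hu.mul_right _)
    · have e1 : (ltParts q ϖ u z (n + 1)).1 - (ltOpZero q ϖ)^[n + 1] z =
          ltOpZero q ϖ ((ltParts q ϖ u z n).1 - (ltOpZero q ϖ)^[n] z) +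
            u * (ltParts q ϖ u z n).2 ^ q := by
        rw [Function.iterate_succ', Function.comp, ltOpZero_sub hadd, ltParts]
        ring
      rw [e1]
      refine dvd_add (pow_dvd_ltOpZero hϖ h3 ?_ (by omega))
        (pow_dvd_mul_of_dvd hu (pow_dvd_pow_of_dvd' h1 le_rfl) (by linarith))
      exact Nat.le_mul_of_pos_left _ (by omega)

/-- The odd part is divisible by u and the correction to the even part already has order (1 + q) μ,
so the q²-th power of the former and u times the q-th power of the latter are both negligible. -/
lemma pow_dvd_ltParts_succ (hadd : ∀ x y : P, (x + y) ^ q = x ^ q + y ^ q) (hϖ : π ^ e ∣ ϖ)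
    (hq : 2 ≤ q) (hu : π ^ μ ∣ u) (z : P) (n : ℕ) :
    π ^ ((1 + q) * μ) ∣ (ltParts q ϖ u z (n + 1)).2 -
      (ϖ * (ltParts q ϖ u z n).2 + u * ((ltOpZero q ϖ)^[n] z) ^ q) := by
  have h2 : 1 + q ≤ q ^ 2 := by nlinarith
  have hμ : μ ≤ q ^ 2 * μ := Nat.le_mul_of_pos_left _ (by omega)
  obtain ⟨h1, h3⟩ := pow_dvd_ltParts hadd hϖ hq hu hμ z n
  have e1 : (ltParts q ϖ u z (n + 1)).2 -
      (ϖ * (ltParts q ϖ u z n).2 + u * ((ltOpZero q ϖ)^[n] z) ^ q) =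
      (ltParts q ϖ u z n).2 ^ q ^ 2 +
        u * ((ltParts q ϖ u z n).1 - (ltOpZero q ϖ)^[n] z) ^ q := by
    rw [sub_pow_of_add_pow hadd, ltParts,
      show ltOpZero q ϖ (ltParts q ϖ u z n).2 =
        (ltParts q ϖ u z n).2 ^ q ^ 2 + ϖ * (ltParts q ϖ u z n).2 from rfl]
    ring
  rw [e1]
  refine dvd_add (pow_dvd_pow_of_dvd' h1 (Nat.mul_le_mul_right _ h2))
    (pow_dvd_mul_of_dvd hu (pow_dvd_pow_of_dvd' h3 le_rfl) ?_)
  have : (1 + q) * μ ≤ q * ((1 + q) * μ) := Nat.le_mul_of_pos_left _ (by omega)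
  omega

/-- First-order expansion in u: the j-th summand uses the factor u once, after j iterations at u =
0, and then only multiplications by ϖ. Everything else has order at least (1 + q) μ. -/
lemma pow_dvd_ltParts_sub_sum (hadd : ∀ x y : P, (x + y) ^ q = x ^ q + y ^ q) (hϖ : π ^ e ∣ ϖ)
    (hq : 2 ≤ q) (hu : π ^ μ ∣ u) (z : P) (n : ℕ) :
    π ^ ((1 + q) * μ) ∣ (ltParts q ϖ u z n).2 -
      ∑ j ∈ Finset.range n, ϖ ^ (n - 1 - j) * u * ((ltOpZero q ϖ)^[j] z) ^ q := by
  induction n with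
  | zero => simp [ltParts]
  | succ n ih =>
    have h := dvd_add (pow_dvd_ltParts_succ hadd hϖ hq hu z n) (ih.mul_left ϖ)
    convert h using 1
    have e1 : ∑ j ∈ Finset.range n, ϖ ^ (n + 1 - 1 - j) * u * ((ltOpZero q ϖ)^[j] z) ^ q =
        ϖ * ∑ j ∈ Finset.range n, ϖ ^ (n - 1 - j) * u * ((ltOpZero q ϖ)^[j] z) ^ q := by
      rw [Finset.mul_sum]
      refine Finset.sum_congr rfl fun j hj => ?_
      have hj' := Finset.mem_range.1 hj
      rw [show n + 1 - 1 - j = (n - 1 - j) + 1 by omega, pow_succ]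
      ring
    rw [Finset.sum_range_succ, e1]
    simp only [Nat.add_sub_cancel, Nat.sub_self, pow_zero, one_mul]
    ring

/-- The iterates at an argument of valuation at least `N`. -/
lemma pow_dvd_ltOp_iterate (hϖ : π ^ e ∣ ϖ)
    (he : e + N = q ^ 2 * N) (hq : 2 ≤ q) (hN : 1 ≤ N) (hu : π ^ μ ∣ u)
    (hμ : e + N + 1 ≤ μ + q * N) {z : P} (hz : π ^ N ∣ z) (n : ℕ) :
    π ^ ((n + 1) * e + N + 1) ∣ (ltOp q ϖ u)^[n + 1] z - ϖ ^ n * ltOpZero q ϖ z := by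
  have h4 : 4 ≤ q ^ 2 := by nlinarith
  have he1 : 1 ≤ e := by nlinarith
  have hF : π ^ (e + N) ∣ ltOpZero q ϖ z := pow_dvd_ltOpZero hϖ hz he.le le_rfl
  induction n with
  -- For one iteration the difference is u z^q, which the hypothesis relating μ, e and N makes
  -- negligible against ϖ z.
  | zero =>
    have e1 : (ltOp q ϖ u)^[0 + 1] z - ϖ ^ 0 * ltOpZero q ϖ z = u * z ^ q := by
      simp only [Function.iterate_succ, Function.iterate_zero, Function.comp, id, ltOp, ltOpZero]
      ring
    rw [e1]
    exact pow_dvd_mul_of_dvd hu (pow_dvd_pow_of_dvd' hz le_rfl) (by linarith)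
  | succ n ih =>
    have hg : π ^ ((n + 1) * e + N) ∣ (ltOp q ϖ u)^[n + 1] z := by
      rw [← sub_add_cancel ((ltOp q ϖ u)^[n + 1] z) (ϖ ^ n * ltOpZero q ϖ z)]
      refine dvd_add (pow_dvd_of_dvd_of_le ih (by omega)) ?_
      refine pow_dvd_mul_of_dvd (a := n * e) (pow_dvd_pow_of_dvd' hϖ le_rfl) hF (by linarith)
    rw [Function.iterate_succ', Function.comp]
    set g := (ltOp q ϖ u)^[n + 1] z
    have e1 : ltOp q ϖ u g - ϖ ^ (n + 1) * ltOpZero q ϖ z =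
        g ^ q ^ 2 + u * g ^ q + ϖ * (g - ϖ ^ n * ltOpZero q ϖ z) := by
      rw [ltOp]; ring
    rw [e1]
    refine dvd_add (dvd_add (pow_dvd_pow_of_dvd' hg ?_)
      (pow_dvd_mul_of_dvd hu (pow_dvd_pow_of_dvd' hg le_rfl) ?_))
      (pow_dvd_mul_of_dvd hϖ ih (by linarith))
    · have h5 : (n + 1) * e ≤ n * e + e + 0 := by linarith
      nlinarith [Nat.zero_le (n * e), Nat.mul_le_mul_right (n * e) h4, Nat.mul_le_mul_right e h4]
    · nlinarith [Nat.zero_le (n * e), Nat.mul_le_mul_right ((n + 1) * e + N) hq]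

end Iterates

end LubinTateCurve

namespace LubinTateCurve

/-! ### Leading terms of the two equations. -/

section LeadingTerms

variable {P : Type*} [CommRing P] {q N e μ k m Q : ℕ} {π ϖ u a x y δ c₀ : P}

/-- The relations ϖ₁^(q²) = -ϖ ϖ₁ and δ^(q²) = δ turn the value at U = δ ϖ₁ x into a multiple of
x^(q²) - x: this is the Artin–Schreier term. At π the even part is negligible because the k-th
iterate vanishes for u = 0, and the odd part is u ϖ₁^q to leading order. M₁ and M₂ stand for the
contributions of S, which depend on the parity of k; the numerical hypotheses express that all other
terms are of higher order. -/
lemma leadingTerms_aux (hadd : ∀ x y : P, (x + y) ^ q = x ^ q + y ^ q) (hϖ : π ^ e ∣ ϖ)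
    (he : e + N = q ^ 2 * N) (hq : 2 ≤ q) (hN : 1 ≤ N) (hk : 1 ≤ k)
    (hu : π ^ μ ∣ u) (hA : k * e + N + 1 ≤ (1 + q) * μ) (hB : μ + q * N + 1 ≤ k * e + N)
    (hC : e + N + 1 ≤ μ + q * N) (heN : q * N + 1 ≤ e)
    {ϖ₁ : P} (hϖ₁ : (ltOpZero q ϖ)^[k - 1] π = ϖ₁) (hϖ₁' : ϖ₁ ^ q ^ 2 = -(ϖ * ϖ₁))
    (hϖ₁N : π ^ N ∣ ϖ₁) (hδ : δ ^ q ^ 2 = δ) {S M₁ M₂ : P}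
    (hM₁ : π ^ (μ + q * N + 1) ∣ (ltOpZero q ϖ)^[k] S - M₁)
    (hM₂ : π ^ (k * e + N + 1) ∣
      ∑ j ∈ Finset.range k, ϖ ^ (k - 1 - j) * u * ((ltOpZero q ϖ)^[j] S) ^ q - M₂) :
    π ^ (μ + q * N + 1) ∣ δ * ((ltParts q ϖ u π k).2 + (ltParts q ϖ u S k).1) -
        (ltOp q ϖ u)^[k] (δ * ϖ₁ * x) - δ * (u * ϖ₁ ^ q + M₁) ∧
    π ^ (k * e + N + 1) ∣ -(δ * ((ltParts q ϖ u π k).1 + (ltParts q ϖ u S k).2)) -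
        (ltOp q ϖ u)^[k] (δ * ϖ₁ * x) - (-(δ * M₂) + δ * (ϖ ^ k * ϖ₁) * (x ^ q ^ 2 - x)) := by
  have hμ : μ ≤ q ^ 2 * μ := Nat.le_mul_of_pos_left _ (by positivity)
  obtain ⟨n, rfl⟩ : ∃ n, k = n + 1 := ⟨k - 1, by omega⟩
  rw [Nat.add_sub_cancel] at hϖ₁
  have h0 : (ltOpZero q ϖ)^[n + 1] π = 0 := by
    rw [Function.iterate_succ', Function.comp, hϖ₁, ltOpZero, hϖ₁']; ring
  have hU : π ^ N ∣ δ * ϖ₁ * x := (hϖ₁N.mul_left δ).mul_right x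
  have hF : ltOpZero q ϖ (δ * ϖ₁ * x) = -(δ * (ϖ * ϖ₁) * (x ^ q ^ 2 - x)) := by
    rw [ltOpZero, mul_pow, mul_pow, hδ, hϖ₁']; ring
  have h1 := pow_dvd_ltOp_iterate hϖ he hq hN hu hC hU n
  rw [hF] at h1
  have h2 : π ^ ((n + 1) * e + N) ∣ (ltOp q ϖ u)^[n + 1] (δ * ϖ₁ * x) := by
    have h3 : π ^ ((n + 1) * e + N) ∣ ϖ ^ n * -(δ * (ϖ * ϖ₁) * (x ^ q ^ 2 - x)) := by
      have h4 : π ^ ((n + 1) * e + N) ∣ ϖ ^ (n + 1) * ϖ₁ :=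
        pow_dvd_mul_of_dvd (pow_dvd_pow_of_dvd' hϖ le_rfl) hϖ₁N le_rfl
      have h5 : ϖ ^ n * -(δ * (ϖ * ϖ₁) * (x ^ q ^ 2 - x)) =
        (ϖ ^ (n + 1) * ϖ₁) * -(δ * (x ^ q ^ 2 - x)) := by ring
      rw [h5]
      exact h4.mul_right _
    have := dvd_add (pow_dvd_of_dvd_of_le h1 (Nat.le_succ _)) h3
    rwa [sub_add_cancel] at this
  obtain ⟨h6, h7⟩ := pow_dvd_ltParts hadd hϖ hq hu hμ π (n + 1)
  obtain ⟨h8, h9⟩ := pow_dvd_ltParts hadd hϖ hq hu hμ S (n + 1)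
  rw [h0, sub_zero] at h7
  have h10 := pow_dvd_ltParts_succ hadd hϖ hq hu π n
  rw [hϖ₁] at h10
  have h11 := (pow_dvd_ltParts hadd hϖ hq hu hμ π n).1
  have h12 := pow_dvd_ltParts_sub_sum hadd hϖ hq hu S (n + 1)
  constructor
  · have h13 : π ^ (μ + q * N + 1) ∣ ϖ * (ltParts q ϖ u π n).2 :=
      pow_dvd_mul_of_dvd hϖ h11 (by linarith)
    have h14 := ((pow_dvd_of_dvd_of_le h10 (by linarith : μ + q * N + 1 ≤ _)).add h13).add
      ((pow_dvd_of_dvd_of_le h9 (by linarith : μ + q * N + 1 ≤ _)).add hM₁)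
    have h15 := (h14.mul_left δ).sub (pow_dvd_of_dvd_of_le h2 hB)
    convert h15 using 1
    ring
  · have h13 := ((pow_dvd_of_dvd_of_le h7 hA).add
      ((pow_dvd_of_dvd_of_le h12 hA).add hM₂)).mul_left (-δ)
    convert h13.sub h1 using 1
    ring

lemma pow_dvd_sub_of_dvd_sub (hadd : ∀ x y : P, (x + y) ^ q = x ^ q + y ^ q) {b c : ℕ} {z w : P}
    (h : π ^ b ∣ z - w) (hc : c ≤ q * b) : π ^ c ∣ z ^ q - w ^ q := by
  rw [← sub_pow_of_add_pow hadd]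
  exact pow_dvd_pow_of_dvd' h hc

lemma pow_dvd_mul_sub_mul {b c d : ℕ} {v z w : P} (hv : π ^ b ∣ v) (h : π ^ c ∣ z - w)
    (hd : d ≤ b + c) : π ^ d ∣ v * z - v * w := by
  rw [← mul_sub]
  exact pow_dvd_mul_of_dvd hv h hd

/-- The last iterate of a uniformizer before it is killed. -/
lemma pow_dvd_iterate_uniformizer_sub (hadd : ∀ x y : P, (x + y) ^ q = x ^ q + y ^ q)
    (hϖ : π ^ e ∣ ϖ) (he : e + N = q ^ 2 * N) (hq : 2 ≤ q) (hNk : N = q ^ (2 * (k - 1)))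
    {ϖ₁ : P} (hϖ₁ : (ltOpZero q ϖ)^[k - 1] π = ϖ₁) : π ^ (N + 1) ∣ ϖ₁ - π ^ N := by
  have := pow_dvd_iterate_sub_pow (v := 1) hadd hϖ he hq (by simp : π ^ 1 ∣ π) (k - 1) (by
    intro j hj
    rw [hNk, one_mul]
    exact Nat.pow_lt_pow_right (by omega) (by omega))
  rwa [hϖ₁, one_mul, ← hNk] at this

/-- The iterates of S have orders q^(k-1+2j), with an odd exponent as k is even, while N has an even
exponent. So the orders jump over N: they are N/q at step m - 1 and qN at step m, and at each step
one of the two terms dominates strictly. -/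
theorem leadingTerms_even (hadd : ∀ x y : P, (x + y) ^ q = x ^ q + y ^ q) (hϖ : π ^ e ∣ ϖ)
    (he : e + N = q ^ 2 * N) (hq : 2 ≤ q) (hm : 1 ≤ m) (hkm : k = 2 * m)
    (hNk : N = q ^ (2 * (k - 1))) (hQk : Q = q ^ (k - 1))
    {ϖ₁ : P} (hϖ₁ : (ltOpZero q ϖ)^[k - 1] π = ϖ₁) (hϖ₁' : ϖ₁ ^ q ^ 2 = -(ϖ * ϖ₁))
    (hδ : δ ^ q ^ 2 = δ) (hu : u = ϖ ^ m * a) :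
    π ^ (m * e + q * N + 1) ∣
      δ * ((ltParts q ϖ u π k).2 + (ltParts q ϖ u (π ^ Q * y) k).1) -
        (ltOp q ϖ u)^[k] (δ * ϖ₁ * x) - δ * (ϖ ^ m * ϖ₁ ^ q) * (a + y ^ (Q * q)) ∧
    π ^ (k * e + N + 1) ∣
      -(δ * ((ltParts q ϖ u π k).1 + (ltParts q ϖ u (π ^ Q * y) k).2)) -
        (ltOp q ϖ u)^[k] (δ * ϖ₁ * x) -
        δ * (ϖ ^ k * ϖ₁) * (x ^ q ^ 2 - x + a * (y ^ (Q * q ^ 2) - y ^ Q)) := by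
  have hN : 1 ≤ N := hNk ▸ Nat.one_le_pow _ _ (by omega)
  have h4 : 4 ≤ q ^ 2 := by nlinarith
  have heN : q * N + 1 ≤ e := by
    have : (q + 2) * N ≤ q ^ 2 * N + N := by nlinarith
    nlinarith
  have h2N : 2 * N ≤ q * N := Nat.mul_le_mul_right N hq
  have hme : e ≤ m * e := Nat.le_mul_of_pos_left _ hm
  have hke : k * e = m * e + m * e := by rw [hkm]; ring
  have hQN : N = Q * Q := by rw [hNk, hQk, ← pow_add]; congr 1; omega
  have hQm : Q * q ^ (2 * m) = q * N := by
    rw [hNk, hQk, ← pow_add, ← pow_succ']; congr 1; omega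
  have hQm' : Q * q ^ (2 * (m - 1)) * q = N := by
    rw [hNk, hQk, ← pow_add, ← pow_succ]; congr 1; omega
  have hqm : q ^ (2 * m) = Q * q := by rw [hQk, ← pow_succ]; congr 1; omega
  have hqm' : q ^ (2 * (m - 1)) * q = Q := by rw [hQk, ← pow_succ]; congr 1; omega
  have hϖm : π ^ (m * e) ∣ ϖ ^ m := pow_dvd_pow_of_dvd' hϖ le_rfl
  have huμ : π ^ (m * e) ∣ u := hu ▸ hϖm.mul_right a
  set S := π ^ Q * y
  have hS : π ^ Q ∣ S := Dvd.intro _ rfl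
  have hsmall : ∀ j < m, Q * q ^ (2 * j) < N := fun j hj => by
    rw [hNk, hQk, ← pow_add]
    exact Nat.pow_lt_pow_right (by omega) (by omega)
  have h1 := pow_dvd_iterate_uniformizer_sub hadd hϖ he hq hNk hϖ₁
  have hϖ₁N : π ^ N ∣ ϖ₁ := by
    have := (pow_dvd_of_dvd_of_le h1 (Nat.le_succ N)).add (dvd_refl (π ^ N))
    rwa [sub_add_cancel] at this
  -- Since Q² = N, the power S^Q is π^N y^Q, and ϖ₁ may replace π^N to leading order; expressing
  -- everything through ϖ₁ makes its functional equation available.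
  have hs : π ^ (N + 1) ∣ S ^ Q - ϖ₁ * y ^ Q := by
    have : S ^ Q - ϖ₁ * y ^ Q = (ϖ₁ - π ^ N) * -y ^ Q := by
      simp only [S, mul_pow, ← pow_mul, ← hQN]; ring
    rw [this]
    exact h1.mul_right _
  have hzm := pow_dvd_iterate_sub_pow hadd hϖ he hq hS m hsmall
  rw [hQm, hqm, pow_mul] at hzm
  have hzm' : π ^ (q * N + 1) ∣ (ltOpZero q ϖ)^[m] S - (ϖ₁ * y ^ Q) ^ q := by
    have := hzm.add (pow_dvd_sub_of_dvd_sub hadd hs (by nlinarith : q * N + 1 ≤ _))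
    rwa [sub_add_sub_cancel] at this
  have hzmd : π ^ (q * N) ∣ (ltOpZero q ϖ)^[m] S :=
    hQm ▸ pow_dvd_iterate_of_small hϖ he hq hS m fun j hj => (hsmall j hj).le
  have hzl := pow_dvd_iterate_sub_pow hadd hϖ he hq hS (m - 1) fun j hj => hsmall j (by omega)
  have hzl' : π ^ (N + 1) ∣ ((ltOpZero q ϖ)^[m - 1] S) ^ q - ϖ₁ * y ^ Q := by
    have := (pow_dvd_sub_of_dvd_sub hadd hzl (by rw [← hQm']; nlinarith : N + 1 ≤ _))
    rw [← pow_mul, hqm'] at this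
    have := this.add hs
    rwa [sub_add_sub_cancel] at this
  have hM₁ : π ^ (m * e + q * N + 1) ∣ (ltOpZero q ϖ)^[k] S - ϖ ^ m * (ϖ₁ * y ^ Q) ^ q := by
    have h2 := pow_dvd_iterate_sub_mul hϖ he hq hzmd (by omega) m
    rw [← Function.iterate_add_apply, ← two_mul, ← hkm] at h2
    have := h2.add (pow_dvd_mul_sub_mul hϖm hzm' (by omega : m * e + q * N + 1 ≤ _))
    rwa [sub_add_sub_cancel] at this
  -- Only j = m - 1 and j = m reach the order ke + N: earlier summands carry too many factors ϖ, and
  -- in later ones the q-th power of the iterate is too large.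
  have hM₂ : π ^ (k * e + N + 1) ∣
      ∑ j ∈ Finset.range k, ϖ ^ (k - 1 - j) * u * ((ltOpZero q ϖ)^[j] S) ^ q -
        (ϖ ^ m * u * (ϖ₁ * y ^ Q) + ϖ ^ (m - 1) * u * ((ϖ₁ * y ^ Q) ^ q) ^ q) := by
    rw [← Finset.sum_erase_add _ _ (Finset.mem_range.2 (by omega : m < k)),
      ← Finset.sum_erase_add _ _ (Finset.mem_erase.2
        ⟨(by omega : m - 1 ≠ m), Finset.mem_range.2 (by omega : m - 1 < k)⟩)]
    rw [add_assoc (Finset.sum _ _), add_sub_assoc (Finset.sum _ _),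
      show k - 1 - (m - 1) = m by omega,
      show k - 1 - m = m - 1 by omega, add_sub_add_comm]
    refine dvd_add (Finset.dvd_sum fun j hj => ?_) (dvd_add ?_ ?_)
    · simp only [Finset.mem_erase, Finset.mem_range] at hj
      obtain ⟨hj1, hj2, hj3⟩ := hj
      rcases lt_or_ge j m with h | h
      · have hϖj : π ^ ((m + 1) * e) ∣ ϖ ^ (k - 1 - j) :=
          pow_dvd_pow_of_dvd' hϖ (Nat.mul_le_mul_right _ (by omega))
        refine (pow_dvd_mul_of_dvd hϖj huμ ?_).mul_right _
        rw [hke, add_mul]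
        omega
      · obtain ⟨t, ht⟩ : ∃ t, j = t + m := ⟨j - m, by omega⟩
        have hz := pow_dvd_iterate_of_large hϖ he hq hzmd (by omega) t
        rw [← Function.iterate_add_apply, ← ht] at hz
        have hϖj : π ^ ((m - 1 - t) * e) ∣ ϖ ^ (k - 1 - j) :=
          pow_dvd_pow_of_dvd' hϖ (Nat.mul_le_mul_right _ (by omega))
        refine pow_dvd_mul_of_dvd (pow_dvd_mul_of_dvd hϖj huμ le_rfl)
          (pow_dvd_pow_of_dvd' hz le_rfl) ?_
        obtain ⟨r, hr⟩ : ∃ r, m = r + 1 + t := ⟨m - 1 - t, by omega⟩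
        have h5 : (m - 1 - t) * e + t * e + e = m * e := by
          rw [show m - 1 - t = r by omega, hr]; ring
        have h6 : 2 * (t * e + q * N) ≤ q * (t * e + q * N) := Nat.mul_le_mul_right _ hq
        have h7 : q * (t * e + q * N) = q * (t * e) + (e + N) := by rw [he]; ring
        have h8 : 2 * (t * e) ≤ q * (t * e) := Nat.mul_le_mul_right _ hq
        have h9 : 1 * e ≤ t * e := Nat.mul_le_mul_right _ (by omega)
        rw [hke, h7]
        omega
    · refine pow_dvd_mul_sub_mul (pow_dvd_mul_of_dvd hϖm huμ le_rfl) hzl' ?_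
      omega
    · have hϖj : π ^ ((m - 1) * e) ∣ ϖ ^ (m - 1) := pow_dvd_pow_of_dvd' hϖ le_rfl
      refine pow_dvd_mul_sub_mul (pow_dvd_mul_of_dvd hϖj huμ le_rfl)
        (pow_dvd_sub_of_dvd_sub hadd hzm' le_rfl) ?_
      have h5 : (m - 1) * e + e = m * e := by
        obtain ⟨r, hr⟩ : ∃ r, m = r + 1 := ⟨m - 1, by omega⟩
        rw [hr, Nat.add_sub_cancel]; ring
      have h7 : q * (q * N + 1) = e + N + q := by rw [he]; ring
      rw [hke, h7]
      omega
  obtain ⟨r1, r2⟩ := leadingTerms_aux (x := x) hadd hϖ he hq hN (by omega) huμ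
    (by
      have : 3 * (m * e) ≤ (1 + q) * (m * e) := Nat.mul_le_mul_right _ (by omega)
      omega)
    (by omega) (by omega) heN hϖ₁ hϖ₁' hϖ₁N hδ hM₁ hM₂
  refine ⟨?_, ?_⟩
  · convert r1 using 2
    rw [hu, mul_pow, ← pow_mul]; ring
  · convert r2 using 2
    -- Here ϖ₁^(q²) = -ϖ ϖ₁ gives the two surviving summands opposite signs, which produces y^(Q q²)
    -- - y^Q.
    obtain ⟨r, hr⟩ : ∃ r, m = r + 1 := ⟨m - 1, by omega⟩
    rw [← pow_mul _ q q, ← pow_two, mul_pow ϖ₁ _ (q ^ 2), hϖ₁', hu, hkm, hr, Nat.add_sub_cancel,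
      ← pow_mul y]
    ring

/-- For odd k the orders of the iterates of S hit N exactly, at step m - 1. Both terms of the
operation then count, and the next iterate is -ϖ ϖ₁ (y^(Q q²) - y^Q) to leading order. The factor c₀
= ϖ^m / ϖ₁^(q-1) is chosen so that u ϖ₁^q has the order of this contribution. -/
theorem leadingTerms_odd (hadd : ∀ x y : P, (x + y) ^ q = x ^ q + y ^ q) (hϖ : π ^ e ∣ ϖ)
    (he : e + N = q ^ 2 * N) (hq : 2 ≤ q) (hm : 2 ≤ m) (hkm : k + 1 = 2 * m)
    (hNk : N = q ^ (2 * (k - 1))) (hQk : Q = q ^ (k - 1))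
    {ϖ₁ : P} (hϖ₁ : (ltOpZero q ϖ)^[k - 1] π = ϖ₁) (hϖ₁' : ϖ₁ ^ q ^ 2 = -(ϖ * ϖ₁))
    (hδ : δ ^ q ^ 2 = δ) (hc₀ : c₀ * ϖ₁ ^ (q - 1) = ϖ ^ m) (hc₀μ : π ^ μ ∣ c₀)
    (hμ : μ + q * N = m * e + N) (hu : u = c₀ * a) :
    π ^ (m * e + N + 1) ∣
      δ * ((ltParts q ϖ u π k).2 + (ltParts q ϖ u (π ^ Q * y) k).1) -
        (ltOp q ϖ u)^[k] (δ * ϖ₁ * x) -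
        δ * (ϖ ^ m * ϖ₁) * (a + -(y ^ (Q * q ^ 2) - y ^ Q)) ∧
    π ^ (k * e + N + 1) ∣
      -(δ * ((ltParts q ϖ u π k).1 + (ltParts q ϖ u (π ^ Q * y) k).2)) -
        (ltOp q ϖ u)^[k] (δ * ϖ₁ * x) -
        δ * (ϖ ^ k * ϖ₁) * (x ^ q ^ 2 - x + a * -y ^ (Q * q)) := by
  have hN : 1 ≤ N := hNk ▸ Nat.one_le_pow _ _ (by omega)
  have h4 : 4 ≤ q ^ 2 := by nlinarith
  have heN : q * N + 1 ≤ e := by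
    have : (q + 2) * N ≤ q ^ 2 * N + N := by nlinarith
    nlinarith
  have h2N : 2 * N ≤ q * N := Nat.mul_le_mul_right N hq
  have hme : 2 * e ≤ m * e := Nat.mul_le_mul_right _ hm
  have hke : k * e + e = m * e + m * e := by
    have : (k + 1) * e = 2 * m * e := by rw [hkm]
    linarith
  have hQN : N = Q * Q := by rw [hNk, hQk, ← pow_add]; congr 1; omega
  have hQm : Q * q ^ (2 * (m - 1)) = N := by
    rw [hNk, hQk, ← pow_add]; congr 1; omega
  have hqm : q ^ (2 * (m - 1)) = Q := by rw [hQk]; congr 1; omega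
  have hm1 : (m - 1) * e + e = m * e := by
    obtain ⟨r, hr⟩ : ∃ r, m = r + 1 := ⟨m - 1, by omega⟩
    rw [hr, Nat.add_sub_cancel]; ring
  have huμ : π ^ μ ∣ u := hu ▸ hc₀μ.mul_right a
  set S := π ^ Q * y
  have hS : π ^ Q ∣ S := Dvd.intro _ rfl
  have hsmall : ∀ j < m - 1, Q * q ^ (2 * j) < N := fun j hj => by
    rw [hNk, hQk, ← pow_add]
    exact Nat.pow_lt_pow_right (by omega) (by omega)
  have h1 := pow_dvd_iterate_uniformizer_sub hadd hϖ he hq hNk hϖ₁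
  have hϖ₁N : π ^ N ∣ ϖ₁ := by
    have := (pow_dvd_of_dvd_of_le h1 (Nat.le_succ N)).add (dvd_refl (π ^ N))
    rwa [sub_add_cancel] at this
  have hs : π ^ (N + 1) ∣ S ^ Q - ϖ₁ * y ^ Q := by
    have : S ^ Q - ϖ₁ * y ^ Q = (ϖ₁ - π ^ N) * -y ^ Q := by
      simp only [S, mul_pow, ← pow_mul, ← hQN]; ring
    rw [this]
    exact h1.mul_right _
  have hzl := pow_dvd_iterate_sub_pow hadd hϖ he hq hS (m - 1) hsmall
  rw [hQm, hqm] at hzl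
  have hzl' : π ^ (N + 1) ∣ (ltOpZero q ϖ)^[m - 1] S - ϖ₁ * y ^ Q := by
    have := hzl.add hs
    rwa [sub_add_sub_cancel] at this
  have hzld : π ^ N ∣ (ltOpZero q ϖ)^[m - 1] S := by
    have := pow_dvd_iterate_of_small hϖ he hq hS (m - 1) fun j hj => (hsmall j hj).le
    rwa [hQm] at this
  have hiter : (ltOpZero q ϖ)^[m] S = ltOpZero q ϖ ((ltOpZero q ϖ)^[m - 1] S) := by
    rw [← Function.comp_apply (f := ltOpZero q ϖ), ← Function.iterate_succ']
    congr 1; omega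
  have hzmd : π ^ (e + N) ∣ (ltOpZero q ϖ)^[m] S := by
    rw [hiter]; exact pow_dvd_ltOpZero hϖ hzld he.le le_rfl
  have hzm : π ^ (e + N + 1) ∣ (ltOpZero q ϖ)^[m] S - ltOpZero q ϖ (ϖ₁ * y ^ Q) := by
    rw [hiter, ← ltOpZero_sub hadd]
    exact pow_dvd_ltOpZero hϖ hzl' (by rw [he]; nlinarith) le_rfl
  have hM₁ : π ^ (μ + q * N + 1) ∣
      (ltOpZero q ϖ)^[k] S - ϖ ^ (m - 1) * ltOpZero q ϖ (ϖ₁ * y ^ Q) := by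
    have h2 := pow_dvd_iterate_sub_mul hϖ he hq hzmd (by omega) (m - 1)
    rw [← Function.iterate_add_apply, show m - 1 + m = k by omega] at h2
    have := (pow_dvd_of_dvd_of_le h2 (by omega : μ + q * N + 1 ≤ _)).add
      (pow_dvd_mul_sub_mul (pow_dvd_pow_of_dvd' hϖ le_rfl : π ^ ((m - 1) * e) ∣ ϖ ^ (m - 1)) hzm
        (by omega : μ + q * N + 1 ≤ _))
    rwa [sub_add_sub_cancel] at this
  have hM₂ : π ^ (k * e + N + 1) ∣
      ∑ j ∈ Finset.range k, ϖ ^ (k - 1 - j) * u * ((ltOpZero q ϖ)^[j] S) ^ q -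
        -- Now a single summand, j = m - 1, has the minimal order; the balance at order N makes all
        -- others strictly smaller.
        ϖ ^ (m - 1) * u * (ϖ₁ * y ^ Q) ^ q := by
    rw [← Finset.sum_erase_add _ _ (Finset.mem_range.2 (by omega : m - 1 < k)), add_sub_assoc,
      show k - 1 - (m - 1) = m - 1 by omega]
    refine dvd_add (Finset.dvd_sum fun j hj => ?_) ?_
    · simp only [Finset.mem_erase, Finset.mem_range] at hj
      obtain ⟨hj1, hj2⟩ := hj
      rcases lt_or_ge j m with h | h
      · have hϖj : π ^ (m * e) ∣ ϖ ^ (k - 1 - j) :=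
          pow_dvd_pow_of_dvd' hϖ (Nat.mul_le_mul_right _ (by omega))
        exact (pow_dvd_mul_of_dvd hϖj huμ (by omega)).mul_right _
      · obtain ⟨t, ht⟩ : ∃ t, j = t + m := ⟨j - m, by omega⟩
        have hz := pow_dvd_iterate_of_large hϖ he hq hzmd (by omega) t
        rw [← Function.iterate_add_apply, ← ht] at hz
        have hϖj : π ^ ((m - 2 - t) * e) ∣ ϖ ^ (k - 1 - j) :=
          pow_dvd_pow_of_dvd' hϖ (Nat.mul_le_mul_right _ (by omega))
        refine pow_dvd_mul_of_dvd (pow_dvd_mul_of_dvd hϖj huμ le_rfl)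
          (pow_dvd_pow_of_dvd' hz le_rfl) ?_
        obtain ⟨r, hr⟩ : ∃ r, m = r + 2 + t := ⟨m - 2 - t, by omega⟩
        have h5 : (m - 2 - t) * e + t * e + 2 * e = m * e := by
          rw [show m - 2 - t = r by omega, hr]; ring
        have h7 : q * (t * e + (e + N)) = q * (t * e) + q * e + q * N := by ring
        have h8 : 2 * (t * e) ≤ q * (t * e) := Nat.mul_le_mul_right _ hq
        have h9 : 2 * e ≤ q * e := Nat.mul_le_mul_right _ hq
        rw [h7]
        omega
    · have hϖj : π ^ ((m - 1) * e) ∣ ϖ ^ (m - 1) := pow_dvd_pow_of_dvd' hϖ le_rfl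
      refine pow_dvd_mul_sub_mul (pow_dvd_mul_of_dvd hϖj huμ le_rfl)
        (pow_dvd_sub_of_dvd_sub hadd hzl' le_rfl) ?_
      have h7 : q * (N + 1) = q * N + q := by ring
      omega
  obtain ⟨r1, r2⟩ := leadingTerms_aux (x := x) hadd hϖ he hq hN (by omega) huμ
    (by
      have h5 : (1 + q) * μ + q ^ 2 * N = (1 + q) * (m * e) + N := by
        have : (1 + q) * (μ + q * N) = (1 + q) * (m * e + N) := by rw [hμ]
        nlinarith
      have h6 : 3 * (m * e) ≤ (1 + q) * (m * e) := Nat.mul_le_mul_right _ (by omega)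
      omega)
    (by omega) (by omega) heN hϖ₁ hϖ₁' hϖ₁N hδ hM₁ hM₂
  rw [hμ] at r1
  have hq1 : c₀ * ϖ₁ ^ q = ϖ ^ m * ϖ₁ := by
    rw [← hc₀, mul_assoc, ← pow_succ, Nat.sub_add_cancel (by omega)]
  obtain ⟨r, hr⟩ : ∃ r, m = r + 1 := ⟨m - 1, by omega⟩
  refine ⟨?_, ?_⟩
  · convert r1 using 2
    rw [ltOpZero, mul_pow, hϖ₁', ← pow_mul, hu]
    rw [hr] at hq1 ⊢
    rw [Nat.add_sub_cancel]
    linear_combination (-δ * a) * hq1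
  · convert r2 using 2
    rw [mul_pow, ← pow_mul, hu, show k = r + m by omega, show m - 1 = r by omega, pow_add]
    linear_combination (δ * ϖ ^ r * a * y ^ (Q * q)) * hq1

end LeadingTerms

end LubinTateCurve

/-! ### Additivity and functoriality of the operation. -/

namespace LubinTateCurve

lemma add_pow_of_natCast_eq_zero {P : Type*} [CommRing P] {p : ℕ} (hp : p.Prime)
    (h : (p : P) = 0) (f : ℕ) (x y : P) : (x + y) ^ p ^ f = x ^ p ^ f + y ^ p ^ f := by
  induction f with
  | zero => simp
  | succ f ih =>
    obtain ⟨r, hr⟩ := exists_add_pow_prime_eq hp (x ^ p ^ f) (y ^ p ^ f)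
    rw [pow_succ, pow_mul, ih, hr, h, pow_mul, pow_mul]
    ring

section LtOp

variable {P : Type*} [CommRing P] {q : ℕ}

lemma ltOp_sub (hadd : ∀ x y : P, (x + y) ^ q = x ^ q + y ^ q) (ϖ u x y : P) :
    ltOp q ϖ u (x - y) = ltOp q ϖ u x - ltOp q ϖ u y :=
  ltOp_iterate_sub hadd ϖ u x y 1

lemma ltOp_zero (hq : q ≠ 0) (ϖ u : P) : ltOp q ϖ u 0 = 0 := by
  simp [ltOp, hq]

lemma ltOp_mul {c : P} (hc : c ^ q = c) (ϖ u x : P) :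
    ltOp q ϖ u (c * x) = c * ltOp q ϖ u x := by
  have : c ^ q ^ 2 = c := by rw [pow_two, pow_mul, hc, hc]
  simp only [ltOp, mul_pow, hc, this]
  ring

lemma map_ltOp {P' : Type*} [CommRing P'] (g : P →+* P') (ϖ u x : P) :
    g (ltOp q ϖ u x) = ltOp q (g ϖ) (g u) (g x) := by
  simp [ltOp]

lemma map_ltOp_iterate {P' : Type*} [CommRing P'] (g : P →+* P') (ϖ u x : P) (n : ℕ) :
    g ((ltOp q ϖ u)^[n] x) = (ltOp q (g ϖ) (g u))^[n] (g x) := by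
  induction n with
  | zero => rfl
  | succ n ih => simp only [Function.iterate_succ', Function.comp, map_ltOp, ih]

lemma ltOp_iterate_mul {c : P} (hc : c ^ q = c) (ϖ u x : P) (n : ℕ) :
    (ltOp q ϖ u)^[n] (c * x) = c * (ltOp q ϖ u)^[n] x := by
  induction n with
  | zero => rfl
  | succ n ih => simp only [Function.iterate_succ', Function.comp, ih, ltOp_mul hc]

lemma ltOp_iterate_zero (hq : q ≠ 0) (ϖ u : P) (n : ℕ) : (ltOp q ϖ u)^[n] 0 = 0 :=
  Function.iterate_fixed (ltOp_zero hq ϖ u) n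

end LtOp

/-! ### Digits in equal characteristic -/

/-- Expansions `a = s(a) + ϖ a'` with `s` a ring homomorphism onto the elements with
`s ^ q = s`. -/
structure Digits (𝒪 : Type*) [CommRing 𝒪] (q : ℕ) (ϖ : 𝒪) where
  /-- the leading digit -/
  s : 𝒪 →+* 𝒪
  /-- the shift -/
  sh : 𝒪 → 𝒪
  eq : ∀ a, a = s a + ϖ * sh a
  s_pow : ∀ a, s a ^ q = s a
  s_eq_self : ∀ a, a ^ q = a → s a = a
  s_uniformizer : s ϖ = 0
  cancel : ∀ a b, ϖ * a = ϖ * b → a = b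

namespace Digits

variable {𝒪 : Type*} [CommRing 𝒪] {q : ℕ} {ϖ : 𝒪} (d : Digits 𝒪 q ϖ)

lemma sh_eq {a b : 𝒪} (h : a = d.s a + ϖ * b) : d.sh a = b :=
  d.cancel _ _ (add_left_cancel ((d.eq a).symm.trans h))

lemma sh_add (a b : 𝒪) : d.sh (a + b) = d.sh a + d.sh b :=
  d.sh_eq (by
    conv_lhs => rw [d.eq a, d.eq b]
    rw [map_add]; ring)

lemma sh_of_pow {a : 𝒪} (h : a ^ q = a) : d.sh a = 0 :=
  d.sh_eq (by rw [d.s_eq_self a h, mul_zero, add_zero])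

lemma sh_mul_of_pow {a : 𝒪} (h : a ^ q = a) (b : 𝒪) : d.sh (a * b) = a * d.sh b :=
  d.sh_eq (by
    conv_lhs => rw [d.eq b]
    rw [map_mul, d.s_eq_self a h]; ring)

lemma sh_uniformizer_mul (a : 𝒪) : d.sh (ϖ * a) = a :=
  d.sh_eq (by rw [map_mul, d.s_uniformizer, zero_mul, zero_add])

lemma s_uniformizer_mul (a : 𝒪) : d.s (ϖ * a) = 0 := by
  rw [map_mul, d.s_uniformizer, zero_mul]

lemma sh_zero : d.sh 0 = 0 := d.sh_eq (by simp)

end Digits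

/-! ### The action of digit expansions on points -/

section ActEval

variable {𝒪 P : Type*} [CommRing 𝒪] [CommRing P] {q : ℕ} {ϖ : 𝒪} (d : Digits 𝒪 q ϖ) (i : 𝒪 →+* P)
  (u : P)

/-- The value at `x` of the first `N` terms of the multiplication by `a` in the formal module with
`[ϖ](X) = X ^ (q ^ 2) + u X ^ q + ϖ X`. -/
def actEval : ℕ → 𝒪 → P → P
  | 0, _, _ => 0
  | N + 1, a, x => i (d.s a) * x + ltOp q (i ϖ) u (actEval N (d.sh a) x)

variable {d i u}

lemma map_digit_pow (a : 𝒪) : i (d.s a) ^ q = i (d.s a) := by rw [← map_pow, d.s_pow]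

lemma actEval_add_right (hadd : ∀ x y : P, (x + y) ^ q = x ^ q + y ^ q) (N : ℕ) (a : 𝒪) (x y : P) :
    actEval d i u N a (x + y) = actEval d i u N a x + actEval d i u N a y := by
  induction N generalizing a with
  | zero => simp [actEval]
  | succ N ih => simp only [actEval, ih, ltOp_add hadd]; ring

lemma actEval_add_left (hadd : ∀ x y : P, (x + y) ^ q = x ^ q + y ^ q) (N : ℕ) (a b : 𝒪) (x : P) :
    actEval d i u N (a + b) x = actEval d i u N a x + actEval d i u N b x := by
  induction N generalizing a b with
  | zero => simp [actEval]
  | succ N ih => simp only [actEval, d.sh_add, ih, ltOp_add hadd, map_add]; ring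

lemma actEval_zero_right (hq : q ≠ 0) (N : ℕ) (a : 𝒪) : actEval d i u N a 0 = 0 := by
  induction N generalizing a with
  | zero => rfl
  | succ N ih => simp [actEval, ih, ltOp_zero hq]

lemma actEval_zero_left (hq : q ≠ 0) (N : ℕ) (x : P) : actEval d i u N 0 x = 0 := by
  induction N with
  | zero => rfl
  | succ N ih => simp [actEval, d.sh_zero, ih, ltOp_zero hq]

lemma actEval_of_pow (hq : q ≠ 0) (N : ℕ) {a : 𝒪} (ha : a ^ q = a) (x : P) :
    actEval d i u (N + 1) a x = i a * x := by
  rw [actEval, d.sh_of_pow ha, actEval_zero_left hq, ltOp_zero hq, add_zero, d.s_eq_self a ha]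

lemma actEval_ltOp (hadd : ∀ x y : P, (x + y) ^ q = x ^ q + y ^ q) (N : ℕ) (a : 𝒪) (x : P) :
    actEval d i u N a (ltOp q (i ϖ) u x) = ltOp q (i ϖ) u (actEval d i u N a x) := by
  -- For q = 0 additivity reads 1 = 1 + 1, so the ring is trivial.
  by_cases hq : q = 0
  · have := hadd 0 0
    simp only [hq, pow_zero] at this
    have h1 : (1 : P) = 0 := by simpa using this
    exact (subsingleton_of_zero_eq_one h1.symm).elim _ _
  induction N generalizing a with
  | zero => simp [actEval, ltOp_zero hq]
  | succ N ih => simp only [actEval, ih, ltOp_add hadd, ltOp_mul (map_digit_pow a)]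

lemma actEval_iterate (hadd : ∀ x y : P, (x + y) ^ q = x ^ q + y ^ q) (N : ℕ) (a : 𝒪) (x : P)
    (n : ℕ) : actEval d i u N a ((ltOp q (i ϖ) u)^[n] x) =
      (ltOp q (i ϖ) u)^[n] (actEval d i u N a x) := by
  induction n with
  | zero => rfl
  | succ n ih => simp only [Function.iterate_succ', Function.comp, actEval_ltOp hadd, ih]

/-- The digit of index N multiplies the N-th iterate of x, which vanishes; on torsion points
finitely many digits give the full action. -/
lemma actEval_succ_of_iterate_eq_zero (hadd : ∀ x y : P, (x + y) ^ q = x ^ q + y ^ q) (hq : q ≠ 0)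
    (N : ℕ) (a : 𝒪) (x : P) (hx : (ltOp q (i ϖ) u)^[N] x = 0) :
    actEval d i u (N + 1) a x = actEval d i u N a x := by
  induction N generalizing a x with
  | zero =>
    have : x = 0 := hx
    rw [this, actEval_zero_right hq, actEval_zero_right hq]
  | succ N ih =>
    rw [actEval, ← actEval_ltOp hadd, ih _ _ hx, actEval_ltOp hadd, ← actEval]

lemma actEval_add_of_iterate_eq_zero (hadd : ∀ x y : P, (x + y) ^ q = x ^ q + y ^ q) (hq : q ≠ 0)
    (N n : ℕ) (a : 𝒪) (x : P) (hx : (ltOp q (i ϖ) u)^[N] x = 0) :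
    actEval d i u (N + n) a x = actEval d i u N a x := by
  induction n with
  | zero => rfl
  | succ n ih =>
    rw [← add_assoc, actEval_succ_of_iterate_eq_zero hadd hq, ih]
    rw [add_comm, Function.iterate_add_apply, hx, ltOp_iterate_zero hq]

lemma actEval_mul_of_pow {a : 𝒪} (ha : a ^ q = a) (N : ℕ) (b : 𝒪) (x : P) :
    actEval d i u N (a * b) x = i a * actEval d i u N b x := by
  have ha' : i a ^ q = i a := by rw [← map_pow, ha]
  induction N generalizing b with
  | zero => simp [actEval]
  | succ N ih =>
    simp only [actEval, d.sh_mul_of_pow ha, ih, map_mul, d.s_eq_self a ha, ltOp_mul ha']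
    ring

lemma actEval_succ_uniformizer_mul (N : ℕ) (a : 𝒪) (x : P) :
    actEval d i u (N + 1) (ϖ * a) x = ltOp q (i ϖ) u (actEval d i u N a x) := by
  rw [actEval, d.s_uniformizer_mul, d.sh_uniformizer_mul, map_zero, zero_mul, zero_add]

lemma actEval_uniformizer_mul (hadd : ∀ x y : P, (x + y) ^ q = x ^ q + y ^ q) (hq : q ≠ 0)
    (N : ℕ) (a : 𝒪) (x : P) (hx : (ltOp q (i ϖ) u)^[N] x = 0) :
    actEval d i u N (ϖ * a) x = ltOp q (i ϖ) u (actEval d i u N a x) := by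
  rw [← actEval_succ_of_iterate_eq_zero hadd hq N _ x hx, actEval_succ_uniformizer_mul]

lemma actEval_pow_uniformizer_mul (hq : q ≠ 0) (N : ℕ) (a : 𝒪) (x : P) :
    actEval d i u N (ϖ ^ N * a) x = 0 := by
  induction N generalizing a with
  | zero => rfl
  | succ N ih => rw [pow_succ', mul_assoc, actEval_succ_uniformizer_mul, ih, ltOp_zero hq]

/-- On torsion points the truncated action is a genuine action. Splitting off the leading digit of a
moves one factor ϖ onto x, which lowers the torsion order of x. -/
lemma actEval_mul (hadd : ∀ x y : P, (x + y) ^ q = x ^ q + y ^ q) (hq : q ≠ 0) (N : ℕ) (a b : 𝒪)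
    (x : P) (hx : (ltOp q (i ϖ) u)^[N] x = 0) :
    actEval d i u N (a * b) x = actEval d i u N a (actEval d i u N b x) := by
  -- The induction is on the torsion order M of x, while the number N of digits stays fixed.
  have key : ∀ M ≤ N, ∀ a x, (ltOp q (i ϖ) u)^[M] x = 0 →
      actEval d i u N (a * b) x = actEval d i u N a (actEval d i u N b x) := by
    intro M
    induction M with
    | zero =>
      intro _ a x hx
      have : x = 0 := hx
      simp only [this, actEval_zero_right hq]
    | succ M ih =>
      intro hM a x hx
      have hxN : (ltOp q (i ϖ) u)^[N] x = 0 := by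
        rw [← Nat.sub_add_cancel hM, Function.iterate_add_apply, hx, ltOp_iterate_zero hq]
      have hy : (ltOp q (i ϖ) u)^[N] (actEval d i u N b x) = 0 := by
        rw [← actEval_iterate hadd, hxN, actEval_zero_right hq]
      have e1 : a * b = d.s a * b + ϖ * (d.sh a * b) := by
        conv_lhs => rw [d.eq a]
        ring
      rw [e1, actEval_add_left hadd, actEval_mul_of_pow (d.s_pow a),
        actEval_uniformizer_mul hadd hq _ _ _ hxN, ← actEval_ltOp hadd, ih (by omega) _ _ hx,
        actEval_ltOp hadd N b, actEval_ltOp hadd N (d.sh a),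
        ← actEval_succ_of_iterate_eq_zero hadd hq N a _ hy, actEval]
  exact key N le_rfl a x hx

lemma map_actEval {P' : Type*} [CommRing P'] (g : P →+* P') (N : ℕ) (a : 𝒪) (x : P) :
    g (actEval d i u N a x) = actEval d (g.comp i) (g u) N a (g x) := by
  induction N generalizing a with
  | zero => simp [actEval]
  | succ N ih => simp [actEval, ih, map_ltOp]

lemma actEval_mem (hq : q ≠ 0) (I : Ideal P) {x : P} (hx : x ∈ I) (N : ℕ) (a : 𝒪) :
    actEval d i u N a x ∈ I := by
  induction N generalizing a with
  | zero => exact I.zero_mem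
  | succ N ih =>
    refine I.add_mem (I.mul_mem_left _ hx) ?_
    refine I.add_mem (I.add_mem ?_ ?_) (I.mul_mem_left _ (ih _))
    · exact I.pow_mem_of_mem (ih _) _ (by positivity)
    · exact I.mul_mem_left _ (I.pow_mem_of_mem (ih _) _ (by positivity))

end ActEval

/-! ### Weights of power series -/

section Weight

variable {A : Type*} [CommRing A] (I : Ideal A) {σ : Type*}

/-- The power series `h` lies in the `m`-th power of the ideal generated by `I` and the
variables, coefficientwise. -/
def HasWeight (m : ℕ) (h : MvPowerSeries σ A) : Prop :=
  ∀ e : σ →₀ ℕ, MvPowerSeries.coeff e h ∈ I ^ (m - e.degree)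

variable {I}

lemma HasWeight.mono {m n : ℕ} {h : MvPowerSeries σ A} (hh : HasWeight I n h) (hmn : m ≤ n) :
    HasWeight I m h := fun e => Ideal.pow_le_pow_right (by omega) (hh e)

lemma hasWeight_zero (m : ℕ) : HasWeight I m (0 : MvPowerSeries σ A) := fun e => by simp

lemma hasWeight_zero_left (h : MvPowerSeries σ A) : HasWeight I 0 h := fun e => by simp

lemma HasWeight.add {m : ℕ} {g h : MvPowerSeries σ A} (hg : HasWeight I m g)
    (hh : HasWeight I m h) : HasWeight I m (g + h) := fun e => by
  rw [map_add]; exact Ideal.add_mem _ (hg e) (hh e)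

lemma HasWeight.sub {m : ℕ} {g h : MvPowerSeries σ A} (hg : HasWeight I m g)
    (hh : HasWeight I m h) : HasWeight I m (g - h) := fun e => by
  rw [map_sub]; exact Ideal.sub_mem _ (hg e) (hh e)

lemma HasWeight.mul {m n : ℕ} {g h : MvPowerSeries σ A} (hg : HasWeight I m g)
    (hh : HasWeight I n h) : HasWeight I (m + n) (g * h) := fun e => by
  classical
  rw [MvPowerSeries.coeff_mul]
  refine Ideal.sum_mem _ fun x hx => ?_
  have hd : x.1.degree + x.2.degree = e.degree := by
    rw [← map_add, Finset.HasAntidiagonal.mem_antidiagonal.1 hx]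
  have := Ideal.mul_mem_mul (hg x.1) (hh x.2)
  rw [← pow_add] at this
  exact Ideal.pow_le_pow_right (by omega) this

lemma HasWeight.pow {m : ℕ} {g : MvPowerSeries σ A} (hg : HasWeight I m g) (n : ℕ) :
    HasWeight I (n * m) (g ^ n) := by
  induction n with
  | zero => simpa using hasWeight_zero_left _
  | succ n ih => rw [pow_succ, Nat.succ_mul]; exact ih.mul hg

lemma hasWeight_C {c : A} (hc : c ∈ I) : HasWeight I 1 (MvPowerSeries.C c : MvPowerSeries σ A) := by
  classical
  intro e
  rw [MvPowerSeries.coeff_C]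
  split_ifs with h
  · simpa [h] using hc
  · exact Ideal.zero_mem _

lemma hasWeight_one {h : MvPowerSeries σ A} (hh : MvPowerSeries.constantCoeff h = 0) :
    HasWeight I 1 h := by
  intro e
  by_cases he : e = 0
  · rw [he, MvPowerSeries.coeff_zero_eq_constantCoeff_apply, hh]
    exact Ideal.zero_mem _
  · have : 1 - e.degree = 0 := by
      have : e.degree ≠ 0 := fun h => he ((Finsupp.degree_eq_zero_iff e).1 h)
      omega
    simp [this]

/-- The q²-th power at least doubles the weight, and u and ϖ each contribute weight one. The
operation is therefore contracting for the filtration by weight. -/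
lemma HasWeight.ltOp {q : ℕ} (hq : 2 ≤ q) {ϖ u : A} (hϖ : ϖ ∈ I) (hu : u ∈ I) {m : ℕ}
    (hm : 1 ≤ m) {g : MvPowerSeries σ A} (hg : HasWeight I m g) :
    HasWeight I (m + 1) (ltOp q (MvPowerSeries.C ϖ) (MvPowerSeries.C u) g) := by
  refine HasWeight.add (HasWeight.add ?_ ?_) ?_
  · exact (hg.pow _).mono (by
      have : 2 ≤ q ^ 2 := by nlinarith
      nlinarith)
  · exact ((hasWeight_C hu).mul (hg.pow _)).mono (by nlinarith)
  · exact ((hasWeight_C hϖ).mul hg).mono (by omega)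

/-- A coefficient of degree n, viewed with weight n + r, lies in I^r = 0. -/
lemma eq_zero_of_hasWeight {r : ℕ} (hI : I ^ r = ⊥) {h : MvPowerSeries σ A}
    (hh : ∀ m, HasWeight I m h) : h = 0 := by
  ext e
  have := hh (e.degree + r) e
  rw [Nat.add_sub_cancel_left, hI] at this
  simpa using this

/-- Uniqueness of solutions of recursions whose right hand side increases weights. -/
lemma eq_zero_of_eq_ltOp {q : ℕ} (hq : 2 ≤ q) {ϖ u : A} (hϖ : ϖ ∈ I) (hu : u ∈ I) {r : ℕ}
    (hI : I ^ r = ⊥) {T : Type*} (D : T → MvPowerSeries σ A)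
    (h0 : ∀ t, MvPowerSeries.constantCoeff (D t) = 0)
    (hD : ∀ t, ∃ t', D t = ltOp q (MvPowerSeries.C ϖ) (MvPowerSeries.C u) (D t')) (t : T) :
    D t = 0 := by
  have key : ∀ m t, HasWeight I (m + 1) (D t) := by
    intro m
    induction m with
    | zero => exact fun t => hasWeight_one (h0 t)
    | succ m ih =>
      intro t
      obtain ⟨t', ht'⟩ := hD t
      rw [ht']
      exact (ih t').ltOp hq hϖ hu (by omega)
  exact eq_zero_of_hasWeight hI fun m => (key m t).mono (Nat.le_succ m)

end Weight

end LubinTateCurve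

namespace LubinTateCurve

/-! ### The formal module with prescribed multiplication by ϖ over a nilpotent thickening. -/

section Construction

variable {𝒪 A : Type*} [CommRing 𝒪] [CommRing A] {q p f : ℕ} {ϖ : 𝒪}

lemma mvPowerSeries_add_pow {σ : Type*} (hp : p.Prime) (hqf : q = p ^ f) (hpA : (p : A) = 0)
    (x y : MvPowerSeries σ A) : (x + y) ^ q = x ^ q + y ^ q := by
  subst hqf
  refine add_pow_of_natCast_eq_zero hp ?_ f x y
  rw [← map_natCast (MvPowerSeries.C (σ := σ) (R := A)), hpA, map_zero]

/-- The power series `X ^ (q ^ 2) + u X ^ q + ϖ X`. -/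
noncomputable abbrev ltSeries (q : ℕ) (ϖ u : A) : PowerSeries A :=
  PowerSeries.X ^ (q ^ 2) + PowerSeries.C u * PowerSeries.X ^ q + PowerSeries.C ϖ * PowerSeries.X

lemma subst_ltOp {τ : Type*} {y : MvPowerSeries τ A} (hy : PowerSeries.HasSubst y) (ϖ u : A)
    (g : PowerSeries A) :
    (ltOp q (PowerSeries.C ϖ) (PowerSeries.C u) g).subst y =
      ltOp q (MvPowerSeries.C ϖ) (MvPowerSeries.C u) (g.subst y) := by
  rw [← PowerSeries.coe_substAlgHom hy]
  have := map_ltOp (q := q) ((PowerSeries.substAlgHom hy : PowerSeries A →ₐ[A] MvPowerSeries τ A) :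
    PowerSeries A →+* MvPowerSeries τ A) (PowerSeries.C ϖ) (PowerSeries.C u) g
  have h2 : ∀ c : A, PowerSeries.substAlgHom hy (PowerSeries.C c) =
      (MvPowerSeries.C c : MvPowerSeries τ A) := fun c => (PowerSeries.substAlgHom hy).commutes c
  simpa only [RingHom.coe_coe, h2] using this

lemma subst_ltSeries {τ : Type*} {y : MvPowerSeries τ A} (hy : PowerSeries.HasSubst y) (ϖ u : A) :
    (ltSeries q ϖ u).subst y = ltOp q (MvPowerSeries.C ϖ) (MvPowerSeries.C u) y := by
  have := subst_ltOp (q := q) hy ϖ u PowerSeries.X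
  rwa [PowerSeries.subst_X hy] at this

lemma subst_C_mul {τ : Type*} {y : MvPowerSeries τ A} (hy : PowerSeries.HasSubst y) (c : A)
    (g : PowerSeries A) :
    (PowerSeries.C c * g).subst y = MvPowerSeries.C c * g.subst y := by
  rw [PowerSeries.subst_mul hy]
  congr 1
  rw [← PowerSeries.coe_substAlgHom hy]
  exact (PowerSeries.substAlgHom hy).commutes c

lemma subst_X_pair {σ : Type*} {f g : MvPowerSeries σ A}
    (hf : MvPowerSeries.constantCoeff f = 0) (hg : MvPowerSeries.constantCoeff g = 0) :
    (FormalGroup.𝔾ₐ (R := A)).toPowerSeries.subst ![f, g] = f + g := by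
  have h := hasSubst_vec hf hg
  rw [FormalGroup.𝔾ₐ_toPowerSeries, MvPowerSeries.subst_add h, MvPowerSeries.subst_X h,
    MvPowerSeries.subst_X h]
  rfl

namespace FormalModule

variable {i : 𝒪 →+* A} {g : PowerSeries A}

lemma act_add_of_additive {M : FormalModule i} (hM : M.group = FormalGroup.𝔾ₐ) (a b : 𝒪) :
    M.act (a + b) = M.act a + M.act b := by
  rw [M.act_add, hM]
  exact subst_X_pair (M.act_constantCoeff a) (M.act_constantCoeff b)

lemma act_eq_rec {M : FormalModule i} {u : A} (hM : M.HasStandardForm q ϖ (ltSeries q (i ϖ) u))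
    (s b : 𝒪) (hs : s ^ q = s) :
    M.act (s + ϖ * b) = PowerSeries.C (i s) * PowerSeries.X +
      ltOp q (PowerSeries.C (i ϖ)) (PowerSeries.C u) (M.act b) := by
  rw [act_add_of_additive hM.group, hM.act_coefficient s hs, M.act_mul, hM.act_uniformizer,
    subst_ltSeries (PowerSeries.HasSubst.of_constantCoeff_zero' (M.act_constantCoeff b))]
  rfl

/-- A formal module in standard form is determined by `[ϖ](X)`. -/
theorem eq_of_hasStandardForm (hp : p.Prime) (hqf : q = p ^ f) (hpA : (p : A) = 0) (hq : 2 ≤ q)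
    (d : Digits 𝒪 q ϖ) {I : Ideal A} {r : ℕ} (hI : I ^ r = ⊥) {u : A} (hu : u ∈ I)
    (hϖ : i ϖ ∈ I) {M M' : FormalModule i} (hM : M.HasStandardForm q ϖ (ltSeries q (i ϖ) u))
    (hM' : M'.HasStandardForm q ϖ (ltSeries q (i ϖ) u)) : M = M' := by
  -- The difference of the two actions at a is the operation applied to the difference at the shift
  -- of a, because the leading digits act identically; the contraction principle makes it vanish.
  have key : ∀ a, M.act a - M'.act a = 0 := by
    refine eq_zero_of_eq_ltOp hq hϖ hu hI (fun a => M.act a - M'.act a) ?_ ?_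
    · intro a
      have h1 := M.act_constantCoeff a
      have h2 := M'.act_constantCoeff a
      change PowerSeries.constantCoeff (M.act a - M'.act a) = 0
      rw [map_sub, h1, h2, sub_zero]
    · intro a
      refine ⟨d.sh a, ?_⟩
      have h1 := act_eq_rec hM (d.s a) (d.sh a) (d.s_pow a)
      have h2 := act_eq_rec hM' (d.s a) (d.sh a) (d.s_pow a)
      rw [← d.eq a] at h1 h2
      rw [ltOp_sub (mvPowerSeries_add_pow hp hqf hpA), h1, h2]
      exact add_sub_add_left_eq_sub _ _ _
  have hact : M.act = M'.act := funext fun a => sub_eq_zero.1 (key a)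
  have hgr : M.group = M'.group := hM.group.trans hM'.group.symm
  cases M
  cases M'
  simp only at hact hgr
  subst hact hgr
  rfl

end FormalModule

variable (d : Digits 𝒪 q ϖ) (i : 𝒪 →+* A) (u : A)

/-- The partial sums of the power series for the multiplication by `a`. -/
noncomputable def actPartial (N : ℕ) (a : 𝒪) : PowerSeries A :=
  actEval d (PowerSeries.C.comp i) (PowerSeries.C u) N a PowerSeries.X

/-- The partial sums of the power series for the multiplication by `a`, as polynomials. -/
noncomputable def actPoly (N : ℕ) (a : 𝒪) : Polynomial A :=
  actEval d (Polynomial.C.comp i) (Polynomial.C u) N a Polynomial.X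

lemma coe_actPoly (N : ℕ) (a : 𝒪) : (actPoly d i u N a : PowerSeries A) = actPartial d i u N a := by
  have := map_actEval (d := d) (i := Polynomial.C.comp i) (u := Polynomial.C u)
    (Polynomial.coeToPowerSeries.ringHom (R := A)) N a Polynomial.X
  have h : (Polynomial.coeToPowerSeries.ringHom (R := A)).comp (Polynomial.C.comp i) =
      PowerSeries.C.comp i := by ext; simp
  rw [h] at this
  simpa [actPoly, actPartial] using this

lemma eval_actPoly (N : ℕ) (a : 𝒪) (x : A) :
    (actPoly d i u N a).eval x = actEval d i u N a x := by
  have := map_actEval (d := d) (i := Polynomial.C.comp i) (u := Polynomial.C u)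
    (Polynomial.evalRingHom x) N a Polynomial.X
  have h : (Polynomial.evalRingHom x).comp (Polynomial.C.comp i) = i := by ext; simp
  rw [h] at this
  simpa [actPoly, actPartial] using this

lemma actPartial_succ (N : ℕ) (a : 𝒪) : actPartial d i u (N + 1) a =
    PowerSeries.C (i (d.s a)) * PowerSeries.X +
      ltOp q (PowerSeries.C (i ϖ)) (PowerSeries.C u) (actPartial d i u N (d.sh a)) := rfl

/-- The power series for the multiplication by `a`, when the `r`-th power of the ideal generated by
`u` and `ϖ` vanishes. -/
noncomputable def actSeries (r : ℕ) (a : 𝒪) : PowerSeries A :=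
  -- The coefficient of X^n is constant from the (n + r)-th partial sum on: later changes have
  -- weight above n + r, and I^r = 0.
  PowerSeries.mk fun n => PowerSeries.coeff n (actPartial d i u (n + r) a)

variable {d i u} {I : Ideal A} {r : ℕ}

/-- The N-th digit enters through N applications of the operation, each of which raises the weight.
-/
lemma hasWeight_actPartial_sub (hp : p.Prime) (hqf : q = p ^ f) (hpA : (p : A) = 0) (hq : 2 ≤ q)
    (hu : u ∈ I) (hϖ : i ϖ ∈ I) (N : ℕ) (a : 𝒪) :
    HasWeight I (N + 1) (actPartial d i u (N + 1) a - actPartial d i u N a) := by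
  induction N generalizing a with
  | zero =>
    refine hasWeight_one ?_
    change PowerSeries.constantCoeff _ = 0
    simp [actPartial, actEval, ltOp, show q ≠ 0 by omega]
  | succ N ih =>
    rw [actPartial_succ d i u (N + 1) a, actPartial_succ d i u N a, add_sub_add_left_eq_sub,
      ← ltOp_sub (mvPowerSeries_add_pow hp hqf hpA)]
    exact (ih _).ltOp hq hϖ hu (by omega)

lemma hasWeight_actPartial_sub_of_le (hp : p.Prime) (hqf : q = p ^ f) (hpA : (p : A) = 0)
    (hq : 2 ≤ q) (hu : u ∈ I) (hϖ : i ϖ ∈ I) {N M : ℕ} (hNM : N ≤ M) (a : 𝒪) :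
    HasWeight I N (actPartial d i u M a - actPartial d i u N a) := by
  induction M, hNM using Nat.le_induction with
  | base => rw [sub_self]; exact hasWeight_zero _
  | succ M hM ih =>
    have := ((hasWeight_actPartial_sub (d := d) hp hqf hpA hq hu hϖ M a).mono
      (by omega : N ≤ M + 1)).add ih
    rwa [sub_add_sub_cancel] at this

lemma hasWeight_actSeries_sub (hp : p.Prime) (hqf : q = p ^ f) (hpA : (p : A) = 0) (hq : 2 ≤ q)
    (hI : I ^ r = ⊥) (hu : u ∈ I) (hϖ : i ϖ ∈ I) (N : ℕ) (a : 𝒪) :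
    HasWeight I N (actSeries d i u r a - actPartial d i u N a) := by
  intro e
  have he : e = Finsupp.single () (e ()) := by ext; simp
  have hdeg : e.degree = e () := by
    conv_lhs => rw [he]
    simp
  have h1 : MvPowerSeries.coeff e (actSeries d i u r a - actPartial d i u N a) =
      MvPowerSeries.coeff e (actPartial d i u (e () + r) a - actPartial d i u N a) := by
    rw [map_sub, map_sub]
    congr 1
    conv_lhs => rw [he]
    conv_rhs => rw [he]
    change PowerSeries.coeff (e ()) (actSeries d i u r a) = PowerSeries.coeff (e ()) _
    rw [actSeries, PowerSeries.coeff_mk]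
    simp
  rw [h1]
  rcases le_total N (e () + r) with h | h
  · exact hasWeight_actPartial_sub_of_le hp hqf hpA hq hu hϖ h a e
  · have h2 := hasWeight_actPartial_sub_of_le (d := d) hp hqf hpA hq hu hϖ h a e
    rw [hdeg, Nat.add_sub_cancel_left, hI, Ideal.mem_bot, map_sub, sub_eq_zero] at h2
    rw [map_sub, h2, sub_self]
    exact Ideal.zero_mem _

lemma constantCoeff_actPartial (hq : 2 ≤ q) (N : ℕ) (a : 𝒪) :
    PowerSeries.constantCoeff (actPartial d i u N a) = 0 := by
  induction N generalizing a with
  | zero => simp [actPartial, actEval]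
  | succ N ih =>
    rw [actPartial_succ]
    simp [ltOp, ih, show q ≠ 0 by omega]

/-- Only ϖ z contributes to linear coefficients, so the linear coefficient is that of the digit
expansion of a truncated modulo ϖ^N. -/
lemma coeff_one_actPartial (hq : 2 ≤ q) (N : ℕ) (a : 𝒪) : ∃ c : A, PowerSeries.coeff 1 (actPartial d i u N a) = i a + i (ϖ ^ N) * c := by
  induction N generalizing a with
  | zero => exact ⟨-i a, by simp [actPartial, actEval]⟩
  | succ N ih =>
    obtain ⟨c, hc⟩ := ih (d.sh a)
    refine ⟨c, ?_⟩
    have h0 := constantCoeff_actPartial (d := d) (i := i) (u := u) hq N (d.sh a)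
    have hX : PowerSeries.X ∣ actPartial d i u N (d.sh a) := PowerSeries.X_dvd_iff.2 h0
    have h2 : ∀ n, 2 ≤ n → PowerSeries.coeff 1 (actPartial d i u N (d.sh a) ^ n) = 0 := by
      intro n hn
      exact (PowerSeries.X_pow_dvd_iff.1 ((pow_dvd_pow _ hn).trans (pow_dvd_pow_of_dvd hX n))) 1
        (by omega)
    rw [actPartial_succ, ltOp, map_add, map_add, map_add, PowerSeries.coeff_C_mul,
      PowerSeries.coeff_C_mul, PowerSeries.coeff_C_mul, h2 _ (by nlinarith), h2 _ hq,
      PowerSeries.coeff_one_X, hc]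
    conv_rhs => rw [d.eq a]
    simp only [map_add, map_mul, pow_succ]
    ring

lemma constantCoeff_actSeries (hq : 2 ≤ q) (a : 𝒪) :
    PowerSeries.constantCoeff (actSeries d i u r a) = 0 := by
  rw [← PowerSeries.coeff_zero_eq_constantCoeff_apply, actSeries, PowerSeries.coeff_mk,
    PowerSeries.coeff_zero_eq_constantCoeff_apply, constantCoeff_actPartial hq]

/-- The recursion characterising the multiplication by `a`. -/
lemma actSeries_eq (hp : p.Prime) (hqf : q = p ^ f) (hpA : (p : A) = 0) (hq : 2 ≤ q)
    (hI : I ^ r = ⊥) (hu : u ∈ I) (hϖ : i ϖ ∈ I) (a : 𝒪) :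
    actSeries d i u r a = PowerSeries.C (i (d.s a)) * PowerSeries.X +
      ltOp q (PowerSeries.C (i ϖ)) (PowerSeries.C u) (actSeries d i u r (d.sh a)) := by
  rw [← sub_eq_zero]
  refine eq_zero_of_hasWeight hI fun m => ?_
  have h1 := hasWeight_actSeries_sub (d := d) hp hqf hpA hq hI hu hϖ (m + 1 + 1) a
  have h2 := (hasWeight_actSeries_sub (d := d) hp hqf hpA hq hI hu hϖ (m + 1) (d.sh a)).ltOp hq hϖ hu
    (by omega)
  have h3 := (h1.sub h2).mono (by omega : m ≤ m + 1 + 1)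
  rw [actPartial_succ, ltOp_sub (mvPowerSeries_add_pow hp hqf hpA)] at h3
  convert h3 using 1
  change (_ : PowerSeries A) = _
  simp only [PowerSeries.C]
  abel

/-- The uniqueness principle behind the module axioms: two families that satisfy the same
contracting recursion agree. Additivity, multiplicativity and compatibility with the group law all
follow by exhibiting a common recursion for both sides. -/
lemma actSeries_ext (hp : p.Prime) (hqf : q = p ^ f) (hpA : (p : A) = 0) (hq : 2 ≤ q)
    (hI : I ^ r = ⊥) (hu : u ∈ I) (hϖ : i ϖ ∈ I) {T σ : Type*} {D D' : T → MvPowerSeries σ A}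
    (h0 : ∀ t, MvPowerSeries.constantCoeff (D t) = 0)
    (h0' : ∀ t, MvPowerSeries.constantCoeff (D' t) = 0)
    (h : ∀ t, ∃ c t', D t = c + ltOp q (MvPowerSeries.C (i ϖ)) (MvPowerSeries.C u) (D t') ∧
      D' t = c + ltOp q (MvPowerSeries.C (i ϖ)) (MvPowerSeries.C u) (D' t')) (t : T) :
    D t = D' t := by
  rw [← sub_eq_zero]
  refine eq_zero_of_eq_ltOp hq hϖ hu hI (fun t => D t - D' t) (fun t => ?_) (fun t => ?_) t
  · rw [map_sub, h0, h0', sub_zero]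
  · obtain ⟨c, t', h1, h2⟩ := h t
    refine ⟨t', ?_⟩
    rw [ltOp_sub (mvPowerSeries_add_pow hp hqf hpA), h1, h2, add_sub_add_left_eq_sub]

end Construction

end LubinTateCurve

namespace LubinTateCurve

section ActSeries

variable {𝒪 A : Type*} [CommRing 𝒪] [CommRing A] {q p f : ℕ} {ϖ : 𝒪}
  {d : Digits 𝒪 q ϖ} {i : 𝒪 →+* A} {u : A} {I : Ideal A} {r : ℕ}

lemma actSeries_add (hp : p.Prime) (hqf : q = p ^ f) (hpA : (p : A) = 0) (hq : 2 ≤ q)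
    (hI : I ^ r = ⊥) (hu : u ∈ I) (hϖ : i ϖ ∈ I) (a b : 𝒪) :
    actSeries d i u r (a + b) = actSeries d i u r a + actSeries d i u r b := by
  refine actSeries_ext (T := 𝒪 × 𝒪) (σ := Unit) hp hqf hpA hq hI hu hϖ
    (D := fun t => actSeries d i u r (t.1 + t.2))
    (D' := fun t => actSeries d i u r t.1 + actSeries d i u r t.2)
    (fun t => constantCoeff_actSeries hq _) (fun t => ?_) (fun t => ?_) (a, b)
  · rw [map_add]
    have h := fun a => constantCoeff_actSeries (d := d) (i := i) (u := u) (r := r) hq a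
    exact (congrArg₂ (· + ·) (h t.1) (h t.2)).trans (add_zero 0)
  · refine ⟨PowerSeries.C (i (d.s (t.1 + t.2))) * PowerSeries.X, (d.sh t.1, d.sh t.2), ?_, ?_⟩
    · have := actSeries_eq (d := d) hp hqf hpA hq hI hu hϖ (t.1 + t.2)
      rw [d.sh_add] at this
      exact this
    · have h1 := actSeries_eq (d := d) hp hqf hpA hq hI hu hϖ t.1
      have h2 := actSeries_eq (d := d) hp hqf hpA hq hI hu hϖ t.2
      have h3 := ltOp_add (mvPowerSeries_add_pow (σ := Unit) hp hqf hpA) (MvPowerSeries.C (i ϖ))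
        (MvPowerSeries.C u) (actSeries d i u r (d.sh t.1)) (actSeries d i u r (d.sh t.2))
      refine (congrArg₂ (· + ·) h1 h2).trans ?_
      refine Eq.trans ?_ (congrArg (_ + ·) h3.symm)
      rw [map_add, map_add, map_add]
      change _ + ltOp q (PowerSeries.C (i ϖ)) (PowerSeries.C u) _ + (_ + ltOp q (PowerSeries.C (i ϖ)) (PowerSeries.C u) _) = (_ : PowerSeries A) + (ltOp q (PowerSeries.C (i ϖ)) (PowerSeries.C u) _ + ltOp q (PowerSeries.C (i ϖ)) (PowerSeries.C u) _)
      ring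

lemma actSeries_of_pow (hp : p.Prime) (hqf : q = p ^ f) (hpA : (p : A) = 0) (hq : 2 ≤ q)
    (hI : I ^ r = ⊥) (hu : u ∈ I) (hϖ : i ϖ ∈ I) {t : 𝒪} (ht : t ^ q = t) :
    actSeries d i u r t = PowerSeries.C (i t) * PowerSeries.X := by
  have h0 : actSeries d i u r 0 = 0 := by
    have := actSeries_add (d := d) hp hqf hpA hq hI hu hϖ 0 0
    rwa [add_zero, left_eq_add] at this
  rw [actSeries_eq hp hqf hpA hq hI hu hϖ, d.sh_of_pow ht, h0, ltOp_zero (by omega), add_zero,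
    d.s_eq_self t ht]

lemma actSeries_uniformizer_mul (hp : p.Prime) (hqf : q = p ^ f) (hpA : (p : A) = 0) (hq : 2 ≤ q)
    (hI : I ^ r = ⊥) (hu : u ∈ I) (hϖ : i ϖ ∈ I) (a : 𝒪) :
    actSeries d i u r (ϖ * a) =
      ltOp q (PowerSeries.C (i ϖ)) (PowerSeries.C u) (actSeries d i u r a) := by
  rw [actSeries_eq hp hqf hpA hq hI hu hϖ, d.s_uniformizer_mul, d.sh_uniformizer_mul, map_zero,
    map_zero, zero_mul, zero_add]

lemma powerSeries_C_pow {t : 𝒪} (ht : t ^ q = t) (σ : Type*) :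
    (MvPowerSeries.C (i t) : MvPowerSeries σ A) ^ q = MvPowerSeries.C (i t) := by
  rw [← map_pow, ← map_pow, ht]

lemma actSeries_mul_of_pow (hp : p.Prime) (hqf : q = p ^ f) (hpA : (p : A) = 0) (hq : 2 ≤ q)
    (hI : I ^ r = ⊥) (hu : u ∈ I) (hϖ : i ϖ ∈ I) {t : 𝒪} (ht : t ^ q = t) (b : 𝒪) :
    actSeries d i u r (t * b) = PowerSeries.C (i t) * actSeries d i u r b := by
  refine actSeries_ext (T := 𝒪) (σ := Unit) hp hqf hpA hq hI hu hϖ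
    (D := fun b => actSeries d i u r (t * b))
    (D' := fun b => PowerSeries.C (i t) * actSeries d i u r b)
    (fun t => constantCoeff_actSeries hq _) (fun b => ?_) (fun b => ?_) b
  · rw [map_mul]
    have h := constantCoeff_actSeries (d := d) (i := i) (u := u) (r := r) hq b
    exact (congrArg (_ * ·) h).trans (mul_zero _)
  · refine ⟨PowerSeries.C (i t) * (PowerSeries.C (i (d.s b)) * PowerSeries.X), d.sh b, ?_, ?_⟩
    · refine (actSeries_eq (d := d) hp hqf hpA hq hI hu hϖ (t * b)).trans ?_
      rw [d.sh_mul_of_pow ht, map_mul, d.s_eq_self t ht, map_mul, map_mul, mul_assoc]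
      rfl
    · refine (congrArg (_ * ·) (actSeries_eq (d := d) hp hqf hpA hq hI hu hϖ b)).trans ?_
      refine (mul_add _ _ _).trans ?_
      exact congrArg (_ + ·) (ltOp_mul (powerSeries_C_pow ht Unit) _ _ _).symm

lemma hasSubst_actSeries (hq : 2 ≤ q) (a : 𝒪) : PowerSeries.HasSubst (actSeries d i u r a) :=
  PowerSeries.HasSubst.of_constantCoeff_zero' (constantCoeff_actSeries hq a)

lemma subst_actSeries (hp : p.Prime) (hqf : q = p ^ f) (hpA : (p : A) = 0) (hq : 2 ≤ q)
    (hI : I ^ r = ⊥) (hu : u ∈ I) (hϖ : i ϖ ∈ I) {σ : Type*} {y : MvPowerSeries σ A}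
    (hy : PowerSeries.HasSubst y) (a : 𝒪) :
    (actSeries d i u r a).subst y = MvPowerSeries.C (i (d.s a)) * y +
      ltOp q (MvPowerSeries.C (i ϖ)) (MvPowerSeries.C u) ((actSeries d i u r (d.sh a)).subst y) := by
  conv_lhs => rw [actSeries_eq (d := d) hp hqf hpA hq hI hu hϖ a]
  rw [PowerSeries.subst_add hy, subst_C_mul hy, PowerSeries.subst_X hy, subst_ltOp hy]

lemma actSeries_mul (hp : p.Prime) (hqf : q = p ^ f) (hpA : (p : A) = 0) (hq : 2 ≤ q)
    (hI : I ^ r = ⊥) (hu : u ∈ I) (hϖ : i ϖ ∈ I) (a b : 𝒪) :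
    actSeries d i u r (a * b) = (actSeries d i u r a).subst (actSeries d i u r b) := by
  refine actSeries_ext (T := 𝒪) (σ := Unit) hp hqf hpA hq hI hu hϖ
    (D := fun a => actSeries d i u r (a * b))
    (D' := fun a => (actSeries d i u r a).subst (actSeries d i u r b))
    (fun t => constantCoeff_actSeries hq _) (fun a => ?_) (fun a => ?_) a
  · exact constantCoeff_subst_zero (constantCoeff_actSeries hq b) (constantCoeff_actSeries hq a)
  -- The recursion runs over the digits of a with b fixed; its inhomogeneous term is the leading
  -- digit times the series of b.
  · refine ⟨PowerSeries.C (i (d.s a)) * actSeries d i u r b, d.sh a, ?_, ?_⟩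
    · have e1 : a * b = d.s a * b + ϖ * (d.sh a * b) := by
        conv_lhs => rw [d.eq a]
        ring
      change actSeries d i u r (a * b) = _
      rw [e1, actSeries_add hp hqf hpA hq hI hu hϖ,
        actSeries_mul_of_pow hp hqf hpA hq hI hu hϖ (d.s_pow a),
        actSeries_uniformizer_mul hp hqf hpA hq hI hu hϖ]
      rfl
    · exact subst_actSeries hp hqf hpA hq hI hu hϖ (hasSubst_actSeries hq b) a

lemma subst_add_actSeries (hp : p.Prime) (hqf : q = p ^ f) (hpA : (p : A) = 0) (hq : 2 ≤ q)
    (hI : I ^ r = ⊥) (hu : u ∈ I) (hϖ : i ϖ ∈ I) {σ : Type*} {y z : MvPowerSeries σ A}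
    (hy : MvPowerSeries.constantCoeff y = 0) (hz : MvPowerSeries.constantCoeff z = 0) (a : 𝒪) :
    (actSeries d i u r a).subst (y + z) =
      (actSeries d i u r a).subst y + (actSeries d i u r a).subst z := by
  have hyz : MvPowerSeries.constantCoeff (y + z) = 0 := by rw [map_add, hy, hz, add_zero]
  refine actSeries_ext (T := 𝒪) (σ := σ) hp hqf hpA hq hI hu hϖ
    (D := fun a => (actSeries d i u r a).subst (y + z))
    (D' := fun a => (actSeries d i u r a).subst y + (actSeries d i u r a).subst z)
    (fun a => constantCoeff_subst_zero hyz (constantCoeff_actSeries hq a))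
    (fun a => ?_) (fun a => ?_) a
  · rw [map_add, constantCoeff_subst_zero hy (constantCoeff_actSeries hq a),
      constantCoeff_subst_zero hz (constantCoeff_actSeries hq a), add_zero]
  · refine ⟨MvPowerSeries.C (i (d.s a)) * (y + z), d.sh a,
      subst_actSeries hp hqf hpA hq hI hu hϖ (.of_constantCoeff_zero hyz) a, ?_⟩
    simp only [subst_actSeries hp hqf hpA hq hI hu hϖ (.of_constantCoeff_zero hy) a,
      subst_actSeries hp hqf hpA hq hI hu hϖ (.of_constantCoeff_zero hz) a]
    rw [ltOp_add (mvPowerSeries_add_pow hp hqf hpA)]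
    ring

lemma coeff_one_actSeries (hq : 2 ≤ q) (hI : I ^ r = ⊥) (hϖ : i ϖ ∈ I) (a : 𝒪) :
    PowerSeries.coeff 1 (actSeries d i u r a) = i a := by
  obtain ⟨c, hc⟩ := coeff_one_actPartial (d := d) (i := i) (u := u) hq (1 + r) a
  have h : i (ϖ ^ (1 + r)) = 0 := by
    have := Ideal.pow_mem_pow hϖ r
    rw [hI, Ideal.mem_bot] at this
    rw [map_pow, pow_add, this, mul_zero]
  rw [actSeries, PowerSeries.coeff_mk, hc, h, zero_mul, add_zero]

/-- The formal module with additive group law and `[ϖ](X) = X ^ (q ^ 2) + u X ^ q + ϖ X`, when `u`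
and `ϖ` are nilpotent. -/
noncomputable def standardFormalModule (d : Digits 𝒪 q ϖ) (i : 𝒪 →+* A) (u : A) (I : Ideal A)
    (r : ℕ) (hp : p.Prime) (hqf : q = p ^ f) (hpA : (p : A) = 0) (hq : 2 ≤ q)
    (hI : I ^ r = ⊥) (hu : u ∈ I) (hϖ : i ϖ ∈ I) : FormalModule i where
  group := FormalGroup.𝔾ₐ
  comm := inferInstance
  act := actSeries d i u r
  act_constantCoeff a := constantCoeff_actSeries hq a
  act_coeff_one a := coeff_one_actSeries hq hI hϖ a
  act_group a := by
    have h0 : MvPowerSeries.constantCoeff (MvPowerSeries.X 0 : MvPowerSeries (Fin 2) A) = 0 :=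
      MvPowerSeries.constantCoeff_X _
    have h1 : MvPowerSeries.constantCoeff (MvPowerSeries.X 1 : MvPowerSeries (Fin 2) A) = 0 :=
      MvPowerSeries.constantCoeff_X _
    rw [subst_X_pair (constantCoeff_subst_zero h0 (constantCoeff_actSeries hq a))
      (constantCoeff_subst_zero h1 (constantCoeff_actSeries hq a)), FormalGroup.𝔾ₐ_toPowerSeries]
    exact subst_add_actSeries hp hqf hpA hq hI hu hϖ h0 h1 a
  act_one := by
    rw [actSeries_of_pow hp hqf hpA hq hI hu hϖ (one_pow q), map_one, map_one, one_mul]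
  act_mul a b := actSeries_mul hp hqf hpA hq hI hu hϖ a b
  act_add a b := by
    rw [actSeries_add hp hqf hpA hq hI hu hϖ]
    exact (subst_X_pair (constantCoeff_actSeries hq a) (constantCoeff_actSeries hq b)).symm

lemma standardFormalModule_hasStandardForm (hp : p.Prime) (hqf : q = p ^ f) (hpA : (p : A) = 0)
    (hq : 2 ≤ q) (hI : I ^ r = ⊥) (hu : u ∈ I) (hϖ : i ϖ ∈ I) :
    (standardFormalModule d i u I r hp hqf hpA hq hI hu hϖ).HasStandardForm q ϖ
      (ltSeries q (i ϖ) u) where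
  group := rfl
  act_uniformizer := by
    have h1 := actSeries_uniformizer_mul (d := d) hp hqf hpA hq hI hu hϖ 1
    rw [mul_one, actSeries_of_pow hp hqf hpA hq hI hu hϖ (one_pow q), map_one, map_one,
      one_mul] at h1
    exact h1
  act_coefficient a ha := actSeries_of_pow hp hqf hpA hq hI hu hϖ ha

end ActSeries

end LubinTateCurve

namespace LubinTateCurve

/-! ### Values of power series in complete local rings -/

section Evaluation

open IsLocalRing

variable {A : Type*} [CommRing A] [IsLocalRing A]

lemma eq_of_forall_sub_mem_pow [IsHausdorff (maximalIdeal A) A] {x y : A}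
    (h : ∀ n : ℕ, x - y ∈ maximalIdeal A ^ n) : x = y := by
  rw [← sub_eq_zero]
  refine IsHausdorff.haus (I := maximalIdeal A) inferInstance _ fun n => ?_
  rw [SModEq.zero]
  simpa using h n

lemma EvaluatesTo.unique [IsHausdorff (maximalIdeal A) A] {f : PowerSeries A} {x y z : A}
    (hy : EvaluatesTo f x y) (hz : EvaluatesTo f x z) : y = z :=
  eq_of_forall_sub_mem_pow fun n => by
    have := Ideal.sub_mem _ (hy n) (hz n)
    rwa [sub_sub_sub_cancel_right] at this

lemma evaluatesTo_coe {x : A} (hx : x ∈ maximalIdeal A) (P : Polynomial A) :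
    EvaluatesTo (P : PowerSeries A) x (P.eval x) := by
  intro n
  rw [Polynomial.eval_eq_sum_range' (n := max n (P.natDegree + 1)) (by omega)]
  simp only [Polynomial.coeff_coe]
  rw [← Finset.sum_sdiff_eq_sub (Finset.range_mono (le_max_left _ _))]
  refine Ideal.sum_mem _ fun i hi => Ideal.mul_mem_left _ _ ?_
  simp only [Finset.mem_sdiff, Finset.mem_range, not_lt] at hi
  exact Ideal.pow_le_pow_right hi.2 (Ideal.pow_mem_pow hx i)

lemma EvaluatesTo.map {B : Type*} [CommRing B] [IsLocalRing B] (h : A →+* B) [IsLocalHom h]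
    {f : PowerSeries A} {x y : A} (hf : EvaluatesTo f x y) :
    EvaluatesTo (f.map h) (h x) (h y) := by
  intro n
  have h1 := Ideal.mem_map_of_mem h (hf n)
  rw [Ideal.map_pow] at h1
  have h2 := Ideal.pow_right_mono (((local_hom_TFAE h).out 0 2).1 ‹IsLocalHom h›) n h1
  simpa using h2

lemma evaluatesTo_ltSeries [IsHausdorff (maximalIdeal A) A] {q : ℕ} {ϖ u x y : A}
    (hx : x ∈ maximalIdeal A) : EvaluatesTo (ltSeries q ϖ u) x y ↔ y = ltOp q ϖ u x := by
  have h := evaluatesTo_coe hx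
    (Polynomial.X ^ (q ^ 2) + Polynomial.C u * Polynomial.X ^ q + Polynomial.C ϖ * Polynomial.X)
  have h1 : ((Polynomial.X ^ (q ^ 2) + Polynomial.C u * Polynomial.X ^ q +
      Polynomial.C ϖ * Polynomial.X : Polynomial A) : PowerSeries A) = ltSeries q ϖ u := by simp
  have h2 : (Polynomial.X ^ (q ^ 2) + Polynomial.C u * Polynomial.X ^ q +
      Polynomial.C ϖ * Polynomial.X : Polynomial A).eval x = ltOp q ϖ u x := by simp [ltOp]
  rw [h1, h2] at h
  exact ⟨fun h' => h'.unique h, fun h' => h' ▸ h⟩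

lemma evaluatesTo_C_mul_X [IsHausdorff (maximalIdeal A) A] {c x y : A}
    (hx : x ∈ maximalIdeal A) :
    EvaluatesTo (PowerSeries.C c * PowerSeries.X) x y ↔ y = c * x := by
  have h := evaluatesTo_coe hx (Polynomial.C c * Polynomial.X)
  simp only [Polynomial.coe_mul, Polynomial.coe_C, Polynomial.coe_X, Polynomial.eval_mul,
    Polynomial.eval_C, Polynomial.eval_X] at h
  exact ⟨fun h' => h'.unique h, fun h' => h' ▸ h⟩

lemma evaluatesTo_X [IsHausdorff (maximalIdeal A) A] {x y : A} (hx : x ∈ maximalIdeal A) :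
    EvaluatesTo PowerSeries.X x y ↔ y = x := by
  simpa using evaluatesTo_C_mul_X (c := 1) (y := y) hx

lemma evaluatesTo₂_add (x y : A) (hx : x ∈ maximalIdeal A) (hy : y ∈ maximalIdeal A) :
    EvaluatesTo₂ (FormalGroup.𝔾ₐ (R := A)).toPowerSeries x y (x + y) := by
  classical
  have hc : ∀ i j : ℕ, (FormalGroup.𝔾ₐ (R := A)).toPowerSeries.coeff
      (Finsupp.single 0 i + Finsupp.single 1 j) =
        (if i = 1 ∧ j = 0 then 1 else 0) + (if i = 0 ∧ j = 1 then 1 else 0) := by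
    intro i j
    rw [FormalGroup.𝔾ₐ_toPowerSeries, map_add, MvPowerSeries.coeff_X, MvPowerSeries.coeff_X]
    congr 1 <;> refine if_congr ?_ rfl rfl <;> rw [Finsupp.ext_iff] <;>
      simp [Fin.forall_fin_two, Finsupp.single_apply]
  intro n
  simp only [hc]
  rcases Nat.lt_or_ge 1 n with h | h
  · have : ∑ i ∈ Finset.range n, ∑ j ∈ Finset.range n,
        ((if i = 1 ∧ j = 0 then 1 else 0) + (if i = 0 ∧ j = 1 then 1 else 0)) * x ^ i * y ^ j =
        x + y := by
      simp only [add_mul, Finset.sum_add_distrib, ite_and, ite_mul, zero_mul, one_mul]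
      simp [show 0 < n by omega, h]
    rw [this, sub_self]
    exact Ideal.zero_mem _
  · have hxy := Ideal.add_mem _ hx hy
    interval_cases n
    · simp
    · simpa using hxy

lemma evaluatesTo₂_iff [IsHausdorff (maximalIdeal A) A] {x y z : A} (hx : x ∈ maximalIdeal A)
    (hy : y ∈ maximalIdeal A) :
    EvaluatesTo₂ (FormalGroup.𝔾ₐ (R := A)).toPowerSeries x y z ↔ z = x + y := by
  refine ⟨fun h => eq_of_forall_sub_mem_pow fun n => ?_, fun h => h ▸ evaluatesTo₂_add x y hx hy⟩
  have := Ideal.sub_mem _ (h n) (evaluatesTo₂_add x y hx hy n)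
  rwa [sub_sub_sub_cancel_right] at this

/-- At a torsion point N + n digits give the same value as N. The series and this partial sum differ
by weight N + n, so their truncations at n differ at x by an element of the n-th power of the
maximal ideal. -/
lemma evaluatesTo_actSeries {𝒪 : Type*} [CommRing 𝒪] {p q f : ℕ} {ϖ : 𝒪} {d : Digits 𝒪 q ϖ}
    {i : 𝒪 →+* A} {u : A} {I : Ideal A} {r : ℕ}
    (hp : p.Prime) (hqf : q = p ^ f) (hpA : (p : A) = 0) (hq : 2 ≤ q)
    (hI : I ^ r = ⊥) (hu : u ∈ I) (hϖ : i ϖ ∈ I) (hIm : I ≤ maximalIdeal A) {x : A}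
    (hx : x ∈ maximalIdeal A) {N : ℕ} (hN : (ltOp q (i ϖ) u)^[N] x = 0) (a : 𝒪) :
    EvaluatesTo (actSeries d i u r a) x (actEval d i u N a x) := by
  have hadd : ∀ x y : A, (x + y) ^ q = x ^ q + y ^ q := by
    subst hqf
    exact add_pow_of_natCast_eq_zero hp hpA f
  intro n
  rw [← actEval_add_of_iterate_eq_zero hadd (by omega) N n a x hN, ← eval_actPoly]
  have h1 := evaluatesTo_coe hx (actPoly d i u (N + n) a) n
  have h2 := hasWeight_actSeries_sub (d := d) hp hqf hpA hq hI hu hϖ (N + n) a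
  rw [coe_actPoly] at h1
  have h3 : ∑ j ∈ Finset.range n, PowerSeries.coeff j (actSeries d i u r a) * x ^ j -
      ∑ j ∈ Finset.range n, PowerSeries.coeff j (actPartial d i u (N + n) a) * x ^ j ∈
        maximalIdeal A ^ n := by
    rw [← Finset.sum_sub_distrib]
    refine Ideal.sum_mem _ fun j hj => ?_
    have h4 := h2 (Finsupp.single () j)
    rw [Finsupp.degree_single] at h4
    rw [← sub_mul, ← map_sub]
    have h5 := Ideal.mul_mem_mul (Ideal.pow_right_mono hIm _ h4) (Ideal.pow_mem_pow hx j)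
    rw [← pow_add] at h5
    exact Ideal.pow_le_pow_right (by omega) h5
  have := Ideal.sub_mem _ h1 h3
  rwa [sub_sub_sub_cancel_right] at this

end Evaluation

/-! ### Base change of isomorphisms -/

section BaseChange

variable {𝒪 A B : Type*} [CommRing 𝒪] [CommRing A] [CommRing B]

lemma FormalModule.ext' {i : 𝒪 →+* A} {M N : FormalModule i} (hg : M.group = N.group)
    (ha : M.act = N.act) : M = N := by
  cases M; cases N
  simp only at hg ha
  subst hg ha
  rfl

lemma FormalModule.map_map {C : Type*} [CommRing C] {i : 𝒪 →+* A} (M : FormalModule i)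
    (h : A →+* B) {i' : 𝒪 →+* B} (hi : ∀ a, h (i a) = i' a) (g : B →+* C) {i'' : 𝒪 →+* C}
    (hi' : ∀ a, g (i' a) = i'' a) (gh : A →+* C) (e : g.comp h = gh)
    (hgh : ∀ a, gh (i a) = i'' a) : (M.map h hi).map g hi' = M.map gh hgh := by
  subst e
  refine FormalModule.ext' ?_ ?_
  · refine FormalGroup.ext ?_
    change MvPowerSeries.map g (MvPowerSeries.map h _) = MvPowerSeries.map (g.comp h) _
    rw [MvPowerSeries.map_comp]; rfl
  · funext a
    change PowerSeries.map g (PowerSeries.map h _) = PowerSeries.map (g.comp h) _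
    rw [PowerSeries.map_comp]; rfl

lemma FormalModule.IsIso.map {i : 𝒪 →+* A} {M N : FormalModule i} {f : PowerSeries A}
    (hf : M.IsIso N f) (h : A →+* B) {i' : 𝒪 →+* B} (hi : ∀ a, h (i a) = i' a) :
    (M.map h hi).IsIso (N.map h hi) (f.map h) where
  constantCoeff := by
    rw [← PowerSeries.coeff_zero_eq_constantCoeff_apply, PowerSeries.coeff_map,
      PowerSeries.coeff_zero_eq_constantCoeff_apply, hf.constantCoeff, map_zero]
  isUnit_coeff_one := by
    rw [PowerSeries.coeff_map]
    exact hf.isUnit_coeff_one.map h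
  group := by
    have hs : ∀ s : Fin 2, PowerSeries.HasSubst (MvPowerSeries.X s : MvPowerSeries (Fin 2) A) :=
      fun s => PowerSeries.HasSubst.of_constantCoeff_zero (by simp)
    have e := congrArg (MvPowerSeries.map h) hf.group
    rw [PowerSeries.map_subst (PowerSeries.HasSubst.of_constantCoeff_zero
        M.group.zero_constantCoeff),
      MvPowerSeries.map_subst (hasSubst_vec
        (constantCoeff_subst_zero (by simp) hf.constantCoeff)
        (constantCoeff_subst_zero (by simp) hf.constantCoeff)), map_vec,
      PowerSeries.map_subst (hs 0), PowerSeries.map_subst (hs 1), MvPowerSeries.map_X,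
      MvPowerSeries.map_X] at e
    exact e
  act a := by
    have e := congrArg (MvPowerSeries.map h) (hf.act a)
    rw [PowerSeries.map_subst (PowerSeries.HasSubst.of_constantCoeff_zero'
      (M.act_constantCoeff a)), PowerSeries.map_subst
      (PowerSeries.HasSubst.of_constantCoeff_zero' hf.constantCoeff)] at e
    exact e

lemma FormalModule.isIso_X {i : 𝒪 →+* A} (M : FormalModule i) : M.IsIso M PowerSeries.X where
  constantCoeff := PowerSeries.constantCoeff_X
  isUnit_coeff_one := by simp
  group := by
    have hs : ∀ s : Fin 2, PowerSeries.HasSubst (MvPowerSeries.X s : MvPowerSeries (Fin 2) A) :=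
      fun s => PowerSeries.HasSubst.of_constantCoeff_zero (by simp)
    rw [PowerSeries.subst_X (PowerSeries.HasSubst.of_constantCoeff_zero
        M.group.zero_constantCoeff), PowerSeries.subst_X (hs 0), PowerSeries.subst_X (hs 1)]
    have : (![MvPowerSeries.X 0, MvPowerSeries.X 1] : Fin 2 → MvPowerSeries (Fin 2) A) =
        MvPowerSeries.X := by
      ext1 s; fin_cases s <;> rfl
    rw [this, MvPowerSeries.subst_self]
    rfl
  act a := by
    rw [PowerSeries.X_subst, PowerSeries.subst_X (PowerSeries.HasSubst.of_constantCoeff_zero'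
      (M.act_constantCoeff a))]

lemma FormalModule.HasStandardForm.map {q : ℕ} {ϖ : 𝒪} {i : 𝒪 →+* A} {M : FormalModule i}
    {g : PowerSeries A} (hM : M.HasStandardForm q ϖ g) (h : A →+* B) {i' : 𝒪 →+* B}
    (hi : ∀ a, h (i a) = i' a) : (M.map h hi).HasStandardForm q ϖ (g.map h) where
  group := by
    refine FormalGroup.ext ?_
    change MvPowerSeries.map h M.group.toPowerSeries = _
    rw [hM.group, FormalGroup.𝔾ₐ_toPowerSeries, FormalGroup.𝔾ₐ_toPowerSeries, map_add,
      MvPowerSeries.map_X, MvPowerSeries.map_X]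
  act_uniformizer := congrArg (PowerSeries.map h) hM.act_uniformizer
  act_coefficient a ha := by
    refine (congrArg (PowerSeries.map h) (hM.act_coefficient a ha)).trans ?_
    rw [map_mul, PowerSeries.map_C, PowerSeries.map_X, hi]

lemma map_ltSeries (h : A →+* B) (q : ℕ) (ϖ u : A) :
    (ltSeries q ϖ u).map h = ltSeries q (h ϖ) (h u) := by
  simp

end BaseChange

end LubinTateCurve

namespace LubinTateCurve

open IsLocalRing

/-! ### Coefficient algebras and their homomorphisms. -/

section CoefficientAlgebra

lemma isAdicComplete_of_pow_eq_bot {A : Type*} [CommRing A] {I : Ideal A} {r : ℕ}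
    (hI : I ^ r = ⊥) : IsAdicComplete I A where
  haus' x hx := by
    have := hx r
    rw [SModEq.zero, hI] at this
    simpa using this
  prec' f hf := by
    refine ⟨f r, fun n => ?_⟩
    rcases le_total n r with h | h
    · exact hf h
    · have h1 := hf h
      rw [SModEq.sub_mem, hI] at h1
      have h2 : f r = f n := by simpa [sub_eq_zero] using h1
      rw [h2]

variable {W A B : Type*} [CommRing W] [IsLocalRing W] [CommRing A] [IsLocalRing A] [Algebra W A]
  [CommRing B] [IsLocalRing B] [Algebra W B] [IsCoefficientAlgebra W B]

lemma IsCoefficientAlgebra.isHausdorff (W B : Type*) [CommRing W] [IsLocalRing W] [CommRing B]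
    [IsLocalRing B] [Algebra W B] [IsCoefficientAlgebra W B] : IsHausdorff (maximalIdeal B) B :=
  have := IsCoefficientAlgebra.isAdicComplete (W := W) (A := B)
  inferInstance

/-- Homomorphisms to coefficient algebras are local. -/
lemma IsCoefficientAlgebra.isLocalHom_algHom (h : A →ₐ[W] B) : IsLocalHom (h : A →+* B) := by
  have hs : Function.Surjective ((residue B).comp (h : A →+* B)) := by
    intro y
    obtain ⟨w, hw⟩ := IsCoefficientAlgebra.residue_surjective (W := W) (A := B) y
    exact ⟨algebraMap W A w, by simpa using hw⟩
  -- The composite to the residue field of B is surjective because it is so on W; its kernel is then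
  -- the maximal ideal of A.
  have hm := IsLocalRing.eq_maximalIdeal (RingHom.ker_isMaximal_of_surjective _ hs)
  refine ⟨fun a ha => ?_⟩
  by_contra hna
  have : a ∈ maximalIdeal A := (mem_maximalIdeal a).2 hna
  rw [← hm, RingHom.mem_ker, RingHom.comp_apply, residue_eq_zero_iff] at this
  exact (mem_maximalIdeal _).1 this ha

lemma isCoefficientAlgebra_of_pow_eq_bot [IsNoetherianRing A] {r : ℕ}
    (hr : maximalIdeal A ^ r = ⊥)
    (hm : (maximalIdeal W).map (algebraMap W A) ≤ maximalIdeal A)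
    (hs : ∀ a : A, ∃ w : W, a - algebraMap W A w ∈ maximalIdeal A) : IsCoefficientAlgebra W A where
  isNoetherianRing := inferInstance
  isAdicComplete := isAdicComplete_of_pow_eq_bot hr
  isLocalHom := ((local_hom_TFAE (algebraMap W A)).out 0 2).2 hm
  residue_surjective y := by
    obtain ⟨a, rfl⟩ := residue_surjective y
    obtain ⟨w, hw⟩ := hs a
    refine ⟨w, ?_⟩
    rw [RingHom.comp_apply, eq_comm, ← sub_eq_zero, ← map_sub, residue_eq_zero_iff]
    exact hw

lemma IsCoefficientAlgebra.exists_sub_mem (b : B) :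
    ∃ w : W, b - algebraMap W B w ∈ maximalIdeal B := by
  obtain ⟨w, hw⟩ := IsCoefficientAlgebra.residue_surjective (W := W) (A := B) (residue B b)
  refine ⟨w, ?_⟩
  rw [← residue_eq_zero_iff, map_sub, sub_eq_zero]
  exact hw.symm

lemma IsCoefficientAlgebra.bijective_residueFieldMap :
    Function.Bijective (ResidueField.map (algebraMap W B)) := by
  refine ⟨RingHom.injective _, fun y => ?_⟩
  obtain ⟨w, hw⟩ := IsCoefficientAlgebra.residue_surjective (W := W) (A := B) y
  exact ⟨residue W w, by rw [← hw]; rfl⟩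

end CoefficientAlgebra

/-! ### The values of level structures -/

namespace LevelDeformation

section Values

variable {𝒪 W A : Type*} [CommRing 𝒪] [IsLocalRing 𝒪] [CommRing W] [IsLocalRing W]
  {j : 𝒪 →+* W} {F₀ : FormalModule ((residue W).comp j)} {n : ℕ} [CommRing A] [IsLocalRing A]
  [Algebra W A] [IsCoefficientAlgebra W A] {T : LevelDeformation F₀ n A} {p f q : ℕ} {ϖ : 𝒪} {u : A}

lemma φ_add_eq (hM : T.M.HasStandardForm q ϖ (ltSeries q (((algebraMap W A).comp j) ϖ) u))
    (x y : Fin 2 → 𝒪 ⧸ maximalIdeal 𝒪 ^ n) : T.φ (x + y) = T.φ x + T.φ y := by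
  have := IsCoefficientAlgebra.isHausdorff W A
  have := T.φ_add x y
  rw [hM.group] at this
  exact (evaluatesTo₂_iff (T.φ_mem x) (T.φ_mem y)).1 this

lemma φ_zero (hM : T.M.HasStandardForm q ϖ (ltSeries q (((algebraMap W A).comp j) ϖ) u)) :
    T.φ 0 = 0 := by
  have := φ_add_eq hM 0 0
  rwa [add_zero, left_eq_add] at this

lemma φ_uniformizer (hM : T.M.HasStandardForm q ϖ (ltSeries q (((algebraMap W A).comp j) ϖ) u))
    (x : Fin 2 → 𝒪 ⧸ maximalIdeal 𝒪 ^ n) :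
    T.φ (ϖ • x) = ltOp q (((algebraMap W A).comp j) ϖ) u (T.φ x) := by
  have := IsCoefficientAlgebra.isHausdorff W A
  have := T.φ_smul ϖ x
  rw [hM.act_uniformizer] at this
  exact (evaluatesTo_ltSeries (T.φ_mem x)).1 this

lemma φ_smul_of_pow (hM : T.M.HasStandardForm q ϖ (ltSeries q (((algebraMap W A).comp j) ϖ) u))
    {t : 𝒪} (ht : t ^ q = t) (x : Fin 2 → 𝒪 ⧸ maximalIdeal 𝒪 ^ n) :
    T.φ (t • x) = ((algebraMap W A).comp j) t * T.φ x := by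
  have := IsCoefficientAlgebra.isHausdorff W A
  have := T.φ_smul t x
  rw [hM.act_coefficient t ht] at this
  exact (evaluatesTo_C_mul_X (T.φ_mem x)).1 this

lemma φ_pow_uniformizer
    (hM : T.M.HasStandardForm q ϖ (ltSeries q (((algebraMap W A).comp j) ϖ) u)) (N : ℕ)
    (x : Fin 2 → 𝒪 ⧸ maximalIdeal 𝒪 ^ n) :
    T.φ (ϖ ^ N • x) = (ltOp q (((algebraMap W A).comp j) ϖ) u)^[N] (T.φ x) := by
  induction N with
  | zero => simp
  | succ N ih => rw [pow_succ', mul_smul, φ_uniformizer hM, ih, Function.iterate_succ_apply']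

lemma pow_smul_eq_zero (hϖ : ϖ ∈ maximalIdeal 𝒪) (x : Fin 2 → 𝒪 ⧸ maximalIdeal 𝒪 ^ n) :
    ϖ ^ n • x = 0 := by
  ext s
  obtain ⟨y, hy⟩ := Ideal.Quotient.mk_surjective (x s)
  rw [Pi.smul_apply, ← hy, Pi.zero_apply]
  change Ideal.Quotient.mk _ (ϖ ^ n * y) = 0
  rw [Ideal.Quotient.eq_zero_iff_mem]
  exact Ideal.mul_mem_right _ _ (Ideal.pow_mem_pow hϖ n)

lemma iterate_φ (hM : T.M.HasStandardForm q ϖ (ltSeries q (((algebraMap W A).comp j) ϖ) u))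
    (hϖ : ϖ ∈ maximalIdeal 𝒪) (x : Fin 2 → 𝒪 ⧸ maximalIdeal 𝒪 ^ n) :
    (ltOp q (((algebraMap W A).comp j) ϖ) u)^[n] (T.φ x) = 0 := by
  rw [← φ_pow_uniformizer hM, pow_smul_eq_zero hϖ, φ_zero hM]

/-- Induction on the torsion order of φ(x): the leading digit acts linearly, and ϖ • x has smaller
torsion order. -/
lemma φ_smul_eq_actEval
    (hM : T.M.HasStandardForm q ϖ (ltSeries q (((algebraMap W A).comp j) ϖ) u))
    (hadd : ∀ x y : A, (x + y) ^ q = x ^ q + y ^ q)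
    (d : Digits 𝒪 q ϖ) (N : ℕ) (a : 𝒪) (x : Fin 2 → 𝒪 ⧸ maximalIdeal 𝒪 ^ n)
    (hx : (ltOp q (((algebraMap W A).comp j) ϖ) u)^[N] (T.φ x) = 0) :
    T.φ (a • x) = actEval d ((algebraMap W A).comp j) u N a (T.φ x) := by
  have hq : q ≠ 0 := by
    rintro rfl
    have h1 : (1 : A) = 0 := by simpa using hadd 0 0
    exact one_ne_zero h1
  induction N generalizing a x with
  | zero =>
    have := IsCoefficientAlgebra.isHausdorff W A
    have h0 : T.φ x = 0 := hx
    -- Torsion order zero means φ(x) = 0, where every truncation of [a] vanishes.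
    refine eq_of_forall_sub_mem_pow fun m => ?_
    have h1 := T.φ_smul a x m
    have h2 : ∑ i ∈ Finset.range m, (T.M.act a).coeff i * T.φ x ^ i = 0 := by
      refine Finset.sum_eq_zero fun i _ => ?_
      rcases Nat.eq_zero_or_pos i with rfl | hi
      · rw [PowerSeries.coeff_zero_eq_constantCoeff_apply, T.M.act_constantCoeff, zero_mul]
      · rw [h0, zero_pow hi.ne', mul_zero]
    rw [h2] at h1
    exact h1
  | succ N ih =>
    have e : a • x = d.s a • x + d.sh a • (ϖ • x) := by
      conv_lhs => rw [d.eq a]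
      rw [add_smul, mul_comm, mul_smul]
    rw [e, φ_add_eq hM, φ_smul_of_pow hM (d.s_pow a), ih (d.sh a) (ϖ • x), φ_uniformizer hM,
      actEval_ltOp hadd, actEval]
    rw [φ_uniformizer hM]
    exact hx

lemma φ_eq_actEval (hM : T.M.HasStandardForm q ϖ (ltSeries q (((algebraMap W A).comp j) ϖ) u))
    (hadd : ∀ x y : A, (x + y) ^ q = x ^ q + y ^ q) (d : Digits 𝒪 q ϖ)
    (hϖ : ϖ ∈ maximalIdeal 𝒪) (a b : 𝒪) :
    T.φ ![Ideal.Quotient.mk _ a, Ideal.Quotient.mk _ b] =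
      actEval d ((algebraMap W A).comp j) u n a (T.φ (Pi.single 0 1)) +
      actEval d ((algebraMap W A).comp j) u n b (T.φ (Pi.single 1 1)) := by
  rw [← φ_smul_eq_actEval hM hadd d n a _ (iterate_φ hM hϖ _),
    ← φ_smul_eq_actEval hM hadd d n b _ (iterate_φ hM hϖ _), ← φ_add_eq hM]
  congr 1
  ext s
  have h : ∀ c : 𝒪, c • (1 : 𝒪 ⧸ maximalIdeal 𝒪 ^ n) = Ideal.Quotient.mk _ c := fun c => by
    rw [Algebra.smul_def, mul_one]; rfl
  fin_cases s <;> simp [h]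

end Values

section Map

variable {𝒪 W A B : Type*} [CommRing 𝒪] [IsLocalRing 𝒪] [CommRing W] [IsLocalRing W]
  {j : 𝒪 →+* W} {F₀ : FormalModule ((residue W).comp j)} {n : ℕ} [CommRing A] [IsLocalRing A]
  [Algebra W A] [IsCoefficientAlgebra W A] [CommRing B] [IsLocalRing B]
  [Algebra W B] [IsCoefficientAlgebra W B]

/-- Base change of deformations with level structure. -/
noncomputable def map [Finite (𝒪 ⧸ maximalIdeal 𝒪 ^ n)] (T : LevelDeformation F₀ n A)
    (h : A →ₐ[W] B) : LevelDeformation F₀ n B where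
  M := T.M.map (h : A →+* B) (fun a => h.commutes (j a))
  ρ := T.ρ
  isIso := by
    have := IsCoefficientAlgebra.isLocalHom_algHom h
    have h0 : (ResidueField.map (h : A →+* B)).comp (ResidueField.map (algebraMap W A)) =
        ResidueField.map (algebraMap W B) := by
      refine Ideal.Quotient.ringHom_ext (RingHom.ext fun w => ?_)
      exact congrArg (residue B) (h.commutes w)
    have h1 : ∀ a, ResidueField.map (h : A →+* B) (((residue A).comp ((algebraMap W A).comp j)) a) =
        ((residue B).comp ((algebraMap W B).comp j)) a := fun a =>
      congrArg (residue B) (h.commutes (j a))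
    have e1 := FormalModule.map_map F₀ (ResidueField.map (algebraMap W A))
      (i' := (residue A).comp ((algebraMap W A).comp j)) (fun _ => rfl)
      (ResidueField.map (h : A →+* B)) h1 _ h0 (fun _ => rfl)
    have e2 := FormalModule.map_map T.M (residue A)
      (i' := (residue A).comp ((algebraMap W A).comp j)) (fun _ => rfl)
      (ResidueField.map (h : A →+* B)) h1 ((residue B).comp (h : A →+* B)) rfl h1
    have e3 := FormalModule.map_map T.M (h : A →+* B) (i' := (algebraMap W B).comp j)
      (fun a => h.commutes (j a)) (residue B)
      (i'' := (residue B).comp ((algebraMap W B).comp j)) (fun _ => rfl)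
      ((residue B).comp (h : A →+* B)) rfl h1
    have e4 : T.ρ.map (ResidueField.map (algebraMap W B)) =
        (T.ρ.map (ResidueField.map (algebraMap W A))).map (ResidueField.map (h : A →+* B)) := by
      rw [← h0, PowerSeries.map_comp]; rfl
    rw [e3, ← e2, ← e1, e4]
    exact T.isIso.map (ResidueField.map (h : A →+* B)) h1
  φ x := h (T.φ x)
  φ_mem x := by
    have := IsCoefficientAlgebra.isLocalHom_algHom h
    have h3 : maximalIdeal A ≤ (maximalIdeal B).comap (h : A →+* B) :=
      ((local_hom_TFAE (h : A →+* B)).out 0 3).1 ‹_›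
    exact h3 (T.φ_mem x)
  φ_add x y := by
    have := IsCoefficientAlgebra.isLocalHom_algHom h
    intro m
    have h1 := Ideal.mem_map_of_mem (h : A →+* B) (T.φ_add x y m)
    rw [Ideal.map_pow] at h1
    have h2 := Ideal.pow_right_mono
      (((local_hom_TFAE (h : A →+* B)).out 0 2).1 ‹_›) m h1
    simp only [map_sub, map_sum, map_mul, map_pow] at h2
    exact h2
  φ_smul a x := by
    have := IsCoefficientAlgebra.isLocalHom_algHom h
    exact (T.φ_smul a x).map (h : A →+* B)
  drinfeld ϖ hϖ := by
    have h1 := map_dvd (PowerSeries.map (h : A →+* B)) (T.drinfeld ϖ hϖ)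
    rw [map_finprod _ (Set.toFinite _)] at h1
    simp only [map_sub, PowerSeries.map_X, PowerSeries.map_C] at h1
    exact h1

end Map

end LevelDeformation

end LubinTateCurve

namespace LubinTateCurve

/-! ### Rigidity of isomorphisms of formal modules in standard form. -/

open IsLocalRing

lemma coeff_pow_self {A : Type*} [CommRing A] {g : PowerSeries A} (hg : g.constantCoeff = 0)
    (n : ℕ) : (g ^ n).coeff n = g.coeff 1 ^ n := by
  obtain ⟨h, rfl⟩ := PowerSeries.X_dvd_iff.2 hg
  have h1 := PowerSeries.coeff_X_pow_mul (h ^ n) n 0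
  rw [zero_add] at h1
  rw [mul_pow, h1]
  have h2 := PowerSeries.coeff_X_pow_mul h 1 0
  rw [zero_add, pow_one] at h2
  simp [h2]

lemma coeff_pow_of_lt {A : Type*} [CommRing A] {g : PowerSeries A} (hg : g.constantCoeff = 0)
    {m n : ℕ} (h : m < n) : (g ^ n).coeff m = 0 :=
  PowerSeries.X_pow_dvd_iff.1 (pow_dvd_pow_of_dvd (PowerSeries.X_dvd_iff.2 hg) n) m h

/-- The parameter `u` of a module isomorphic to one with `[ϖ](X) = X ^ (q ^ 2)` vanishes. -/
lemma eq_zero_of_isIso {𝒪 A : Type*} [CommRing 𝒪] [CommRing A] {i : 𝒪 →+* A} {q : ℕ} (hq : 2 ≤ q)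
    {ϖ : 𝒪} {u c : A} (hc : c = 0) {M N : FormalModule i} {g : PowerSeries A} (hg : M.IsIso N g)
    (hM : M.HasStandardForm q ϖ (PowerSeries.X ^ (q ^ 2)))
    (hN : N.HasStandardForm q ϖ (ltSeries q c u)) : u = 0 := by
  have h := hg.act ϖ
  have hqq : q < q ^ 2 := by nlinarith
  rw [hM.act_uniformizer, hN.act_uniformizer, hc,
    subst_ltSeries (PowerSeries.HasSubst.of_constantCoeff_zero' hg.constantCoeff)] at h
  -- Compare the coefficients of X^q: a series in X^(q²) has none, while the other side contributes
  -- u times the q-th power of the leading coefficient of g.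
  have h1 := congrArg (PowerSeries.coeff q) h
  rw [PowerSeries.coeff_subst_X_pow (by positivity),
    if_neg (fun hd => absurd (Nat.le_of_dvd (by omega) hd) (by omega))] at h1
  change 0 = PowerSeries.coeff q (g ^ (q ^ 2) + PowerSeries.C u * g ^ q + PowerSeries.C 0 * g) at h1
  rw [map_add, map_add, coeff_pow_of_lt hg.constantCoeff hqq, PowerSeries.coeff_C_mul,
    PowerSeries.coeff_C_mul, coeff_pow_self hg.constantCoeff, zero_mul, zero_add, add_zero] at h1
  exact ((hg.isUnit_coeff_one.pow q).mul_left_eq_zero).1 h1.symm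

section Rigidity

variable {A : Type*} [CommRing A] {q p f : ℕ}

/-- One step in the proof that isomorphisms which are the identity modulo a nilpotent ideal are
equal to the identity. -/
lemma rigidity_step (hp : p.Prime) (hqf : q = p ^ f) (hpA : (p : A) = 0) (hq : 2 ≤ q)
    {m J : Ideal A} (hJ : J ≤ m) (hmJ : m * J = ⊥) {ϖ u u' : A} (hϖ : ϖ ∈ m) (hu : u ∈ m)
    {g : PowerSeries A} (hg0 : g.constantCoeff = 0)
    (hg : ∀ n, (g - PowerSeries.X).coeff n ∈ J)
    (h : g.subst (ltSeries q ϖ u) = (ltSeries q ϖ u').subst g) : g = PowerSeries.X := by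
  have hqq : q < q ^ 2 := by nlinarith
  have hmul : ∀ a ∈ m, ∀ b ∈ J, a * b = 0 := fun a ha b hb => by
    have := Ideal.mul_mem_mul ha hb
    rwa [hmJ, Ideal.mem_bot] at this
  have hs : PowerSeries.HasSubst (ltSeries q ϖ u) :=
    PowerSeries.HasSubst.of_constantCoeff_zero' (by simp [show q ≠ 0 by omega])
  have hs' : PowerSeries.HasSubst (PowerSeries.X ^ (q ^ 2) : PowerSeries A) :=
    PowerSeries.HasSubst.X_pow (by positivity)
  set d := g - PowerSeries.X with hd
  have hgd : g = PowerSeries.X + d := by rw [hd]; ring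
  have hd0 : d.constantCoeff = 0 := by simp [hd, hg0]
  -- products with elements of the maximal ideal vanish
  have hCd : ∀ a ∈ m, PowerSeries.C a * d = 0 := fun a ha => by
    ext n
    rw [PowerSeries.coeff_C_mul, hmul a ha _ (hg n), map_zero]
  have hdd : d ^ 2 = 0 := by
    ext n
    rw [pow_two, PowerSeries.coeff_mul, map_zero]
    exact Finset.sum_eq_zero fun x _ => hmul _ (hJ (hg _)) _ (hg _)
  have hdq : ∀ n, 2 ≤ n → d ^ n = 0 := fun n hn => by
    obtain ⟨c, rfl⟩ := Nat.exists_eq_add_of_le hn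
    rw [pow_add, hdd, zero_mul]
  -- The coefficients of d are killed by u and ϖ, so substituting the full series into d is the same
  -- as substituting X^(q²).
  have hsub : d.subst (ltSeries q ϖ u) = d.subst (PowerSeries.X ^ (q ^ 2) : PowerSeries A) := by
    ext n
    rw [PowerSeries.coeff_subst' hs, PowerSeries.coeff_subst' hs']
    refine finsum_congr fun e => ?_
    obtain ⟨c, hc⟩ := sub_dvd_pow_sub_pow (ltSeries q ϖ u) (PowerSeries.X ^ (q ^ 2)) e
    rw [← sub_eq_zero, ← smul_sub, ← map_sub, hc, smul_eq_mul, ← PowerSeries.coeff_C_mul,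
      ← mul_assoc]
    have : PowerSeries.C (d.coeff e) * (ltSeries q ϖ u - PowerSeries.X ^ (q ^ 2)) = 0 := by
      have h1 := hmul u hu _ (hg e)
      have h2 := hmul ϖ hϖ _ (hg e)
      have : PowerSeries.C (d.coeff e) * (ltSeries q ϖ u - PowerSeries.X ^ (q ^ 2)) =
          PowerSeries.C (u * d.coeff e) * PowerSeries.X ^ q +
            PowerSeries.C (ϖ * d.coeff e) * PowerSeries.X := by
        rw [map_mul, map_mul]; ring
      rw [this, h1, h2]
      simp
    rw [this, zero_mul, map_zero]
  have hsg : PowerSeries.HasSubst g := PowerSeries.HasSubst.of_constantCoeff_zero' hg0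
  rw [subst_ltSeries hsg] at h
  have hadd := mvPowerSeries_add_pow (σ := Unit) hp hqf hpA
  -- All products of d with itself and with ϖ, u' vanish here beyond first order, and the
  -- commutation relation collapses to d(X^(q²)) = (u' - u) X^q.
  have h1 : d.subst (PowerSeries.X ^ (q ^ 2) : PowerSeries A) =
      PowerSeries.C (u' - u) * PowerSeries.X ^ q := by
    have e1 : g.subst (ltSeries q ϖ u) = ltSeries q ϖ u +
        d.subst (PowerSeries.X ^ (q ^ 2) : PowerSeries A) := by
      conv_lhs => rw [hgd]
      rw [PowerSeries.subst_add hs, PowerSeries.subst_X hs, hsub]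
    have e2 : ltOp q (PowerSeries.C ϖ) (PowerSeries.C u') g = ltSeries q ϖ u' := by
      have e3 : ltOp q (PowerSeries.C ϖ) (PowerSeries.C u') d = 0 := by
        rw [ltOp, hdq _ (by omega), hdq q hq, hCd ϖ hϖ, mul_zero, add_zero, add_zero]
      have e4 := ltOp_add hadd (PowerSeries.C ϖ) (PowerSeries.C u') PowerSeries.X d
      rw [e3, add_zero] at e4
      conv_lhs => rw [hgd]
      exact e4
    have e5 : ltSeries q ϖ u + d.subst (PowerSeries.X ^ (q ^ 2) : PowerSeries A) =
        ltSeries q ϖ u' := e1.symm.trans (h.trans e2)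
    rw [eq_sub_of_add_eq' e5, map_sub]
    ring
  -- The left side has exponents divisible by q² only, and q is not such an exponent, so every
  -- coefficient of d is zero.
  have h2 : d = 0 := by
    ext n
    rcases Nat.eq_zero_or_pos n with rfl | hn
    · rw [PowerSeries.coeff_zero_eq_constantCoeff_apply, hd0, map_zero]
    have := congrArg (PowerSeries.coeff (q ^ 2 * n)) h1
    rw [PowerSeries.coeff_subst_X_pow (by positivity), if_pos (dvd_mul_right _ _),
      Nat.mul_div_cancel_left _ (by positivity), PowerSeries.coeff_C_mul, PowerSeries.coeff_X_pow,
      if_neg (by nlinarith), mul_zero] at this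
    rw [map_zero]
    exact this
  rw [hgd, h2, add_zero]

/-- Isomorphisms which are the identity modulo a nilpotent ideal are equal to the identity. -/
theorem eq_X_of_subst_ltSeries (hp : p.Prime) (hqf : q = p ^ f) (hpA : (p : A) = 0) (hq : 2 ≤ q)
    {m : Ideal A} {r : ℕ} (hr : m ^ r = ⊥) {ϖ u u' : A} (hϖ : ϖ ∈ m) (hu : u ∈ m)
    {g : PowerSeries A} (hg0 : g.constantCoeff = 0)
    (hg : ∀ n, (g - PowerSeries.X).coeff n ∈ m)
    (h : g.subst (ltSeries q ϖ u) = (ltSeries q ϖ u').subst g) : g = PowerSeries.X := by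
  have key : ∀ s n, (g - PowerSeries.X).coeff n ∈ m ^ (s + 1) := by
    intro s
    induction s with
    | zero => simpa using hg
    | succ s ih =>
      -- Modulo m^(s+2) the image of m kills the image of m^(s+1), so one step of rigidity improves
      -- the congruence from m^(s+1) to m^(s+2).
      let π := Ideal.Quotient.mk (m ^ (s + 1 + 1))
      have hs : PowerSeries.HasSubst (ltSeries q ϖ u) :=
        PowerSeries.HasSubst.of_constantCoeff_zero' (by simp [show q ≠ 0 by omega])
      have hsg : PowerSeries.HasSubst g := PowerSeries.HasSubst.of_constantCoeff_zero' hg0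
      have e : (g.map π).subst (ltSeries q (π ϖ) (π u)) =
          (ltSeries q (π ϖ) (π u')).subst (g.map π) := by
        have e1 := congrArg (MvPowerSeries.map π) h
        rw [PowerSeries.map_subst hs, PowerSeries.map_subst hsg] at e1
        rw [← map_ltSeries, ← map_ltSeries]
        exact e1
      have hX : g.map π = PowerSeries.X := by
        refine rigidity_step hp hqf (by rw [← map_natCast π, hpA, map_zero]) hq
          (m := m.map π) (J := (m ^ (s + 1)).map π) ?_ ?_ (Ideal.mem_map_of_mem π hϖ)
          (Ideal.mem_map_of_mem π hu) ?_ (fun n => ?_) e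
        · exact Ideal.map_mono (Ideal.pow_le_self (by omega))
        · rw [← Ideal.map_mul, ← pow_succ', Ideal.map_quotient_self]
        · rw [← PowerSeries.coeff_zero_eq_constantCoeff_apply, PowerSeries.coeff_map,
            PowerSeries.coeff_zero_eq_constantCoeff_apply, hg0, map_zero]
        · have : g.map π - PowerSeries.X = (g - PowerSeries.X).map π := by simp
          rw [this, PowerSeries.coeff_map]
          exact Ideal.mem_map_of_mem π (ih n)
      intro n
      have h1 : (g - PowerSeries.X).map π = 0 := by simp [hX]
      have h2 := congrArg (PowerSeries.coeff n) h1
      rw [PowerSeries.coeff_map, map_zero] at h2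
      exact Ideal.Quotient.eq_zero_iff_mem.1 h2
  rw [← sub_eq_zero]
  ext n
  have := Ideal.pow_le_pow_right (Nat.le_succ r) (key r n)
  rw [hr] at this
  simpa using this

end Rigidity

/-! ### Generators of the universal deformation ring -/

section Generators

/-- The equalizer contains W and generators of the maximal ideal, hence approximates every element
modulo each power of that ideal; both homomorphisms kill a sufficiently high power. -/
lemma algHom_eq_of_span {W R P : Type*} [CommRing W] [IsLocalRing W] [CommRing R] [IsLocalRing R]
    [Algebra W R] [IsCoefficientAlgebra W R] [CommRing P] [Algebra W P] {s : Set R} {w : W}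
    (hs : maximalIdeal R = Ideal.span (insert (algebraMap W R w) s)) {h h' : R →ₐ[W] P}
    (hh : ∀ x ∈ s, h x = h' x) {r : ℕ}
    (hr : (Ideal.span (insert (algebraMap W P w) (h '' s))) ^ r = ⊥) : h = h' := by
  set S : Subalgebra W R := AlgHom.equalizer h h' with hS
  have hs' : ∀ x ∈ insert (algebraMap W R w) s, x ∈ S := by
    rintro x (rfl | hx)
    · exact S.algebraMap_mem w
    · exact hh x hx
  have key : ∀ n x, ∃ y ∈ S, x - y ∈ maximalIdeal R ^ n := by
    intro n
    induction n with
    | zero => exact fun x => ⟨0, S.zero_mem, by simp⟩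
    | succ n ih =>
      intro x
      obtain ⟨c, hc⟩ := IsCoefficientAlgebra.exists_sub_mem (W := W) x
      have h1 : ∀ z ∈ maximalIdeal R, ∀ a, ∃ y ∈ S, a * z - y ∈ maximalIdeal R ^ (n + 1) := by
        intro z hz
        have hz' := hz
        rw [hs] at hz'
        induction hz' using Submodule.span_induction with
        | mem z hz' =>
          intro a
          obtain ⟨y, hy, hy'⟩ := ih a
          refine ⟨y * z, S.mul_mem hy (hs' z hz'), ?_⟩
          rw [← sub_mul, pow_succ]
          exact Ideal.mul_mem_mul hy' hz
        | zero => exact fun a => ⟨0, S.zero_mem, by simp⟩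
        | add b c hb hc ihb ihc =>
          intro a
          have hb : b ∈ maximalIdeal R := by rw [hs]; exact hb
          have hc : c ∈ maximalIdeal R := by rw [hs]; exact hc
          obtain ⟨y, hy, hy'⟩ := ihb hb a
          obtain ⟨z, hz, hz'⟩ := ihc hc a
          refine ⟨y + z, S.add_mem hy hz, ?_⟩
          rw [mul_add, add_sub_add_comm]
          exact Ideal.add_mem _ hy' hz'
        | smul b z hzs ih' =>
          intro a
          have hz : z ∈ maximalIdeal R := by rw [hs]; exact hzs
          rw [smul_eq_mul, ← mul_assoc]
          exact ih' hz (a * b)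
      obtain ⟨y, hy, hy'⟩ := h1 _ hc 1
      refine ⟨algebraMap W R c + y, S.add_mem (S.algebraMap_mem c) hy, ?_⟩
      rwa [← sub_sub, ← one_mul (x - _)]
  have hmap : ∀ g : R →ₐ[W] P, (∀ x ∈ s, g x = h x) → ∀ x ∈ maximalIdeal R ^ r, g x = 0 := by
    intro g hg x hx
    have h1 := Ideal.mem_map_of_mem g hx
    have h2 : g '' insert (algebraMap W R w) s = insert (algebraMap W P w) (h '' s) := by
      rw [Set.image_insert_eq, g.commutes, Set.image_congr hg]
    rw [Ideal.map_pow, hs, Ideal.map_span, h2, hr] at h1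
    exact h1
  ext x
  obtain ⟨y, hy, hxy⟩ := key r x
  have h1 := hmap h (fun _ _ => rfl) _ hxy
  have h2 := hmap h' (fun x hx => (hh x hx).symm) _ hxy
  rw [map_sub, sub_eq_zero] at h1 h2
  rw [h1, h2]
  exact hy

end Generators

/-! ### The maximal ideal of the universal deformation ring -/

section MaximalIdeal

variable {𝒪 W : Type*} [CommRing 𝒪] [IsLocalRing 𝒪] [CommRing W] [IsLocalRing W]
  {j : 𝒪 →+* W} {F₀ : FormalModule ((residue W).comp j)} {n : ℕ} {A : Type*} [CommRing A]
  [IsLocalRing A] [Algebra W A] [IsCoefficientAlgebra W A] {T : LevelDeformation F₀ n A}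
  {p f q : ℕ} {ϖ : 𝒪} {u : A}

lemma algebraMap_mem_maximalIdeal (W A : Type*) [CommRing W] [IsLocalRing W] [CommRing A]
    [IsLocalRing A] [Algebra W A] [IsCoefficientAlgebra W A] {w : W} (hw : w ∈ maximalIdeal W) :
    algebraMap W A w ∈ maximalIdeal A := by
  have := IsCoefficientAlgebra.isLocalHom (W := W) (A := A)
  have h3 : maximalIdeal W ≤ (maximalIdeal A).comap (algebraMap W A) :=
    ((local_hom_TFAE (algebraMap W A)).out 0 3).1 ‹_›
  exact h3 hw

/-- Over the residue field the module is isomorphic to F₀, which has no term in X^q. -/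
lemma LevelDeformation.parameter_mem (hq : 2 ≤ q)
    (hF₀ : F₀.HasStandardForm q ϖ (PowerSeries.X ^ (q ^ 2))) (hϖ : j ϖ ∈ maximalIdeal W)
    (hM : T.M.HasStandardForm q ϖ (ltSeries q (((algebraMap W A).comp j) ϖ) u)) :
    u ∈ maximalIdeal A := by
  have h1 := hM.map (residue A) (i' := (residue A).comp ((algebraMap W A).comp j)) (fun _ => rfl)
  have h2 := hF₀.map (ResidueField.map (algebraMap W A))
    (i' := (residue A).comp ((algebraMap W A).comp j)) (fun _ => rfl)
  rw [map_pow, PowerSeries.map_X] at h2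
  rw [map_ltSeries] at h1
  rw [← residue_eq_zero_iff]
  refine eq_zero_of_isIso hq ?_ T.isIso h2 h1
  rw [residue_eq_zero_iff]
  exact algebraMap_mem_maximalIdeal W A hϖ

end MaximalIdeal

section Universal

variable {𝒪 W : Type u} [CommRing 𝒪] [IsLocalRing 𝒪] [CommRing W] [IsLocalRing W]
  {j : 𝒪 →+* W} {F₀ : FormalModule ((residue W).comp j)} {n : ℕ} {R : Type u} [CommRing R]
  [IsLocalRing R] [Algebra W R] [IsCoefficientAlgebra W R] {T : LevelDeformation F₀ n R}
  {p f q : ℕ} {ϖ : 𝒪} {u : R}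

/-- The maximal ideal of the universal deformation ring is generated by `ϖ`, `u`, and the
coordinates of the universal level structure. -/
theorem LevelDeformation.IsUniversal.maximalIdeal_eq_span [Finite (𝒪 ⧸ maximalIdeal 𝒪 ^ n)]
    (hT : T.IsUniversal) (hp : p.Prime) (hqf : q = p ^ f) (hpR : (p : R) = 0) (hq : 2 ≤ q)
    (d : Digits 𝒪 q ϖ) (hϖ : ϖ ∈ maximalIdeal 𝒪) (hW : maximalIdeal W = Ideal.span {j ϖ})
    (hF₀ : F₀.HasStandardForm q ϖ (PowerSeries.X ^ (q ^ 2)))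
    (hM : T.M.HasStandardForm q ϖ (ltSeries q (((algebraMap W R).comp j) ϖ) u)) :
    maximalIdeal R = Ideal.span (insert (algebraMap W R (j ϖ))
      {u, T.φ (Pi.single 0 1), T.φ (Pi.single 1 1)}) := by
  have hjϖ : j ϖ ∈ maximalIdeal W := hW ▸ Ideal.mem_span_singleton_self _
  have hadd : ∀ x y : R, (x + y) ^ q = x ^ q + y ^ q := by
    subst hqf; exact add_pow_of_natCast_eq_zero hp hpR f
  set I := Ideal.span (insert (algebraMap W R (j ϖ))
    {u, T.φ (Pi.single 0 1), T.φ (Pi.single 1 1)}) with hI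
  have hIm : I ≤ maximalIdeal R := by
    rw [hI, Ideal.span_le]
    rintro x (rfl | rfl | rfl | rfl)
    · exact algebraMap_mem_maximalIdeal W R hjϖ
    · exact parameter_mem hq hF₀ hjϖ hM
    · exact T.φ_mem _
    · exact T.φ_mem _
  refine le_antisymm ?_ hIm
  -- By Nakayama it suffices that m lies in I + m². Over R/J compare the quotient map h₁ with the
  -- map h₂ through the residue field; if they agree, then m maps to zero.
  set J := I ⊔ maximalIdeal R ^ 2 with hJdef
  have hJm : J ≤ maximalIdeal R := sup_le hIm (Ideal.pow_le_self (by omega))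
  have : Nontrivial (R ⧸ J) := Ideal.Quotient.nontrivial_iff.2
    (ne_top_of_le_ne_top (Ideal.IsPrime.ne_top inferInstance) hJm)
  have : IsLocalRing (R ⧸ J) := .of_surjective' _ Ideal.Quotient.mk_surjective
  let h₁ : R →ₐ[W] R ⧸ J := Ideal.Quotient.mkₐ W J
  have hmQ : maximalIdeal (R ⧸ J) = (maximalIdeal R).map (Ideal.Quotient.mk J) := by
    have h := IsLocalRing.eq_maximalIdeal (Ideal.comap_isMaximal_of_surjective
      (Ideal.Quotient.mk J) Ideal.Quotient.mk_surjective (K := maximalIdeal (R ⧸ J)))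
    rw [← h, Ideal.map_comap_of_surjective _ Ideal.Quotient.mk_surjective]
  have hmQ2 : maximalIdeal (R ⧸ J) ^ 2 = ⊥ := by
    rw [hmQ, ← Ideal.map_pow, Ideal.map_eq_bot_iff_le_ker, Ideal.mk_ker]
    exact le_sup_right
  have : IsNoetherianRing R := IsCoefficientAlgebra.isNoetherianRing (W := W)
  have : IsCoefficientAlgebra W (R ⧸ J) := by
    refine isCoefficientAlgebra_of_pow_eq_bot hmQ2 ?_ fun a => ?_
    · rw [Ideal.map_le_iff_le_comap, hmQ]
      exact fun w hw => Ideal.mem_map_of_mem (Ideal.Quotient.mk J)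
        (algebraMap_mem_maximalIdeal W R hw)
    · obtain ⟨a, rfl⟩ := Ideal.Quotient.mk_surjective a
      obtain ⟨w, hw⟩ := IsCoefficientAlgebra.exists_sub_mem (W := W) a
      exact ⟨w, by rw [hmQ]; exact Ideal.mem_map_of_mem (Ideal.Quotient.mk J) hw⟩
  have hker : ∀ w ∈ maximalIdeal W, algebraMap W (R ⧸ J) w = 0 := by
    intro w hw
    rw [hW, Ideal.mem_span_singleton] at hw
    obtain ⟨c, rfl⟩ := hw
    have : algebraMap W (R ⧸ J) (j ϖ) = 0 := Ideal.Quotient.eq_zero_iff_mem.2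
      (Ideal.mem_sup_left (Ideal.subset_span (Set.mem_insert _ _)))
    rw [map_mul, this, zero_mul]
  -- The maximal ideal of W is generated by the image of ϖ, which dies in R/J. So the residue field
  -- acts on R/J and the constant map is W-linear.
  obtain ⟨h₂, hh₂⟩ : ∃ h₂ : R →ₐ[W] R ⧸ J, ∀ x ∈ maximalIdeal R, h₂ x = 0 := by
    let e := RingEquiv.ofBijective _ (IsCoefficientAlgebra.bijective_residueFieldMap (W := W) (B := R))
    let g : ResidueField W →+* R ⧸ J := Ideal.Quotient.lift _ (algebraMap W (R ⧸ J)) hker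
    refine ⟨{ toRingHom := g.comp ((e.symm : ResidueField R →+* ResidueField W).comp (residue R))
              commutes' := fun w => ?_ }, fun x hx => ?_⟩
    · have : e.symm (residue R (algebraMap W R w)) = residue W w :=
        e.symm_apply_eq.2 rfl
      change g (e.symm (residue R (algebraMap W R w))) = _
      rw [this]
      rfl
    · change g (e.symm (residue R x)) = 0
      rw [(residue_eq_zero_iff x).2 hx, map_zero, map_zero]
  have hIJ : ∀ x ∈ I, h₁ x = 0 := fun x hx =>
    Ideal.Quotient.eq_zero_iff_mem.2 (Ideal.mem_sup_left hx)
  -- Every point of the level structure is a combination of the two basis points, so it lies in I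
  -- and both maps kill it.
  have hφ : ∀ x, h₁ (T.φ x) = h₂ (T.φ x) := by
    intro x
    obtain ⟨a, ha⟩ := Ideal.Quotient.mk_surjective (x 0)
    obtain ⟨b, hb⟩ := Ideal.Quotient.mk_surjective (x 1)
    have hx : x = ![Ideal.Quotient.mk _ a, Ideal.Quotient.mk _ b] := by
      ext s; fin_cases s <;> simp [ha, hb]
    have : T.φ x ∈ I := by
      rw [hx, φ_eq_actEval hM hadd d hϖ]
      refine I.add_mem (actEval_mem (by omega) I (Ideal.subset_span ?_) _ _)
        (actEval_mem (by omega) I (Ideal.subset_span ?_) _ _) <;> simp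
    rw [hIJ _ this, hh₂ _ (hIm this)]
  -- Both maps send u to zero, so the two base changes have the same [ϖ], which determines a module
  -- in standard form.
  have hmap : T.M.map (h₂ : R →+* R ⧸ J) (i' := (algebraMap W (R ⧸ J)).comp j)
      (fun a => h₂.commutes (j a)) = (T.map h₁).M := by
    have hu0 : u ∈ I := Ideal.subset_span (by simp)
    have e1 := hM.map (h₂ : R →+* R ⧸ J) (i' := (algebraMap W (R ⧸ J)).comp j)
      (fun a => h₂.commutes (j a))
    have e2 := hM.map (h₁ : R →+* R ⧸ J) (i' := (algebraMap W (R ⧸ J)).comp j)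
      (fun a => h₁.commutes (j a))
    have c1 : (h₁ : R →+* R ⧸ J) u = 0 := hIJ u hu0
    have c2 : (h₂ : R →+* R ⧸ J) u = 0 := hh₂ u (hIm hu0)
    have c3 : ∀ h : R →ₐ[W] R ⧸ J, (h : R →+* R ⧸ J) (((algebraMap W R).comp j) ϖ) =
        ((algebraMap W (R ⧸ J)).comp j) ϖ := fun h => h.commutes (j ϖ)
    rw [map_ltSeries, c2, c3] at e1
    rw [map_ltSeries, c1, c3] at e2
    refine FormalModule.eq_of_hasStandardForm hp hqf ?_ hq d hmQ2 (Ideal.zero_mem _) ?_ e1 e2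
    · rw [← map_natCast (Ideal.Quotient.mk J), hpR, map_zero]
    · change algebraMap W (R ⧸ J) (j ϖ) ∈ _
      rw [hker _ hjϖ]
      exact Ideal.zero_mem _
  have hiso : ∀ h : R →ₐ[W] R ⧸ J, T.M.map (h : R →+* R ⧸ J)
      (i' := (algebraMap W (R ⧸ J)).comp j) (fun a => h.commutes (j a)) = (T.map h₁).M →
      (∀ x, h₁ (T.φ x) = h (T.φ x)) → T.BaseChangeIso h (T.map h₁) := by
    intro h hM' hφ'
    have := IsCoefficientAlgebra.isHausdorff W (R ⧸ J)
    refine ⟨PowerSeries.X, ?_, ?_, fun x => ?_⟩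
    · rw [hM']
      exact FormalModule.isIso_X _
    · rw [PowerSeries.map_X]
      refine PowerSeries.subst_X (PowerSeries.HasSubst.of_constantCoeff_zero' ?_)
      exact (T.map h₁).isIso.constantCoeff
    · rw [evaluatesTo_X]
      · exact hφ' x
      · rw [← hφ']
        exact (T.map h₁).φ_mem x
  -- Both maps induce the same deformation up to isomorphism, so the uniqueness in the universal
  -- property identifies them.
  have h12 : h₁ = h₂ := (hT (R ⧸ J) (T.map h₁)).unique
    (hiso h₁ rfl fun _ => rfl) (hiso h₂ hmap hφ)
  have hle : maximalIdeal R ≤ J := fun x hx => by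
    rw [← Ideal.Quotient.eq_zero_iff_mem]
    change h₁ x = 0
    rw [h12, hh₂ x hx]
  refine Submodule.le_of_le_smul_of_le_jacobson_bot (I := maximalIdeal R) (IsNoetherian.noetherian _)
    (IsLocalRing.maximalIdeal_le_jacobson _) ?_
  rwa [smul_eq_mul, ← pow_two]

end Universal

end LubinTateCurve

namespace LubinTateCurve

/-! ### Deformations with level structure built from torsion points. -/

open IsLocalRing

section NilpotentAlgebra

lemma adjoin_sub_mem_span {W A : Type*} [CommRing W] [CommRing A] [Algebra W A] (s : Set A) (a : A)
    (ha : a ∈ Algebra.adjoin W s) : ∃ w : W, a - algebraMap W A w ∈ Ideal.span s := by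
  induction ha using Algebra.adjoin_induction with
  | mem x hx => exact ⟨0, by simpa using Ideal.subset_span hx⟩
  | algebraMap w => exact ⟨w, by simp⟩
  | add x y _ _ hx hy =>
    obtain ⟨w, hw⟩ := hx
    obtain ⟨v, hv⟩ := hy
    exact ⟨w + v, by rw [map_add, add_sub_add_comm]; exact Ideal.add_mem _ hw hv⟩
  | mul x y _ _ hx hy =>
    obtain ⟨w, hw⟩ := hx
    obtain ⟨v, hv⟩ := hy
    refine ⟨w * v, ?_⟩
    have : x * y - algebraMap W A (w * v) =
        y * (x - algebraMap W A w) + algebraMap W A w * (y - algebraMap W A v) := by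
      rw [map_mul]; ring
    rw [this]
    exact Ideal.add_mem _ (Ideal.mul_mem_left _ _ hw) (Ideal.mul_mem_left _ _ hv)

variable {W A : Type*} [CommRing W] [IsLocalRing W] [CommRing A] [Algebra W A]

/-- Such an element is the sum of the image of a unit of W and a nilpotent element. -/
lemma isUnit_of_not_mem_of_pow_eq_bot {I : Ideal A} {r : ℕ} (hI : I ^ r = ⊥)
    (hs : ∀ a : A, ∃ w : W, a - algebraMap W A w ∈ I)
    (hm : (maximalIdeal W).map (algebraMap W A) ≤ I) {a : A} (ha : a ∉ I) : IsUnit a := by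
  obtain ⟨w, hw⟩ := hs a
  have hwu : IsUnit w := by
    by_contra h
    have h1 := hm (Ideal.mem_map_of_mem (algebraMap W A) ((mem_maximalIdeal w).2 h))
    exact ha (by simpa using I.add_mem hw h1)
  have hn : IsNilpotent (a - algebraMap W A w) := by
    refine ⟨r, ?_⟩
    have := Ideal.pow_mem_pow hw r
    rwa [hI] at this
  have := hn.isUnit_add_left_of_commute (hwu.map (algebraMap W A)) (Commute.all _ _)
  rwa [add_sub_cancel] at this

lemma isLocalRing_of_pow_eq_bot [Nontrivial A] {I : Ideal A} {r : ℕ} (hI : I ^ r = ⊥)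
    (hs : ∀ a : A, ∃ w : W, a - algebraMap W A w ∈ I)
    (hm : (maximalIdeal W).map (algebraMap W A) ≤ I) : IsLocalRing A := by
  have hmem : ∀ a, a ∈ nonunits A → a ∈ I := fun a ha => by
    by_contra h
    exact ha (isUnit_of_not_mem_of_pow_eq_bot hI hs hm h)
  refine IsLocalRing.of_nonunits_add fun a b ha hb hab => ?_
  have h1 := Ideal.pow_mem_pow (I.add_mem (hmem a ha) (hmem b hb)) r
  rw [hI, Ideal.mem_bot] at h1
  exact (hab.pow r).ne_zero h1

lemma maximalIdeal_eq_of_pow_eq_bot [IsLocalRing A] {I : Ideal A} {r : ℕ} (hI : I ^ r = ⊥)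
    (hs : ∀ a : A, ∃ w : W, a - algebraMap W A w ∈ I)
    (hm : (maximalIdeal W).map (algebraMap W A) ≤ I) : maximalIdeal A = I := by
  refine le_antisymm (fun a ha => ?_) (fun a ha => ?_)
  · by_contra h
    exact (mem_maximalIdeal a).1 ha (isUnit_of_not_mem_of_pow_eq_bot hI hs hm h)
  · refine (mem_maximalIdeal a).2 fun h => ?_
    have h1 := Ideal.pow_mem_pow ha r
    rw [hI, Ideal.mem_bot] at h1
    exact (h.pow r).ne_zero h1

end NilpotentAlgebra

section Points

variable {𝒪 A : Type*} [CommRing 𝒪] [IsLocalRing 𝒪] [CommRing A] {q p f : ℕ} {ϖ : 𝒪}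

/-- The `𝒪`-linear combinations of two `ϖⁿ`-torsion points. -/
noncomputable def levelPoint (d : Digits 𝒪 q ϖ) (i : 𝒪 →+* A) (u : A) (n : ℕ) (x y : A)
    (v : Fin 2 → 𝒪 ⧸ maximalIdeal 𝒪 ^ n) : A :=
  actEval d i u n (v 0).out x + actEval d i u n (v 1).out y

variable {d : Digits 𝒪 q ϖ} {i : 𝒪 →+* A} {u : A} {n : ℕ} {x y : A}

/-- The first n digits depend only on the class modulo ϖ^n, so the representatives chosen in
`levelPoint` do not matter. -/
lemma actEval_eq_of_mk_eq (hadd : ∀ x y : A, (x + y) ^ q = x ^ q + y ^ q) (hq : q ≠ 0)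
    (hϖ : maximalIdeal 𝒪 = Ideal.span {ϖ}) {a b : 𝒪}
    (hab : Ideal.Quotient.mk (maximalIdeal 𝒪 ^ n) a = Ideal.Quotient.mk (maximalIdeal 𝒪 ^ n) b)
    (x : A) : actEval d i u n a x = actEval d i u n b x := by
  rw [Ideal.Quotient.eq, hϖ, Ideal.span_singleton_pow, Ideal.mem_span_singleton] at hab
  obtain ⟨c, hc⟩ := hab
  rw [sub_eq_iff_eq_add] at hc
  rw [hc, actEval_add_left hadd, actEval_pow_uniformizer_mul hq, zero_add]

lemma levelPoint_mk (hadd : ∀ x y : A, (x + y) ^ q = x ^ q + y ^ q) (hq : q ≠ 0)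
    (hϖ : maximalIdeal 𝒪 = Ideal.span {ϖ}) {v : Fin 2 → 𝒪 ⧸ maximalIdeal 𝒪 ^ n} {a b : 𝒪}
    (ha : Ideal.Quotient.mk _ a = v 0) (hb : Ideal.Quotient.mk _ b = v 1) :
    levelPoint d i u n x y v = actEval d i u n a x + actEval d i u n b y := by
  exact congrArg₂ (· + ·)
    (actEval_eq_of_mk_eq hadd hq hϖ ((Ideal.Quotient.mk_out _).trans ha.symm) x)
    (actEval_eq_of_mk_eq hadd hq hϖ ((Ideal.Quotient.mk_out _).trans hb.symm) y)

lemma levelPoint_add (hadd : ∀ x y : A, (x + y) ^ q = x ^ q + y ^ q) (hq : q ≠ 0)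
    (hϖ : maximalIdeal 𝒪 = Ideal.span {ϖ}) (v w : Fin 2 → 𝒪 ⧸ maximalIdeal 𝒪 ^ n) :
    levelPoint d i u n x y (v + w) = levelPoint d i u n x y v + levelPoint d i u n x y w := by
  have hmk : ∀ (v : Fin 2 → 𝒪 ⧸ maximalIdeal 𝒪 ^ n) s,
    Ideal.Quotient.mk (maximalIdeal 𝒪 ^ n) (v s).out = v s := fun v s => Ideal.Quotient.mk_out _
  rw [levelPoint_mk hadd hq hϖ (a := (v 0).out + (w 0).out) (b := (v 1).out + (w 1).out)
    (by rw [map_add, hmk, hmk]; rfl) (by rw [map_add, hmk, hmk]; rfl),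
    levelPoint, levelPoint, actEval_add_left hadd, actEval_add_left hadd]
  ring

lemma levelPoint_smul (hadd : ∀ x y : A, (x + y) ^ q = x ^ q + y ^ q) (hq : q ≠ 0)
    (hϖ : maximalIdeal 𝒪 = Ideal.span {ϖ}) (hx : (ltOp q (i ϖ) u)^[n] x = 0)
    (hy : (ltOp q (i ϖ) u)^[n] y = 0) (a : 𝒪) (v : Fin 2 → 𝒪 ⧸ maximalIdeal 𝒪 ^ n) :
    levelPoint d i u n x y (a • v) = actEval d i u n a (levelPoint d i u n x y v) := by
  have hmk : ∀ s, Ideal.Quotient.mk (maximalIdeal 𝒪 ^ n) (a * (v s).out) = (a • v) s := fun s => by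
    rw [map_mul, Pi.smul_apply, Algebra.smul_def]
    exact congrArg (_ * ·) (Ideal.Quotient.mk_out _)
  rw [levelPoint_mk hadd hq hϖ (hmk 0) (hmk 1), levelPoint, actEval_add_right hadd,
    actEval_mul hadd hq _ _ _ _ hx, actEval_mul hadd hq _ _ _ _ hy]

lemma iterate_levelPoint (hadd : ∀ x y : A, (x + y) ^ q = x ^ q + y ^ q) (hq : q ≠ 0)
    (hx : (ltOp q (i ϖ) u)^[n] x = 0) (hy : (ltOp q (i ϖ) u)^[n] y = 0)
    (v : Fin 2 → 𝒪 ⧸ maximalIdeal 𝒪 ^ n) :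
    (ltOp q (i ϖ) u)^[n] (levelPoint d i u n x y v) = 0 := by
  rw [levelPoint, ltOp_iterate_add hadd, ← actEval_iterate hadd, ← actEval_iterate hadd, hx, hy,
    actEval_zero_right hq, actEval_zero_right hq, add_zero]

lemma levelPoint_mem (hq : q ≠ 0) (I : Ideal A) (hx : x ∈ I) (hy : y ∈ I)
    (v : Fin 2 → 𝒪 ⧸ maximalIdeal 𝒪 ^ n) : levelPoint d i u n x y v ∈ I :=
  I.add_mem (actEval_mem hq I hx _ _) (actEval_mem hq I hy _ _)

lemma levelPoint_single_zero (hadd : ∀ x y : A, (x + y) ^ q = x ^ q + y ^ q) (hq : q ≠ 0)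
    (hϖ : maximalIdeal 𝒪 = Ideal.span {ϖ}) (hn : n ≠ 0) :
    levelPoint d i u n x y (Pi.single 0 1) = x := by
  obtain ⟨n, rfl⟩ := Nat.exists_eq_succ_of_ne_zero hn
  rw [levelPoint_mk hadd hq hϖ (a := 1) (b := 0) (by simp) (by simp), actEval_zero_left hq,
    actEval_of_pow hq _ (one_pow q), map_one, one_mul, add_zero]

lemma levelPoint_single_one (hadd : ∀ x y : A, (x + y) ^ q = x ^ q + y ^ q) (hq : q ≠ 0)
    (hϖ : maximalIdeal 𝒪 = Ideal.span {ϖ}) (hn : n ≠ 0) :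
    levelPoint d i u n x y (Pi.single 1 1) = y := by
  obtain ⟨n, rfl⟩ := Nat.exists_eq_succ_of_ne_zero hn
  rw [levelPoint_mk hadd hq hϖ (a := 0) (b := 1) (by simp) (by simp), actEval_zero_left hq,
    actEval_of_pow hq _ (one_pow q), map_one, one_mul, zero_add]

lemma map_levelPoint {B : Type*} [CommRing B] (g : A →+* B) (v : Fin 2 → 𝒪 ⧸ maximalIdeal 𝒪 ^ n) :
    g (levelPoint d i u n x y v) = levelPoint d (g.comp i) (g u) n (g x) (g y) v := by
  rw [levelPoint, map_add, map_actEval, map_actEval]; rfl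

end Points

section Construction

lemma actSeries_pow_uniformizer {𝒪 A : Type*} [CommRing 𝒪] [CommRing A] {p q f : ℕ} {ϖ : 𝒪}
    {d : Digits 𝒪 q ϖ} {i : 𝒪 →+* A} {u : A}
    {I : Ideal A} {r : ℕ} (hp : p.Prime) (hqf : q = p ^ f) (hpA : (p : A) = 0)
    (hq : 2 ≤ q) (hI : I ^ r = ⊥) (hu : u ∈ I) (hϖ : i ϖ ∈ I) (N : ℕ) :
    actSeries d i u r (ϖ ^ N) =
      (((ltOp q (Polynomial.C (i ϖ)) (Polynomial.C u))^[N] Polynomial.X : Polynomial A) :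
        PowerSeries A) := by
  induction N with
  | zero =>
    rw [pow_zero, actSeries_of_pow hp hqf hpA hq hI hu hϖ (one_pow q), map_one, map_one, one_mul]
    simp
  | succ N ih =>
    rw [pow_succ', actSeries_uniformizer_mul hp hqf hpA hq hI hu hϖ, ih, Function.iterate_succ_apply']
    have := map_ltOp (q := q) (Polynomial.coeToPowerSeries.ringHom (R := A)) (Polynomial.C (i ϖ))
      (Polynomial.C u) ((ltOp q (Polynomial.C (i ϖ)) (Polynomial.C u))^[N] Polynomial.X)
    simpa using this.symm

variable {𝒪 W : Type*} [CommRing 𝒪] [IsLocalRing 𝒪] [CommRing W] [IsLocalRing W]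
  {j : 𝒪 →+* W} {F₀ : FormalModule ((residue W).comp j)} {n : ℕ}
  {p f q : ℕ} {ϖ : 𝒪} {R : Type*} [CommRing R]
  [IsLocalRing R] [Algebra W R] [IsCoefficientAlgebra W R] {A : Type*} [CommRing A]
  [IsLocalRing A] [Algebra W A] [IsCoefficientAlgebra W A]

/-- The isomorphism `ρ` of a deformation is an isomorphism onto the reduction of any
other module in standard form. -/
lemma LevelDeformation.isIso_of_hasStandardForm (T : LevelDeformation F₀ n R)
    (hp : p.Prime) (hqf : q = p ^ f) (hpA : (p : A) = 0) (hq : 2 ≤ q) (d : Digits 𝒪 q ϖ)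
    (hϖ : j ϖ ∈ maximalIdeal W) {u : R} (hu : u ∈ maximalIdeal R)
    (hM : T.M.HasStandardForm q ϖ (ltSeries q (((algebraMap W R).comp j) ϖ) u))
    {u' : A} (hu' : u' ∈ maximalIdeal A) {M : FormalModule ((algebraMap W A).comp j)}
    (hM' : M.HasStandardForm q ϖ (ltSeries q (((algebraMap W A).comp j) ϖ) u')) :
    (F₀.map (ResidueField.map (algebraMap W A))
      (i' := (residue A).comp ((algebraMap W A).comp j)) (fun _ => rfl)).IsIso
    (M.map (residue A) (i' := (residue A).comp ((algebraMap W A).comp j)) (fun _ => rfl))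
    (T.ρ.map (ResidueField.map (algebraMap W A))) := by
  let e := RingEquiv.ofBijective _ (IsCoefficientAlgebra.bijective_residueFieldMap (W := W) (B := R))
  let g : ResidueField R →+* ResidueField A :=
    (ResidueField.map (algebraMap W A)).comp (e.symm : ResidueField R →+* ResidueField W)
  have h0 : g.comp (ResidueField.map (algebraMap W R)) = ResidueField.map (algebraMap W A) := by
    ext w
    exact congrArg (ResidueField.map (algebraMap W A)) (e.symm_apply_apply w)
  have h1 : ∀ a, g (((residue R).comp ((algebraMap W R).comp j)) a) =
      ((residue A).comp ((algebraMap W A).comp j)) a := fun a =>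
    congrArg (fun h : ResidueField W →+* ResidueField A => h (residue W (j a))) h0
  have e1 := FormalModule.map_map F₀ (ResidueField.map (algebraMap W R))
    (i' := (residue R).comp ((algebraMap W R).comp j)) (fun _ => rfl) g h1 _ h0 (fun _ => rfl)
  have e4 : T.ρ.map (ResidueField.map (algebraMap W A)) =
      (T.ρ.map (ResidueField.map (algebraMap W R))).map g := by
    rw [← h0, PowerSeries.map_comp]; rfl
  have s1 := (hM.map (residue R) (i' := (residue R).comp ((algebraMap W R).comp j))
    (fun _ => rfl)).map g h1
  have s2 := hM'.map (residue A) (i' := (residue A).comp ((algebraMap W A).comp j)) (fun _ => rfl)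
  rw [map_ltSeries, map_ltSeries, (residue_eq_zero_iff u).2 hu, map_zero] at s1
  rw [map_ltSeries, (residue_eq_zero_iff u').2 hu'] at s2
  have c : ((residue A).comp ((algebraMap W A).comp j)) ϖ = 0 := by
    rw [RingHom.comp_apply, residue_eq_zero_iff]
    exact algebraMap_mem_maximalIdeal W A hϖ
  -- Over the residue field both u and ϖ vanish, so both reductions have [ϖ] = X^(q²) and coincide.
  -- The isomorphism ρ is transported along the identification of residue fields through W.
  have e5 : (T.M.map (residue R) (i' := (residue R).comp ((algebraMap W R).comp j))
      (fun _ => rfl)).map g h1 = M.map (residue A)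
        (i' := (residue A).comp ((algebraMap W A).comp j)) (fun _ => rfl) := by
    refine FormalModule.eq_of_hasStandardForm hp hqf ?_ hq d (I := ⊥) (r := 1) (pow_one _)
      (Ideal.zero_mem _) ?_ (u := 0) ?_ s2
    · rw [← map_natCast (residue A), hpA, map_zero]
    · rw [c]; exact Ideal.zero_mem _
    · have c' : g (residue R (((algebraMap W R).comp j) ϖ)) =
        ((residue A).comp ((algebraMap W A).comp j)) ϖ := h1 ϖ
      rw [c'] at s1
      exact s1
  rw [← e1, ← e5, e4]
  exact T.isIso.map g h1

lemma eq_X_of_subst_eq_self {k : Type*} [CommRing k] {g ρ : PowerSeries k}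
    (hρ : ρ.constantCoeff = 0) (hρ' : IsUnit (ρ.coeff 1)) (h : g.subst ρ = ρ) :
    g = PowerSeries.X := by
  have h1 := PowerSeries.subst_substInvOfIsUnit_right ρ hρ hρ'
  have h2 := congrArg (PowerSeries.subst (ρ.substInvOfIsUnit hρ')) h
  rw [PowerSeries.subst_comp_subst_apply (PowerSeries.HasSubst.of_constantCoeff_zero' hρ)
    (PowerSeries.HasSubst.substInvOfIsUnit ρ hρ'), h1, PowerSeries.X_subst] at h2
  exact h2

end Construction

end LubinTateCurve

namespace LubinTateCurve

open IsLocalRing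

section Lift

variable {𝒪 W : Type u} [CommRing 𝒪] [IsLocalRing 𝒪] [CommRing W] [IsLocalRing W]
  {j : 𝒪 →+* W} {F₀ : FormalModule ((residue W).comp j)} {n : ℕ}
  {p f q : ℕ} {ϖ : 𝒪} {R : Type u} [CommRing R]
  [IsLocalRing R] [Algebra W R] [IsCoefficientAlgebra W R]

open Classical in
/-- Points of the universal deformation ring with nilpotent coordinates. -/
theorem LevelDeformation.IsUniversal.exists_algHom_of_pow_eq_bot
    {T : LevelDeformation F₀ n R} (hT : T.IsUniversal) [Fintype (𝒪 ⧸ maximalIdeal 𝒪 ^ n)]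
    (hn : n ≠ 0) (hp : p.Prime) (hqf : q = p ^ f) (hpW : (p : W) = 0) (hq : 2 ≤ q)
    (d : Digits 𝒪 q ϖ) (hϖ : maximalIdeal 𝒪 = Ideal.span {ϖ}) (hϖ' : Irreducible ϖ)
    (hjϖ : j ϖ ∈ maximalIdeal W) {u : R} (hu : u ∈ maximalIdeal R)
    (hM : T.M.HasStandardForm q ϖ (ltSeries q (((algebraMap W R).comp j) ϖ) u))
    {A : Type u} [CommRing A] [IsLocalRing A] [Algebra W A] [IsCoefficientAlgebra W A] {r : ℕ}
    (hr : maximalIdeal A ^ r = ⊥) {u' x y : A} (hu' : u' ∈ maximalIdeal A)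
    (hx : x ∈ maximalIdeal A) (hy : y ∈ maximalIdeal A)
    (hx' : (ltOp q (((algebraMap W A).comp j) ϖ) u')^[n] x = 0)
    (hy' : (ltOp q (((algebraMap W A).comp j) ϖ) u')^[n] y = 0)
    (hdvd : ∏ v, (Polynomial.X -
        Polynomial.C (levelPoint d ((algebraMap W A).comp j) u' n x y v)) ∣
      (ltOp q (Polynomial.C (((algebraMap W A).comp j) ϖ)) (Polynomial.C u'))^[n] Polynomial.X) :
    ∃ h : R →ₐ[W] A, h u = u' ∧ h (T.φ (Pi.single 0 1)) = x ∧ h (T.φ (Pi.single 1 1)) = y := by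
  have hpA : (p : A) = 0 := by rw [← map_natCast (algebraMap W A), hpW, map_zero]
  have hadd : ∀ x y : A, (x + y) ^ q = x ^ q + y ^ q := by
    subst hqf; exact add_pow_of_natCast_eq_zero hp hpA f
  have hq0 : q ≠ 0 := by omega
  have := IsCoefficientAlgebra.isHausdorff W A
  have hiϖ : ((algebraMap W A).comp j) ϖ ∈ maximalIdeal A := algebraMap_mem_maximalIdeal W A hjϖ
  let M := standardFormalModule d ((algebraMap W A).comp j) u' (maximalIdeal A) r hp hqf hpA hq hr
    hu' hiϖ
  have hMs : M.HasStandardForm q ϖ (ltSeries q (((algebraMap W A).comp j) ϖ) u') :=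
    standardFormalModule_hasStandardForm hp hqf hpA hq hr hu' hiϖ
  let φ := levelPoint d ((algebraMap W A).comp j) u' n x y
  have hφm : ∀ v, φ v ∈ maximalIdeal A := levelPoint_mem hq0 _ hx hy
  let T' : LevelDeformation F₀ n A :=
    { M := M
      ρ := T.ρ
      isIso := T.isIso_of_hasStandardForm hp hqf hpA hq d hjϖ hu hM hu' hMs
      φ := φ
      φ_mem := hφm
      φ_add := fun v w => by
        rw [hMs.group]
        exact (evaluatesTo₂_iff (hφm v) (hφm w)).2 (levelPoint_add hadd hq0 hϖ v w)
      φ_smul := fun a v => by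
        have h1 : φ (a • v) = _ := levelPoint_smul hadd hq0 hϖ hx' hy' a v
        rw [h1]
        exact evaluatesTo_actSeries hp hqf hpA hq hr hu' hiϖ le_rfl (hφm v)
          (iterate_levelPoint hadd hq0 hx' hy' v) a
      drinfeld := fun ϖ' hirr => by
        -- Any other prime element is ϖ v with v a unit. As [v^n] has no constant term, [ϖ^n]
        -- divides the composite of [v^n] with [ϖ^n], so the divisibility for ϖ suffices.
        have hass : Associated ϖ ϖ' := by
          have h1 : ϖ' ∈ maximalIdeal 𝒪 := (mem_maximalIdeal _).2 hirr.not_isUnit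
          rw [hϖ, Ideal.mem_span_singleton] at h1
          exact (hϖ'.dvd_irreducible_iff_associated hirr).1 h1
        obtain ⟨v, rfl⟩ := hass
        rw [mul_pow, mul_comm, M.act_mul, finprod_eq_prod_of_fintype]
        have h1 := map_dvd (Polynomial.coeToPowerSeries.ringHom (R := A)) hdvd
        rw [map_prod] at h1
        simp only [map_sub, Polynomial.coeToPowerSeries.ringHom_apply, Polynomial.coe_X,
          Polynomial.coe_C] at h1
        rw [← actSeries_pow_uniformizer (d := d) hp hqf hpA hq hr hu' hiϖ n] at h1
        refine h1.trans ?_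
        obtain ⟨g, hg⟩ := PowerSeries.X_dvd_iff.2 (M.act_constantCoeff ((v : 𝒪) ^ n))
        have hs := PowerSeries.HasSubst.of_constantCoeff_zero' (M.act_constantCoeff (ϖ ^ n))
        rw [hg, PowerSeries.subst_mul hs, PowerSeries.subst_X hs]
        exact Dvd.intro _ rfl }
  obtain ⟨h, ⟨g, hg, hgρ, hgφ⟩, -⟩ := hT A T'
  have hloc := IsCoefficientAlgebra.isLocalHom_algHom h
  have hhm : ∀ z ∈ maximalIdeal R, h z ∈ maximalIdeal A := by
    have h3 : maximalIdeal R ≤ (maximalIdeal A).comap (h : R →+* A) :=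
      ((local_hom_TFAE (h : R →+* A)).out 0 3).1 ‹_›
    exact h3
  -- The isomorphism supplied by universality respects ρ, so it is the identity over the residue
  -- field; commuting with [ϖ], it is the identity by rigidity. This is what turns isomorphism into
  -- equality of coordinates.
  have hgX : g = PowerSeries.X := by
    have hMh := hM.map (h : R →+* A) (i' := (algebraMap W A).comp j) (fun a => h.commutes (j a))
    rw [map_ltSeries, show (h : R →+* A) (((algebraMap W R).comp j) ϖ) =
      ((algebraMap W A).comp j) ϖ from h.commutes (j ϖ)] at hMh
    refine eq_X_of_subst_ltSeries hp hqf hpA hq hr hiϖ (hhm u hu) (u' := u') hg.constantCoeff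
      (fun m => ?_) ?_
    · have h1 : g.map (residue A) = PowerSeries.X :=
        eq_X_of_subst_eq_self T'.isIso.constantCoeff T'.isIso.isUnit_coeff_one hgρ
      have h2 : (g - PowerSeries.X).map (residue A) = 0 := by
        rw [map_sub, h1, PowerSeries.map_X, sub_self]
      have h3 := congrArg (PowerSeries.coeff m) h2
      rw [PowerSeries.coeff_map, map_zero, residue_eq_zero_iff] at h3
      exact h3
    · have h1 := hg.act ϖ
      rw [hMh.act_uniformizer] at h1
      exact h1.trans (by rw [show T'.M.act ϖ = _ from hMs.act_uniformizer])
  have hφ : ∀ v, h (T.φ v) = φ v := fun v => by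
    have h1 := hgφ v
    rw [hgX, evaluatesTo_X (hhm _ (T.φ_mem v))] at h1
    exact h1.symm
  refine ⟨h, ?_, ?_, ?_⟩
  · have hMh := hM.map (h : R →+* A) (i' := (algebraMap W A).comp j) (fun a => h.commutes (j a))
    -- With g = X, comparing the coefficients of X^q in [ϖ] identifies h(u) with u'.
    have h1 := hg.act ϖ
    rw [hMh.act_uniformizer, show T'.M.act ϖ = _ from hMs.act_uniformizer, hgX,
      PowerSeries.X_subst, PowerSeries.subst_X (PowerSeries.HasSubst.of_constantCoeff_zero'
        (by simp [hq0])), map_ltSeries, show (h : R →+* A) (((algebraMap W R).comp j) ϖ) =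
      ((algebraMap W A).comp j) ϖ from h.commutes (j ϖ)] at h1
    have h2 := congrArg (PowerSeries.coeff q) (add_left_cancel (add_right_cancel h1))
    simpa using h2
  · rw [hφ]; exact levelPoint_single_zero hadd hq0 hϖ hn
  · rw [hφ]; exact levelPoint_single_one hadd hq0 hϖ hn

end Lift

end LubinTateCurve

namespace LubinTateCurve

open IsLocalRing

section Divisibility

open Polynomial

/-- Split off one root at a time: at the next root the factors already extracted take
non-zero-divisor values and can be cancelled. -/
lemma prod_X_sub_C_dvd {B ι : Type*} [CommRing B] (s : Finset ι) (a : ι → B)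
    (h : ∀ i ∈ s, ∀ k ∈ s, i ≠ k → a i - a k ∈ nonZeroDivisors B) (P : B[X])
    (hP : ∀ i ∈ s, P.eval (a i) = 0) : ∏ i ∈ s, (X - C (a i)) ∣ P := by
  classical
  induction s using Finset.induction_on with
  | empty => simp
  | insert i s his ih =>
    obtain ⟨g, rfl⟩ := ih (fun k hk l hl => h k (Finset.mem_insert_of_mem hk) l
      (Finset.mem_insert_of_mem hl)) (fun k hk => hP k (Finset.mem_insert_of_mem hk))
    have h1 := hP i (Finset.mem_insert_self _ _)
    rw [eval_mul, eval_prod] at h1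
    have h2 : ∏ k ∈ s, (X - C (a k)).eval (a i) ∈ nonZeroDivisors B := by
      refine prod_mem fun k hk => ?_
      rw [eval_sub, eval_X, eval_C]
      exact h i (Finset.mem_insert_self _ _) k (Finset.mem_insert_of_mem hk)
        (fun e => his (e ▸ hk))
    have h3 : g.eval (a i) = 0 := (mem_nonZeroDivisors_iff.1 h2).1 _ h1
    obtain ⟨g', rfl⟩ := dvd_iff_isRoot.2 h3
    rw [Finset.prod_insert his, mul_comm (X - C (a i))]
    exact mul_dvd_mul_left _ (Dvd.intro _ rfl)

end Divisibility

section Transfer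

lemma map_iterate_eq_zero {𝒪 B P : Type*} [CommRing 𝒪] [CommRing B] [CommRing P] {q n : ℕ} {ϖ : 𝒪}
    {i : 𝒪 →+* B} {u x : B} (g : B →+* P) {i' : 𝒪 →+* P} (hi : g.comp i = i')
    (h : (ltOp q (i ϖ) u)^[n] x = 0) : (ltOp q (i' ϖ) (g u))^[n] (g x) = 0 := by
  subst hi
  have e := map_ltOp_iterate (q := q) g (i ϖ) u x n
  rw [h, map_zero] at e
  exact e.symm

lemma map_iterate_X {𝒪 B P : Type*} [CommRing 𝒪] [CommRing B] [CommRing P] {q n : ℕ} {ϖ : 𝒪}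
    {i : 𝒪 →+* B} {u : B} (g : B →+* P) {i' : 𝒪 →+* P} (hi : g.comp i = i') :
    ((ltOp q (Polynomial.C (i ϖ)) (Polynomial.C u))^[n] Polynomial.X).map g =
      (ltOp q (Polynomial.C (i' ϖ)) (Polynomial.C (g u)))^[n] Polynomial.X := by
  subst hi
  have e1 := map_ltOp_iterate (q := q) (Polynomial.mapRingHom g)
    (Polynomial.C (i ϖ)) (Polynomial.C u) Polynomial.X n
  simpa only [Polynomial.coe_mapRingHom, Polynomial.map_C, Polynomial.map_X,
    RingHom.comp_apply] using e1

variable {𝒪 B P : Type*} [CommRing 𝒪] [IsLocalRing 𝒪] [CommRing B] [CommRing P] {q n : ℕ} {ϖ : 𝒪}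
  {d : Digits 𝒪 q ϖ} {i : 𝒪 →+* B} {u x y : B}

lemma map_prod_levelPoint [Fintype (𝒪 ⧸ maximalIdeal 𝒪 ^ n)] (g : B →+* P)
    {i' : 𝒪 →+* P} (hi : g.comp i = i') :
    (∏ v, (Polynomial.X - Polynomial.C (levelPoint d i u n x y v))).map g =
      ∏ v, (Polynomial.X - Polynomial.C (levelPoint d i' (g u) n (g x) (g y) v)) := by
  subst hi
  rw [Polynomial.map_prod]
  refine Finset.prod_congr rfl fun v _ => ?_
  rw [Polynomial.map_sub, Polynomial.map_X, Polynomial.map_C, map_levelPoint g]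

end Transfer

section Lift

variable {𝒪 W : Type u} [CommRing 𝒪] [IsLocalRing 𝒪] [CommRing W] [IsLocalRing W]
  {j : 𝒪 →+* W} {F₀ : FormalModule ((residue W).comp j)} {n : ℕ}
  {p f q : ℕ} {ϖ : 𝒪} {R : Type u} [CommRing R]
  [IsLocalRing R] [Algebra W R] [IsCoefficientAlgebra W R]

/-- Points of the universal deformation ring with nilpotent coordinates, in arbitrary rings. -/
theorem LevelDeformation.IsUniversal.exists_algHom_of_isNilpotent
    {T : LevelDeformation F₀ n R} (hT : T.IsUniversal) [Fintype (𝒪 ⧸ maximalIdeal 𝒪 ^ n)]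
    [IsNoetherianRing W]
    (hn : n ≠ 0) (hp : p.Prime) (hqf : q = p ^ f) (hpW : (p : W) = 0) (hq : 2 ≤ q)
    (d : Digits 𝒪 q ϖ) (hϖ : maximalIdeal 𝒪 = Ideal.span {ϖ}) (hϖ' : Irreducible ϖ)
    (hW : maximalIdeal W = Ideal.span {j ϖ}) {u : R} (hu : u ∈ maximalIdeal R)
    (hM : T.M.HasStandardForm q ϖ (ltSeries q (((algebraMap W R).comp j) ϖ) u))
    {P : Type u} [CommRing P] [Nontrivial P] [Algebra W P] {u' x y : P}
    (hnil : ∀ z ∈ insert (algebraMap W P (j ϖ)) ({u', x, y} : Set P), IsNilpotent z)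
    (hx' : (ltOp q (((algebraMap W P).comp j) ϖ) u')^[n] x = 0)
    (hy' : (ltOp q (((algebraMap W P).comp j) ϖ) u')^[n] y = 0)
    (hdvd : ∏ v, (Polynomial.X -
        Polynomial.C (levelPoint d ((algebraMap W P).comp j) u' n x y v)) ∣
      (ltOp q (Polynomial.C (((algebraMap W P).comp j) ϖ)) (Polynomial.C u'))^[n] Polynomial.X) :
    ∃ h : R →ₐ[W] P, h u = u' ∧ h (T.φ (Pi.single 0 1)) = x ∧ h (T.φ (Pi.single 1 1)) = y := by
  set s : Set P := {u', x, y} with hs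
  -- The target need not be noetherian or local, but the W-subalgebra generated by the three
  -- nilpotent coordinates is a coefficient algebra with nilpotent maximal ideal.
  set A := Algebra.adjoin W s with hA
  have hfin : s.Finite := by rw [hs]; exact Set.toFinite _
  have hinj : Function.Injective (algebraMap A P) := Subtype.val_injective
  let uA : A := ⟨u', Algebra.subset_adjoin (by simp [hs])⟩
  let xA : A := ⟨x, Algebra.subset_adjoin (by simp [hs])⟩
  let yA : A := ⟨y, Algebra.subset_adjoin (by simp [hs])⟩
  have : Algebra.FiniteType W A :=
    (Subalgebra.fg_iff_finiteType _).1 (Subalgebra.fg_def.2 ⟨s, hfin, rfl⟩)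
  have : IsNoetherianRing A := Algebra.FiniteType.isNoetherianRing W A
  set I : Ideal A := Ideal.span (insert (algebraMap W A (j ϖ)) {uA, xA, yA}) with hI
  obtain ⟨r, hr⟩ : IsNilpotent I := by
    rw [Ideal.FG.isNilpotent_iff_le_nilradical (IsNoetherian.noetherian I), hI, Ideal.span_le]
    intro z hz
    refine (IsNilpotent.map_iff hinj).1 (hnil _ ?_)
    rcases hz with rfl | rfl | rfl | rfl
    · exact Or.inl rfl
    · exact Or.inr (Or.inl rfl)
    · exact Or.inr (Or.inr (Or.inl rfl))
    · exact Or.inr (Or.inr (Or.inr rfl))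
  have hsub : ∀ a : A, ∃ w : W, a - algebraMap W A w ∈ I := by
    intro a
    have h1 : a ∈ Algebra.adjoin W ({uA, xA, yA} : Set A) := by
      have h2 : ({uA, xA, yA} : Set A) = Subtype.val ⁻¹' s := by
        ext z; simp [hs, uA, xA, yA, Subtype.ext_iff]
      rw [h2, Algebra.adjoin_adjoin_coe_preimage]
      trivial
    obtain ⟨w, hw⟩ := adjoin_sub_mem_span _ a h1
    exact ⟨w, Ideal.span_mono (Set.subset_insert _ _) hw⟩
  have hmI : (maximalIdeal W).map (algebraMap W A) ≤ I := by
    rw [hW, Ideal.map_span, Set.image_singleton, Ideal.span_singleton_le_iff_mem]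
    exact Ideal.subset_span (Set.mem_insert _ _)
  have : Nontrivial A := inferInstance
  have : IsLocalRing A := isLocalRing_of_pow_eq_bot hr hsub hmI
  have hmax : maximalIdeal A = I := maximalIdeal_eq_of_pow_eq_bot hr hsub hmI
  have : IsCoefficientAlgebra W A := isCoefficientAlgebra_of_pow_eq_bot (by rw [hmax]; exact hr)
    (by rw [hmax]; exact hmI) (by rw [hmax]; exact hsub)
  have hcomp : (algebraMap A P).comp ((algebraMap W A).comp j) = (algebraMap W P).comp j := rfl
  have hmap : ∀ z : A, (ltOp q (((algebraMap W P).comp j) ϖ) u')^[n] z.1 = 0 →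
      (ltOp q (((algebraMap W A).comp j) ϖ) uA)^[n] z = 0 := fun z hz => by
    have e := map_ltOp_iterate (q := q) (algebraMap A P) (((algebraMap W A).comp j) ϖ) uA z n
    exact hinj ((e.trans hz).trans (map_zero _).symm)
  obtain ⟨h, h1, h2, h3⟩ := hT.exists_algHom_of_pow_eq_bot hn hp hqf hpW hq d hϖ hϖ'
    (hW ▸ Ideal.mem_span_singleton_self _) hu hM (A := A) (r := r) (by rw [hmax]; exact hr)
    (u' := uA) (x := xA) (y := yA)
    (by rw [hmax]; exact Ideal.subset_span (by simp))
    (by rw [hmax]; exact Ideal.subset_span (by simp))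
    (by rw [hmax]; exact Ideal.subset_span (by simp))
    (hmap xA hx') (hmap yA hy') (by
      -- Divisibility by a monic polynomial descends along an injective ring map.
      rw [← Polynomial.map_dvd_map _ hinj (Polynomial.monic_prod_of_monic _ _
        fun v _ => Polynomial.monic_X_sub_C _), map_prod_levelPoint _ hcomp,
        map_iterate_X _ hcomp]
      exact hdvd)
  exact ⟨A.val.comp h, congrArg Subtype.val h1, congrArg Subtype.val h2, congrArg Subtype.val h3⟩

/-- Points of the universal deformation ring with topologically nilpotent coordinates. -/
theorem LevelDeformation.IsUniversal.exists_algHom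
    {T : LevelDeformation F₀ n R} (hT : T.IsUniversal) [Fintype (𝒪 ⧸ maximalIdeal 𝒪 ^ n)]
    [IsNoetherianRing W]
    (hn : n ≠ 0) (hp : p.Prime) (hqf : q = p ^ f) (hpW : (p : W) = 0) (hq : 2 ≤ q)
    (d : Digits 𝒪 q ϖ) (hϖ : maximalIdeal 𝒪 = Ideal.span {ϖ}) (hϖ' : Irreducible ϖ)
    (hW : maximalIdeal W = Ideal.span {j ϖ})
    (hF₀ : F₀.HasStandardForm q ϖ (PowerSeries.X ^ (q ^ 2))) {u : R}
    (hM : T.M.HasStandardForm q ϖ (ltSeries q (((algebraMap W R).comp j) ϖ) u))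
    {B : Type u} [CommRing B] [Algebra W B] (I : Ideal B) [IsAdicComplete I B] (hI : I ≠ ⊤)
    {u' x y : B}
    (hnil : ∀ z ∈ insert (algebraMap W B (j ϖ)) ({u', x, y} : Set B), ∃ N : ℕ, z ^ N ∈ I)
    (hx' : (ltOp q (((algebraMap W B).comp j) ϖ) u')^[n] x = 0)
    (hy' : (ltOp q (((algebraMap W B).comp j) ϖ) u')^[n] y = 0)
    (hnzd : ∀ v, v ≠ 0 → levelPoint d ((algebraMap W B).comp j) u' n x y v ∈ nonZeroDivisors B) :
    ∃ h : R →ₐ[W] B, h u = u' ∧ h (T.φ (Pi.single 0 1)) = x ∧ h (T.φ (Pi.single 1 1)) = y := by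
  classical
  have hpR : (p : R) = 0 := by rw [← map_natCast (algebraMap W R), hpW, map_zero]
  have hpB : (p : B) = 0 := by rw [← map_natCast (algebraMap W B), hpW, map_zero]
  have hadd : ∀ x y : B, (x + y) ^ q = x ^ q + y ^ q := by
    subst hqf; exact add_pow_of_natCast_eq_zero hp hpB f
  have hϖm : ϖ ∈ maximalIdeal 𝒪 := hϖ ▸ Ideal.mem_span_singleton_self _
  have hjϖ : j ϖ ∈ maximalIdeal W := hW ▸ Ideal.mem_span_singleton_self _
  have hu : u ∈ maximalIdeal R := parameter_mem hq hF₀ hjϖ hM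
  have hgen := hT.maximalIdeal_eq_span hp hqf hpR hq d hϖm hW hF₀ hM
  -- Differences of level points are again level points, and each is a root of the iterate. The
  -- divisibility is established over B, where non-zero-divisors are available, and only then
  -- reduced modulo I^N.
  have hdvd : ∏ v, (Polynomial.X -
        Polynomial.C (levelPoint d ((algebraMap W B).comp j) u' n x y v)) ∣
      (ltOp q (Polynomial.C (((algebraMap W B).comp j) ϖ)) (Polynomial.C u'))^[n]
        Polynomial.X := by
    refine prod_X_sub_C_dvd _ _ (fun v _ w _ hvw => ?_) _ (fun v _ => ?_)
    · have e := levelPoint_add (d := d) (i := (algebraMap W B).comp j) (u := u') (x := x) (y := y)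
        hadd (by omega) hϖ (v - w) w
      rw [sub_add_cancel] at e
      rw [e, add_sub_cancel_right]
      exact hnzd _ (sub_ne_zero.2 hvw)
    · have e1 := map_ltOp_iterate (q := q) (Polynomial.evalRingHom
        (levelPoint d ((algebraMap W B).comp j) u' n x y v))
        (Polynomial.C (((algebraMap W B).comp j) ϖ)) (Polynomial.C u') Polynomial.X n
      simp only [Polynomial.coe_evalRingHom, Polynomial.eval_C, Polynomial.eval_X] at e1
      rw [e1]
      exact iterate_levelPoint hadd (by omega) hx' hy' v
  have hnilq : ∀ (N : ℕ) (z : B) (M : ℕ), z ^ M ∈ I →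
      IsNilpotent (Ideal.Quotient.mk (I ^ N) z) := fun N z M hz => by
    refine ⟨M * N, ?_⟩
    rw [← map_pow, pow_mul, Ideal.Quotient.eq_zero_iff_mem]
    exact Ideal.pow_mem_pow hz N
  have hnilP : ∀ (N : ℕ), ∀ z ∈ insert (algebraMap W (B ⧸ I ^ N) (j ϖ))
      ({Ideal.Quotient.mk _ u', Ideal.Quotient.mk _ x, Ideal.Quotient.mk _ y} :
        Set (B ⧸ I ^ N)), IsNilpotent z := by
    rintro N z (rfl | rfl | rfl | rfl)
    · obtain ⟨M, hM⟩ := hnil _ (Or.inl rfl); exact hnilq N _ M hM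
    · obtain ⟨M, hM⟩ := hnil _ (Or.inr (Or.inl rfl)); exact hnilq N _ M hM
    · obtain ⟨M, hM⟩ := hnil _ (Or.inr (Or.inr (Or.inl rfl))); exact hnilq N _ M hM
    · obtain ⟨M, hM⟩ := hnil _ (Or.inr (Or.inr (Or.inr rfl))); exact hnilq N _ M hM
  have hex : ∀ N : ℕ, ∃ h : R →ₐ[W] B ⧸ I ^ N, h u = Ideal.Quotient.mk _ u' ∧
      h (T.φ (Pi.single 0 1)) = Ideal.Quotient.mk _ x ∧
      h (T.φ (Pi.single 1 1)) = Ideal.Quotient.mk _ y := by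
    have hsucc : ∀ N : ℕ, N ≠ 0 → ∃ h : R →ₐ[W] B ⧸ I ^ N, h u = Ideal.Quotient.mk _ u' ∧
        h (T.φ (Pi.single 0 1)) = Ideal.Quotient.mk _ x ∧
        h (T.φ (Pi.single 1 1)) = Ideal.Quotient.mk _ y := by
      intro N hN
      have : Nontrivial (B ⧸ I ^ N) := Ideal.Quotient.nontrivial_iff.2
        (ne_top_of_le_ne_top hI (Ideal.pow_le_self hN))
      have hcomp : (Ideal.Quotient.mk (I ^ N)).comp ((algebraMap W B).comp j) =
        (algebraMap W (B ⧸ I ^ N)).comp j := rfl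
      refine hT.exists_algHom_of_isNilpotent hn hp hqf hpW hq d hϖ hϖ' hW hu hM (hnilP N)
        (map_iterate_eq_zero _ hcomp hx') (map_iterate_eq_zero _ hcomp hy') ?_
      rw [← map_prod_levelPoint _ hcomp, ← map_iterate_X _ hcomp]
      exact Polynomial.map_dvd _ hdvd
    intro N
    -- B/I^0 is the trivial ring, so the homomorphism for N = 0 is taken by projection from N = 1.
    rcases Nat.eq_zero_or_pos N with rfl | hN
    · obtain ⟨h, h1, h2, h3⟩ := hsucc 1 one_ne_zero
      refine ⟨(Ideal.Quotient.factorₐ W (Ideal.pow_le_pow_right zero_le_one)).comp h, ?_, ?_, ?_⟩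
      · rw [AlgHom.comp_apply, h1]; rfl
      · rw [AlgHom.comp_apply, h2]; rfl
      · rw [AlgHom.comp_apply, h3]; rfl
    · exact hsucc N hN.ne'
  choose h h1 h2 h3 using hex
  -- The homomorphisms agree on generators of the maximal ideal of R, so they form a compatible
  -- system and pass to the limit B.
  have hcompat : ∀ {m n : ℕ} (hle : m ≤ n),
      (Ideal.Quotient.factorₐ W (Ideal.pow_le_pow_right hle)).comp (h n) = h m := by
    intro m l hle
    obtain ⟨r, hr⟩ : IsNilpotent (Ideal.span (insert (algebraMap W (B ⧸ I ^ m) (j ϖ))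
      ({Ideal.Quotient.mk _ u', Ideal.Quotient.mk _ x, Ideal.Quotient.mk _ y} :
        Set (B ⧸ I ^ m)))) := by
      rw [Ideal.FG.isNilpotent_iff_le_nilradical (Submodule.fg_span (Set.toFinite _)),
        Ideal.span_le]
      exact hnilP m
    refine algHom_eq_of_span hgen (w := j ϖ) (r := r) ?_ ?_
    · rintro z (rfl | rfl | rfl)
      · rw [AlgHom.comp_apply, h1, h1]; rfl
      · rw [AlgHom.comp_apply, h2, h2]; rfl
      · rw [AlgHom.comp_apply, h3, h3]; rfl
    · have e1 := h1 l
      have e2 := h2 l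
      have e3 := h3 l
      rw [Set.image_insert_eq, Set.image_insert_eq, Set.image_singleton, AlgHom.comp_apply,
        AlgHom.comp_apply, AlgHom.comp_apply, h1, h2, h3]
      exact hr
  have heq : ∀ (a : R) (b : B), (∀ N, h N a = Ideal.Quotient.mk _ b) →
      IsAdicComplete.liftAlgHom I h hcompat a = b := by
    intro a b hab
    rw [← sub_eq_zero]
    refine IsHausdorff.haus (I := I) inferInstance _ fun N => ?_
    rw [SModEq.zero, smul_eq_mul, Ideal.mul_top, ← Ideal.Quotient.eq, ← hab]
    exact IsAdicComplete.mk_liftAlgHom I h hcompat N a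
  exact ⟨IsAdicComplete.liftAlgHom I h hcompat, heq _ _ h1, heq _ _ h2, heq _ _ h3⟩

end Lift

end LubinTateCurve

namespace LubinTateCurve

open MvPolynomial in
lemma pderiv_aeval_X_of_ne {σ A : Type*} [CommRing A] {i j : σ} (hij : j ≠ i)
    (P : Polynomial ℤ) : pderiv i (Polynomial.aeval (X j : MvPolynomial σ A) P) = 0 := by
  induction P using Polynomial.induction_on' with
  | add P Q hP hQ => rw [map_add, map_add, hP, hQ, add_zero]
  | monomial n a =>
    rw [Polynomial.aeval_monomial, Derivation.leibniz, Derivation.leibniz_pow,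
      pderiv_X_of_ne hij]
    simp

/-! ### Smooth curves defined by two equations in three variables -/

section CurveAlgebra

open MvPolynomial

variable {A : Type u} [CommRing A] (G : Fin 2 → MvPolynomial (Fin 3) A)

/-- The Jacobian determinant with respect to the first two variables. -/
noncomputable def curveJacobian : MvPolynomial (Fin 3) A :=
  pderiv 0 (G 0) * pderiv 1 (G 1) - pderiv 1 (G 0) * pderiv 0 (G 1)

/-- The equations `G = 0`, and the equation making the Jacobian determinant invertible. -/
noncomputable def curveRelation : Fin 3 → MvPolynomial (Fin 4) A :=
  ![rename Fin.castSucc (G 0), rename Fin.castSucc (G 1),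
    X 3 * rename Fin.castSucc (curveJacobian G) - 1]

/-- The locus where the Jacobian determinant of the equations `G = 0` is invertible. -/
abbrev CurveAlgebra : Type u :=
  MvPolynomial (Fin 4) A ⧸ Ideal.span (Set.range (curveRelation G))

lemma pderiv_last_rename (P : MvPolynomial (Fin 3) A) :
    pderiv (3 : Fin 4) (rename Fin.castSucc P) = 0 := by
  refine pderiv_eq_zero_of_notMem_vars fun h => ?_
  classical
  have := vars_rename Fin.castSucc P h
  simp only [Finset.mem_image] at this
  obtain ⟨a, -, ha⟩ := this
  exact absurd ha (by fin_cases a <;> decide)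

/-- Differentiate the three relations in the variables 0, 1 and 3. The matrix is block triangular
with determinant the square of the Jacobian J, one factor coming from X₃ J - 1, and that relation
makes J invertible. -/
theorem isStandardSmooth_curveAlgebra : Algebra.IsStandardSmooth A (CurveAlgebra G) := by
  let a : Fin 3 → Fin 4 := ![0, 1, 3]
  have ha : Function.Injective a := by
    intro i j; fin_cases i <;> fin_cases j <;> simp [a]
  let P : Algebra.PreSubmersivePresentation A (CurveAlgebra G) (Fin 4) (Fin 3) :=
    Algebra.PreSubmersivePresentation.naive (v := curveRelation G) a ha
  have hJ : P.jacobian = Ideal.Quotient.mk _ (rename Fin.castSucc (curveJacobian G)) *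
      Ideal.Quotient.mk _ (rename Fin.castSucc (curveJacobian G)) := by
    have hd : ∀ (i : Fin 3) (Q : MvPolynomial (Fin 3) A),
        pderiv (Fin.castSucc i) (rename Fin.castSucc Q) = rename Fin.castSucc (pderiv i Q) :=
      fun i Q => pderiv_rename (Fin.castSucc_injective 3) i Q
    have hd0 := hd 0
    have hd1 := hd 1
    simp only [show Fin.castSucc (0 : Fin 3) = (0 : Fin 4) from rfl,
      show Fin.castSucc (1 : Fin 3) = (1 : Fin 4) from rfl] at hd0 hd1
    have hdet : P.jacobiMatrix.det = rename Fin.castSucc (curveJacobian G) *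
        rename Fin.castSucc (curveJacobian G) := by
      have hent : ∀ i j, P.jacobiMatrix i j = pderiv (a i) (curveRelation G j) := fun i j =>
        Algebra.PreSubmersivePresentation.jacobiMatrix_naive (v := curveRelation G) a ha _ _ i j
      rw [Matrix.det_fin_three]
      simp only [hent, show a 0 = 0 from rfl, show a 1 = 1 from rfl, show a 2 = 3 from rfl,
        show curveRelation G 0 = rename Fin.castSucc (G 0) from rfl,
        show curveRelation G 1 = rename Fin.castSucc (G 1) from rfl,
        show curveRelation G 2 = X 3 * rename Fin.castSucc (curveJacobian G) - 1 from rfl,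
        pderiv_last_rename]
      have e3 : pderiv (3 : Fin 4) (X 3 * rename Fin.castSucc (curveJacobian G) - 1) =
          rename Fin.castSucc (curveJacobian G) := by
        rw [map_sub, Derivation.leibniz, pderiv_last_rename, pderiv_X_self, pderiv_one]
        simp
      rw [e3, hd0, hd0, hd1, hd1]
      conv_rhs => rw [curveJacobian, map_sub, map_mul, map_mul]
      simp only [curveJacobian, map_sub, map_mul]
      ring
    rw [Algebra.PreSubmersivePresentation.jacobian_eq_jacobiMatrix_det, hdet]
    exact map_mul (algebraMap P.Ring (CurveAlgebra G)) _ _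
  have hu : IsUnit (Ideal.Quotient.mk (Ideal.span (Set.range (curveRelation G)))
      (rename Fin.castSucc (curveJacobian G))) := by
    refine IsUnit.of_mul_eq_one (Ideal.Quotient.mk _ (X 3)) ?_
    rw [← map_mul, mul_comm, ← map_one (Ideal.Quotient.mk _), Ideal.Quotient.eq]
    exact Ideal.subset_span ⟨2, rfl⟩
  exact (Algebra.SubmersivePresentation.mk P (hJ ▸ hu.mul hu)).isStandardSmooth

variable {G}

/-- The homomorphism given by a solution of the equations with invertible Jacobian determinant. -/
noncomputable def curveLift {B : Type*} [CommRing B] [Algebra A B] (z : Fin 3 → B) (t : B)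
    (hz : ∀ s, aeval z (G s) = 0) (ht : t * aeval z (curveJacobian G) = 1) :
    CurveAlgebra G →ₐ[A] B :=
  Ideal.Quotient.liftₐ _ (aeval (![z 0, z 1, z 2, t] : Fin 4 → B)) (by
    have hr : ∀ P : MvPolynomial (Fin 3) A,
        aeval (![z 0, z 1, z 2, t] : Fin 4 → B) (rename Fin.castSucc P) = aeval z P := by
      intro P
      rw [aeval_rename]
      congr 2
      ext s; fin_cases s <;> rfl
    change Ideal.span _ ≤ RingHom.ker (aeval (![z 0, z 1, z 2, t] : Fin 4 → B))
    rw [Ideal.span_le]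
    rintro _ ⟨s, rfl⟩
    change aeval _ _ = 0
    fin_cases s
    · exact (hr _).trans (hz 0)
    · exact (hr _).trans (hz 1)
    · change aeval _ (X 3 * rename Fin.castSucc (curveJacobian G) - 1) = 0
      rw [map_sub, map_mul, hr, aeval_X, map_one]
      exact sub_eq_zero.2 ht)

variable (G) in
/-- The coordinate functions. -/
noncomputable def curveCoord (s : Fin 3) : CurveAlgebra G :=
  Ideal.Quotient.mk _ (X (Fin.castSucc s))

variable (G) in
/-- The inverse of the Jacobian determinant. -/
noncomputable def curveInverse : CurveAlgebra G := Ideal.Quotient.mk _ (X 3)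

lemma aeval_curveCoord (P : MvPolynomial (Fin 3) A) :
    aeval (curveCoord G) P = Ideal.Quotient.mk _ (rename Fin.castSucc P) := by
  have : (aeval (curveCoord G) : MvPolynomial (Fin 3) A →ₐ[A] CurveAlgebra G) =
      (Ideal.Quotient.mkₐ A _).comp (rename Fin.castSucc) := by
    ext s
    simp [curveCoord]
  rw [this]; rfl

lemma aeval_curveCoord_relation (s : Fin 2) : aeval (curveCoord G) (G s) = 0 := by
  rw [aeval_curveCoord, Ideal.Quotient.eq_zero_iff_mem]
  fin_cases s
  · exact Ideal.subset_span ⟨0, rfl⟩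
  · exact Ideal.subset_span ⟨1, rfl⟩

lemma curveInverse_mul : curveInverse G * aeval (curveCoord G) (curveJacobian G) = 1 := by
  rw [aeval_curveCoord, curveInverse, ← map_mul, ← map_one (Ideal.Quotient.mk _),
    Ideal.Quotient.eq]
  exact Ideal.subset_span ⟨2, rfl⟩

lemma curveLift_coord {B : Type*} [CommRing B] [Algebra A B] (z : Fin 3 → B) (t : B)
    (hz : ∀ s, aeval z (G s) = 0) (ht : t * aeval z (curveJacobian G) = 1) (s : Fin 3) :
    curveLift z t hz ht (curveCoord G s) = z s := by
  change aeval (![z 0, z 1, z 2, t] : Fin 4 → B) (X (Fin.castSucc s)) = z s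
  rw [aeval_X]
  fin_cases s <;> rfl

/-- The fourth generator is the inverse of a polynomial in the other three, so it needs no separate
check. -/
lemma curveAlgebra_hom_ext {B : Type*} [CommRing B] [Algebra A B] {g h : CurveAlgebra G →ₐ[A] B}
    (H : ∀ s, g (curveCoord G s) = h (curveCoord G s)) : g = h := by
  have ht : g (curveInverse G) = h (curveInverse G) := by
    have e : ∀ g : CurveAlgebra G →ₐ[A] B, g (curveInverse G) *
        aeval (fun s => g (curveCoord G s)) (curveJacobian G) = 1 := fun g => by
      have := congrArg g (curveInverse_mul (G := G))
      rw [map_mul, map_one, ← AlgHom.comp_apply, comp_aeval] at this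
      exact this
    have e1 := e g
    have e2 := e h
    rw [← funext H] at e2
    calc g (curveInverse G) = g (curveInverse G) * (h (curveInverse G) *
          aeval (fun s => g (curveCoord G s)) (curveJacobian G)) := by rw [e2, mul_one]
      _ = h (curveInverse G) * (g (curveInverse G) *
          aeval (fun s => g (curveCoord G s)) (curveJacobian G)) := by ring
      _ = h (curveInverse G) := by rw [e1, mul_one]
  refine Ideal.Quotient.algHom_ext _ (MvPolynomial.algHom_ext fun s => ?_)
  fin_cases s
  · exact H 0
  · exact H 1
  · exact H 2
  · exact ht

end CurveAlgebra

/-! ### Artin–Schreier type curves -/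

section Reduction

open MvPolynomial

variable {κ : Type*} [Field κ] {q : ℕ} (h : Polynomial ℤ)

/-- The polynomial `X ^ (q ^ 2) - X - h(Y)`. -/
noncomputable abbrev artinSchreier (κ : Type*) [Field κ] (q : ℕ) (h : Polynomial ℤ) :
    MvPolynomial (Fin 2) κ :=
  X 0 ^ (q ^ 2) - X 0 - Polynomial.aeval (X 1) h

lemma pderiv_artinSchreier (hq : (q : κ) = 0) : pderiv 0 (artinSchreier κ q h) = -1 := by
  have hq2 : ((q : MvPolynomial (Fin 2) κ)) = 0 := by
    rw [← map_natCast (C : κ →+* MvPolynomial (Fin 2) κ), hq, map_zero]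
  rw [artinSchreier, map_sub, map_sub, pderiv_aeval_X_of_ne (by decide), Derivation.leibniz_pow,
    pderiv_X_self]
  simp [hq2]

/-- A square factor d² would have d dividing the derivative in X, which is -1. Hence the polynomial
is squarefree and generates a radical ideal. -/
lemma isReduced_artinSchreier (hq : (q : κ) = 0) :
    IsReduced (MvPolynomial (Fin 2) κ ⧸ Ideal.span {artinSchreier κ q h}) := by
  rw [← Ideal.isRadical_iff_quotient_reduced, ← isRadical_iff_span_singleton]
  refine Squarefree.isRadical fun d hd => ?_
  obtain ⟨c, hc⟩ := hd
  have h1 := congrArg (pderiv 0) hc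
  rw [pderiv_artinSchreier h hq, Derivation.leibniz, Derivation.leibniz] at h1
  refine isUnit_of_dvd_one (Dvd.intro (-(d * pderiv 0 c + c * pderiv 0 d + c * pderiv 0 d)) ?_)
  have h2 : (1 : MvPolynomial (Fin 2) κ) = -(-1) := by ring
  rw [h2, h1]
  simp only [smul_eq_mul]
  ring

end Reduction

end LubinTateCurve

namespace LubinTateCurve

/-! ### The special fibre of the curve. -/

section CurveReduction

open MvPolynomial IsLocalRing

variable {A : Type u} [CommRing A] {π : A} {q : ℕ} {α β : Polynomial ℤ}
  {G : Fin 2 → MvPolynomial (Fin 3) A} {r₀ r₁ : MvPolynomial (Fin 3) A}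

/-- Modulo π the first equation is linear in X₀ and free of X₁, and the derivative of X₁^(q²) - X₁
is -1 because q = 0. So the Jacobian matrix is triangular with diagonal 1, -1. -/
lemma curveJacobian_eq (hq : (q : A) = 0)
    (h0 : G 0 = X 0 + Polynomial.aeval (X 2) α + C π * r₀)
    (h1 : G 1 = X 1 ^ (q ^ 2) - X 1 + X 0 * Polynomial.aeval (X 2) β + C π * r₁) :
    ∃ s, curveJacobian G = -1 + C π * s := by
  have hq' : (q : MvPolynomial (Fin 3) A) = 0 := by
    rw [← map_natCast (C : A →+* MvPolynomial (Fin 3) A), hq, map_zero]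
  have hd : ∀ (s : Fin 3) (P Q : MvPolynomial (Fin 3) A),
      pderiv s (P * Q) = P * pderiv s Q + Q * pderiv s P := fun s P Q => Derivation.leibniz _ _ _
  have e00 : pderiv 0 (G 0) = 1 + C π * pderiv 0 r₀ := by
    rw [h0, map_add, map_add, hd, pderiv_X_self, pderiv_C, pderiv_aeval_X_of_ne (by decide)]
    ring
  have e10 : pderiv 1 (G 0) = C π * pderiv 1 r₀ := by
    rw [h0, map_add, map_add, hd, pderiv_X_of_ne (by decide), pderiv_C,
      pderiv_aeval_X_of_ne (by decide)]
    ring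
  have e11 : pderiv 1 (G 1) = -1 + C π * pderiv 1 r₁ := by
    rw [h1, map_add, map_add, map_sub, hd, hd, pderiv_X_self, pderiv_C,
      pderiv_aeval_X_of_ne (by decide), pderiv_X_of_ne (by decide), Derivation.leibniz_pow,
      pderiv_X_self]
    simp [hq']
  exact ⟨-pderiv 0 r₀ + pderiv 1 r₁ + C π * pderiv 0 r₀ * pderiv 1 r₁ -
    pderiv 1 r₀ * pderiv 0 (G 1), by rw [curveJacobian, e00, e10, e11]; ring⟩

/-- The reduction of the curve. -/
theorem exists_reduction_curveAlgebra [IsLocalRing A] (hm : maximalIdeal A = Ideal.span {π}) (hq : (q : A) = 0)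
    (h0 : G 0 = X 0 + Polynomial.aeval (X 2) α + C π * r₀)
    (h1 : G 1 = X 1 ^ (q ^ 2) - X 1 + X 0 * Polynomial.aeval (X 2) β + C π * r₁) :
    ∃ g : CurveAlgebra G →ₐ[A] MvPolynomial (Fin 2) (ResidueField A) ⧸
        Ideal.span {artinSchreier (ResidueField A) q (α * β)},
      Function.Surjective g ∧ ∀ c, g c = 0 ↔ algebraMap A (CurveAlgebra G) π ∣ c := by
  set D := MvPolynomial (Fin 2) (ResidueField A) ⧸
    Ideal.span {artinSchreier (ResidueField A) q (α * β)} with hD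
  obtain ⟨s, hs⟩ := curveJacobian_eq hq h0 h1
  have hπ : π ∈ maximalIdeal A := hm ▸ Ideal.mem_span_singleton_self π
  have hπD : algebraMap A D π = 0 := by
    rw [IsScalarTower.algebraMap_apply A (ResidueField A) D]
    rw [show algebraMap A (ResidueField A) π = residue A π from rfl,
      (residue_eq_zero_iff π).2 hπ, map_zero]
  let x : D := Ideal.Quotient.mk _ (X 0)
  let y : D := Ideal.Quotient.mk _ (X 1)
  have hae : ∀ P : Polynomial ℤ, Ideal.Quotient.mk _ (Polynomial.aeval (X 1) P) =
      Polynomial.aeval y P := fun P =>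
    (Polynomial.aeval_algHom_apply ((Ideal.Quotient.mk (Ideal.span
      {artinSchreier (ResidueField A) q (α * β)})).toIntAlgHom) (X 1) P).symm
  have hrel : x ^ (q ^ 2) - x - Polynomial.aeval y α * Polynomial.aeval y β = 0 := by
    rw [← map_mul, ← hae]
    change Ideal.Quotient.mk _ (artinSchreier (ResidueField A) q (α * β)) = 0
    exact Ideal.Quotient.eq_zero_iff_mem.2 (Ideal.mem_span_singleton_self _)
  -- On the special fibre the first equation determines X₀ as -α(y); substitution into the second
  -- leaves the Artin–Schreier equation. The Jacobian is -1 there, so its inverse is -1 too.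
  let z : Fin 3 → D := ![-Polynomial.aeval y α, x, y]
  have haez : ∀ P : Polynomial ℤ, aeval z (Polynomial.aeval (X 2 : MvPolynomial (Fin 3) A) P) =
      Polynomial.aeval y P := fun P => by
    have := Polynomial.aeval_algHom_apply ((aeval z : MvPolynomial (Fin 3) A →ₐ[A] D) :
      MvPolynomial (Fin 3) A →+* D).toIntAlgHom (X 2) P
    refine this.symm.trans ?_
    congr 1
    change Polynomial.aeval (aeval z (X 2)) = _
    rw [aeval_X]; rfl
  have hz0 : aeval z (G 0) = 0 := by
    rw [h0, map_add, map_add, map_mul, haez, aeval_X, aeval_C, hπD, zero_mul, add_zero]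
    exact neg_add_cancel _
  have hz1 : aeval z (G 1) = 0 := by
    rw [h1, map_add, map_add, map_sub, map_mul, map_mul, map_pow, haez, aeval_X, aeval_X, aeval_C,
      hπD, zero_mul, add_zero]
    change x ^ (q ^ 2) - x + -Polynomial.aeval y α * Polynomial.aeval y β = 0
    rw [← hrel]; ring
  have hzJ : (-1) * aeval z (curveJacobian G) = 1 := by
    rw [hs, map_add, map_mul, map_neg, map_one, aeval_C, hπD]
    ring
  let g : CurveAlgebra G →ₐ[A] D := curveLift z (-1) (fun s => by
    fin_cases s
    · exact hz0
    · exact hz1) hzJ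
  have hg : ∀ s, g (curveCoord G s) = z s := curveLift_coord z (-1) _ hzJ
  refine ⟨g, ?_, fun c => ⟨fun hc => ?_, ?_⟩⟩
  · intro d
    obtain ⟨P, rfl⟩ := Ideal.Quotient.mk_surjective d
    change _ ∈ g.range
    induction P using MvPolynomial.induction_on with
    | C a =>
      obtain ⟨a, rfl⟩ := IsLocalRing.residue_surjective a
      exact ⟨algebraMap A _ a, g.commutes a⟩
    | add P Q hP hQ => rw [map_add]; exact add_mem hP hQ
    | mul_X P s hP =>
      rw [map_mul]
      refine mul_mem hP ?_
      fin_cases s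
      · exact ⟨curveCoord G 1, hg 1⟩
      · exact ⟨curveCoord G 2, hg 2⟩
  -- Every algebra map out of the curve that kills π factors through g; applied to the quotient by π
  -- this shows that the kernel of g is generated by π.
  · suffices key : ∀ (Q : Type u) [CommRing Q] [Algebra A Q] (f : CurveAlgebra G →ₐ[A] Q),
        algebraMap A Q π = 0 → f c = 0 by
      let I : Ideal (CurveAlgebra G) := Ideal.span {algebraMap A (CurveAlgebra G) π}
      have := key (CurveAlgebra G ⧸ I) (Ideal.Quotient.mkₐ A I)
        (Ideal.Quotient.eq_zero_iff_mem.2 (Ideal.mem_span_singleton_self _))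
      exact Ideal.mem_span_singleton.1 (Ideal.Quotient.eq_zero_iff_mem.1 this)
    intro Q _ _ f hπQ
    let w : Fin 3 → Q := fun s => f (curveCoord G s)
    have hw : ∀ P : MvPolynomial (Fin 3) A, aeval w P = f (aeval (curveCoord G) P) :=
      fun P => by
      have : (aeval w : MvPolynomial (Fin 3) A →ₐ[A] Q) = f.comp (aeval (curveCoord G)) := by
        ext s; simp [w]
      rw [this]; rfl
    have haew : ∀ P : Polynomial ℤ, aeval w (Polynomial.aeval (X 2 : MvPolynomial (Fin 3) A) P) =
        Polynomial.aeval (w 2) P := fun P => by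
      have := Polynomial.aeval_algHom_apply ((aeval w : MvPolynomial (Fin 3) A →ₐ[A] Q) :
        MvPolynomial (Fin 3) A →+* Q).toIntAlgHom (X 2) P
      refine this.symm.trans ?_
      congr 1
      change Polynomial.aeval (aeval w (X 2)) = _
      rw [aeval_X]
    have hw0 : w 0 + Polynomial.aeval (w 2) α = 0 := by
      have := (hw (G 0)).trans (by rw [aeval_curveCoord_relation, map_zero])
      rwa [h0, map_add, map_add, map_mul, haew, aeval_X, aeval_C, hπQ, zero_mul, add_zero] at this
    have hw1 : w 1 ^ (q ^ 2) - w 1 + w 0 * Polynomial.aeval (w 2) β = 0 := by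
      have := (hw (G 1)).trans (by rw [aeval_curveCoord_relation, map_zero])
      rwa [h1, map_add, map_add, map_sub, map_mul, map_mul, map_pow, haew, aeval_X, aeval_X,
        aeval_C, hπQ, zero_mul, add_zero] at this
    let κQ : ResidueField A →+* Q := Ideal.Quotient.lift (maximalIdeal A) (algebraMap A Q) (by
      intro a ha
      rw [hm, Ideal.mem_span_singleton] at ha
      obtain ⟨b, rfl⟩ := ha
      rw [map_mul, hπQ, zero_mul])
    let ev : MvPolynomial (Fin 2) (ResidueField A) →+* Q := eval₂Hom κQ ![w 1, w 2]
    have hevX0 : ev (X 0) = w 1 := eval₂Hom_X' _ _ _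
    have hevX1 : ev (X 1) = w 2 := eval₂Hom_X' _ _ _
    have hevae : ∀ P : Polynomial ℤ, ev (Polynomial.aeval (X 1) P) = Polynomial.aeval (w 2) P :=
      fun P => by
        have := Polynomial.aeval_algHom_apply ev.toIntAlgHom (X 1) P
        refine this.symm.trans ?_
        congr 1
        change Polynomial.aeval (ev (X 1)) = _
        rw [hevX1]
    let back : D →+* Q := Ideal.Quotient.lift _ ev (by
      intro P hP
      rw [Ideal.mem_span_singleton] at hP
      obtain ⟨P, rfl⟩ := hP
      have : ev (artinSchreier (ResidueField A) q (α * β)) = 0 := by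
        rw [artinSchreier, map_sub, map_sub, map_pow, hevX0]
        erw [hevae (α * β)]
        rw [map_mul, ← hw1, eq_neg_of_add_eq_zero_left hw0]
        ring
      rw [map_mul, this, zero_mul])
    have hbae : ∀ P : Polynomial ℤ, back (Polynomial.aeval y P) = Polynomial.aeval (w 2) P :=
      fun P => by
        rw [← hae]
        exact hevae P
    let backA : D →ₐ[A] Q := { back with
      commutes' := fun a => by
        change back (Ideal.Quotient.mk _ (C (residue A a))) = _
        change ev (C (residue A a)) = _
        exact eval₂Hom_C _ _ _ }
    have hcomp : backA.comp g = f := by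
      refine curveAlgebra_hom_ext fun s => ?_
      rw [AlgHom.comp_apply, hg]
      fin_cases s
      · change back (-Polynomial.aeval y α) = w 0
        rw [map_neg, hbae]
        exact (eq_neg_of_add_eq_zero_left hw0).symm
      · exact hevX0
      · exact hevX1
    rw [← hcomp, AlgHom.comp_apply, hc, map_zero]
  · rintro ⟨c, rfl⟩
    rw [map_mul, g.commutes, hπD, zero_mul]

end CurveReduction

end LubinTateCurve

namespace LubinTateCurve

/-! ### Completions with respect to a principal ideal -/

section Completion

variable {A C D E : Type*} [CommRing A] [CommRing C] [CommRing D] [CommRing E] [Algebra A C]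
  [Algebra A D] [Algebra A E] {π : A}

/-- The homomorphism `φ` exhibits `D` as the `π`-adic completion of `C`. -/
structure IsCompletionMap (π : A) (φ : C →ₐ[A] D) : Prop where
  dvd : ∀ n c, algebraMap A D π ^ n ∣ φ c → algebraMap A C π ^ n ∣ c
  exists_sub : ∀ (n : ℕ) d, ∃ c, algebraMap A D π ^ n ∣ d - φ c
  complete : IsAdicComplete (Ideal.span {algebraMap A D π}) D

lemma eq_zero_of_forall_pow_dvd {x z : D} (h : IsHausdorff (Ideal.span {x}) D)
    (hz : ∀ n, x ^ n ∣ z) : z = 0 :=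
  h.haus' z fun n => by
    rw [SModEq.zero, smul_eq_mul, Ideal.mul_top, Ideal.span_singleton_pow,
      Ideal.mem_span_singleton]
    exact hz n

lemma exists_limit_of_pow_dvd {x : D} (h : IsPrecomplete (Ideal.span {x}) D) (f : ℕ → D)
    (hf : ∀ n, x ^ n ∣ f (n + 1) - f n) : ∃ y, ∀ n, x ^ n ∣ f n - y := by
  have hf' : ∀ m k, x ^ m ∣ f m - f (m + k) := fun m k => by
    induction k with
    | zero => simp
    | succ k ih =>
      have := (dvd_sub ih ((pow_dvd_pow x (Nat.le_add_right m k)).trans (hf (m + k))))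
      rwa [sub_sub, add_sub_cancel] at this
  obtain ⟨y, hy⟩ := h.prec' f fun {m n} hmn => by
    obtain ⟨k, rfl⟩ := Nat.exists_eq_add_of_le hmn
    rw [SModEq.sub_mem, smul_eq_mul, Ideal.mul_top, Ideal.span_singleton_pow,
      Ideal.mem_span_singleton]
    exact hf' m k
  refine ⟨y, fun n => ?_⟩
  have := hy n
  rwa [SModEq.sub_mem, smul_eq_mul, Ideal.mul_top, Ideal.span_singleton_pow,
    Ideal.mem_span_singleton] at this

lemma isCompletionMap_adicCompletion {I : Ideal C} (hI : I = Ideal.span {algebraMap A C π}) :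
    IsCompletionMap π ((Algebra.ofId C (AdicCompletion I C)).restrictScalars A) := by
  have hfg : I.FG := hI ▸ ⟨{algebraMap A C π}, by simp⟩
  have hm : algebraMap A (AdicCompletion I C) π =
      algebraMap C (AdicCompletion I C) (algebraMap A C π) :=
    IsScalarTower.algebraMap_apply A C _ π
  refine ⟨fun n c ⟨d, hd⟩ => ?_, fun n d => ?_, ?_⟩
  · have h1 := congrArg (AdicCompletion.evalₐ I n) hd
    change AdicCompletion.evalₐ I n (algebraMap C _ c) = _ at h1
    rw [AlgHom.commutes, hm, map_mul, map_pow, AlgHom.commutes, ← map_pow] at h1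
    have h2 : algebraMap C (C ⧸ I ^ n) (algebraMap A C π ^ n) = 0 := by
      refine Ideal.Quotient.eq_zero_iff_mem.2 (Ideal.pow_mem_pow ?_ n)
      exact hI ▸ Ideal.mem_span_singleton_self _
    rw [h2, zero_mul] at h1
    have h3 : c ∈ I ^ n := Ideal.Quotient.eq_zero_iff_mem.1 h1
    rwa [hI, Ideal.span_singleton_pow, Ideal.mem_span_singleton] at h3
  · obtain ⟨c, hc⟩ := Ideal.Quotient.mk_surjective (AdicCompletion.evalₐ I n d)
    refine ⟨c, ?_⟩
    have h1 : AdicCompletion.evalₐ I n (d - algebraMap C _ c) = 0 := by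
      rw [map_sub, AlgHom.commutes, ← hc]
      exact sub_self _
    have h2 : d - algebraMap C _ c ∈ (I ^ n • ⊤ : Submodule C (AdicCompletion I C)) := by
      rw [AdicCompletion.pow_smul_top_eq_ker_eval hfg, LinearMap.mem_ker]
      have := AdicCompletion.factor_evalₐ_eq_eval I (d - algebraMap C _ c)
        (le_of_eq (by rw [smul_eq_mul, Ideal.mul_top]) : I ^ n ≤ I ^ n • ⊤)
      rw [h1, map_zero] at this
      exact this.symm
    have hIn : I ^ n = Ideal.span {algebraMap A C π ^ n} := by
      conv_lhs => rw [hI]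
      rw [Ideal.span_singleton_pow]
    generalize hJ : I ^ n = J at h2 hIn
    rw [hIn, Submodule.ideal_span_singleton_smul] at h2
    obtain ⟨z, -, hz⟩ := Submodule.mem_smul_pointwise_iff_exists _ _ _ |>.1 h2
    refine ⟨z, ?_⟩
    change d - algebraMap C _ c = _
    rw [← hz, hm, Algebra.smul_def, map_pow]
  · have := (IsAdicComplete.map_algebraMap_iff I (AdicCompletion I C) (S := AdicCompletion I C)).2
      (AdicCompletion.isAdicComplete hfg)
    have e : I.map (algebraMap C (AdicCompletion I C)) =
        Ideal.span {algebraMap A (AdicCompletion I C) π} := by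
      rw [hm]
      refine (congrArg (Ideal.map (algebraMap C (AdicCompletion I C))) hI).trans ?_
      rw [Ideal.map_span, Set.image_singleton]
    rwa [e] at this

namespace IsCompletionMap

variable {φ : C →ₐ[A] D}

lemma congr (h : IsCompletionMap π φ) (e : D ≃ₐ[A] E) :
    IsCompletionMap π ((e : D →ₐ[A] E).comp φ) := by
  have hd : ∀ n x, algebraMap A E π ^ n ∣ e x ↔ algebraMap A D π ^ n ∣ x := fun n x => by
    rw [← e.commutes, ← map_pow, map_dvd_iff e]
  refine ⟨fun n c hc => h.dvd n c ((hd n _).1 hc), fun n x => ?_,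
    { toIsHausdorff := ⟨fun x hx => ?_⟩, toIsPrecomplete := ⟨fun f hf => ?_⟩ }⟩
  · obtain ⟨c, hc⟩ := h.exists_sub n (e.symm x)
    refine ⟨c, ?_⟩
    rw [← hd, map_sub, e.apply_symm_apply] at hc
    exact hc
  · have h0 : e.symm x = 0 := by
      refine eq_zero_of_forall_pow_dvd h.complete.toIsHausdorff fun n => ?_
      have := hx n
      rw [SModEq.zero, smul_eq_mul, Ideal.mul_top, Ideal.span_singleton_pow,
        Ideal.mem_span_singleton] at this
      rwa [← hd, e.apply_symm_apply]
    exact (map_eq_zero_iff e.symm e.symm.injective).1 h0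
  · obtain ⟨y, hy⟩ := exists_limit_of_pow_dvd h.complete.toIsPrecomplete (fun n => e.symm (f n))
      fun n => by
        have := hf n.le_succ
        rw [SModEq.sub_mem, smul_eq_mul, Ideal.mul_top, Ideal.span_singleton_pow,
          Ideal.mem_span_singleton] at this
        rw [← map_sub, ← hd, e.apply_symm_apply, ← neg_sub]
        exact this.neg_right
    refine ⟨e y, fun n => ?_⟩
    rw [SModEq.sub_mem, smul_eq_mul, Ideal.mul_top, Ideal.span_singleton_pow,
      Ideal.mem_span_singleton]
    have := hy n
    rwa [← hd, map_sub, e.apply_symm_apply] at this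

/-- The completion of a `π`-torsion-free ring is `π`-torsion-free. -/
lemma eq_zero_of_mul_eq_zero (h : IsCompletionMap π φ)
    (hC : ∀ c, algebraMap A C π * c = 0 → c = 0) {d : D} (hd : algebraMap A D π * d = 0) :
    d = 0 := by
  refine eq_zero_of_forall_pow_dvd h.complete.toIsHausdorff fun n => ?_
  obtain ⟨c, hc⟩ := h.exists_sub (n + 1) d
  obtain ⟨z, hz⟩ := hc
  -- Since π d = 0 and d ≡ φ(c) modulo π^(n+1), the element φ(π c) is divisible by π^(n+2).
  -- Divisibility passes back to C, where one factor π can be cancelled.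
  have h1 : algebraMap A D π ^ (n + 2) ∣ φ (algebraMap A C π * c) :=
    ⟨-z, by
      rw [map_mul, AlgHom.commutes, ← sub_sub_cancel d (φ c), hz, mul_sub, hd]
      ring⟩
  obtain ⟨y, hy⟩ := h.dvd _ _ h1
  have h2 : c = algebraMap A C π ^ (n + 1) * y := sub_eq_zero.1 (hC _ (by
    rw [mul_sub, hy]; ring))
  have h3 : algebraMap A D π ^ (n + 1) ∣ d := by
    rw [← sub_add_cancel d (φ c), hz, h2, map_mul, map_pow, AlgHom.commutes]
    exact dvd_add (dvd_mul_right _ _) (dvd_mul_right _ _)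
  exact (pow_dvd_pow _ n.le_succ).trans h3

/-- Approximate d by elements of C and take the limit of their images; divisibility in D reflects to
C, so different approximations have close images. -/
lemma exists_lift (h : IsCompletionMap π φ)
    (hE : IsAdicComplete (Ideal.span {algebraMap A E π}) E) (g : C →ₐ[A] E) :
    ∃ f : D →ₐ[A] E, f.comp φ = g := by
  have hg : ∀ n c c' d, algebraMap A D π ^ n ∣ d - φ c → algebraMap A D π ^ n ∣ d - φ c' →
      algebraMap A E π ^ n ∣ g c - g c' := fun n c c' d hc hc' => by
    have h1 : algebraMap A D π ^ n ∣ φ (c - c') := by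
      have := dvd_sub hc' hc
      rwa [sub_sub_sub_cancel_left, ← map_sub] at this
    obtain ⟨z, hz⟩ := h.dvd _ _ h1
    exact ⟨g z, by rw [← map_sub, hz, map_mul, map_pow, AlgHom.commutes]⟩
  choose r hr using h.exists_sub
  have hstep : ∀ d n, algebraMap A E π ^ n ∣ g (r (n + 1) d) - g (r n d) := fun d n =>
    hg n _ _ d ((pow_dvd_pow _ n.le_succ).trans (hr _ _)) (hr _ _)
  choose F hF using fun d => exists_limit_of_pow_dvd hE.toIsPrecomplete
    (fun n => g (r n d)) (hstep d)
  -- The value is characterised by any system of approximations, not only the chosen one; this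
  -- yields the ring homomorphism laws.
  have key : ∀ d e, (∀ n, ∃ c, algebraMap A D π ^ n ∣ d - φ c ∧ algebraMap A E π ^ n ∣ e - g c) →
      F d = e := fun d e he => by
    refine sub_eq_zero.1 (eq_zero_of_forall_pow_dvd hE.toIsHausdorff fun n => ?_)
    obtain ⟨c, hc, hc'⟩ := he n
    have h1 := hg n _ _ d hc (hr n d)
    have h2 := hF d n
    have : F d - e = -((g (r n d) - F d) + (g c - g (r n d)) + (e - g c)) := by ring
    rw [this]
    exact ((h2.add h1).add hc').neg_right
  have hF' : ∀ d n, ∃ c, algebraMap A D π ^ n ∣ d - φ c ∧ algebraMap A E π ^ n ∣ F d - g c :=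
    fun d n => ⟨r n d, hr n d, by rw [← neg_sub]; exact (hF d n).neg_right⟩
  have hmap : ∀ c, F (φ c) = g c := fun c => key _ _ fun n => ⟨c, by simp, by simp⟩
  let f : D →+* E :=
    { toFun := F
      map_one' := by rw [← map_one φ, hmap, map_one]
      map_zero' := by rw [← map_zero φ, hmap, map_zero]
      map_add' := fun x y => key _ _ fun n => by
        obtain ⟨c, h1, h2⟩ := hF' x n
        obtain ⟨c', h3, h4⟩ := hF' y n
        refine ⟨c + c', ?_, ?_⟩
        · rw [map_add, add_sub_add_comm]; exact h1.add h3
        · rw [map_add, add_sub_add_comm]; exact h2.add h4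
      map_mul' := fun x y => key _ _ fun n => by
        obtain ⟨c, h1, h2⟩ := hF' x n
        obtain ⟨c', h3, h4⟩ := hF' y n
        refine ⟨c * c', ?_, ?_⟩
        · rw [map_mul, show x * y - φ c * φ c' = (x - φ c) * y + φ c * (y - φ c') by ring]
          exact (h1.mul_right _).add (h3.mul_left _)
        · rw [map_mul, show F x * F y - g c * g c' = (F x - g c) * F y + g c * (F y - g c') by ring]
          exact (h2.mul_right _).add (h4.mul_left _) }
  refine ⟨{ f with commutes' := fun a => ?_ }, AlgHom.ext fun c => hmap c⟩
  change F _ = _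
  rw [← φ.commutes, hmap, AlgHom.commutes]

end IsCompletionMap

end Completion

end LubinTateCurve

namespace LubinTateCurve

/-! ### Smooth algebraizability of completions. -/

section Algebraizable

open IsLocalRing

variable {𝒪 C D : Type u} [CommRing 𝒪] [IsLocalRing 𝒪] [CommRing C] [CommRing D] [Algebra 𝒪 C]
  [Algebra 𝒪 D] {π : 𝒪} {φ : C →ₐ[𝒪] D}

lemma powIdeal_eq_span (hm : maximalIdeal 𝒪 = Ideal.span {π}) (n : ℕ) :
    powIdeal 𝒪 D n = Ideal.span {algebraMap 𝒪 D π ^ n} := by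
  rw [powIdeal, hm, Ideal.span_singleton_pow, Ideal.map_span, Set.image_singleton, map_pow]

lemma IsCompletionMap.surjective_mk (h : IsCompletionMap π φ)
    (hm : maximalIdeal 𝒪 = Ideal.span {π}) (n : ℕ) :
    Function.Surjective ((Ideal.Quotient.mk (powIdeal 𝒪 D n)).comp (φ : C →+* D)) := by
  intro d
  obtain ⟨d, rfl⟩ := Ideal.Quotient.mk_surjective d
  obtain ⟨c, hc⟩ := h.exists_sub n d
  refine ⟨c, (Ideal.Quotient.eq.2 ?_).symm⟩
  rwa [powIdeal_eq_span hm, Ideal.mem_span_singleton]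

/-- C → D/π^n is surjective with kernel π^n C, so D/π^n is the base change of C to 𝒪/π^n. Under
`Spec` this is the pullback square in the definition of algebraizability. -/
lemma IsCompletionMap.isPushout (h : IsCompletionMap π φ)
    (hm : maximalIdeal 𝒪 = Ideal.span {π}) (n : ℕ) :
    IsPushout (CommRingCat.ofHom (algebraMap 𝒪 C))
      (CommRingCat.ofHom (Ideal.Quotient.mk (maximalIdeal 𝒪 ^ n)))
      (CommRingCat.ofHom ((Ideal.Quotient.mk (powIdeal 𝒪 D n)).comp (φ : C →+* D)))
      (CommRingCat.ofHom
        (Ideal.quotientMap (powIdeal 𝒪 D n) (algebraMap 𝒪 D) Ideal.le_comap_map)) := by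
  have hs := h.surjective_mk hm n
  have hex : ∀ (E : Type u) [CommRing E] (a : C →+* E) (b : 𝒪 ⧸ maximalIdeal 𝒪 ^ n →+* E),
      a.comp (algebraMap 𝒪 C) = b.comp (Ideal.Quotient.mk _) →
      ∃ l : D ⧸ powIdeal 𝒪 D n →+* E,
        l.comp ((Ideal.Quotient.mk (powIdeal 𝒪 D n)).comp (φ : C →+* D)) = a ∧
        l.comp (Ideal.quotientMap (powIdeal 𝒪 D n) (algebraMap 𝒪 D) Ideal.le_comap_map) = b := by
    intro E _ a b hab
    have hab' : ∀ x, a (algebraMap 𝒪 C x) = b (Ideal.Quotient.mk _ x) := fun x =>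
      RingHom.congr_fun hab x
    have hker : ∀ c ∈ RingHom.ker ((Ideal.Quotient.mk (powIdeal 𝒪 D n)).comp (φ : C →+* D)),
        a c = 0 := by
      intro c hc
      have h1 : φ c ∈ powIdeal 𝒪 D n := Ideal.Quotient.eq_zero_iff_mem.1 hc
      rw [powIdeal_eq_span hm, Ideal.mem_span_singleton] at h1
      obtain ⟨y, rfl⟩ := h.dvd _ _ h1
      rw [map_mul, ← map_pow, hab', Ideal.Quotient.eq_zero_iff_mem.2, map_zero, zero_mul]
      exact Ideal.pow_mem_pow (hm ▸ Ideal.mem_span_singleton_self π) n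
    refine ⟨(Ideal.Quotient.lift _ a hker).comp
      (RingHom.quotientKerEquivOfSurjective hs).symm.toRingHom, ?_, ?_⟩
    · ext c
      change Ideal.Quotient.lift _ a hker ((RingHom.quotientKerEquivOfSurjective hs).symm _) = a c
      rw [show ((Ideal.Quotient.mk (powIdeal 𝒪 D n)).comp (φ : C →+* D)) c =
        RingHom.quotientKerEquivOfSurjective hs (Ideal.Quotient.mk _ c) from rfl,
        RingEquiv.symm_apply_apply, Ideal.Quotient.lift_mk]
    · refine Ideal.Quotient.ringHom_ext (RingHom.ext fun x => ?_)
      refine Eq.trans ?_ (hab' x)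
      change Ideal.Quotient.lift _ a hker ((RingHom.quotientKerEquivOfSurjective hs).symm
        (Ideal.Quotient.mk _ (algebraMap 𝒪 D x))) = _
      rw [← φ.commutes, show Ideal.Quotient.mk (powIdeal 𝒪 D n) (φ (algebraMap 𝒪 C x)) =
        RingHom.quotientKerEquivOfSurjective hs (Ideal.Quotient.mk _ (algebraMap 𝒪 C x)) from rfl,
        RingEquiv.symm_apply_apply, Ideal.Quotient.lift_mk]
  refine IsPushout.of_isColimit' ⟨?_⟩ ?_
  · ext x
    change Ideal.Quotient.mk _ (φ (algebraMap 𝒪 C x)) = Ideal.Quotient.mk _ (algebraMap 𝒪 D x)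
    rw [φ.commutes]
  · choose l hl using fun s : Limits.PushoutCocone (CommRingCat.ofHom (algebraMap 𝒪 C))
      (CommRingCat.ofHom (Ideal.Quotient.mk (maximalIdeal 𝒪 ^ n))) =>
      hex s.pt s.inl.hom s.inr.hom (congrArg CommRingCat.Hom.hom s.condition)
    refine Limits.PushoutCocone.IsColimit.mk _ (fun s => CommRingCat.ofHom (l s))
      (fun s => ?_) (fun s => ?_) (fun s m hm1 _ => ?_)
    · ext x
      exact RingHom.congr_fun (hl s).1 x
    · ext x
      exact RingHom.congr_fun (hl s).2 x
    · refine CommRingCat.hom_ext (RingHom.ext fun x => ?_)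
      obtain ⟨c, rfl⟩ := hs x
      exact (RingHom.congr_fun (congrArg CommRingCat.Hom.hom hm1) c).trans
        (RingHom.congr_fun (hl s).1 c).symm

/-- The formal completion of a smooth affine scheme is smoothly algebraizable as soon as it is
topologically finitely presented. -/
theorem IsCompletionMap.isSmoothlyAlgebraizable (h : IsCompletionMap π φ)
    (hm : maximalIdeal 𝒪 = Ideal.span {π}) [Algebra.Smooth 𝒪 C]
    (hfp : IsTopologicallyFinitelyPresented 𝒪 D) : IsSmoothlyAlgebraizable 𝒪 D := by
  have hs : Smooth (Spec.map (CommRingCat.ofHom (algebraMap 𝒪 C))) := by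
    rw [HasRingHomProperty.Spec_iff (P := @Smooth)]
    exact RingHom.smooth_algebraMap.2 inferInstance
  refine ⟨hfp, Spec (CommRingCat.of C), Spec.map (CommRingCat.ofHom (algebraMap 𝒪 C)), hs,
    inferInstance, inferInstance, inferInstance, fun n => Spec.map (CommRingCat.ofHom
      ((Ideal.Quotient.mk (powIdeal 𝒪 D n)).comp (φ : C →+* D))), fun n => ?_, fun n => ?_⟩
  · exact isPullback_SpecMap_of_isPushout _ _ _ _ (h.isPushout hm n)
  · rw [← Spec.map_comp]
    rfl

/-- The completion of a finitely presented algebra is topologically finitely presented, if it is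
torsion-free. -/
theorem IsCompletionMap.isTopologicallyFinitelyPresented (h : IsCompletionMap π φ)
    (hm : maximalIdeal 𝒪 = Ideal.span {π}) (hD : ∀ d, algebraMap 𝒪 D π * d = 0 → d = 0)
    {n r : ℕ} (ψ : MvPolynomial (Fin n) 𝒪 →ₐ[𝒪] C) (hψ : Function.Surjective ψ)
    (g : Fin r → MvPolynomial (Fin n) 𝒪) (hg : RingHom.ker ψ = Ideal.span (Set.range g)) :
    IsTopologicallyFinitelyPresented 𝒪 D := by
  let P := MvPolynomial (Fin n) 𝒪
  set I := (maximalIdeal 𝒪).map (algebraMap 𝒪 P) with hI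
  have hI' : I = Ideal.span {algebraMap 𝒪 P π} := by
    rw [hI, hm, Ideal.map_span, Set.image_singleton]
  let Ph := AdicCompletion I P
  let ι : P →ₐ[𝒪] Ph := (Algebra.ofId P Ph).restrictScalars 𝒪
  have hι : IsCompletionMap π ι := isCompletionMap_adicCompletion hI'
  obtain ⟨f, hf⟩ := hι.exists_lift h.complete (φ.comp ψ)
  have hf' : ∀ x, f (ι x) = φ (ψ x) := fun x => AlgHom.congr_fun hf x
  have hPc := hι.complete.toIsPrecomplete
  -- successive approximation
  have hsurj : Function.Surjective f := by
    intro d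
    have step : ∀ d, ∃ x : Ph, ∃ d', d - f x = algebraMap 𝒪 D π * d' := fun d => by
      obtain ⟨c, d', hc⟩ := h.exists_sub 1 d
      obtain ⟨x, rfl⟩ := hψ c
      exact ⟨ι x, d', by rw [hf', hc, pow_one]⟩
    choose x d' hd' using step
    let s : ℕ → Ph := fun N => ∑ i ∈ Finset.range N, algebraMap 𝒪 Ph π ^ i * x (d'^[i] d)
    have hs : ∀ N, d - f (s N) = algebraMap 𝒪 D π ^ N * (d'^[N] d) := fun N => by
      induction N with
      | zero => simp [s]
      | succ N ih =>
        have : s (N + 1) = s N + algebraMap 𝒪 Ph π ^ N * x (d'^[N] d) :=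
          Finset.sum_range_succ _ _
        rw [this, map_add, ← sub_sub, ih, map_mul, map_pow, f.commutes, ← mul_sub, hd',
          Function.iterate_succ_apply', pow_succ]
        ring
    obtain ⟨y, hy⟩ := exists_limit_of_pow_dvd hPc s fun N =>
      ⟨x (d'^[N] d), by simp only [s]; rw [Finset.sum_range_succ, add_sub_cancel_left]⟩
    refine ⟨y, (sub_eq_zero.1 (eq_zero_of_forall_pow_dvd h.complete.toIsHausdorff fun N => ?_)).symm⟩
    obtain ⟨z, hz⟩ := hy N
    refine ⟨d'^[N] d + f z, ?_⟩
    rw [mul_add, ← hs, ← f.commutes, ← map_pow, ← map_mul, ← hz, map_sub]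
    ring
  have hker : RingHom.ker f = Ideal.span (Set.range fun i => ι (g i)) := by
    apply le_antisymm
    · intro x hx
      -- An element of the kernel is, modulo π, in the ideal generated by the relations g. The error
      -- divided by π is again in the kernel because D is torsion-free, so the process can be
      -- iterated and the coefficients converge.
      have step : ∀ x : RingHom.ker f, ∃ (a : Fin r → Ph) (x' : RingHom.ker f),
          (x : Ph) - ∑ i, a i * ι (g i) = algebraMap 𝒪 Ph π * x' := fun ⟨x, hx⟩ => by
        obtain ⟨y, z, hz⟩ := hι.exists_sub 1 x
        rw [pow_one] at hz
        have h1 : algebraMap 𝒪 D π ^ 1 ∣ φ (ψ y) := by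
          refine ⟨-f z, ?_⟩
          have := congrArg f hz
          rw [map_sub, (RingHom.mem_ker).1 hx, hf', map_mul, f.commutes] at this
          rw [pow_one, mul_neg, ← this, zero_sub, neg_neg]
        obtain ⟨c, hc⟩ := h.dvd _ _ h1
        obtain ⟨y', rfl⟩ := hψ c
        have h2 : y - algebraMap 𝒪 P π * y' ∈ RingHom.ker ψ := by
          rw [RingHom.mem_ker, map_sub, hc, map_mul, AlgHom.commutes, pow_one, sub_self]
        rw [hg, Ideal.mem_span_range_iff_exists_fun] at h2
        obtain ⟨a, ha⟩ := h2
        have h3 : x - ∑ i, ι (a i) * ι (g i) = algebraMap 𝒪 Ph π * (ι y' + z) := by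
          have := congrArg ι ha
          rw [map_sum, map_sub, map_mul, AlgHom.commutes] at this
          simp only [map_mul] at this
          rw [this, mul_add, ← hz]
          ring
        refine ⟨fun i => ι (a i), ⟨ι y' + z, ?_⟩, h3⟩
        refine RingHom.mem_ker.2 (hD _ ?_)
        have h4 : ∀ i, f (ι (g i)) = 0 := fun i => by
          have : g i ∈ RingHom.ker ψ := hg ▸ Ideal.subset_span ⟨i, rfl⟩
          rw [hf', RingHom.mem_ker.1 this, map_zero]
        have h5 := congrArg f h3
        rw [map_sub, map_sum, RingHom.mem_ker.1 hx, map_mul, f.commutes] at h5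
        simp only [map_mul, h4, mul_zero, Finset.sum_const_zero, sub_zero] at h5
        exact h5.symm
      choose a x' hx' using step
      let x₀ : RingHom.ker f := ⟨x, hx⟩
      let s : Fin r → ℕ → Ph := fun j N =>
        ∑ i ∈ Finset.range N, algebraMap 𝒪 Ph π ^ i * a (x'^[i] x₀) j
      have hs : ∀ N, x - ∑ j, s j N * ι (g j) = algebraMap 𝒪 Ph π ^ N * (x'^[N] x₀ : Ph) :=
        fun N => by
        induction N with
        | zero => simp [s, x₀]
        | succ N ih =>
          have : ∀ j, s j (N + 1) = s j N + algebraMap 𝒪 Ph π ^ N * a (x'^[N] x₀) j :=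
            fun j => Finset.sum_range_succ _ _
          simp only [this, add_mul, Finset.sum_add_distrib]
          rw [← sub_sub, ih, Function.iterate_succ_apply', pow_succ, mul_assoc _ (algebraMap 𝒪 Ph π),
            ← hx', mul_sub, Finset.mul_sum]
          simp only [mul_assoc]
      choose y hy using fun j => exists_limit_of_pow_dvd hPc (s j) fun N =>
        ⟨a (x'^[N] x₀) j, by simp only [s]; rw [Finset.sum_range_succ, add_sub_cancel_left]⟩
      have hxy : x = ∑ j, y j * ι (g j) := by
        refine sub_eq_zero.1 (eq_zero_of_forall_pow_dvd hι.complete.toIsHausdorff fun N => ?_)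
        have e : x - ∑ j, y j * ι (g j) = (x - ∑ j, s j N * ι (g j)) +
            ∑ j, (s j N - y j) * ι (g j) := by
          simp only [sub_mul, Finset.sum_sub_distrib]; ring
        rw [e, hs]
        exact dvd_add (dvd_mul_right _ _) (Finset.dvd_sum fun j _ => (hy j N).mul_right _)
      rw [hxy]
      exact Ideal.sum_mem _ fun j _ => Ideal.mul_mem_left _ _ (Ideal.subset_span ⟨j, rfl⟩)
    · rw [Ideal.span_le]
      rintro _ ⟨i, rfl⟩
      have : g i ∈ RingHom.ker ψ := hg ▸ Ideal.subset_span ⟨i, rfl⟩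
      change f (ι (g i)) = 0
      rw [hf', RingHom.mem_ker.1 this, map_zero]
  refine ⟨n, RingHom.ker f, ?_, ⟨(Ideal.quotientKerAlgEquivOfSurjective hsurj).symm⟩⟩
  rw [hker]
  exact (Submodule.fg_iff_exists_finite_generating_family).2 ⟨Fin r, inferInstance, _, rfl⟩

end Algebraizable

end LubinTateCurve

namespace LubinTateCurve

/-! ### Power-bounded and topologically nilpotent elements for a lattice. -/

section PowerBounded

open IsLocalRing

variable {K : Type u} [NormedField K] [IsUltrametricDist K] {π : integers K}

lemma exists_pow_mul_eq_coe (hm : maximalIdeal (integers K) = Ideal.span {π}) (c : K) :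
    ∃ (N : ℕ) (a : integers K), (π : K) ^ N * c = a := by
  have hπ : ‖(π : K)‖ < 1 :=
    (mem_maximalIdeal_integers _).1 (hm ▸ Ideal.mem_span_singleton_self π)
  have ht : Filter.Tendsto (fun N : ℕ => ‖(π : K)‖ ^ N * ‖c‖) Filter.atTop (nhds (0 * ‖c‖)) :=
    (tendsto_pow_atTop_nhds_zero_of_lt_one (norm_nonneg _) hπ).mul_const _
  rw [zero_mul] at ht
  obtain ⟨N, hN⟩ := (ht.eventually_le_const (show (0 : ℝ) < 1 by norm_num)).exists
  exact ⟨N, ⟨(π : K) ^ N * c, (mem_integers _).2 (by rw [norm_mul, norm_pow]; exact hN)⟩, rfl⟩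

lemma exists_mul_eq_uniformizer_pow (hm : maximalIdeal (integers K) = Ideal.span {π})
    {a : integers K} (ha : a ≠ 0) : ∃ (N : ℕ) (b : integers K), π ^ N = a * b := by
  obtain ⟨N, b, hb⟩ := exists_pow_mul_eq_coe hm (a : K)⁻¹
  have ha' : (a : K) ≠ 0 := fun h => ha (Subtype.ext h)
  refine ⟨N, b, Subtype.ext ?_⟩
  change (π : K) ^ N = a * b
  rw [← hb, mul_comm, mul_assoc, inv_mul_cancel₀ ha', mul_one]

variable {D A : Type u} [CommRing D] [Algebra (integers K) D] [CommRing A] [Algebra K A]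

/-- Over a valuation ring flat means torsion-free, and every non-zero scalar divides a power of π.
-/
lemma flat_of_torsionFree (hm : maximalIdeal (integers K) = Ideal.span {π})
    (hD : ∀ d : D, algebraMap (integers K) D π * d = 0 → d = 0) : Module.Flat (integers K) D := by
  rw [Module.Flat.flat_iff_torsion_eq_bot_of_isBezout, eq_bot_iff]
  rintro d ⟨⟨a, ha⟩, had⟩
  obtain ⟨N, b, hb⟩ := exists_mul_eq_uniformizer_pow hm (nonZeroDivisors.ne_zero ha)
  have had' : a • d = 0 := had
  have h1 : algebraMap (integers K) D π ^ N * d = 0 := by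
    rw [← map_pow, hb, mul_comm a b, map_mul, mul_assoc, ← Algebra.smul_def a, had', mul_zero]
  clear hb
  induction N with
  | zero => simpa using h1
  | succ N ih => exact ih (hD _ (by rw [← mul_assoc, ← pow_succ', h1]))

/-- The data of a `K`-algebra `A` with a `π`-torsion-free lattice `D`. -/
structure IsLattice (π : integers K) (j : D →ₐ[integers K] A) : Prop where
  injective : Function.Injective j
  exists_pow_smul : ∀ x, ∃ (N : ℕ) (d : D), (π : K) ^ N • x = j d

lemma isLattice_includeRight (hm : maximalIdeal (integers K) = Ideal.span {π})
    (hD : ∀ d : D, algebraMap (integers K) D π * d = 0 → d = 0) :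
    IsLattice π (Algebra.TensorProduct.includeRight : D →ₐ[integers K] K ⊗[integers K] D) := by
  have := flat_of_torsionFree hm hD
  suffices key : ∀ i : D →ₐ[integers K] K ⊗[integers K] D, (∀ d, i d = 1 ⊗ₜ d) →
      ∀ x, ∃ (N : ℕ) (d : D), (π : K) ^ N • x = i d from
    ⟨Algebra.TensorProduct.includeRight_injective (IsFractionRing.injective _ _),
      key _ fun _ => rfl⟩
  intro i hi x
  induction x using TensorProduct.induction_on with
  | zero => exact ⟨0, 0, by rw [smul_zero, map_zero]⟩
  | tmul c d =>
    obtain ⟨N, a, ha⟩ := exists_pow_mul_eq_coe hm c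
    refine ⟨N, a • d, ?_⟩
    rw [TensorProduct.smul_tmul', smul_eq_mul, ha, hi]
    rw [← TensorProduct.smul_tmul]
    congr 1
    change (a : K) = (a : K) • 1
    simp
  | add x y hx hy =>
    obtain ⟨N, d, hd⟩ := hx
    obtain ⟨M, d', hd'⟩ := hy
    refine ⟨N + M, algebraMap (integers K) D π ^ M * d + algebraMap (integers K) D π ^ N * d', ?_⟩
    have e : ∀ (n : ℕ) (z : K ⊗[integers K] D),
        algebraMap (integers K) (K ⊗[integers K] D) π ^ n * z = (π : K) ^ n • z := fun n z => by
      rw [← map_pow, ← Algebra.smul_def]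
      rfl
    rw [map_add, map_mul, map_mul, map_pow, map_pow, AlgHom.commutes, e, e, ← hd, ← hd', smul_add,
      smul_smul, smul_smul, ← pow_add, ← pow_add, add_comm M N]

variable {j : D →ₐ[integers K] A}

lemma algebraMap_integers_mul (a : integers K) (x : A) :
    algebraMap (integers K) A a * x = (a : K) • x := by
  rw [← Algebra.smul_def]
  rfl

lemma IsLattice.map_smul (a : integers K) (d : D) :
    j (algebraMap (integers K) D a * d) = (a : K) • j d := by
  rw [map_mul, AlgHom.commutes, algebraMap_integers_mul]

/-- The hypothesis says that D/π is reduced. If π^M x lies in D with M > 0 minimal, boundedness of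
the powers of x makes a power of π^M x divisible by π, hence π^M x itself, contradicting minimality.
-/
lemma IsLattice.mem_powerBounded (h : IsLattice π j)
    (hm : maximalIdeal (integers K) = Ideal.span {π}) (hπ : π ≠ 0)
    (hD : ∀ (n : ℕ) (d : D), algebraMap (integers K) D π ∣ d ^ n → algebraMap (integers K) D π ∣ d)
    (x : A) : x ∈ powerBounded j.range ↔ x ∈ j.range := by
  have hπ' : (π : K) ≠ 0 := fun e => hπ (Subtype.ext e)
  refine ⟨fun ⟨c, hc, hx⟩ => ?_, fun hx => ⟨1, one_ne_zero, fun n => by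
    rw [one_smul]; exact pow_mem hx n⟩⟩
  have hx' : ∃ N : ℕ, ∀ n, (π : K) ^ N • x ^ n ∈ j.range := by
    obtain ⟨N, a, ha⟩ := exists_pow_mul_eq_coe hm c⁻¹
    refine ⟨N, fun n => ?_⟩
    obtain ⟨d, hd⟩ := hx n
    refine ⟨algebraMap _ D a * d, ?_⟩
    change j _ = _
    rw [IsLattice.map_smul, ← ha, show j d = _ from hd, smul_smul, inv_mul_cancel_right₀ hc]
  obtain ⟨N, hN⟩ := hx'
  have hM : ∃ M : ℕ, (π : K) ^ M • x ∈ j.range := by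
    obtain ⟨M, d, hd⟩ := h.exists_pow_smul x
    exact ⟨M, d, hd.symm⟩
  classical
  obtain ⟨d, hd⟩ := Nat.find_spec hM
  have hmin := fun k => Nat.find_min hM (m := k)
  set M := Nat.find hM
  rcases Nat.eq_zero_or_pos M with h0 | h0
  · rw [h0, pow_zero, one_smul] at hd
    exact ⟨d, hd⟩
  exfalso
  -- With π^N bounding all powers of x, the exponent N + 1 works since M (N + 1) exceeds N.
  obtain ⟨d', hd'⟩ := hD (N + 1) d (by
    obtain ⟨y, hy⟩ := hN (N + 1)
    obtain ⟨k, hk⟩ : ∃ k, M * (N + 1) = k + 1 + N := by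
      obtain ⟨M', hM'⟩ := Nat.exists_eq_add_of_le' h0
      rw [hM']
      exact ⟨M' * (N + 1), by ring⟩
    refine ⟨algebraMap _ D (π ^ k) * y, h.injective ?_⟩
    rw [map_pow, IsLattice.map_smul, IsLattice.map_smul, show j d = _ from hd,
      show j y = _ from hy, smul_pow, ← pow_mul, hk, smul_smul, smul_smul]
    congr 1
    push_cast
    ring)
  obtain ⟨M', hM'⟩ := Nat.exists_eq_add_of_le' h0
  refine hmin M' (by omega) ⟨d', ?_⟩
  have e : (π : K) • j d' = (π : K) • ((π : K) ^ M' • x) := by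
    rw [← IsLattice.map_smul, ← hd', show j d = _ from hd, smul_smul, ← pow_succ', hM']
  have := congrArg (fun z => (π : K)⁻¹ • z) e
  simp only [smul_smul, ← mul_assoc, inv_mul_cancel₀ hπ', one_smul, one_mul] at this
  exact this

/-- If a power of d lies in π D, then d does, D/π being reduced; conversely powers of a multiple of
π tend to zero. -/
lemma IsLattice.mem_topologicallyNilpotent (h : IsLattice π j)
    (hm : maximalIdeal (integers K) = Ideal.span {π}) (hπ : π ≠ 0)
    (hD : ∀ (n : ℕ) (d : D), algebraMap (integers K) D π ∣ d ^ n → algebraMap (integers K) D π ∣ d)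
    (d : D) (hd : j d ∈ powerBounded j.range) :
    (⟨j d, hd⟩ : powerBounded j.range) ∈ topologicallyNilpotent j.range ↔
      algebraMap (integers K) D π ∣ d := by
  have hπ' : (π : K) ≠ 0 := fun e => hπ (Subtype.ext e)
  constructor
  · intro hx
    obtain ⟨N, hN⟩ := hx (π : K)⁻¹
    obtain ⟨y, hy⟩ := hN N le_rfl
    refine hD N d ⟨y, h.injective ?_⟩
    rw [IsLattice.map_smul, show j y = _ from hy, smul_smul, mul_inv_cancel₀ hπ', one_smul, map_pow]
  · rintro ⟨d, rfl⟩ c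
    obtain ⟨N, a, ha⟩ := exists_pow_mul_eq_coe hm c
    refine ⟨N, fun n hn => ?_⟩
    obtain ⟨k, rfl⟩ := Nat.exists_eq_add_of_le hn
    refine ⟨algebraMap _ D (π ^ k * a) * d ^ (N + k), ?_⟩
    change j _ = c • j _ ^ _
    rw [IsLattice.map_smul, IsLattice.map_smul, smul_pow, smul_smul, map_pow]
    congr 1
    push_cast
    rw [← ha]
    ring

/-- The power-bounded elements form the lattice. -/
noncomputable def IsLattice.equiv (h : IsLattice π j)
    (hm : maximalIdeal (integers K) = Ideal.span {π}) (hπ : π ≠ 0)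
    (hD : ∀ (n : ℕ) (d : D),
      algebraMap (integers K) D π ∣ d ^ n → algebraMap (integers K) D π ∣ d) :
    D ≃ₐ[integers K] powerBounded j.range :=
  (AlgEquiv.ofInjective j h.injective).trans
    (Subalgebra.equivOfEq _ _ (SetLike.ext fun x => (h.mem_powerBounded hm hπ hD x).symm))

lemma IsLattice.mem_topologicallyNilpotent_iff_dvd (h : IsLattice π j)
    (hm : maximalIdeal (integers K) = Ideal.span {π}) (hπ : π ≠ 0)
    (hD : ∀ (n : ℕ) (d : D), algebraMap (integers K) D π ∣ d ^ n → algebraMap (integers K) D π ∣ d)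
    (x : powerBounded j.range) :
    x ∈ topologicallyNilpotent j.range ↔
      algebraMap (integers K) (powerBounded j.range) π ∣ x := by
  obtain ⟨d, rfl⟩ := (h.equiv hm hπ hD).surjective x
  rw [← (h.equiv hm hπ hD).commutes, map_dvd_iff (h.equiv hm hπ hD)]
  exact h.mem_topologicallyNilpotent hm hπ hD d _

end PowerBounded

/-! ### The special fibre as a tensor product. -/

section Tensor

open IsLocalRing

variable {𝒪 B : Type u} [CommRing 𝒪] [IsLocalRing 𝒪] [CommRing B] [Algebra 𝒪 B] {π : 𝒪}

lemma tmul_one_eq_zero_iff (hm : maximalIdeal 𝒪 = Ideal.span {π}) (b : B) :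
    b ⊗ₜ[𝒪] (1 : ResidueField 𝒪) = 0 ↔ algebraMap 𝒪 B π ∣ b := by
  constructor
  · intro hb
    let I : Ideal B := Ideal.span {algebraMap 𝒪 B π}
    have hI : ∀ a ∈ maximalIdeal 𝒪, algebraMap 𝒪 (B ⧸ I) a = 0 := fun a ha => by
      rw [hm, Ideal.mem_span_singleton] at ha
      obtain ⟨a, rfl⟩ := ha
      refine Ideal.Quotient.eq_zero_iff_mem.2 (Ideal.mem_span_singleton.2 ?_)
      exact ⟨algebraMap 𝒪 B a, map_mul _ _ _⟩
    let g : ResidueField 𝒪 →ₐ[𝒪] B ⧸ I := Ideal.Quotient.liftₐ (maximalIdeal 𝒪)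
      (Algebra.ofId 𝒪 (B ⧸ I)) hI
    have := congrArg (Algebra.TensorProduct.lift (Ideal.Quotient.mkₐ 𝒪 I) g
      fun _ _ => Commute.all _ _) hb
    rw [Algebra.TensorProduct.lift_tmul, map_one, mul_one, map_zero] at this
    exact Ideal.mem_span_singleton.1 (Ideal.Quotient.eq_zero_iff_mem.1 this)
  · rintro ⟨b, rfl⟩
    rw [← Algebra.smul_def, TensorProduct.smul_tmul, Algebra.smul_def, mul_one]
    rw [show algebraMap 𝒪 (ResidueField 𝒪) π = residue 𝒪 π from rfl,
      (residue_eq_zero_iff π).2 (hm ▸ Ideal.mem_span_singleton_self π), TensorProduct.tmul_zero]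

lemma surjective_tmul_one : Function.Surjective fun b : B => b ⊗ₜ[𝒪] (1 : ResidueField 𝒪) := by
  intro x
  induction x using TensorProduct.induction_on with
  | zero => exact ⟨0, TensorProduct.zero_tmul _ _⟩
  | tmul b a =>
    obtain ⟨a, rfl⟩ := IsLocalRing.residue_surjective a
    refine ⟨a • b, ?_⟩
    change (a • b) ⊗ₜ[𝒪] (1 : ResidueField 𝒪) = _
    rw [TensorProduct.smul_tmul, Algebra.smul_def, mul_one]
    rfl
  | add x y hx hy =>
    obtain ⟨b, rfl⟩ := hx
    obtain ⟨c, rfl⟩ := hy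
    exact ⟨b + c, TensorProduct.add_tmul _ _ _⟩

/-- The special fibre of `B`. -/
lemma exists_algEquiv_tensor_residueField (hm : maximalIdeal 𝒪 = Ideal.span {π}) {J : Ideal B}
    (hJ : ∀ b, b ∈ J ↔ algebraMap 𝒪 B π ∣ b) :
    ∃ e : (B ⧸ J) ≃ₐ[𝒪] B ⊗[𝒪] ResidueField 𝒪, ∀ b, e (Ideal.Quotient.mk _ b) = b ⊗ₜ 1 := by
  let i : B →ₐ[𝒪] B ⊗[𝒪] ResidueField 𝒪 := Algebra.TensorProduct.includeLeft
  have hi : Function.Surjective i := surjective_tmul_one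
  have hker : J = RingHom.ker i := by
    ext b
    rw [hJ, RingHom.mem_ker]
    exact (tmul_one_eq_zero_iff hm b).symm
  exact ⟨(Ideal.quotientEquivAlgOfEq 𝒪 hker).trans (Ideal.quotientKerAlgEquivOfSurjective hi),
    fun b => rfl⟩

lemma nonempty_algEquiv_tensor_residueField (hm : maximalIdeal 𝒪 = Ideal.span {π}) {S : Type u}
    [CommRing S] [Algebra 𝒪 S] (g : B →ₐ[𝒪] S) (hg : Function.Surjective g)
    (hg' : ∀ b, g b = 0 ↔ algebraMap 𝒪 B π ∣ b) :
    Nonempty (B ⊗[𝒪] ResidueField 𝒪 ≃ₐ[𝒪] S) := by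
  obtain ⟨e, -⟩ := exists_algEquiv_tensor_residueField hm (J := RingHom.ker g)
    fun b => RingHom.mem_ker.trans (hg' b)
  exact ⟨e.symm.trans (Ideal.quotientKerAlgEquivOfSurjective hg)⟩

end Tensor

end LubinTateCurve

namespace LubinTateCurve

/-! ### Canonical reduction of an affinoid with smooth formal model. -/

section CurveReduction

open MvPolynomial IsLocalRing

lemma smooth_curveAlgebra {A : Type u} [CommRing A] (G : Fin 2 → MvPolynomial (Fin 3) A) :
    Algebra.Smooth A (CurveAlgebra G) :=
  have := isStandardSmooth_curveAlgebra G
  inferInstance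

/-- Smooth algebras are flat, so non-zero scalars of a domain act injectively. -/
lemma curveAlgebra_eq_zero_of_mul_eq_zero {A : Type u} [CommRing A] [IsDomain A]
    (G : Fin 2 → MvPolynomial (Fin 3) A) {π : A} (hπ : π ≠ 0) (c : CurveAlgebra G)
    (hc : algebraMap A (CurveAlgebra G) π * c = 0) : c = 0 := by
  have := smooth_curveAlgebra G
  have : Module.Flat A (CurveAlgebra G) := Algebra.Smooth.flat A (CurveAlgebra G)
  have := Module.Flat.isSMulRegular_of_nonZeroDivisors (M := CurveAlgebra G)
    (mem_nonZeroDivisors_of_ne_zero hπ)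
  refine this ?_
  change π • c = π • 0
  rw [smul_zero]
  exact (Algebra.smul_def π c).trans hc

variable {K : Type u} [NormedField K] [IsUltrametricDist K] {π : integers K} {q : ℕ}
  {α β : Polynomial ℤ} {G : Fin 2 → MvPolynomial (Fin 3) (integers K)}
  {r₀ r₁ : MvPolynomial (Fin 3) (integers K)} {D A : Type u} [CommRing D] [Algebra (integers K) D]
  [CommRing A] [Algebra K A] {φ : CurveAlgebra G →ₐ[integers K] D} {j : D →ₐ[integers K] A}

/-- The special fibre is killed by π, hence π-adically complete, so the reduction map of the curve
extends to the completion; its kernel is still generated by π. -/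
lemma IsCompletionMap.exists_reduction (h : IsCompletionMap π φ)
    (hm : maximalIdeal (integers K) = Ideal.span {π}) (hq : (q : integers K) = 0)
    (h0 : G 0 = X 0 + Polynomial.aeval (X 2) α + C π * r₀)
    (h1 : G 1 = X 1 ^ (q ^ 2) - X 1 + X 0 * Polynomial.aeval (X 2) β + C π * r₁) :
    ∃ g : D →ₐ[integers K] MvPolynomial (Fin 2) (ResidueField (integers K)) ⧸
        Ideal.span {artinSchreier (ResidueField (integers K)) q (α * β)},
      Function.Surjective g ∧ ∀ d, g d = 0 ↔ algebraMap (integers K) D π ∣ d := by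
  obtain ⟨g, hg, hg'⟩ := exists_reduction_curveAlgebra hm hq h0 h1
  set S := MvPolynomial (Fin 2) (ResidueField (integers K)) ⧸
        Ideal.span {artinSchreier (ResidueField (integers K)) q (α * β)}
  have hπS : algebraMap (integers K) S π = 0 := by
    rw [← g.commutes]
    exact (hg' _).2 dvd_rfl
  have hS : IsAdicComplete (Ideal.span {algebraMap (integers K) S π}) S := by
    rw [hπS, Ideal.span_singleton_eq_bot.2 rfl]
    infer_instance
  obtain ⟨f, hf⟩ := h.exists_lift hS g
  have hf' : ∀ c, f (φ c) = g c := fun c => AlgHom.congr_fun hf c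
  refine ⟨f, fun s => ?_, fun d => ⟨fun hd => ?_, ?_⟩⟩
  · obtain ⟨c, rfl⟩ := hg s
    exact ⟨φ c, hf' c⟩
  · obtain ⟨c, z, hc⟩ := h.exists_sub 1 d
    rw [pow_one] at hc
    have h2 : f d = f (φ c) := by
      rw [← sub_eq_zero, ← map_sub, hc, map_mul, f.commutes, hπS, zero_mul]
    rw [hd, hf'] at h2
    obtain ⟨c', rfl⟩ := (hg' c).1 h2.symm
    refine ⟨z + φ c', ?_⟩
    rw [mul_add, ← hc, map_mul, φ.commutes]
    ring
  · rintro ⟨d, rfl⟩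
    rw [map_mul, f.commutes, hπS, zero_mul]

lemma natCast_residueField_eq_zero (hq : (q : integers K) = 0) :
    (q : ResidueField (integers K)) = 0 := by
  rw [← map_natCast (residue (integers K)), hq, map_zero]

lemma IsCompletionMap.dvd_of_dvd_pow (h : IsCompletionMap π φ)
    (hm : maximalIdeal (integers K) = Ideal.span {π}) (hq : (q : integers K) = 0)
    (h0 : G 0 = X 0 + Polynomial.aeval (X 2) α + C π * r₀)
    (h1 : G 1 = X 1 ^ (q ^ 2) - X 1 + X 0 * Polynomial.aeval (X 2) β + C π * r₁) (n : ℕ) (d : D)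
    (hd : algebraMap (integers K) D π ∣ d ^ n) : algebraMap (integers K) D π ∣ d := by
  obtain ⟨g, -, hg'⟩ := h.exists_reduction hm hq h0 h1
  rw [← hg', map_pow] at hd
  have := isReduced_artinSchreier (α * β) (natCast_residueField_eq_zero hq)
  rw [← hg']
  exact IsReduced.eq_zero _ ⟨n, hd⟩

lemma IsCompletionMap.eq_zero_of_curveAlgebra (h : IsCompletionMap π φ) (hπ : π ≠ 0) (d : D)
    (hd : algebraMap (integers K) D π * d = 0) : d = 0 :=
  h.eq_zero_of_mul_eq_zero (curveAlgebra_eq_zero_of_mul_eq_zero G hπ) hd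

/-- The affinoid whose formal model is the completion of the curve `G = 0`. -/
theorem IsLattice.canonicalReduction (hj : IsLattice π j) (h : IsCompletionMap π φ)
    (hm : maximalIdeal (integers K) = Ideal.span {π}) (hπ : π ≠ 0) (hq : (q : integers K) = 0)
    (h0 : G 0 = X 0 + Polynomial.aeval (X 2) α + C π * r₀)
    (h1 : G 1 = X 1 ^ (q ^ 2) - X 1 + X 0 * Polynomial.aeval (X 2) β + C π * r₁) :
    IsSmoothlyAlgebraizable (integers K) (powerBounded j.range) ∧
    (∃ e : (powerBounded j.range ⧸ topologicallyNilpotent j.range) ≃ₐ[integers K]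
        powerBounded j.range ⊗[integers K] ResidueField (integers K),
      ∀ a, e (Ideal.Quotient.mk _ a) = a ⊗ₜ 1) ∧
    Nonempty (powerBounded j.range ⊗[integers K] ResidueField (integers K) ≃ₐ[integers K]
      MvPolynomial (Fin 2) (ResidueField (integers K)) ⧸
        Ideal.span {artinSchreier (ResidueField (integers K)) q (α * β)}) := by
  have hD := h.dvd_of_dvd_pow hm hq h0 h1
  have h' := h.congr (hj.equiv hm hπ hD)
  have hsm := smooth_curveAlgebra G
  refine ⟨h'.isSmoothlyAlgebraizable hm ?_, ?_, ?_⟩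
  · exact h'.isTopologicallyFinitelyPresented hm (h'.eq_zero_of_curveAlgebra hπ)
      (Ideal.Quotient.mkₐ (integers K) (Ideal.span (Set.range (curveRelation G))))
      Ideal.Quotient.mk_surjective (curveRelation G) (Ideal.mk_ker)
  · exact exists_algEquiv_tensor_residueField hm
      (hj.mem_topologicallyNilpotent_iff_dvd hm hπ hD)
  · obtain ⟨g, hg, hg'⟩ := h'.exists_reduction hm hq h0 h1
    exact nonempty_algEquiv_tensor_residueField hm g hg hg'

end CurveReduction

end LubinTateCurve

namespace LubinTateCurve

/-! ### The equations of the curve -/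

section CurveModel

open MvPolynomial

variable {A : Type u} [CommRing A] {q k : ℕ} {ϖ π ζ : A}

/-- The point with complex multiplication: `π` is a torsion point of exact order `ϖ ^ k` of the
formal module with `[ϖ](X) = X ^ (q ^ 2) + ϖ X`. -/
structure CMParameters (q k : ℕ) (ϖ π ζ : A) : Prop where
  exists_prime : ∃ p f : ℕ, p.Prime ∧ q = p ^ f ∧ (p : A) = 0
  two_le_q : 2 ≤ q
  two_le_k : 2 ≤ k
  associated : Associated ϖ (π ^ ((q ^ 2 - 1) * q ^ (2 * (k - 1))))
  iterate : (ltOpZero q ϖ)^[k] π = 0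
  ζ_pow : ζ ^ q ^ 2 = ζ
  isUnit : IsUnit (ζ ^ q - ζ)

/-- The valuations of the scaling factors of the three coordinate functions. -/
def cmExponent (q k : ℕ) : Fin 3 → ℕ :=
  let e := (q ^ 2 - 1) * q ^ (2 * (k - 1))
  let m := (k + 1) / 2
  ![if Even k then m * e else m * e - (q - 1) * q ^ (2 * (k - 1)), q ^ (2 * (k - 1)), q ^ (k - 1)]

/-- The smooth curve whose completion is the formal model of the affinoid: the functions `u`, `U`,
`S` are multiples of the coordinate functions. -/
structure CurveModel (q k : ℕ) (ϖ π ζ : A) where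
  /-- the coefficients of the leading terms -/
  α : Polynomial ℤ
  /-- the coefficients of the leading terms -/
  β : Polynomial ℤ
  /-- the equations -/
  G : Fin 2 → MvPolynomial (Fin 3) A
  /-- the error terms -/
  r₀ : MvPolynomial (Fin 3) A
  /-- the error terms -/
  r₁ : MvPolynomial (Fin 3) A
  /-- the scaling factors of the coordinate functions -/
  c : Fin 3 → A
  /-- the scaling factors of the equations -/
  κ : Fin 2 → A
  α_mul_β : α * β = Polynomial.X ^ (q ^ (k - 1) * q) *
    (Polynomial.X ^ (q ^ (k - 1) * q ^ 2) - Polynomial.X ^ q ^ (k - 1))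
  G_zero : G 0 = X 0 + Polynomial.aeval (X 2) α + C π * r₀
  G_one : G 1 = X 1 ^ (q ^ 2) - X 1 + X 0 * Polynomial.aeval (X 2) β + C π * r₁
  associated : ∀ s, Associated (c s) (π ^ cmExponent q k s)
  κ_ne_zero : ∀ s, κ s ≠ 0
  relation_zero : ∀ {B : Type u} [CommRing B] [Algebra A B] (z : Fin 3 → B),
    let a := algebraMap A B
    (ltOp q (a ϖ) (a (c 0) * z 0))^[k] (a ζ * a π + (a ζ ^ q * (a (c 2) * z 2) - a (c 1) * z 1)) -
      a ζ * (ltOp q (a ϖ) (a (c 0) * z 0))^[k] (a π + a (c 2) * z 2) = a (κ 0) * aeval z (G 0)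
  relation_one : ∀ {B : Type u} [CommRing B] [Algebra A B] (z : Fin 3 → B),
    let a := algebraMap A B
    (ltOp q (a ϖ) (a (c 0) * z 0))^[k] (a ζ * a π + (a ζ ^ q * (a (c 2) * z 2) - a (c 1) * z 1)) -
      a ζ ^ q * (ltOp q (a ϖ) (a (c 0) * z 0))^[k] (a π + a (c 2) * z 2) = a (κ 1) * aeval z (G 1)

lemma map_ltOpZero_iterate {P P' : Type*} [CommRing P] [CommRing P'] (g : P →+* P') (ϖ x : P)
    (n : ℕ) : g ((ltOpZero q ϖ)^[n] x) = (ltOpZero q (g ϖ))^[n] (g x) := by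
  induction n with
  | zero => rfl
  | succ n ih =>
    simp only [Function.iterate_succ', Function.comp]
    rw [← ih]
    simp [ltOpZero]

/-- An error divisible by one more π than κ accounts for is κ times an error divisible by π. -/
lemma exists_eq_mul_of_pow_dvd_sub {P : Type*} [CommRing P] {π κ H L : P} {n : ℕ}
    (hκ : κ ∣ π ^ n) (h : π ^ (n + 1) ∣ H - κ * L) : ∃ r, H = κ * (L + π * r) := by
  obtain ⟨c, hc⟩ := hκ
  obtain ⟨r, hr⟩ := h
  exact ⟨c * r, by rw [pow_succ, hc] at hr; linear_combination hr⟩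

namespace CMParameters

lemma add_pow (h : CMParameters q k ϖ π ζ) (B : Type*) [CommRing B] [Algebra A B] (x y : B) :
    (x + y) ^ q = x ^ q + y ^ q := by
  obtain ⟨p, f, hp, rfl, hA⟩ := h.exists_prime
  exact add_pow_of_natCast_eq_zero hp (by rw [← map_natCast (algebraMap A B), hA, map_zero]) f x y

lemma natCast_eq_zero (h : CMParameters q k ϖ π ζ) : (q : A) = 0 := by
  obtain ⟨p, f, hp, rfl, hA⟩ := h.exists_prime
  have hf : f ≠ 0 := by
    rintro rfl
    have := h.two_le_q
    simp at this
  rw [Nat.cast_pow, hA, zero_pow hf]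

lemma delta_pow (h : CMParameters q k ϖ π ζ) : (ζ ^ q - ζ) ^ q ^ 2 = ζ ^ q - ζ := by
  rw [sub_pow_of_add_pow (add_pow_sq (h.add_pow A)), h.ζ_pow, ← pow_mul, mul_comm, pow_mul, h.ζ_pow]

lemma exponent_add (h : CMParameters q k ϖ π ζ) : (q ^ 2 - 1) * q ^ (2 * (k - 1)) +
    q ^ (2 * (k - 1)) = q ^ 2 * q ^ (2 * (k - 1)) := by
  have : 1 ≤ q ^ 2 := Nat.one_le_pow _ _ (by have := h.two_le_q; omega)
  obtain ⟨c, hc⟩ := Nat.exists_eq_add_of_le' this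
  rw [hc, Nat.add_sub_cancel]
  ring

/-- The iterate is π^N (1 + π r), and 1 + π r is a unit. -/
lemma associated_iterate [IsLocalRing A] (h : CMParameters q k ϖ π ζ) (hπ : π ∈ IsLocalRing.maximalIdeal A) :
    Associated ((ltOpZero q ϖ)^[k - 1] π) (π ^ q ^ (2 * (k - 1))) := by
  obtain ⟨r, hr⟩ := pow_dvd_iterate_uniformizer_sub (h.add_pow A) h.associated.symm.dvd
    h.exponent_add h.two_le_q rfl rfl
  rw [pow_succ, mul_assoc, sub_eq_iff_eq_add, add_comm, ← mul_one_add] at hr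
  have hu : IsUnit (1 + π * r) := by
    by_contra hu
    have h1 : (1 : A) = (1 + π * r) - π * r := by ring
    refine (Ideal.ne_top_iff_one _).1 (IsLocalRing.maximalIdeal.isMaximal A).ne_top ?_
    rw [h1]
    exact Ideal.sub_mem _ hu (Ideal.mul_mem_right _ _ hπ)
  rw [hr]
  exact (associated_mul_unit_left _ _ hu)

lemma iterate_pow (h : CMParameters q k ϖ π ζ) :
    ((ltOpZero q ϖ)^[k - 1] π) ^ q ^ 2 = -(ϖ * (ltOpZero q ϖ)^[k - 1] π) := by
  have := h.iterate
  obtain ⟨n, rfl⟩ : ∃ n, k = n + 1 := ⟨k - 1, by have := h.two_le_k; omega⟩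
  rw [Function.iterate_succ', Function.comp, ltOpZero] at this
  exact eq_neg_of_add_eq_zero_left this

variable [IsLocalRing A] [IsDomain A]

/-- The equations are identities in the polynomial ring in a, x, y, specialised by `aeval` to any
algebra. One computation thus serves the generic fibre of R and the complete rings mapping from the
curve. -/
lemma exists_curveModel_aux (h : CMParameters q k ϖ π ζ) (hπ : π ∈ IsLocalRing.maximalIdeal A)
    (hπ0 : π ≠ 0) {α β : Polynomial ℤ} {c₀ : A} {n : Fin 2 → ℕ} {κ : Fin 2 → A}
    (hαβ : α * β = Polynomial.X ^ (q ^ (k - 1) * q) *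
      (Polynomial.X ^ (q ^ (k - 1) * q ^ 2) - Polynomial.X ^ q ^ (k - 1)))
    (hc₀ : Associated c₀ (π ^ cmExponent q k 0)) (hκ : ∀ s, Associated (κ s) (π ^ n s))
    (h0 : (C π : MvPolynomial (Fin 3) A) ^ (n 0 + 1) ∣
      ((C ζ) ^ q - C ζ) * ((ltParts q (C ϖ) (C c₀ * X 0) (C π) k).2 +
        (ltParts q (C ϖ) (C c₀ * X 0) (C π ^ q ^ (k - 1) * X 2) k).1) -
        (ltOp q (C ϖ) (C c₀ * X 0))^[k]
          ((C ζ ^ q - C ζ) * C ((ltOpZero q ϖ)^[k - 1] π) * X 1) -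
        C (κ 0) * (X 0 + Polynomial.aeval (X 2) α))
    (h1 : (C π : MvPolynomial (Fin 3) A) ^ (n 1 + 1) ∣
      -((C ζ ^ q - C ζ) * ((ltParts q (C ϖ) (C c₀ * X 0) (C π) k).1 +
        (ltParts q (C ϖ) (C c₀ * X 0) (C π ^ q ^ (k - 1) * X 2) k).2)) -
        (ltOp q (C ϖ) (C c₀ * X 0))^[k]
          ((C ζ ^ q - C ζ) * C ((ltOpZero q ϖ)^[k - 1] π) * X 1) -
        C (κ 1) * (X 1 ^ q ^ 2 - X 1 + X 0 * Polynomial.aeval (X 2) β)) :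
    Nonempty (CurveModel q k ϖ π ζ) := by
  have hCκ : ∀ s, (C (κ s) : MvPolynomial (Fin 3) A) ∣ C π ^ n s := fun s => by
    rw [← map_pow]
    exact map_dvd _ (hκ s).dvd
  obtain ⟨r₀, hr₀⟩ := exists_eq_mul_of_pow_dvd_sub (hCκ 0) h0
  obtain ⟨r₁, hr₁⟩ := exists_eq_mul_of_pow_dvd_sub (hCκ 1) h1
  have hζ : (C ζ : MvPolynomial (Fin 3) A) ^ q ^ 2 = C ζ := by rw [← map_pow, h.ζ_pow]
  have e0 := (ltOp_iterate_combination_one (h.add_pow (MvPolynomial (Fin 3) A)) (C ϖ) (C c₀ * X 0)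
    (C π) (C π ^ q ^ (k - 1) * X 2) ((C ζ ^ q - C ζ) * C ((ltOpZero q ϖ)^[k - 1] π) * X 1)
    hζ k).trans hr₀
  have e1 := (ltOp_iterate_combination_two (h.add_pow (MvPolynomial (Fin 3) A)) (C ϖ) (C c₀ * X 0)
    (C π) (C π ^ q ^ (k - 1) * X 2) ((C ζ ^ q - C ζ) * C ((ltOpZero q ϖ)^[k - 1] π) * X 1)
    hζ k).trans hr₁
  -- The scaling factors of u, U, S, in this order. Taking δ ϖ₁ for U rather than a power of π gives
  -- the term x^(q²) - x coefficient one.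
  let c : Fin 3 → A := ![c₀, (ζ ^ q - ζ) * (ltOpZero q ϖ)^[k - 1] π, π ^ q ^ (k - 1)]
  have hC1 : (C (c 1) : MvPolynomial (Fin 3) A) =
      (C ζ ^ q - C ζ) * C ((ltOpZero q ϖ)^[k - 1] π) := by
    simp only [c, Matrix.cons_val_one, Matrix.cons_val_zero, map_mul, map_sub, map_pow]
  have hC2 : (C (c 2) : MvPolynomial (Fin 3) A) = C π ^ q ^ (k - 1) := map_pow _ _ _
  rw [← hC1, ← hC2] at e0 e1
  have hcases : ∀ {L : MvPolynomial (Fin 3) A} {w κ : A} {B : Type u} [CommRing B] [Algebra A B]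
      (z : Fin 3 → B) {v : MvPolynomial (Fin 3) A} (_ : v = C w),
      (ltOp q (C ϖ) (C c₀ * X 0))^[k] (C ζ * C π + (C ζ ^ q * (C (c 2) * X 2) - C (c 1) * X 1)) -
        v * (ltOp q (C ϖ) (C c₀ * X 0))^[k] (C π + C (c 2) * X 2) = C κ * L →
      let a := algebraMap A B
      (ltOp q (a ϖ) (a (c 0) * z 0))^[k]
          (a ζ * a π + (a ζ ^ q * (a (c 2) * z 2) - a (c 1) * z 1)) -
        a w * (ltOp q (a ϖ) (a (c 0) * z 0))^[k] (a π + a (c 2) * z 2) = a κ * aeval z L := by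
    intro L w κ B _ _ z v hv e
    subst hv
    have e' := congrArg ((aeval z : MvPolynomial (Fin 3) A →ₐ[A] B) : _ →+* B) e
    simp only [map_sub, map_mul, map_ltOp_iterate, map_add, map_pow] at e'
    simp only [RingHom.coe_coe, aeval_C, aeval_X] at e'
    exact e'
  refine ⟨{ α := α, β := β, G := ![_, _], r₀ := r₀, r₁ := r₁, c := c, κ := κ, α_mul_β := hαβ,
            G_zero := rfl, G_one := rfl, associated := ?_, κ_ne_zero := ?_,
            relation_zero := fun z => hcases z rfl e0, relation_one := fun z => ?_ }⟩
  · intro s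
    fin_cases s
    · exact hc₀
    · exact (associated_unit_mul_left _ _ h.isUnit).trans (h.associated_iterate hπ)
    · exact Associated.refl _
  · intro s h0
    have := (hκ s).symm
    rw [h0, associated_zero_iff_eq_zero] at this
    exact pow_ne_zero _ hπ0 this
  · have := hcases z (map_pow C ζ q).symm e1
    simp only [map_pow] at this
    exact this

/-- The equations of the curve exist. -/
theorem nonempty_curveModel (h : CMParameters q k ϖ π ζ) (hπ : π ∈ IsLocalRing.maximalIdeal A)
    (hπ0 : π ≠ 0) : Nonempty (CurveModel q k ϖ π ζ) := by
  have hq := h.two_le_q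
  have hk := h.two_le_k
  set N := q ^ (2 * (k - 1)) with hN
  set Q := q ^ (k - 1) with hQ
  set e := (q ^ 2 - 1) * N with he
  set ϖ₁ := (ltOpZero q ϖ)^[k - 1] π with hϖ₁
  have heN : e + N = q ^ 2 * N := h.exponent_add
  have hϖ₁N : Associated ϖ₁ (π ^ N) := h.associated_iterate hπ
  have hϖe : Associated ϖ (π ^ e) := h.associated
  have hδ1 : Associated (ζ ^ q - ζ) 1 := associated_one_iff_isUnit.2 h.isUnit
  have hCϖ : (C π : MvPolynomial (Fin 3) A) ^ e ∣ C ϖ := by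
    rw [← map_pow]; exact map_dvd _ h.associated.symm.dvd
  have hCϖ₁ : (ltOpZero q (C ϖ))^[k - 1] (C π : MvPolynomial (Fin 3) A) = C ϖ₁ :=
    (map_ltOpZero_iterate C ϖ π (k - 1)).symm
  have hCϖ₁' : (C ϖ₁ : MvPolynomial (Fin 3) A) ^ q ^ 2 = -(C ϖ * C ϖ₁) := by
    rw [← map_pow, h.iterate_pow, map_neg, map_mul]
  have hCδ : (C ζ ^ q - C ζ : MvPolynomial (Fin 3) A) ^ q ^ 2 = C ζ ^ q - C ζ := by
    rw [← map_pow, ← map_sub, ← map_pow, h.delta_pow]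
  have hϖpow : ∀ n, Associated (ϖ ^ n) (π ^ (n * e)) := fun n => by
    rw [mul_comm, pow_mul]; exact hϖe.pow_pow
  have hκ1 : Associated ((ζ ^ q - ζ) * (ϖ ^ k * ϖ₁)) (π ^ (k * e + N)) := by
    have := hδ1.mul_mul ((hϖpow k).mul_mul hϖ₁N)
    rwa [one_mul, ← pow_add] at this
  rcases Nat.even_or_odd k with hev | hodd
  · set m := (k + 1) / 2 with hm
    have hkm : k = 2 * m := by obtain ⟨r, hr⟩ := hev; omega
    obtain ⟨H0, H1⟩ := leadingTerms_even (x := X 1) (y := X 2) (a := X 0)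
      (h.add_pow (MvPolynomial (Fin 3) A)) hCϖ heN hq (m := m) (by omega) hkm hN hQ hCϖ₁ hCϖ₁' hCδ rfl
    have hκ0 : Associated ((ζ ^ q - ζ) * (ϖ ^ m * ϖ₁ ^ q)) (π ^ (m * e + q * N)) := by
      have := hδ1.mul_mul ((hϖpow m).mul_mul (hϖ₁N.pow_pow (n := q)))
      rwa [one_mul, ← pow_mul, ← pow_add, mul_comm N] at this
    refine h.exists_curveModel_aux hπ hπ0 (α := Polynomial.X ^ (Q * q))
      (β := Polynomial.X ^ (Q * q ^ 2) - Polynomial.X ^ Q) (c₀ := ϖ ^ m)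
      (n := ![m * e + q * N, k * e + N])
      (κ := ![(ζ ^ q - ζ) * (ϖ ^ m * ϖ₁ ^ q), (ζ ^ q - ζ) * (ϖ ^ k * ϖ₁)]) rfl ?_ ?_ ?_ ?_
    · simp only [cmExponent, hev, if_true, Matrix.cons_val_zero]
      exact hϖpow m
    · intro s
      fin_cases s
      · exact hκ0
      · exact hκ1
    · simpa using H0
    · simpa using H1
  · set m := (k + 1) / 2 with hm
    have hkm : k + 1 = 2 * m := by obtain ⟨r, hr⟩ := hodd; omega
    have hle : (q - 1) * N ≤ m * e := by
      have h1 : q - 1 ≤ q ^ 2 - 1 := Nat.sub_le_sub_right (by nlinarith) 1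
      calc (q - 1) * N ≤ e := Nat.mul_le_mul_right _ h1
        _ ≤ m * e := Nat.le_mul_of_pos_left _ (by omega)
    have hϖ₁q : Associated (ϖ₁ ^ (q - 1)) (π ^ ((q - 1) * N)) := by
      rw [mul_comm, pow_mul]; exact hϖ₁N.pow_pow
    -- For odd k the factor c₀ is ϖ^m / ϖ₁^(q-1), which is integral; its order (m e minus (q - 1) N)
    -- matches the bound m - 1/(q + 1) for v(u).
    obtain ⟨c₀, hc₀⟩ : ϖ₁ ^ (q - 1) ∣ ϖ ^ m :=
      hϖ₁q.dvd.trans ((pow_dvd_pow π hle).trans (hϖpow m).symm.dvd)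
    have hc₀μ : Associated c₀ (π ^ (m * e - (q - 1) * N)) := by
      refine Associated.of_mul_left (a := ϖ₁ ^ (q - 1)) (c := π ^ ((q - 1) * N)) ?_ hϖ₁q ?_
      · rw [← hc₀, ← pow_add, Nat.add_sub_cancel' hle]
        exact hϖpow m
      · intro h0
        rw [h0] at hϖ₁q
        exact pow_ne_zero _ hπ0 ((associated_zero_iff_eq_zero _).1 hϖ₁q.symm)
    have hμ : m * e - (q - 1) * N + q * N = m * e + N := by
      have : q * N = (q - 1) * N + N := by
        obtain ⟨r, rfl⟩ : ∃ r, q = r + 1 := ⟨q - 1, by omega⟩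
        rw [Nat.add_sub_cancel]; ring
      omega
    obtain ⟨H0, H1⟩ := leadingTerms_odd (x := X 1) (y := X 2) (a := X 0) (c₀ := C c₀)
      (μ := m * e - (q - 1) * N)
      (h.add_pow (MvPolynomial (Fin 3) A)) hCϖ heN hq (m := m) (by omega) hkm hN hQ hCϖ₁ hCϖ₁' hCδ
      (by rw [← map_pow, ← map_mul, ← map_pow, hc₀, mul_comm])
      (by rw [← map_pow]; exact map_dvd _ hc₀μ.symm.dvd) hμ rfl
    have hκ0 : Associated ((ζ ^ q - ζ) * (ϖ ^ m * ϖ₁)) (π ^ (m * e + N)) := by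
      have := hδ1.mul_mul ((hϖpow m).mul_mul hϖ₁N)
      rwa [one_mul, ← pow_add] at this
    refine h.exists_curveModel_aux hπ hπ0
      (α := -(Polynomial.X ^ (Q * q ^ 2) - Polynomial.X ^ Q))
      (β := -Polynomial.X ^ (Q * q)) (c₀ := c₀)
      (n := ![m * e + N, k * e + N])
      (κ := ![(ζ ^ q - ζ) * (ϖ ^ m * ϖ₁), (ζ ^ q - ζ) * (ϖ ^ k * ϖ₁)]) (by ring) ?_ ?_ ?_ ?_
    · simp only [cmExponent, Nat.not_even_iff_odd.2 hodd, if_false, Matrix.cons_val_zero]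
      exact hc₀μ
    · intro s
      fin_cases s
      · exact hκ0
      · exact hκ1
    · simpa using H0
    · simpa using H1

end CMParameters

end CurveModel

end LubinTateCurve

namespace LubinTateCurve

/-! ### Level points over the curve are non-zero-divisors. -/

section Points

open IsLocalRing

lemma add_pow_pow {B : Type*} [CommRing B] {q : ℕ} (hadd : ∀ x y : B, (x + y) ^ q = x ^ q + y ^ q)
    (n : ℕ) (x y : B) : (x + y) ^ q ^ n = x ^ q ^ n + y ^ q ^ n := by
  induction n with
  | zero => simp
  | succ n ih => rw [pow_succ, pow_mul, ih, hadd, ← pow_mul, ← pow_mul]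

lemma pow_dvd_iterate_sub {B : Type*} [CommRing B] {q N : ℕ} {ϖ u π : B}
    (hadd : ∀ x y : B, (x + y) ^ q = x ^ q + y ^ q) (hq : q ≠ 0) (hϖ : π ^ N ∣ ϖ) (hu : π ^ N ∣ u)
    (z : B) (n : ℕ) : π ^ N ∣ (ltOp q ϖ u)^[n] z - z ^ q ^ (2 * n) := by
  induction n with
  | zero => simp
  | succ n ih =>
    rw [Function.iterate_succ', Function.comp]
    set w := (ltOp q ϖ u)^[n] z
    have e : ltOp q ϖ u w - z ^ q ^ (2 * (n + 1)) =
        (w - z ^ q ^ (2 * n)) ^ q ^ 2 + (u * w ^ q + ϖ * w) := by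
      have : z ^ q ^ (2 * (n + 1)) = (z ^ q ^ (2 * n)) ^ q ^ 2 := by
        rw [← pow_mul, ← pow_add]; rfl
      rw [this, sub_pow_of_add_pow (add_pow_sq hadd), ltOp]
      ring
    rw [e]
    exact (dvd_pow ih (by positivity)).add ((hu.mul_right _).add (hϖ.mul_right _))

/-- Modulo ϖ and u the iterate is the q^(2k)-th power, which fixes η and doubles the order of π² s
relative to that of π. -/
lemma pow_dvd_iterate_add_sub {B : Type*} [CommRing B] {q k : ℕ} {ϖ u π η : B}
    (hadd : ∀ x y : B, (x + y) ^ q = x ^ q + y ^ q) (hq : q ≠ 0)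
    (hϖ : π ^ (q ^ (2 * k) + 1) ∣ ϖ) (hu : π ^ (q ^ (2 * k) + 1) ∣ u) (hη : η ^ q ^ 2 = η) (s : B) :
    π ^ (q ^ (2 * k) + 1) ∣
      (ltOp q ϖ u)^[k] (η * π + π ^ 2 * s) - η * π ^ q ^ (2 * k) := by
  have h1 := pow_dvd_iterate_sub hadd hq hϖ hu (η * π + π ^ 2 * s) k
  have hηk : η ^ q ^ (2 * k) = η := by
    rw [pow_mul]
    induction k with
    | zero => simp
    | succ k ih =>
      have hη' : ∀ n, η ^ (q ^ 2) ^ n = η := fun n => by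
        induction n with
        | zero => simp
        | succ n ih => rw [pow_succ, pow_mul, ih, hη]
      exact hη' _
  rw [add_pow_pow hadd, mul_pow, mul_pow, hηk, ← pow_mul] at h1
  have h2 : π ^ (q ^ (2 * k) + 1) ∣ π ^ (2 * q ^ (2 * k)) * s ^ q ^ (2 * k) :=
    (pow_dvd_pow π (by have : 0 < q ^ (2 * k) := by positivity
                       omega)).mul_right _
  have := h1.add h2
  convert this using 1
  ring

variable {𝒪 B : Type*} [CommRing 𝒪] [CommRing B] {q : ℕ} {ϖ : 𝒪}
  {d : Digits 𝒪 q ϖ} {i : 𝒪 →+* B} {u : B} {n : ℕ} {x y : B}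

lemma actEval_pow_mul (hadd : ∀ x y : B, (x + y) ^ q = x ^ q + y ^ q) (hq : q ≠ 0)
    (hx : (ltOp q (i ϖ) u)^[n] x = 0) (N : ℕ) (a : 𝒪) :
    actEval d i u n (ϖ ^ N * a) x = (ltOp q (i ϖ) u)^[N] (actEval d i u n a x) := by
  induction N with
  | zero => simp
  | succ N ih =>
    rw [pow_succ', mul_assoc, actEval_uniformizer_mul hadd hq _ _ _ hx, ih,
      Function.iterate_succ', Function.comp]

/-- Some ϖ^l v is non-zero and killed by ϖ, so its coordinates are ϖ^n times digits s₀, s₁, not both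
zero. Its point is π^N (s₀ + s₁ ζ + π b), a non-zero-divisor times a unit. It is also a multiple of
the point of v, because an action without constant term preserves ideals; a factor of a
non-zero-divisor is one. -/
lemma levelPoint_mem_nonZeroDivisors [IsLocalRing 𝒪] (hadd : ∀ x y : B, (x + y) ^ q = x ^ q + y ^ q) (hq : q ≠ 0)
    (hϖ : maximalIdeal 𝒪 = Ideal.span {ϖ}) (hx : (ltOp q (i ϖ) u)^[n + 1] x = 0)
    (hy : (ltOp q (i ϖ) u)^[n + 1] y = 0) {π ζ : B} {N : ℕ}
    (hX : π ^ (N + 1) ∣ (ltOp q (i ϖ) u)^[n] x - π ^ N)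
    (hY : π ^ (N + 1) ∣ (ltOp q (i ϖ) u)^[n] y - ζ * π ^ N) (hπ : π ∈ nonZeroDivisors B)
    (hunit : ∀ s s' : 𝒪, s ^ q = s → s' ^ q = s' → (s ≠ 0 ∨ s' ≠ 0) →
      ∀ b, IsUnit (i s + i s' * ζ + π * b))
    (v : Fin 2 → 𝒪 ⧸ maximalIdeal 𝒪 ^ (n + 1)) (hv : v ≠ 0) :
    levelPoint d i u (n + 1) x y v ∈ nonZeroDivisors B := by
  classical
  have hk : ∃ l, ϖ ^ l • v = 0 := ⟨n + 1, funext fun t => by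
    obtain ⟨b, hb⟩ := Ideal.Quotient.mk_surjective (v t)
    rw [Pi.smul_apply, ← hb, Pi.zero_apply, Algebra.smul_def]
    refine (map_mul (Ideal.Quotient.mk _) (ϖ ^ (n + 1)) b).symm.trans ?_
    refine Ideal.Quotient.eq_zero_iff_mem.2 (Ideal.mul_mem_right _ _ (Ideal.pow_mem_pow ?_ _))
    exact hϖ ▸ Ideal.mem_span_singleton_self _⟩
  obtain ⟨l, hl⟩ : ∃ l, Nat.find hk = l + 1 := ⟨Nat.find hk - 1, by
    have : Nat.find hk ≠ 0 := fun h0 => hv (by simpa [h0] using Nat.find_spec hk)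
    omega⟩
  have h1 : ϖ ^ l • v ≠ 0 := Nat.find_min hk (by omega)
  have h2 : ϖ ^ (l + 1) • v = 0 := hl ▸ Nat.find_spec hk
  set w := ϖ ^ l • v with hw
  have h3 : ∀ t, ∃ s : 𝒪, s ^ q = s ∧ Ideal.Quotient.mk _ (ϖ ^ n * s) = w t := fun t => by
    obtain ⟨b, hb⟩ := Ideal.Quotient.mk_surjective (w t)
    have h4 : Ideal.Quotient.mk (maximalIdeal 𝒪 ^ (n + 1)) (ϖ * b) = 0 := by
      have e1 : ϖ • w = 0 := ((congrArg (fun a : 𝒪 => a • v) (pow_succ' ϖ l)).trans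
        (mul_smul _ _ _)).symm.trans h2
      refine (map_mul (Ideal.Quotient.mk _) ϖ b).trans ?_
      rw [hb]
      exact (Algebra.smul_def ϖ (w t)).symm.trans (congrFun e1 t)
    rw [Ideal.Quotient.eq_zero_iff_mem, hϖ, Ideal.span_singleton_pow,
      Ideal.mem_span_singleton] at h4
    obtain ⟨c, hc⟩ := h4
    have h5 : b = ϖ ^ n * c := d.cancel _ _ (by rw [hc]; ring)
    refine ⟨d.s c, d.s_pow c, ?_⟩
    rw [← hb, h5, Ideal.Quotient.eq, hϖ, Ideal.span_singleton_pow, Ideal.mem_span_singleton]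
    exact ⟨-d.sh c, by
      conv_lhs => rw [d.eq c]
      rw [map_add, map_mul, d.s_uniformizer, d.s_eq_self _ (d.s_pow c)]; ring⟩
  choose s hs hs' using h3
  have h4 : s 0 ≠ 0 ∨ s 1 ≠ 0 := by
    by_contra! h0
    refine h1 (funext fun t => ?_)
    rw [← hs' t]
    fin_cases t
    · simp [h0.1]
    · simp [h0.2]
  have h5 : levelPoint d i u (n + 1) x y w =
      i (s 0) * (ltOp q (i ϖ) u)^[n] x + i (s 1) * (ltOp q (i ϖ) u)^[n] y := by
    rw [levelPoint_mk hadd hq hϖ (hs' 0) (hs' 1), actEval_pow_mul hadd hq hx,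
      actEval_pow_mul hadd hq hy, actEval_of_pow hq _ (hs 0), actEval_of_pow hq _ (hs 1),
      ltOp_iterate_mul (by rw [← map_pow, hs]), ltOp_iterate_mul (by rw [← map_pow, hs])]
  obtain ⟨b, hb⟩ := hX
  obtain ⟨b', hb'⟩ := hY
  have h6 : levelPoint d i u (n + 1) x y w =
      π ^ N * (i (s 0) + i (s 1) * ζ + π * (i (s 0) * b + i (s 1) * b')) := by
    rw [h5]
    linear_combination i (s 0) * hb + i (s 1) * hb'
  have h7 : levelPoint d i u (n + 1) x y w ∈ nonZeroDivisors B := by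
    rw [h6]
    exact mul_mem (pow_mem hπ N) (hunit _ _ (hs 0) (hs 1) h4 _).mem_nonZeroDivisors
  have h8 : levelPoint d i u (n + 1) x y w ∈ Ideal.span {levelPoint d i u (n + 1) x y v} := by
    rw [hw, levelPoint_smul hadd hq hϖ hx hy]
    exact actEval_mem hq _ (Ideal.mem_span_singleton_self _) _ _
  obtain ⟨c, hc⟩ := Ideal.mem_span_singleton.1 h8
  rw [hc] at h7
  exact (mul_mem_nonZeroDivisors.1 h7).1

end Points

section CMPoints

open MvPolynomial IsLocalRing

variable {A : Type u} [CommRing A] {q k : ℕ} {ϖ π ζ : A}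

namespace CMParameters

/-- If t = s + s' ζ were in the maximal ideal, so would be t^q - t = s' (ζ^q - ζ). For s' ≠ 0 this
is a unit, since non-zero solutions of s'^q = s' are units. -/
lemma isUnit_add_mul [IsLocalRing A] [IsDomain A] (h : CMParameters q k ϖ π ζ) {s s' : A}
    (hs : s ^ q = s) (hs' : s' ^ q = s') (hne : s ≠ 0 ∨ s' ≠ 0) : IsUnit (s + s' * ζ) := by
  have hq := h.two_le_q
  have hunit : ∀ s : A, s ^ q = s → s ≠ 0 → IsUnit s := fun s hs h0 => by
    obtain ⟨r, rfl⟩ : ∃ r, q = r + 2 := ⟨q - 2, by omega⟩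
    refine IsUnit.of_mul_eq_one (s ^ r) (mul_left_cancel₀ h0 ?_)
    linear_combination hs
  by_cases h0 : s' = 0
  · rw [h0, zero_mul, add_zero]
    exact hunit s hs (hne.resolve_right (not_not.2 h0))
  by_contra hu
  obtain ⟨t, ht⟩ := hunit s' hs' h0
  have h1 : s + s' * ζ ∈ maximalIdeal A := hu
  have h2 : (s + s' * ζ) ^ q - (s + s' * ζ) = s' * (ζ ^ q - ζ) := by
    have := h.add_pow A s (s' * ζ)
    rw [this, mul_pow, hs, hs']
    ring
  have h3 : s' * (ζ ^ q - ζ) ∈ maximalIdeal A := by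
    rw [← h2]
    exact Ideal.sub_mem _ (Ideal.pow_mem_of_mem _ h1 _ (by omega)) h1
  exact h3 ((hunit s' hs' h0).mul h.isUnit)

variable {B : Type u} [CommRing B] [Algebra A B] {z : Fin 3 → B}

/-- The two combinations of [ϖ^k](X) and [ϖ^k](Y) have determinant a unit multiple of ζ^q - ζ, so
both vanish only if the torsion equations hold. -/
lemma iterate_eq_zero (h : CMParameters q k ϖ π ζ) (M : CurveModel q k ϖ π ζ)
    (hz : ∀ s, aeval z (M.G s) = 0) :
    let a := algebraMap A B
    (ltOp q (a ϖ) (a (M.c 0) * z 0))^[k] (a π + a (M.c 2) * z 2) = 0 ∧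
    (ltOp q (a ϖ) (a (M.c 0) * z 0))^[k]
      (a ζ * a π + (a ζ ^ q * (a (M.c 2) * z 2) - a (M.c 1) * z 1)) = 0 := by
  intro a
  have h0 := M.relation_zero z
  have h1 := M.relation_one z
  simp only [hz, mul_zero] at h0 h1
  have h2 : (ltOp q (a ϖ) (a (M.c 0) * z 0))^[k] (a π + a (M.c 2) * z 2) = 0 := by
    have hu := h.isUnit.map a
    refine (hu.mul_right_eq_zero).1 ?_
    rw [map_sub, map_pow]
    linear_combination h0 - h1
  refine ⟨h2, ?_⟩
  have h3 := h0
  rw [h2, mul_zero, sub_zero] at h3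
  exact h3

/-- The converse needs cancellation of the scaling factors of the equations; it will be used where
they are invertible. -/
lemma aeval_eq_zero (M : CurveModel q k ϖ π ζ) (hκ : ∀ s b, algebraMap A B (M.κ s) * b = 0 → b = 0)
    (hx : (ltOp q (algebraMap A B ϖ) (algebraMap A B (M.c 0) * z 0))^[k]
      (algebraMap A B π + algebraMap A B (M.c 2) * z 2) = 0)
    (hy : (ltOp q (algebraMap A B ϖ) (algebraMap A B (M.c 0) * z 0))^[k]
      (algebraMap A B ζ * algebraMap A B π + (algebraMap A B ζ ^ q *
        (algebraMap A B (M.c 2) * z 2) - algebraMap A B (M.c 1) * z 1)) = 0) (s : Fin 2) :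
    aeval z (M.G s) = 0 := by
  have h0 := M.relation_zero z
  have h1 := M.relation_one z
  simp only [hx, hy, mul_zero, sub_zero] at h0 h1
  fin_cases s
  · exact hκ 0 _ h0.symm
  · exact hκ 1 _ h1.symm

end CMParameters

end CMPoints

end LubinTateCurve

namespace LubinTateCurve

/-! ### Points of the curve as points of the Lubin–Tate curve. -/

section CMPoints

open MvPolynomial IsLocalRing

variable {A : Type u} [CommRing A] {q k : ℕ} {ϖ π ζ : A}

/-- These bounds make ϖ and u negligible to order N + 1 and U, S divisible by π², which isolates the
contribution of the torsion point. -/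
lemma CMParameters.succ_le_exponent (h : CMParameters q k ϖ π ζ) :
    q ^ (2 * (k - 1)) + 1 ≤ (q ^ 2 - 1) * q ^ (2 * (k - 1)) ∧
    q ^ (2 * (k - 1)) + 1 ≤ cmExponent q k 0 ∧ 2 ≤ cmExponent q k 1 ∧ 2 ≤ cmExponent q k 2 := by
  have hq := h.two_le_q
  have hk := h.two_le_k
  have hpow : ∀ n, n ≠ 0 → 2 ≤ q ^ n := fun n hn => hq.trans (Nat.le_self_pow hn q)
  have hN := hpow (2 * (k - 1)) (by omega)
  have h3 : 3 ≤ q ^ 2 - 1 := by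
    have : 4 ≤ q ^ 2 := by nlinarith
    omega
  refine ⟨?_, ?_, hN, hpow (k - 1) (by omega)⟩
  · nlinarith
  · simp only [cmExponent, Matrix.cons_val_zero]
    set N := q ^ (2 * (k - 1))
    have h3N : 3 * N ≤ (q ^ 2 - 1) * N := Nat.mul_le_mul_right _ h3
    split_ifs with hev
    · have : (q ^ 2 - 1) * N ≤ (k + 1) / 2 * ((q ^ 2 - 1) * N) :=
        Nat.le_mul_of_pos_left _ (by omega)
      omega
    · have h2 : 2 ≤ (k + 1) / 2 := by
        have := Nat.not_even_iff_odd.1 hev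
        obtain ⟨r, hr⟩ := this
        omega
      have h4 : 2 * ((q ^ 2 - 1) * N) ≤ (k + 1) / 2 * ((q ^ 2 - 1) * N) :=
        Nat.mul_le_mul_right _ h2
      have h5 : (q - 1) * N ≤ (q ^ 2 - 1) * N :=
        Nat.mul_le_mul_right _ (Nat.sub_le_sub_right (by nlinarith) 1)
      omega

variable {𝒪 W R : Type u} [CommRing 𝒪] [IsLocalRing 𝒪] [CommRing W]
  [IsLocalRing W] {j : 𝒪 →+* W} {F₀ : FormalModule ((residue W).comp j)} [CommRing R]
  [IsLocalRing R] [Algebra W R] [IsCoefficientAlgebra W R] {T : LevelDeformation F₀ k R}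
  {p f : ℕ} {ϖ₀ : 𝒪} {u : R}

/-- To leading order the level points of exact order ϖ are π^N and ζ π^N, with independent residues
over 𝔽_q. -/
lemma dvd_uniformizer_iterate_sub (h : CMParameters q k ϖ π ζ) (M : CurveModel q k ϖ π ζ)
    {B : Type u} [CommRing B] [Algebra A B] (z : Fin 3 → B) :
    let a := algebraMap A B
    a π ^ (q ^ (2 * (k - 1)) + 1) ∣ (ltOp q (a ϖ) (a (M.c 0) * z 0))^[k - 1]
      (a π + a (M.c 2) * z 2) - a π ^ q ^ (2 * (k - 1)) ∧
    a π ^ (q ^ (2 * (k - 1)) + 1) ∣ (ltOp q (a ϖ) (a (M.c 0) * z 0))^[k - 1]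
      (a ζ * a π + (a ζ ^ q * (a (M.c 2) * z 2) - a (M.c 1) * z 1)) -
        a ζ * a π ^ q ^ (2 * (k - 1)) := by
  intro a
  obtain ⟨h1, h2, h3, h4⟩ := h.succ_le_exponent
  have hq : q ≠ 0 := by have := h.two_le_q; omega
  have hc : ∀ {n : ℕ} (s : Fin 3), n ≤ cmExponent q k s → a π ^ n ∣ a (M.c s) := fun s hs => by
    rw [← map_pow]
    exact map_dvd a ((pow_dvd_pow π hs).trans (M.associated s).symm.dvd)
  have hϖ : a π ^ (q ^ (2 * (k - 1)) + 1) ∣ a ϖ := by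
    rw [← map_pow]
    exact map_dvd a ((pow_dvd_pow π h1).trans h.associated.symm.dvd)
  have hu := (hc 0 h2).mul_right (z 0)
  obtain ⟨c₁, hc₁⟩ := hc 1 h3
  obtain ⟨c₂, hc₂⟩ := hc 2 h4
  constructor
  · have := pow_dvd_iterate_add_sub (h.add_pow B) hq hϖ hu (one_pow (q ^ 2)) (c₂ * z 2)
    rw [one_mul, one_mul, ← mul_assoc, ← hc₂] at this
    exact this
  · have := pow_dvd_iterate_add_sub (h.add_pow B) hq hϖ hu (η := a ζ)
      (by rw [← map_pow, h.ζ_pow]) (a ζ ^ q * (c₂ * z 2) - c₁ * z 1)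
    rwa [show a π ^ 2 * (a ζ ^ q * (c₂ * z 2) - c₁ * z 1) =
      a ζ ^ q * (a (M.c 2) * z 2) - a (M.c 1) * z 1 by rw [hc₁, hc₂]; ring] at this

/-- The points of the curve with values in a complete ring are points of the Lubin–Tate curve. -/
theorem LevelDeformation.IsUniversal.exists_algHom_of_curve (hT : T.IsUniversal)
    [Fintype (𝒪 ⧸ maximalIdeal 𝒪 ^ k)] [IsNoetherianRing W]
    (hp : p.Prime) (hqf : q = p ^ f) (hpW : (p : W) = 0)
    (d : Digits 𝒪 q ϖ₀) (hϖ : maximalIdeal 𝒪 = Ideal.span {ϖ₀}) (hϖ' : Irreducible ϖ₀)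
    (hW : maximalIdeal W = Ideal.span {j ϖ₀})
    (hF₀ : F₀.HasStandardForm q ϖ₀ (PowerSeries.X ^ (q ^ 2)))
    (hM : T.M.HasStandardForm q ϖ₀ (ltSeries q (((algebraMap W R).comp j) ϖ₀) u))
    [IsLocalRing A] [IsDomain A] {i : W →+* A} (hi : Function.Injective (i.comp j))
    (h : CMParameters q k (i (j ϖ₀)) π ζ) (M : CurveModel q k (i (j ϖ₀)) π ζ)
    {B : Type u} [CommRing B] [Algebra A B] [Algebra W B]
    (hWB : ∀ w, algebraMap W B w = algebraMap A B (i w))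
    (hB : IsAdicComplete (Ideal.span {algebraMap A B π}) B)
    (hne : Ideal.span {algebraMap A B π} ≠ ⊤)
    (htf : ∀ b, algebraMap A B π * b = 0 → b = 0)
    {z : Fin 3 → B} (hz : ∀ s, aeval z (M.G s) = 0) :
    let a := algebraMap A B
    ∃ g : R →ₐ[W] B, g u = a (M.c 0) * z 0 ∧
      g (T.φ (Pi.single 0 1)) = a π + a (M.c 2) * z 2 ∧
      g (T.φ (Pi.single 1 1)) = a ζ * a π + (a ζ ^ q * (a (M.c 2) * z 2) - a (M.c 1) * z 1) := by
  intro a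
  obtain ⟨h1, h2, h3, h4⟩ := h.succ_le_exponent
  have hk := h.two_le_k
  have hq := h.two_le_q
  obtain ⟨hx, hy⟩ := h.iterate_eq_zero M hz
  obtain ⟨hX, hY⟩ := dvd_uniformizer_iterate_sub h M z
  set I := Ideal.span {a π} with hI
  have hIπ : a π ∈ I := Ideal.mem_span_singleton_self _
  have hc : ∀ s, 1 ≤ cmExponent q k s → a (M.c s) ∈ I := fun s hs => by
    have : a π ^ 1 ∣ a (M.c s) := by
      rw [← map_pow]
      exact map_dvd a ((pow_dvd_pow π hs).trans (M.associated s).symm.dvd)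
    rw [pow_one] at this
    exact Ideal.mem_span_singleton.2 this
  have hϖI : a (i (j ϖ₀)) ∈ I := by
    have : a π ^ 1 ∣ a (i (j ϖ₀)) := by
      rw [← map_pow]
      exact map_dvd a ((pow_dvd_pow π (by omega)).trans h.associated.symm.dvd)
    rw [pow_one] at this
    exact Ideal.mem_span_singleton.2 this
  have hc0 := hc 0 (by omega)
  have hc1 := hc 1 (by omega)
  have hc2 := hc 2 (by omega)
  have hjϖ : ((algebraMap W B).comp j) ϖ₀ = a (i (j ϖ₀)) := hWB _
  have hnil : ∀ w ∈ insert (algebraMap W B (j ϖ₀)) ({a (M.c 0) * z 0, a π + a (M.c 2) * z 2,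
      a ζ * a π + (a ζ ^ q * (a (M.c 2) * z 2) - a (M.c 1) * z 1)} : Set B), ∃ N : ℕ, w ^ N ∈ I := by
    intro w hw
    refine ⟨1, ?_⟩
    rw [pow_one]
    rcases hw with rfl | rfl | rfl | rfl
    · rw [hWB]; exact hϖI
    · exact Ideal.mul_mem_right _ _ hc0
    · exact Ideal.add_mem _ hIπ (Ideal.mul_mem_right _ _ hc2)
    · exact Ideal.add_mem _ (Ideal.mul_mem_left _ _ hIπ) (Ideal.sub_mem _
        (Ideal.mul_mem_left _ _ (Ideal.mul_mem_right _ _ hc2)) (Ideal.mul_mem_right _ _ hc1))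
  refine hT.exists_algHom (by omega) hp hqf hpW hq d hϖ hϖ' hW hF₀ hM I hne hnil
    (by rw [hjϖ]; exact hx) (by rw [hjϖ]; exact hy) fun v hv => ?_
  obtain ⟨n, rfl⟩ : ∃ n, k = n + 1 := ⟨k - 1, by omega⟩
  refine levelPoint_mem_nonZeroDivisors (h.add_pow B) (by omega) hϖ (by rw [hjϖ]; exact hx)
    (by rw [hjϖ]; exact hy) (by rw [hjϖ]; exact hX) (by rw [hjϖ]; exact hY) ?_ ?_ v hv
  · rw [mem_nonZeroDivisors_iff_right]
    exact fun b hb => htf b (by rw [mul_comm]; exact hb)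
  · intro s s' hs hs' hne b
    have h5 : IsUnit (i (j s) + i (j s') * ζ) := h.isUnit_add_mul
      (by rw [← map_pow, ← map_pow, hs]) (by rw [← map_pow, ← map_pow, hs'])
      (hne.imp (fun h0 h1 => h0 (hi (by rw [map_zero]; exact h1)))
        (fun h0 h1 => h0 (hi (by rw [map_zero]; exact h1))))
    -- By completeness π lies in the Jacobson radical, so adding a multiple of π preserves units.
    have h6 : a π ∈ Ideal.jacobson ⊥ := IsAdicComplete.le_jacobson_bot I hIπ
    obtain ⟨c, hc⟩ := (h5.map a)
    have h7 := Ideal.mem_jacobson_bot.1 h6 (b * (c⁻¹ : Bˣ))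
    have h8 : ((algebraMap W B).comp j) s + ((algebraMap W B).comp j) s' * a ζ + a π * b =
        (a π * (b * (c⁻¹ : Bˣ)) + 1) * c := by
      rw [add_mul, one_mul, mul_assoc, mul_assoc, Units.inv_mul, mul_one, hc, map_add, map_mul,
        RingHom.comp_apply, RingHom.comp_apply, hWB, hWB]
      ring
    rw [h8]
    exact h7.mul c.isUnit

end CMPoints

end LubinTateCurve

namespace LubinTateCurve

/-! ### Comparison of completions through generators modulo π. -/

section Approximation

open MvPolynomial

variable {A σ : Type*} [CommRing A] {π : A}

lemma exists_pow_dvd_sub_aeval {C : Type*} [CommRing C] [Algebra A C] {z : σ → C}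
    (h : ∀ c, ∃ P : MvPolynomial σ A, algebraMap A C π ∣ c - aeval z P) (n : ℕ) (c : C) :
    ∃ P : MvPolynomial σ A, algebraMap A C π ^ n ∣ c - aeval z P := by
  induction n with
  | zero => exact ⟨0, by simp⟩
  | succ n ih =>
    obtain ⟨P, x, hx⟩ := ih
    obtain ⟨P', y, hy⟩ := h x
    refine ⟨P + MvPolynomial.C (π ^ n) * P', y, ?_⟩
    rw [map_add, map_mul, aeval_C, map_pow]
    linear_combination hx + algebraMap A C π ^ n * hy

/-- The elements which are congruent to a polynomial in `z` modulo `π`. -/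
lemma exists_dvd_sub_aeval_of_adjoin {C : Type*} [CommRing C] [Algebra A C] {z : σ → C}
    {S : Set C} (hS : ∀ c ∈ S, ∃ P : MvPolynomial σ A, algebraMap A C π ∣ c - aeval z P) {c : C}
    (hc : c ∈ Algebra.adjoin A S) :
    ∃ P : MvPolynomial σ A, algebraMap A C π ∣ c - aeval z P := by
  induction hc using Algebra.adjoin_induction with
  | mem x hx => exact hS x hx
  | algebraMap r => exact ⟨MvPolynomial.C r, by simp⟩
  | add x y _ _ hx hy =>
    obtain ⟨P, hP⟩ := hx
    obtain ⟨P', hP'⟩ := hy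
    exact ⟨P + P', by rw [map_add, add_sub_add_comm]; exact hP.add hP'⟩
  | mul x y _ _ hx hy =>
    obtain ⟨P, hP⟩ := hx
    obtain ⟨P', hP'⟩ := hy
    refine ⟨P * P', ?_⟩
    rw [map_mul, show x * y - aeval z P * aeval z P' =
      (x - aeval z P) * y + aeval z P * (y - aeval z P') by ring]
    exact (hP.mul_right _).add (hP'.mul_left _)

/-- If `C` and `A₀` are generated modulo `π` by corresponding elements, then the completion of `A₀`
is a completion of `C`. -/
lemma isCompletionMap_of_retraction {C A₀ D B : Type*} [CommRing C] [CommRing A₀] [CommRing D]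
    [CommRing B] [Algebra A C] [Algebra A A₀] [Algebra A D] [Algebra A B] {ιA : A₀ →ₐ[A] D}
    {ιC : C →ₐ[A] B} (hιA : IsCompletionMap π ιA) (hιC : IsCompletionMap π ιC) {θ : C →ₐ[A] D}
    {ψ : A₀ →ₐ[A] B} {x : σ → C} {z : σ → A₀}
    (hx : ∀ c, ∃ P : MvPolynomial σ A, algebraMap A C π ∣ c - aeval x P)
    (hz : ∀ c, ∃ P : MvPolynomial σ A, algebraMap A A₀ π ∣ c - aeval z P)
    (hθ : ∀ s, θ (x s) = ιA (z s)) (hψ : ∀ s, ψ (z s) = ιC (x s)) : IsCompletionMap π θ := by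
  have hθ' : ∀ P : MvPolynomial σ A, θ (aeval x P) = ιA (aeval z P) := fun P => by
    have : θ.comp (aeval x) = ιA.comp (aeval z) := by ext s; simp [hθ]
    exact AlgHom.congr_fun this P
  have hψ' : ∀ P : MvPolynomial σ A, ψ (aeval z P) = ιC (aeval x P) := fun P => by
    have : ψ.comp (aeval z) = ιC.comp (aeval x) := by ext s; simp [hψ]
    exact AlgHom.congr_fun this P
  refine ⟨fun n c hc => ?_, fun n d => ?_, hιA.complete⟩
  -- Replace c by a polynomial P in the coordinates modulo π^n. Divisibility of θ(P(x)) = ιA(P(z))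
  -- reflects to A₀, passes through ψ to ιC(P(x)), and reflects to C. No other injectivity statement
  -- about A₀ is needed.
  · obtain ⟨P, hP⟩ := exists_pow_dvd_sub_aeval hx n c
    obtain ⟨c', hc'⟩ := hP
    have h1 : algebraMap A D π ^ n ∣ ιA (aeval z P) := by
      rw [← hθ']
      have e : θ (aeval x P) = θ c - algebraMap A D π ^ n * θ c' := by
        rw [← θ.commutes, ← map_pow, ← map_mul, ← hc', map_sub]; ring
      rw [e]
      exact dvd_sub hc (dvd_mul_right _ _)
    obtain ⟨y, hy⟩ := hιA.dvd _ _ h1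
    have h2 : algebraMap A B π ^ n ∣ ιC (aeval x P) := by
      rw [← hψ', hy, map_mul, map_pow, ψ.commutes]
      exact dvd_mul_right _ _
    have h3 := hιC.dvd _ _ h2
    rw [← sub_add_cancel c (aeval x P), hc']
    exact dvd_add (dvd_mul_right _ _) h3
  · obtain ⟨a, ha⟩ := hιA.exists_sub n d
    obtain ⟨P, a', ha'⟩ := exists_pow_dvd_sub_aeval hz n a
    refine ⟨aeval x P, ?_⟩
    rw [hθ']
    have e : d - ιA (aeval z P) = (d - ιA a) + algebraMap A D π ^ n * ιA a' := by
      rw [← ιA.commutes, ← map_pow, ← map_mul, ← ha', map_sub]; ring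
    rw [e]
    exact dvd_add ha (dvd_mul_right _ _)

end Approximation

section Curve

open MvPolynomial IsLocalRing

variable {A : Type u} [CommRing A] {π : A} {q : ℕ} {α β : Polynomial ℤ}
  {G : Fin 2 → MvPolynomial (Fin 3) A} {r₀ r₁ : MvPolynomial (Fin 3) A}

/-- The remaining generator, the inverse Jacobian, is congruent to -1 modulo π. -/
lemma exists_dvd_sub_aeval_curveCoord {s : MvPolynomial (Fin 3) A}
    (hs : curveJacobian G = -1 + C π * s) (c : CurveAlgebra G) :
    ∃ P : MvPolynomial (Fin 3) A, algebraMap A (CurveAlgebra G) π ∣ c - aeval (curveCoord G) P := by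
  let S : Set (CurveAlgebra G) := Set.range (curveCoord G) ∪ {curveInverse G}
  refine exists_dvd_sub_aeval_of_adjoin (S := S) ?_ ?_
  · rintro _ (⟨t, rfl⟩ | rfl)
    · exact ⟨X t, by simp⟩
    · refine ⟨-1, curveInverse G * aeval (curveCoord G) s, ?_⟩
      have := curveInverse_mul (G := G)
      rw [hs, map_add, map_mul, map_neg, map_one, aeval_C] at this
      rw [map_neg, map_one]
      linear_combination -this
  · obtain ⟨P, rfl⟩ := Ideal.Quotient.mk_surjective c
    induction P using MvPolynomial.induction_on with
    | C a => exact Subalgebra.algebraMap_mem _ a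
    | add P Q hP hQ => rw [map_add]; exact add_mem hP hQ
    | mul_X P t hP =>
      rw [map_mul]
      refine mul_mem hP (Algebra.subset_adjoin ?_)
      fin_cases t
      · exact Or.inl ⟨0, rfl⟩
      · exact Or.inl ⟨1, rfl⟩
      · exact Or.inl ⟨2, rfl⟩
      · exact Or.inr rfl

/-- The origin lies on the curve when h has no constant term. -/
lemma nontrivial_artinSchreier {κ : Type*} [Field κ] (hq : q ≠ 0) {h : Polynomial ℤ}
    (hh : h.coeff 0 = 0) :
    Nontrivial (MvPolynomial (Fin 2) κ ⧸ Ideal.span {artinSchreier κ q h}) := by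
  refine Ideal.Quotient.nontrivial_iff.2 fun htop => ?_
  have h1 : Ideal.span {artinSchreier κ q h} ≤ RingHom.ker (constantCoeff : _ →+* κ) := by
    rw [Ideal.span_singleton_le_iff_mem, RingHom.mem_ker, artinSchreier, map_sub, map_sub, map_pow,
      constantCoeff_X, zero_pow (by positivity)]
    have := Polynomial.aeval_algHom_apply (constantCoeff : MvPolynomial (Fin 2) κ →+* κ).toIntAlgHom
      (X 1) h
    rw [show (constantCoeff : MvPolynomial (Fin 2) κ →+* κ).toIntAlgHom (X 1) = 0 from
      constantCoeff_X _ _, ← Polynomial.coeff_zero_eq_aeval_zero', hh, map_zero] at this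
    rw [sub_self, zero_sub, neg_eq_zero]
    exact this.symm
  rw [htop] at h1
  exact one_ne_zero ((map_one constantCoeff).symm.trans (RingHom.mem_ker.1 (h1 Submodule.mem_top)))

lemma not_dvd_one_curveAlgebra [IsLocalRing A] (hm : maximalIdeal A = Ideal.span {π})
    (hq0 : q ≠ 0) (hq : (q : A) = 0)
    (h0 : G 0 = X 0 + Polynomial.aeval (X 2) α + C π * r₀)
    (h1 : G 1 = X 1 ^ (q ^ 2) - X 1 + X 0 * Polynomial.aeval (X 2) β + C π * r₁)
    (hαβ : (α * β).coeff 0 = 0) : ¬ algebraMap A (CurveAlgebra G) π ∣ 1 := by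
  intro h
  obtain ⟨g, -, hg⟩ := exists_reduction_curveAlgebra hm hq h0 h1
  have := (hg 1).2 h
  have hn := nontrivial_artinSchreier (κ := ResidueField A) hq0 hαβ
  rw [map_one] at this
  exact one_ne_zero this

/-- The homomorphism from the curve to a complete ring given by a solution of its equations. -/
lemma exists_algHom_curveAlgebra {s : MvPolynomial (Fin 3) A}
    (hs : curveJacobian G = -1 + C π * s) {D : Type*} [CommRing D] [Algebra A D]
    (hD : IsAdicComplete (Ideal.span {algebraMap A D π}) D) {z : Fin 3 → D}
    (hz : ∀ t, aeval z (G t) = 0) :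
    ∃ θ : CurveAlgebra G →ₐ[A] D, ∀ t, θ (curveCoord G t) = z t := by
  have h6 : algebraMap A D π ∈ Ideal.jacobson ⊥ :=
    IsAdicComplete.le_jacobson_bot _ (Ideal.mem_span_singleton_self _)
  have h7 := Ideal.mem_jacobson_bot.1 h6 (-aeval z s)
  obtain ⟨t, ht⟩ := h7.exists_left_inv
  have hJ : -t * aeval z (curveJacobian G) = 1 := by
    rw [hs, map_add, map_mul, map_neg, map_one, aeval_C]
    linear_combination ht
  exact ⟨curveLift z (-t) hz hJ, curveLift_coord z (-t) hz hJ⟩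

end Curve

end LubinTateCurve

namespace LubinTateCurve

/-! ### The affinoid model and the coordinates of the curve. -/

section AffinoidModel

open MvPolynomial IsLocalRing

variable {E K R : Type u} [NormedField E] [IsUltrametricDist E] [NormedField K]
  [IsUltrametricDist K] [Algebra E K] [CommRing R] [Algebra (integers E) R]

lemma one_tmul_algebraMap (w : integers E) :
    (1 : K) ⊗ₜ[integers E] algebraMap (integers E) R w =
      algebraMap K (K ⊗[integers E] R) (algebraMap E K w) := by
  rw [Algebra.algebraMap_eq_smul_one, ← TensorProduct.smul_tmul]
  change _ = (algebraMap E K w) ⊗ₜ[integers E] (1 : R)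
  congr 1
  rw [Algebra.smul_def, mul_one]
  rfl

lemma algebraMap_integers_tensor (a : integers K) :
    algebraMap (integers K) (K ⊗[integers E] R) a = algebraMap K (K ⊗[integers E] R) (a : K) := rfl

/-- The `K`-algebra homomorphism on the generic fibre given by a homomorphism on `R`. -/
lemma exists_algHom_tensor {L : Type u} [CommRing L] [Algebra K L] (g : R →+* L)
    (hg : ∀ w, g (algebraMap (integers E) R w) = algebraMap K L (algebraMap E K w)) :
    ∃ Ψ : K ⊗[integers E] R →ₐ[K] L, ∀ x, Ψ (1 ⊗ₜ x) = g x := by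
  letI : Algebra (integers E) L := ((algebraMap K L).comp (algebraMap (integers E) K)).toAlgebra
  haveI : IsScalarTower (integers E) K L := .of_algebraMap_eq fun _ => rfl
  let g' : R →ₐ[integers E] L := { g with commutes' := hg }
  refine ⟨Algebra.TensorProduct.lift (Algebra.ofId K L) g' fun _ _ => Commute.all _ _, fun x => ?_⟩
  rw [Algebra.TensorProduct.lift_tmul, map_one, one_mul]
  rfl

lemma exists_algHom_of_map_le_range {P B L : Type u} [CommRing P] [Algebra K P] [CommRing B]
    [Algebra (integers K) B] [CommRing L] [Algebra K L] {π : integers K} {j : B →ₐ[integers K] L}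
    (hj : IsLattice π j) (Ψ : P →ₐ[K] L) (S : Subalgebra (integers K) P)
    (hS : ∀ a ∈ S, Ψ a ∈ j.range) : ∃ ψ : S →ₐ[integers K] B, ∀ a, j (ψ a) = Ψ a := by
  choose ψ hψ using fun a : S => hS a a.2
  have hψ' : ∀ a, j (ψ a) = Ψ a := hψ
  have hΨ : ∀ a : integers K, Ψ (algebraMap (integers K) P a) = algebraMap (integers K) L a :=
    fun a => Ψ.commutes (a : K)
  refine ⟨{ toFun := ψ, map_one' := ?_, map_mul' := fun a b => ?_, map_zero' := ?_,
            map_add' := fun a b => ?_, commutes' := fun a => ?_ }, hψ'⟩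
  all_goals apply hj.injective
  · rw [hψ', map_one]; exact map_one Ψ
  · rw [map_mul, hψ', hψ', hψ']; exact map_mul Ψ _ _
  · rw [hψ', map_zero]; exact map_zero Ψ
  · rw [map_add, hψ', hψ', hψ']; exact map_add Ψ _ _
  · rw [hψ', j.commutes]; exact hΨ a

variable {q k : ℕ} {ζ : integers E} {ϖ : integers E} {π : integers K} {u X Y : R} {r : Fin 3 → ℝ}

/-- The coordinate functions of the curve as functions on the affinoid. -/
noncomputable def cmCoord (q : ℕ) (ζ' π : K) (c : Fin 3 → K) (u X Y : R) :
    Fin 3 → K ⊗[integers E] R :=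
  -- The curve has its coordinates in the order u, U, S, whereas `cmFunctions` lists u, S, U.
  ![(c 0)⁻¹ • cmFunctions q ζ' π u X Y 0, (c 1)⁻¹ • cmFunctions q ζ' π u X Y 2,
    (c 2)⁻¹ • cmFunctions q ζ' π u X Y 1]

lemma cmCoord_relations {ζ' π : K} {c : Fin 3 → K} (hc : ∀ s, c s ≠ 0) (u X Y : R) :
    let a := algebraMap K (K ⊗[integers E] R)
    let w := cmCoord q ζ' π c u X Y
    a (c 0) * w 0 = 1 ⊗ₜ u ∧ a π + a (c 2) * w 2 = 1 ⊗ₜ X ∧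
      a ζ' * a π + (a ζ' ^ q * (a (c 2) * w 2) - a (c 1) * w 1) = 1 ⊗ₜ Y := by
  intro a w
  have h : ∀ (s t : Fin 3), a (c s) * ((c s)⁻¹ • cmFunctions q ζ' π u X Y t) =
      cmFunctions q ζ' π u X Y t := fun s t => by
    rw [← Algebra.smul_def, smul_smul, mul_inv_cancel₀ (hc s), one_smul]
  have h0 : a (c 0) * w 0 = 1 ⊗ₜ u := h 0 0
  have h1 : a (c 1) * w 1 = ζ' ^ q • (1 ⊗ₜ X - π ⊗ₜ 1) - (1 ⊗ₜ Y - (ζ' * π) ⊗ₜ 1) := h 1 2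
  have h2 : a (c 2) * w 2 = 1 ⊗ₜ X - π ⊗ₜ 1 := h 2 1
  have e : ∀ x : K, x ⊗ₜ[integers E] (1 : R) = a x := fun _ => rfl
  refine ⟨h0, ?_, ?_⟩
  · rw [h2, e]; ring
  · rw [h1, h2, e, e, Algebra.smul_def, map_pow, map_mul]; ring

end AffinoidModel

end LubinTateCurve

namespace LubinTateCurve

section AffinoidCurve

open MvPolynomial IsLocalRing

variable {E K R : Type u} [NormedField E] [IsUltrametricDist E] [NormedField K]
  [IsUltrametricDist K] [Algebra E K] [CommRing R] [Algebra (integers E) R]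
  {q k : ℕ} {ϖ : integers E} {π ζ : integers K} {u X Y : R} {r : Fin 3 → ℝ}
  {i : integers E →+* integers K}

/-- On the generic fibre the universal points satisfy the torsion equations and the constants
divided out are invertible. -/
lemma cmCoord_aeval_eq_zero (hi : ∀ w, (i w : K) = algebraMap E K w)
    (M : CurveModel q k (i ϖ) π ζ) (hc : ∀ s, M.c s ≠ 0)
    (hX : (ltOp q (algebraMap (integers E) R ϖ) u)^[k] X = 0)
    (hY : (ltOp q (algebraMap (integers E) R ϖ) u)^[k] Y = 0) (s : Fin 2) :
    aeval (cmCoord (E := E) q (ζ : K) (π : K) (fun s => (M.c s : K)) u X Y) (M.G s) = 0 := by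
  have hc' : ∀ s, (M.c s : K) ≠ 0 := fun s hs => hc s (Subtype.ext hs)
  obtain ⟨h0, h1, h2⟩ := cmCoord_relations (E := E) (ζ' := (ζ : K)) (π := (π : K))
    (c := fun s => (M.c s : K)) hc' u X Y
  have hP : ∀ z, (ltOp q (algebraMap (integers E) R ϖ) u)^[k] z = 0 →
      (ltOp q (algebraMap (integers K) (K ⊗[integers E] R) (i ϖ)) (1 ⊗ₜ u))^[k] (1 ⊗ₜ z) = 0 := by
    intro z hz
    have := map_ltOp_iterate (q := q)
      (Algebra.TensorProduct.includeRight : R →ₐ[integers E] K ⊗[integers E] R).toRingHom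
      (algebraMap (integers E) R ϖ) u z k
    rw [hz, map_zero] at this
    rw [algebraMap_integers_tensor, hi, ← one_tmul_algebraMap]
    exact this.symm
  have hK : ∀ (a : integers K) (b : K ⊗[integers E] R), a ≠ 0 →
      algebraMap (integers K) (K ⊗[integers E] R) a * b = 0 → b = 0 := by
    intro a b ha hab
    rw [algebraMap_integers_tensor, ← Algebra.smul_def] at hab
    have ha' : (a : K) ≠ 0 := fun h => ha (Subtype.ext h)
    rw [← inv_smul_smul₀ ha' b, hab, smul_zero]
  refine CMParameters.aeval_eq_zero M (fun s b => hK _ b (M.κ_ne_zero s)) ?_ ?_ s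
  · have := hP X hX
    rw [← h0, ← h1] at this
    exact this
  · have := hP Y hY
    rw [← h0, ← h2] at this
    exact this

/-- The homomorphism from the affinoid model to a complete ring over which the functions on the
curve are given by a homomorphism on `R`. -/
lemma exists_algHom_affinoidModel (hi : ∀ w, (i w : K) = algebraMap E K w)
    (hm : maximalIdeal (integers K) = Ideal.span {π}) {c : Fin 3 → integers K}
    (hc : ∀ s, c s ≠ 0) (hr : r = ![‖(c 0 : K)‖, ‖(c 2 : K)‖, ‖(c 1 : K)‖])
    {B : Type u} [CommRing B] [Algebra (integers K) B]
    (hB : ∀ b, algebraMap (integers K) B π * b = 0 → b = 0) (g : R →+* B)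
    (hg : ∀ w, g (algebraMap (integers E) R w) = algebraMap (integers K) B (i w))
    {z : Fin 3 → B} (hu : g u = algebraMap (integers K) B (c 0) * z 0)
    (hX : g X = algebraMap (integers K) B π + algebraMap (integers K) B (c 2) * z 2)
    (hY : g Y = algebraMap (integers K) B ζ * algebraMap (integers K) B π +
      (algebraMap (integers K) B ζ ^ q * (algebraMap (integers K) B (c 2) * z 2) -
        algebraMap (integers K) B (c 1) * z 1)) :
    ∃ ψ : affinoidModel (E := E) (cmFunctions q (ζ : K) (π : K) u X Y) r →ₐ[integers K] B,
      ∀ (a : affinoidModel (E := E) (cmFunctions q (ζ : K) (π : K) u X Y) r) (s : Fin 3),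
        (a : K ⊗[integers E] R) = cmCoord q (ζ : K) (π : K) (fun s => (c s : K)) u X Y s →
          ψ a = z s := by
  have hL := isLattice_includeRight hm hB
  obtain ⟨J, hJ⟩ : ∃ J : B →ₐ[integers K] K ⊗[integers K] B,
    J = Algebra.TensorProduct.includeRight := ⟨_, rfl⟩
  rw [← hJ] at hL
  have hJK : ∀ a : integers K, J (algebraMap (integers K) B a) =
      algebraMap K (K ⊗[integers K] B) (a : K) := fun a => J.commutes a
  obtain ⟨Ψ, hΨ⟩ := exists_algHom_tensor (E := E) (K := K) (J.toRingHom.comp g) fun w => by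
    rw [← hi, ← hJK, ← hg]; rfl
  have hΨ' : ∀ x, Ψ (1 ⊗ₜ x) = J (g x) := hΨ
  have hc' : ∀ s, (c s : K) ≠ 0 := fun s hs => hc s (Subtype.ext hs)
  obtain ⟨h0, h1, h2⟩ := cmCoord_relations (E := E) (ζ' := (ζ : K)) (π := (π : K))
    (c := fun s => (c s : K)) hc' u X Y
  have hcan : ∀ s x, algebraMap K (K ⊗[integers K] B) (c s : K) * x = 
      algebraMap K (K ⊗[integers K] B) (c s : K) * J (z s) → x = J (z s) := fun s x hx => by
    rw [← Algebra.smul_def, ← Algebra.smul_def] at hx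
    rw [← inv_smul_smul₀ (hc' s) x, hx, inv_smul_smul₀ (hc' s)]
  have hz0 : Ψ (cmCoord q (ζ : K) (π : K) (fun s => (c s : K)) u X Y 0) = J (z 0) := by
    refine hcan 0 _ ?_
    have := congrArg Ψ h0
    rw [hΨ', hu, map_mul, map_mul, hJK, Ψ.commutes] at this
    exact this
  have hz2 : Ψ (cmCoord q (ζ : K) (π : K) (fun s => (c s : K)) u X Y 2) = J (z 2) := by
    refine hcan 2 _ ?_
    have := congrArg Ψ h1
    rw [hΨ', hX, map_add, map_add, map_mul, map_mul, hJK, hJK, Ψ.commutes, Ψ.commutes] at this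
    exact add_left_cancel this
  have hz1 : Ψ (cmCoord q (ζ : K) (π : K) (fun s => (c s : K)) u X Y 1) = J (z 1) := by
    refine hcan 1 _ ?_
    have := congrArg Ψ h2
    simp only [hΨ', hY, map_add, map_sub, map_mul, map_pow, hJK, Ψ.commutes, hz2] at this
    exact sub_right_injective (add_left_cancel this)
  have hz : ∀ s, Ψ (cmCoord q (ζ : K) (π : K) (fun s => (c s : K)) u X Y s) = J (z s) := fun s => by
    fin_cases s
    exacts [hz0, hz1, hz2]
  -- A generator scaled by d with ‖c‖ ≤ ‖d‖ is the integral multiple c/d of a coordinate, so it is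
  -- enough to handle the coordinates.
  have key : ∀ (d : K) (s t : Fin 3), d ≠ 0 → ‖(c s : K)‖ ≤ ‖d‖ →
      cmCoord (E := E) q (ζ : K) (π : K) (fun s => (c s : K)) u X Y s =
        (c s : K)⁻¹ • cmFunctions q (ζ : K) (π : K) u X Y t →
      Ψ (d⁻¹ • cmFunctions q (ζ : K) (π : K) u X Y t) ∈ J.range := by
    intro d s t hd hcd h
    have hmem : d⁻¹ * (c s : K) ∈ integers K := by
      rw [mem_integers, norm_mul, norm_inv, inv_mul_le_one₀ (norm_pos_iff.2 hd)]
      exact hcd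
    refine ⟨algebraMap (integers K) B ⟨_, hmem⟩ * z s, ?_⟩
    change J (algebraMap (integers K) B ⟨_, hmem⟩ * z s) = _
    rw [map_mul, hJK, ← hz, h, ← Algebra.smul_def, map_smul, map_smul, smul_smul, mul_assoc,
      mul_inv_cancel₀ (hc' s), mul_one]
  obtain ⟨ψ, hψ⟩ := exists_algHom_of_map_le_range hL Ψ
    (affinoidModel (E := E) (cmFunctions q (ζ : K) (π : K) u X Y) r) fun a ha => by
      induction ha using Algebra.adjoin_induction with
      | mem x hx =>
        rcases hx with ⟨x, rfl⟩ | ⟨t, d, hd, hrd, rfl⟩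
        · exact ⟨g x, (hΨ' x).symm⟩
        · rw [hr] at hrd
          fin_cases t
          · exact key d 0 0 hd hrd rfl
          · exact key d 2 1 hd hrd rfl
          · exact key d 1 2 hd hrd rfl
      | algebraMap a =>
        exact ⟨algebraMap (integers K) B a, (hJK a).trans (Ψ.commutes (a : K)).symm⟩
      | add x y _ _ hx hy => rw [map_add]; exact add_mem hx hy
      | mul x y _ _ hx hy => rw [map_mul]; exact mul_mem hx hy
  exact ⟨ψ, fun a s ha => hL.injective ((hψ a).trans ((congrArg Ψ ha).trans (hz s)))⟩

lemma cmCoord_mem_affinoidModel {c : Fin 3 → integers K} (hc : ∀ s, c s ≠ 0)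
    (hr : r = ![‖(c 0 : K)‖, ‖(c 2 : K)‖, ‖(c 1 : K)‖]) (s : Fin 3) :
    cmCoord q (ζ : K) (π : K) (fun s => (c s : K)) u X Y s ∈
      affinoidModel (E := E) (cmFunctions q (ζ : K) (π : K) u X Y) r := by
  have hc' : ∀ s, (c s : K) ≠ 0 := fun s hs => hc s (Subtype.ext hs)
  refine Algebra.subset_adjoin (Or.inr ?_)
  rw [hr]
  fin_cases s
  · exact ⟨0, c 0, hc' 0, le_rfl, rfl⟩
  · exact ⟨2, c 1, hc' 1, le_rfl, rfl⟩
  · exact ⟨1, c 2, hc' 2, le_rfl, rfl⟩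

/-- The affinoid model is generated by the coordinate functions modulo the uniformizer. -/
lemma exists_dvd_sub_aeval_affinoidModel (hi : ∀ w, (i w : K) = algebraMap E K w)
    {c : Fin 3 → integers K} (hc : ∀ s, c s ≠ 0)
    (hr : r = ![‖(c 0 : K)‖, ‖(c 2 : K)‖, ‖(c 1 : K)‖]) (hπc : ∀ s, π ∣ c s) (hπϖ : π ∣ i ϖ)
    (hR : ∀ x : R, ∃ w, x - algebraMap (integers E) R w ∈
      Ideal.span (insert (algebraMap (integers E) R ϖ) {u, X, Y}))
    {A₀ : Subalgebra (integers K) (K ⊗[integers E] R)}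
    (hA₀ : A₀ = affinoidModel (cmFunctions q (ζ : K) (π : K) u X Y) r) {z : Fin 3 → A₀}
    (hz : ∀ s, (z s : K ⊗[integers E] R) =
      cmCoord q (ζ : K) (π : K) (fun s => (c s : K)) u X Y s)
    (a : A₀) :
    ∃ P : MvPolynomial (Fin 3) (integers K), algebraMap (integers K) A₀ π ∣ a - aeval z P := by
  have hc' : ∀ s, (c s : K) ≠ 0 := fun s hs => hc s (Subtype.ext hs)
  have hA : ∀ b : integers K, ((algebraMap (integers K) A₀ b : A₀) : K ⊗[integers E] R) =
    algebraMap K (K ⊗[integers E] R) (b : K) := fun _ => rfl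
  obtain ⟨h0, h1, h2⟩ := cmCoord_relations (E := E) (q := q) (ζ' := (ζ : K)) (π := (π : K))
    (c := fun s => (c s : K)) hc' u X Y
  have key : ∀ (b : A₀) (d : K) (s t : Fin 3), d ≠ 0 → ‖(c s : K)‖ ≤ ‖d‖ →
      cmCoord (E := E) q (ζ : K) (π : K) (fun s => (c s : K)) u X Y s =
        (c s : K)⁻¹ • cmFunctions q (ζ : K) (π : K) u X Y t →
      (b : K ⊗[integers E] R) = d⁻¹ • cmFunctions q (ζ : K) (π : K) u X Y t →
      ∃ P : MvPolynomial (Fin 3) (integers K), algebraMap (integers K) A₀ π ∣ b - aeval z P := by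
    intro b d s t hd hcd h hb
    have hmem : d⁻¹ * (c s : K) ∈ integers K := by
      rw [mem_integers, norm_mul, norm_inv, inv_mul_le_one₀ (norm_pos_iff.2 hd)]
      exact hcd
    refine ⟨MvPolynomial.C ⟨_, hmem⟩ * MvPolynomial.X s, ?_⟩
    have : b = aeval z (MvPolynomial.C (⟨_, hmem⟩ : integers K) * MvPolynomial.X s) := by
      rw [map_mul, aeval_C, aeval_X]
      refine Subtype.ext ?_
      rw [hb, MulMemClass.coe_mul, hA, hz, h, ← Algebra.smul_def, smul_smul, mul_assoc,
        mul_inv_cancel₀ (hc' s), mul_one]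
    rw [← this, sub_self]
    exact dvd_zero _
  refine exists_dvd_sub_aeval_of_adjoin (S := (fun a : A₀ => (a : K ⊗[integers E] R)) ⁻¹'
    (Set.range (fun x : R => (1 : K) ⊗ₜ[integers E] x) ∪ {g | ∃ (i : Fin 3) (c : K),
      c ≠ 0 ∧ r i ≤ ‖c‖ ∧ g = c⁻¹ • cmFunctions q (ζ : K) (π : K) u X Y i})) ?_ ?_
  · rintro b (⟨x, hx⟩ | ⟨t, d, hd, hrd, hb⟩)
    · obtain ⟨w, hw⟩ := hR x
      have hgen : ∀ x : R, (1 : K) ⊗ₜ[integers E] x ∈ A₀ := fun x => by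
        rw [hA₀]
        exact Algebra.subset_adjoin (Or.inl ⟨x, rfl⟩)
      let ι : R →+* A₀ := (Algebra.TensorProduct.includeRight :
        R →ₐ[integers E] K ⊗[integers E] R).toRingHom.codRestrict A₀.toSubring hgen
      have hι : ∀ x, ((ι x : A₀) : K ⊗[integers E] R) = 1 ⊗ₜ x := fun _ => rfl
      have hιw : ∀ w, ι (algebraMap (integers E) R w) = algebraMap (integers K) A₀ (i w) :=
        fun w => Subtype.ext (by rw [hι, hA, one_tmul_algebraMap, hi])
      have hb : b = ι x := Subtype.ext hx.symm
      refine ⟨MvPolynomial.C (i w), ?_⟩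
      rw [aeval_C, hb, ← hιw, ← map_sub, ← Ideal.mem_span_singleton, ← Ideal.mem_comap]
      -- The generators ϖ, u, X, Y of the ideal all become divisible by π in the model, so R
      -- contributes only scalars modulo π.
      refine Ideal.span_le.2 ?_ hw
      have hd : ∀ s, algebraMap (integers K) A₀ π ∣ algebraMap (integers K) A₀ (c s) :=
        fun s => map_dvd _ (hπc s)
      rintro y (rfl | hy | hy | hy)
      · rw [SetLike.mem_coe, Ideal.mem_comap, Ideal.mem_span_singleton, hιw]
        exact map_dvd _ hπϖ
      all_goals rw [SetLike.mem_coe, Ideal.mem_comap, Ideal.mem_span_singleton]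
      · rw [hy]
        have : ι u = algebraMap (integers K) A₀ (c 0) * z 0 := Subtype.ext (by
          rw [hι, MulMemClass.coe_mul, hA, hz, h0])
        rw [this]
        exact (hd 0).mul_right _
      · rw [hy]
        have : ι X = algebraMap (integers K) A₀ π + algebraMap (integers K) A₀ (c 2) * z 2 :=
          Subtype.ext (by
            rw [hι, AddMemClass.coe_add, MulMemClass.coe_mul, hA, hA, hz, h1])
        rw [this]
        exact dvd_add dvd_rfl ((hd 2).mul_right _)
      · rw [hy]
        have : ι Y = algebraMap (integers K) A₀ ζ * algebraMap (integers K) A₀ π +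
            (algebraMap (integers K) A₀ ζ ^ q * (algebraMap (integers K) A₀ (c 2) * z 2) -
              algebraMap (integers K) A₀ (c 1) * z 1) :=
          Subtype.ext (by
            rw [hι, ← h2, ← hz, ← hz]; rfl)
        rw [this]
        exact dvd_add (dvd_mul_left _ _)
          (dvd_sub (((hd 2).mul_right _).mul_left _) ((hd 1).mul_right _))
    · rw [hr] at hrd
      fin_cases t
      · exact key b d 0 0 hd hrd rfl hb
      · exact key b d 2 1 hd hrd rfl hb
      · exact key b d 1 2 hd hrd rfl hb
  · have htop : Algebra.adjoin (integers K) ((fun a : A₀ => (a : K ⊗[integers E] R)) ⁻¹'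
        (Set.range (fun x : R => (1 : K) ⊗ₜ[integers E] x) ∪ {g | ∃ (i : Fin 3) (c : K),
          c ≠ 0 ∧ r i ≤ ‖c‖ ∧ g = c⁻¹ • cmFunctions q (ζ : K) (π : K) u X Y i})) = ⊤ := by
      subst hA₀
      exact Algebra.adjoin_adjoin_coe_preimage
    rw [htop]
    exact Algebra.mem_top

/-- The formal model of the affinoid is the completion of the curve. -/
theorem exists_isCompletionMap_affinoidFormalModel (hi : ∀ w, (i w : K) = algebraMap E K w)
    (hm : maximalIdeal (integers K) = Ideal.span {π}) (M : CurveModel q k (i ϖ) π ζ) (hc : ∀ s, M.c s ≠ 0) (hπc : ∀ s, π ∣ M.c s) (hπϖ : π ∣ i ϖ)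
    (hr : r = ![‖(M.c 0 : K)‖, ‖(M.c 2 : K)‖, ‖(M.c 1 : K)‖])
    (hX : (ltOp q (algebraMap (integers E) R ϖ) u)^[k] X = 0)
    (hY : (ltOp q (algebraMap (integers E) R ϖ) u)^[k] Y = 0)
    (hR : ∀ x : R, ∃ w, x - algebraMap (integers E) R w ∈
      Ideal.span (insert (algebraMap (integers E) R ϖ) {u, X, Y}))
    {s : MvPolynomial (Fin 3) (integers K)}
    (hs : curveJacobian M.G = -1 + MvPolynomial.C π * s)
    {B : Type u} [CommRing B] [Algebra (integers K) B] {ιC : CurveAlgebra M.G →ₐ[integers K] B}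
    (hιC : IsCompletionMap π ιC)
    (hB : ∀ b, algebraMap (integers K) B π * b = 0 → b = 0) (g : R →+* B)
    (hg : ∀ w, g (algebraMap (integers E) R w) = algebraMap (integers K) B (i w))
    (hu' : g u = algebraMap (integers K) B (M.c 0) * ιC (curveCoord M.G 0))
    (hX' : g X = algebraMap (integers K) B π +
      algebraMap (integers K) B (M.c 2) * ιC (curveCoord M.G 2))
    (hY' : g Y = algebraMap (integers K) B ζ * algebraMap (integers K) B π +
      (algebraMap (integers K) B ζ ^ q * (algebraMap (integers K) B (M.c 2) *
        ιC (curveCoord M.G 2)) - algebraMap (integers K) B (M.c 1) * ιC (curveCoord M.G 1))) :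
    ∃ θ : CurveAlgebra M.G →ₐ[integers K]
      affinoidFormalModel (E := E) (cmFunctions q (ζ : K) (π : K) u X Y) r,
      IsCompletionMap π θ := by
  obtain ⟨A₀, hA₀⟩ : ∃ A₀ : Subalgebra (integers K) (K ⊗[integers E] R),
    A₀ = affinoidModel (cmFunctions q (ζ : K) (π : K) u X Y) r := ⟨_, rfl⟩
  have hψ := exists_algHom_affinoidModel hi hm hc hr hB g hg
    (z := fun s => ιC (curveCoord M.G s)) hu' hX' hY'
  have hmem := cmCoord_mem_affinoidModel (E := E) (q := q) (π := π) (ζ := ζ) (u := u) (X := X)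
    (Y := Y) hc hr
  unfold affinoidFormalModel
  rw [← hA₀] at hψ hmem ⊢
  obtain ⟨ψ, hψ⟩ := hψ
  let z : Fin 3 → A₀ := fun s => ⟨_, hmem s⟩
  have hz : ∀ t, aeval z (M.G t) = 0 := fun t => by
    refine Subtype.ext ?_
    have := cmCoord_aeval_eq_zero hi M hc hX hY t
    have e : A₀.val.comp (aeval z) = aeval fun s => (z s : K ⊗[integers E] R) := by
      ext s; simp
    exact (AlgHom.congr_fun e (M.G t)).trans this
  have hI : (maximalIdeal (integers K)).map (algebraMap (integers K) A₀) =
      Ideal.span {algebraMap (integers K) A₀ π} := by rw [hm, Ideal.map_span, Set.image_singleton]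
  have hιA := isCompletionMap_adicCompletion (A := integers K) (C := A₀) (π := π) hI
  set ιA := (Algebra.ofId A₀ (AdicCompletion ((maximalIdeal (integers K)).map
    (algebraMap (integers K) A₀)) A₀)).restrictScalars (integers K)
  obtain ⟨θ, hθ⟩ := exists_algHom_curveAlgebra hs hιA.complete (z := fun s => ιA (z s)) fun t => by
    have e : ιA.comp (aeval z) = aeval fun s => ιA (z s) := by ext s; simp
    rw [← e, AlgHom.comp_apply, hz, map_zero]
  exact ⟨θ, isCompletionMap_of_retraction hιA hιC (exists_dvd_sub_aeval_curveCoord hs)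
    (exists_dvd_sub_aeval_affinoidModel hi hc hr hπc hπϖ hR hA₀ fun s => rfl) hθ
    fun s => hψ _ _ rfl⟩

end AffinoidCurve

end LubinTateCurve

namespace LubinTateCurve

/-! ### Rings of integers as discrete valuation rings, and digit expansions. -/

section DiscreteValuation

open IsLocalRing

variable {K : Type*} [NormedField K] [IsUltrametricDist K] {π : integers K}

lemma associated_of_norm_eq {a b : integers K} (h : ‖(a : K)‖ = ‖(b : K)‖) : Associated a b := by
  by_cases ha : (a : K) = 0
  · have hb : (b : K) = 0 := norm_eq_zero.1 (by rw [← h, ha, norm_zero])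
    rw [Subtype.ext (ha.trans hb.symm)]
  · have hu : ‖(b : K) / a‖ = 1 := by rw [norm_div, ← h, div_self (norm_ne_zero_iff.2 ha)]
    obtain ⟨v, hv⟩ := (isUnit_integers ⟨(b : K) / a, (mem_integers _).2 hu.le⟩).2 hu
    exact ⟨v, Subtype.ext (by rw [hv]; exact mul_div_cancel₀ _ ha)⟩

lemma exists_pow_norm_eq (h0 : 0 < ‖(π : K)‖) (h1 : ‖(π : K)‖ < 1)
    (hK : ∀ z : K, z ≠ 0 → ∃ n : ℤ, ‖z‖ = ‖(π : K)‖ ^ n) {a : integers K} (ha : a ≠ 0) :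
    ∃ n : ℕ, ‖(a : K)‖ = ‖(π : K)‖ ^ n := by
  obtain ⟨n, hn⟩ := hK a fun h => ha (Subtype.ext h)
  have h2 := (mem_integers _).1 a.2
  have hn0 : 0 ≤ n := by
    by_contra! h
    rw [hn] at h2
    exact h2.not_gt (one_lt_zpow_of_neg₀ h0 h1 h)
  obtain ⟨m, rfl⟩ := Int.eq_ofNat_of_zero_le hn0
  exact ⟨m, by rw [hn, zpow_natCast]⟩

lemma irreducible_of_norm (h0 : 0 < ‖(π : K)‖) (h1 : ‖(π : K)‖ < 1)
    (hK : ∀ z : K, z ≠ 0 → ∃ n : ℤ, ‖z‖ = ‖(π : K)‖ ^ n) : Irreducible π := by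
  refine ⟨fun h => h1.ne ((isUnit_integers _).1 h), fun a b hab => ?_⟩
  have hπ : π ≠ 0 := fun h => by rw [h] at h0; simp at h0
  obtain ⟨n, hn⟩ := exists_pow_norm_eq h0 h1 hK (a := a) fun h => hπ (by rw [hab, h, zero_mul])
  obtain ⟨m, hm⟩ := exists_pow_norm_eq h0 h1 hK (a := b) fun h => hπ (by rw [hab, h, mul_zero])
  have e : ‖(π : K)‖ ^ 1 = ‖(π : K)‖ ^ (n + m) := by
    rw [pow_one, pow_add, ← hn, ← hm, ← norm_mul]
    exact congrArg (fun x : integers K => ‖(x : K)‖) hab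
  have := pow_right_injective₀ h0 h1.ne e
  rw [isUnit_integers, isUnit_integers, hn, hm]
  rcases Nat.eq_zero_or_pos n with rfl | hn'
  · exact Or.inl (pow_zero _)
  · rw [show m = 0 by omega]
    exact Or.inr (pow_zero _)

lemma isDiscreteValuationRing_integers (h0 : 0 < ‖(π : K)‖) (h1 : ‖(π : K)‖ < 1)
    (hK : ∀ z : K, z ≠ 0 → ∃ n : ℤ, ‖z‖ = ‖(π : K)‖ ^ n) :
    IsDiscreteValuationRing (integers K) := by
  refine IsDiscreteValuationRing.ofHasUnitMulPowIrreducibleFactorization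
    ⟨π, irreducible_of_norm h0 h1 hK, fun {a} ha => ?_⟩
  obtain ⟨n, hn⟩ := exists_pow_norm_eq h0 h1 hK ha
  refine ⟨n, associated_of_norm_eq ?_⟩
  rw [hn, ← norm_pow]
  rfl

end DiscreteValuation

section LocalField

open IsLocalRing

variable {F : Type*} [NontriviallyNormedField F] [IsUltrametricDist F] {ϖ : integers F}

lemma eq_of_pow_card_eq_self (p : ℕ) [Fact p.Prime] [CharP F p] [ProperSpace F]
    {x y : F} (hx : x ^ Nat.card (ResidueField (integers F)) = x)
    (hy : y ^ Nat.card (ResidueField (integers F)) = y) (h : ‖x - y‖ < 1) : x = y := by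
  obtain ⟨g, hg, hq⟩ := natCard_residueField (L := F) p
  have hq2 : 2 ≤ p ^ g := (Fact.out : p.Prime).two_le.trans (Nat.le_self_pow (by omega) p)
  rw [hq] at hx hy
  by_contra hne
  have e : (x - y) ^ p ^ g = x - y := by rw [sub_pow_char_pow, hx, hy]
  exact h.ne (norm_eq_one_of_pow_eq_self hq2 e (sub_ne_zero.2 hne))

/-- The expansion of the elements of a local field of positive characteristic as power series in
a uniformizer. -/
lemma nonempty_digits (p : ℕ) [Fact p.Prime] [CharP F p] [ProperSpace F] (hϖ : Irreducible ϖ) :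
    Nonempty (Digits (integers F) (Nat.card (ResidueField (integers F))) ϖ) := by
  obtain ⟨g, hg, hq⟩ := natCard_residueField (L := F) p
  have hq2 : 2 ≤ p ^ g := (Fact.out : p.Prime).two_le.trans (Nat.le_self_pow (by omega) p)
  set q := Nat.card (ResidueField (integers F)) with hqdef
  have hϖ0 : (ϖ : F) ≠ 0 := norm_pos_iff.1 (norm_uniformizer_pos hϖ)
  choose s hs hs' using fun a : integers F => exists_teichmuller p (a : F) ((mem_integers _).1 a.2)
  have hs'' : ∀ a, s a ^ p ^ g = s a := fun a => by rw [← hq]; exact hs a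
  have hs1 : ∀ a, ‖s a‖ ≤ 1 := fun a => by
    have := norm_sub_le_of_le ((mem_integers _).1 a.2) (hs' a).le
    rwa [sub_sub_cancel] at this
  -- Teichmüller representatives are unique; so their products, and in characteristic p also their
  -- sums, are the representatives of products and sums.
  have huniq : ∀ (a : integers F) (y : F), y ^ q = y → ‖(a : F) - y‖ < 1 → s a = y :=
    fun a y hy h => eq_of_pow_card_eq_self p (hs a) hy (by
      rw [← sub_sub_sub_cancel_left _ _ (a : F)]
      exact norm_sub_lt_of_lt h (hs' a))
  have hmax : ∀ x y : F, ‖x‖ < 1 → ‖y‖ < 1 → ‖x + y‖ < 1 := fun x y hx hy =>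
    (IsUltrametricDist.norm_add_le_max x y).trans_lt (max_lt hx hy)
  let S : integers F →+* integers F :=
    { toFun := fun a => ⟨s a, (mem_integers _).2 (hs1 a)⟩
      map_one' := Subtype.ext (huniq 1 1 (one_pow q) (by simp))
      map_zero' := Subtype.ext (huniq 0 0 (zero_pow (by omega)) (by simp))
      map_mul' := fun a b => Subtype.ext (huniq _ _ (by
        change (s a * s b) ^ q = s a * s b
        rw [mul_pow, hs, hs]) (by
        change ‖(a : F) * b - s a * s b‖ < 1
        rw [show (a : F) * b - s a * s b = (a - s a) * b + s a * (b - s b) by ring]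
        refine hmax _ _ ?_ ?_
        · rw [norm_mul]
          exact mul_lt_one_of_nonneg_of_lt_one_left (norm_nonneg _) (hs' a)
            ((mem_integers _).1 b.2)
        · rw [norm_mul]
          exact mul_lt_one_of_nonneg_of_lt_one_right (hs1 a) (norm_nonneg _) (hs' b)))
      map_add' := fun a b => Subtype.ext (huniq _ _ (by
        change (s a + s b) ^ q = s a + s b
        rw [hq, add_pow_char_pow, hs'', hs'']) (by
        change ‖(a : F) + b - (s a + s b)‖ < 1
        rw [add_sub_add_comm]
        exact hmax _ _ (hs' a) (hs' b))) }
  have hSh : ∀ a : integers F, ‖((a : F) - s a) / ϖ‖ ≤ 1 := fun a => by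
    rw [norm_div]
    exact div_le_one_of_le₀ (norm_le_uniformizer hϖ (hs' a)) (norm_nonneg _)
  refine ⟨⟨S, fun a => ⟨_, (mem_integers _).2 (hSh a)⟩, fun a => Subtype.ext ?_,
    fun a => Subtype.ext (hs a), fun a ha => Subtype.ext ?_, Subtype.ext ?_, fun a b h => ?_⟩⟩
  · change (a : F) = s a + ϖ * ((a - s a) / ϖ)
    rw [mul_div_cancel₀ _ hϖ0, add_sub_cancel]
  · exact huniq a a (congrArg Subtype.val ha) (by simp)
  · exact huniq ϖ 0 (zero_pow (by omega)) (by simpa using norm_uniformizer_lt_one hϖ)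
  · exact mul_left_cancel₀ hϖ.ne_zero h

lemma maximalIdeal_integers_eq_span (hϖ : Irreducible ϖ) :
    maximalIdeal (integers F) = Ideal.span {ϖ} := by
  have := isDiscreteValuationRing_integers (norm_uniformizer_pos hϖ) (norm_uniformizer_lt_one hϖ)
    fun z hz => exists_zpow_norm_eq hϖ hz
  exact hϖ.maximalIdeal_eq

lemma finite_quotient_maximalIdeal_pow [ProperSpace F] (hϖ : Irreducible ϖ) (n : ℕ) :
    Finite (integers F ⧸ maximalIdeal (integers F) ^ n) := by
  have : Finite (integers F ⧸ maximalIdeal (integers F)) := finite_residueField (L := F)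
  exact Ideal.finite_quotient_pow ⟨{ϖ}, by rw [maximalIdeal_integers_eq_span hϖ]; simp⟩ n

end LocalField

/-! ### The radii of the affinoid as norms of powers of π. -/

section Radii

/-- Multiplication by the ramification index e converts valuations with v(ϖ) = 1 into π-orders. The
indices 1 and 2 are interchanged because the two lists order S and U differently. -/
lemma mul_cmValuations {q k : ℕ} (hq : 2 ≤ q) (hk : 2 ≤ k) :
    let e : ℝ := (((q ^ 2 - 1) * q ^ (2 * (k - 1)) : ℕ) : ℝ)
    e * cmValuations q k 0 = cmExponent q k 0 ∧ e * cmValuations q k 1 = cmExponent q k 2 ∧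
      e * cmValuations q k 2 = cmExponent q k 1 := by
  intro e
  have hq1 : (2 : ℝ) ≤ q := by exact_mod_cast hq
  have hq2 : (q : ℝ) ^ 2 - 1 ≠ 0 := by nlinarith
  have hq0 : (q : ℝ) ^ (k - 1) ≠ 0 := by positivity
  have he : e = ((q : ℝ) ^ 2 - 1) * (q : ℝ) ^ (2 * (k - 1)) := by
    simp only [e]
    rw [Nat.cast_mul, Nat.cast_sub (by nlinarith)]
    push_cast
    ring
  refine ⟨?_, ?_, ?_⟩
  · simp only [cmValuations, cmExponent, Matrix.cons_val_zero]
    split_ifs with hev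
    · rw [mul_comm, Nat.cast_mul (_ / 2)]
    · have h1 : (q - 1) * q ^ (2 * (k - 1)) ≤ (k + 1) / 2 * ((q ^ 2 - 1) * q ^ (2 * (k - 1))) := by
        rw [← mul_assoc]
        refine Nat.mul_le_mul_right _ ?_
        calc q - 1 ≤ q ^ 2 - 1 := Nat.sub_le_sub_right (by nlinarith) 1
          _ ≤ _ := Nat.le_mul_of_pos_left _ (by omega)
      rw [Nat.cast_sub h1, Nat.cast_mul (_ / 2), Nat.cast_mul (q - 1), Nat.cast_sub (by omega)]
      have h2 : (q : ℝ) + 1 ≠ 0 := by positivity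
      change e * _ = _ * e - _
      rw [he]
      push_cast
      field_simp
      ring
  · simp only [cmValuations, cmExponent, Matrix.cons_val_one, Matrix.cons_val]
    rw [he]
    push_cast
    field_simp
    rw [mul_comm 2, pow_mul]
  · simp only [cmValuations, cmExponent, Matrix.cons_val_one, Matrix.cons_val]
    rw [he]
    push_cast
    field_simp

lemma rpow_cmValuations {q k : ℕ} (hq : 2 ≤ q) (hk : 2 ≤ k) {ρ σ : ℝ} (hρ : 0 ≤ ρ)
    (hσ : ρ ^ ((q ^ 2 - 1) * q ^ (2 * (k - 1))) = σ) :
    (fun i => σ ^ cmValuations q k i) =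
      ![ρ ^ cmExponent q k 0, ρ ^ cmExponent q k 2, ρ ^ cmExponent q k 1] := by
  obtain ⟨h0, h1, h2⟩ := mul_cmValuations hq hk
  subst hσ
  ext i
  fin_cases i
  all_goals
    simp only [← Real.rpow_natCast, Fin.mk_one, Fin.reduceFinMk, Fin.zero_eta, Matrix.cons_val]
    rw [← Real.rpow_mul hρ]
  · rw [h0]
  · rw [h1]
  · rw [h2]

end Radii

end LubinTateCurve

namespace LubinTateCurve

/-! ### Assembly over the Lubin–Tate curve. -/

section Parameters

open IsLocalRing

lemma cmParameters_integers {K : Type*} [NormedField K] [IsUltrametricDist K] {p f q k : ℕ}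
    (hp : p.Prime) (hqf : q = p ^ f) (hpK : (p : K) = 0) (hq : 2 ≤ q) (hk : 2 ≤ k)
    {ϖ π ζ : integers K} (h0 : 0 < ‖(ϖ : K)‖) (h1 : ‖(ϖ : K)‖ < 1)
    (hπ : IsPrimitiveTorsion q (ϖ : K) k (π : K)) (hζ : ζ ^ q ^ 2 = ζ) (hζ' : ζ ^ q ≠ ζ) :
    CMParameters q k ϖ π ζ := by
  have hpA : (p : integers K) = 0 := Subtype.ext (by simpa using hpK)
  refine ⟨⟨p, f, hp, hqf, hpA⟩, hq, hk, associated_of_norm_eq ?_, Subtype.ext ?_, hζ, ?_⟩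
  · rw [← norm_of_isPrimitiveTorsion hq (by omega) h0 h1 hπ, ← norm_pow, mul_comm]
    rfl
  · have := map_ltOpZero_iterate (q := q) (integers K).subtype ϖ π k
    exact this.trans hπ.1
  · rw [isUnit_integers]
    -- ζ^q - ζ is non-zero and again fixed by the q²-th power, so it has norm one.
    refine norm_eq_one_of_pow_eq_self (n := q ^ 2) (by nlinarith) ?_ fun h => hζ' ?_
    · have hadd := add_pow_pow (q := q) (B := integers K)
        (fun x y => by rw [hqf]; exact add_pow_of_natCast_eq_zero hp hpA f x y) 2
        (ζ ^ q - ζ) ζ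
      rw [sub_add_cancel, ← pow_mul, mul_comm q, pow_mul, hζ] at hadd
      exact congrArg Subtype.val (eq_sub_of_add_eq hadd.symm)
    · exact sub_eq_zero.1 (Subtype.ext h)

open MvPolynomial in
-- Additivity of the q^(k-1)-th power extracts it from the product of the two leading coefficients.
lemma artinSchreier_eq {κ : Type*} [Field κ] {p f q k : ℕ} (hp : p.Prime) (hqf : q = p ^ f)
    (hpκ : (p : κ) = 0) {h : Polynomial ℤ} (hh : h = Polynomial.X ^ (q ^ (k - 1) * q) *
      (Polynomial.X ^ (q ^ (k - 1) * q ^ 2) - Polynomial.X ^ q ^ (k - 1))) :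
    artinSchreier κ q h = X 0 ^ (q ^ 2) - X 0 -
      (X 1 ^ (q * (q + 1)) - X 1 ^ (q + 1)) ^ (q ^ (k - 1)) := by
  have hpM : (p : MvPolynomial (Fin 2) κ) = 0 := by
    rw [← map_natCast (C : κ →+* MvPolynomial (Fin 2) κ), hpκ, map_zero]
  have hadd := add_pow_pow (q := q) (B := MvPolynomial (Fin 2) κ)
    (fun x y => by rw [hqf]; exact add_pow_of_natCast_eq_zero hp hpM f x y) (k - 1)
    (X 1 ^ (q * (q + 1)) - X 1 ^ (q + 1)) (X 1 ^ (q + 1))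
  rw [sub_add_cancel] at hadd
  rw [eq_sub_of_add_eq hadd.symm, artinSchreier, hh, map_mul, map_sub, map_pow, map_pow, map_pow,
    Polynomial.aeval_X]
  congr 1
  ring

end Parameters

section AffinoidReduction

open MvPolynomial IsLocalRing

variable {E K R : Type u} [NormedField E] [IsUltrametricDist E] [NormedField K]
  [IsUltrametricDist K] [Algebra E K] [CommRing R] [Algebra (integers E) R] {ι : Type*}
  {f : ι → K ⊗[integers E] R} {r : ι → ℝ} {π : integers K} {q : ℕ} {α β : Polynomial ℤ}
  {G : Fin 2 → MvPolynomial (Fin 3) (integers K)} {r₀ r₁ : MvPolynomial (Fin 3) (integers K)}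
  {θ : CurveAlgebra G →ₐ[integers K] affinoidFormalModel f r}

lemma IsCompletionMap.canonicalReduction (h : IsCompletionMap π θ)
    (hm : maximalIdeal (integers K) = Ideal.span {π}) (hπ : π ≠ 0) (hq : (q : integers K) = 0)
    (h0 : G 0 = X 0 + Polynomial.aeval (X 2) α + C π * r₀)
    (h1 : G 1 = X 1 ^ (q ^ 2) - X 1 + X 0 * Polynomial.aeval (X 2) β + C π * r₁) :
    IsSmoothlyAlgebraizable (integers K) (affinoidPowerBounded f r) ∧
    (∃ e : (affinoidPowerBounded f r ⧸ affinoidTopologicallyNilpotent f r) ≃ₐ[integers K]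
        affinoidPowerBounded f r ⊗[integers K] ResidueField (integers K),
      ∀ a, e (Ideal.Quotient.mk _ a) = a ⊗ₜ 1) ∧
    Nonempty (affinoidPowerBounded f r ⊗[integers K] ResidueField (integers K) ≃ₐ[integers K]
      MvPolynomial (Fin 2) (ResidueField (integers K)) ⧸
        Ideal.span {artinSchreier (ResidueField (integers K)) q (α * β)}) := by
  have hL := isLattice_includeRight hm (fun d => h.eq_zero_of_curveAlgebra hπ d)
  exact IsLattice.canonicalReduction (A := affinoidAlgebra f r) hL h hm hπ hq h0 h1

end AffinoidReduction

section LubinTate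

open MvPolynomial IsLocalRing

variable {F E K R : Type u} [NontriviallyNormedField F]
  [IsUltrametricDist F] [ProperSpace F] [NormedField E] [IsUltrametricDist E]
  [NormedField K] [IsUltrametricDist K] [Algebra E K] {j : integers F →+* integers E}
  {F₀ : FormalModule ((residue (integers E)).comp j)} {k : ℕ} [CommRing R] [IsLocalRing R]
  [Algebra (integers E) R] [IsCoefficientAlgebra (integers E) R] {T : LevelDeformation F₀ k R}
  {u : R} {ϖ : integers F}

/-- The fields E and K enter only through their value groups: ϖ generates that of E and the torsion
point π that of K. -/
theorem LevelDeformation.IsUniversal.canonicalReduction (hT : T.IsUniversal) (p : ℕ)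
    [Fact p.Prime] [CharP F p]
    {q : ℕ} (hq : q = Nat.card (ResidueField (integers F))) (hϖ : Irreducible ϖ) (hk : 2 ≤ k)
    (hj : ∀ a, ‖(j a : E)‖ = ‖(a : F)‖) (hn : ∀ y : E, ‖algebraMap E K y‖ = ‖y‖)
    (hE : ∀ z : E, z ≠ 0 → ∃ n : ℤ, ‖z‖ = ‖(ϖ : F)‖ ^ n)
    (hF₀ : F₀.HasStandardForm q ϖ (PowerSeries.X ^ (q ^ 2)))
    (hM : T.M.HasStandardForm q ϖ (ltSeries q (((algebraMap (integers E) R).comp j) ϖ) u))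
    {ζ : E} (hζ : ζ ^ (q ^ 2) = ζ) (hζ' : ζ ^ q ≠ ζ) {π : K}
    (hπ : IsPrimitiveTorsion q (algebraMap E K (j ϖ)) k π)
    (hK : ∀ z : K, z ≠ 0 → ∃ n : ℤ, ‖z‖ = ‖π‖ ^ n) :
    let f : Fin 3 → K ⊗[integers E] R := cmFunctions q (algebraMap E K ζ) π u
      (T.φ (Pi.single 0 1)) (T.φ (Pi.single 1 1))
    let r : Fin 3 → ℝ := fun i => ‖(ϖ : F)‖ ^ cmValuations q k i
    IsSmoothlyAlgebraizable (integers K) (affinoidPowerBounded f r) ∧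
    (∃ e : (affinoidPowerBounded f r ⧸ affinoidTopologicallyNilpotent f r) ≃ₐ[integers K]
        affinoidPowerBounded f r ⊗[integers K] ResidueField (integers K),
      ∀ a, e (Ideal.Quotient.mk _ a) = a ⊗ₜ 1) ∧
    Nonempty (affinoidPowerBounded f r ⊗[integers K] ResidueField (integers K) ≃ₐ[integers K]
      MvPolynomial (Fin 2) (ResidueField (integers K)) ⧸ Ideal.span
        {(X 0 ^ (q ^ 2) - X 0 - (X 1 ^ (q * (q + 1)) - X 1 ^ (q + 1)) ^ (q ^ (k - 1)) :
          MvPolynomial (Fin 2) (ResidueField (integers K)))}) := by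
  intro f r
  have hp : p.Prime := Fact.out
  obtain ⟨g₀, hg₀, hqf⟩ := natCard_residueField (L := F) p
  rw [← hq] at hqf
  have hq2 : 2 ≤ q := hqf ▸ hp.two_le.trans (Nat.le_self_pow (by omega) p)
  have hϖ0 := norm_uniformizer_pos hϖ
  have hϖ1 := norm_uniformizer_lt_one hϖ
  have hp𝒪 : (p : integers F) = 0 := Subtype.ext (by simp)
  have hpW : (p : integers E) = 0 := by rw [← map_natCast j, hp𝒪, map_zero]
  have hpE : (p : E) = 0 := congrArg Subtype.val hpW
  have hpK : (p : K) = 0 := by rw [← map_natCast (algebraMap E K), hpE, map_zero]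
  have hpR : (p : R) = 0 := by rw [← map_natCast (algebraMap (integers E) R), hpW, map_zero]
  have hpκ : (p : ResidueField (integers K)) = 0 := by
    rw [← map_natCast (residue (integers K)), show (p : integers K) = 0 from Subtype.ext hpK,
      map_zero]
  -- the rings of integers
  have hE' : ∀ z : E, z ≠ 0 → ∃ n : ℤ, ‖z‖ = ‖(j ϖ : E)‖ ^ n := by rwa [hj]
  have hdvrE := isDiscreteValuationRing_integers (by rwa [hj]) (by rwa [hj]) hE'
  have hW : maximalIdeal (integers E) = Ideal.span {j ϖ} :=
    (irreducible_of_norm (by rwa [hj]) (by rwa [hj]) hE').maximalIdeal_eq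
  have := finite_quotient_maximalIdeal_pow hϖ k
  have := Fintype.ofFinite (integers F ⧸ maximalIdeal (integers F) ^ k)
  have hmF := maximalIdeal_integers_eq_span hϖ
  have hϖm : ϖ ∈ maximalIdeal (integers F) := hmF ▸ Ideal.mem_span_singleton_self _
  obtain ⟨d⟩ := nonempty_digits p hϖ
  rw [← hq] at d
  have hπn := norm_of_isPrimitiveTorsion hq2 (by omega) (by rwa [hn, hj]) (by rwa [hn, hj]) hπ
  rw [hn, hj, mul_comm] at hπn
  have he : (q ^ 2 - 1) * q ^ (2 * (k - 1)) ≠ 0 :=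
    (Nat.mul_pos (Nat.sub_pos_of_lt (by nlinarith)) (by positivity)).ne'
  have hπ0 : 0 < ‖π‖ := by
    rcases (norm_nonneg π).eq_or_lt with h | h
    · rw [← h, zero_pow he] at hπn
      exact absurd hπn hϖ0.ne
    · exact h
  have hπ1 : ‖π‖ < 1 := by
    by_contra! h
    exact hϖ1.not_ge (hπn ▸ one_le_pow₀ h)
  obtain ⟨π, rfl⟩ : ∃ π' : integers K, (π' : K) = π := ⟨⟨π, (mem_integers _).2 hπ1.le⟩, rfl⟩
  have hdvrK := isDiscreteValuationRing_integers hπ0 hπ1 hK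
  have hirr := irreducible_of_norm hπ0 hπ1 hK
  have hm : maximalIdeal (integers K) = Ideal.span {π} := hirr.maximalIdeal_eq
  have hπm : π ∈ maximalIdeal (integers K) := hm ▸ Ideal.mem_span_singleton_self _
  have hπne : π ≠ 0 := hirr.ne_zero
  let i : integers E →+* integers K := integersMap (algebraMap E K) hn
  have hi : ∀ w, (i w : K) = algebraMap E K w := fun _ => rfl
  have hij : Function.Injective (i.comp j) := by
    rw [injective_iff_map_eq_zero]
    intro a ha
    have : ‖((i.comp j) a : K)‖ = ‖(a : F)‖ := by rw [RingHom.comp_apply, hi, hn, hj]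
    rw [ha] at this
    exact Subtype.ext (norm_eq_zero.1 (this.symm.trans norm_zero))
  have hζ0 : ζ ≠ 0 := fun h => hζ' (by rw [h, zero_pow (by omega)])
  have hζn : ‖ζ‖ = 1 := norm_eq_one_of_pow_eq_self (by nlinarith) hζ hζ0
  let ζ' : integers E := ⟨ζ, (mem_integers _).2 hζn.le⟩
  -- the curve
  have h : CMParameters q k (i (j ϖ)) π (i ζ') := by
    refine cmParameters_integers hp hqf hpK hq2 hk (by rwa [hi, hn, hj]) (by rwa [hi, hn, hj]) hπ
      ?_ ?_
    · rw [← map_pow]; exact congrArg i (Subtype.ext hζ)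
    · rw [← map_pow]
      exact fun h => hζ' ((algebraMap E K).injective (congrArg Subtype.val h))
  obtain ⟨M⟩ := h.nonempty_curveModel hπm hπne
  have hqA : (q : integers K) = 0 := h.natCast_eq_zero
  obtain ⟨s, hs⟩ := curveJacobian_eq hqA M.G_zero M.G_one
  have hexp : ∀ t, cmExponent q k t ≠ 0 := fun t => by
    obtain ⟨-, h2, h3, h4⟩ := h.succ_le_exponent
    fin_cases t
    · change cmExponent q k 0 ≠ 0; omega
    · change cmExponent q k 1 ≠ 0; omega
    · change cmExponent q k 2 ≠ 0; omega
  have hc : ∀ t, M.c t ≠ 0 := fun t ht => by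
    have := M.associated t
    rw [ht] at this
    exact pow_ne_zero _ hπne (((associated_zero_iff_eq_zero _).1 this.symm))
  have hπc : ∀ t, π ∣ M.c t := fun t =>
    (dvd_pow_self π (hexp t)).trans (M.associated t).symm.dvd
  have hπϖ : π ∣ i (j ϖ) := (dvd_pow_self π he).trans h.associated.symm.dvd
  have hcn : ∀ t, ‖(M.c t : K)‖ = ‖(π : K)‖ ^ cmExponent q k t := fun t => by
    obtain ⟨v, hv⟩ := M.associated t
    have h5 := congrArg (fun x : integers K => ‖(x : K)‖) hv
    have h6 := (isUnit_integers (v : integers K)).1 v.isUnit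
    simpa [h6] using h5
  have hr : r = ![‖(M.c 0 : K)‖, ‖(M.c 2 : K)‖, ‖(M.c 1 : K)‖] := by
    rw [hcn, hcn, hcn]
    exact rpow_cmValuations hq2 hk (norm_nonneg _) hπn
  have hR : ∀ x : R, ∃ w, x - algebraMap (integers E) R w ∈
      Ideal.span (insert (algebraMap (integers E) R (j ϖ))
        {u, T.φ (Pi.single 0 1), T.φ (Pi.single 1 1)}) := fun x => by
    rw [← hT.maximalIdeal_eq_span hp hqf hpR hq2 d hϖm hW hF₀ hM]
    exact IsCoefficientAlgebra.exists_sub_mem x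
  -- the completion of the curve
  have hC := curveAlgebra_eq_zero_of_mul_eq_zero M.G hπne
  obtain ⟨B, _, _, ιC, hιC⟩ : ∃ (B : Type u) (_ : CommRing B) (_ : Algebra (integers K) B)
      (ιC : CurveAlgebra M.G →ₐ[integers K] B), IsCompletionMap π ιC :=
    ⟨_, _, _, _, isCompletionMap_adicCompletion (A := integers K) (C := CurveAlgebra M.G)
      (π := π) rfl⟩
  have hB : ∀ b, algebraMap (integers K) B π * b = 0 → b = 0 := fun b hb =>
    hιC.eq_zero_of_mul_eq_zero hC hb
  have hαβ : (M.α * M.β).coeff 0 = 0 := by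
    rw [M.α_mul_β, Polynomial.mul_coeff_zero, Polynomial.coeff_X_pow, if_neg, zero_mul]
    have : 0 < q ^ (k - 1) * q := by positivity
    omega
  have hne : Ideal.span {algebraMap (integers K) B π} ≠ ⊤ := fun htop => by
    have h7 : algebraMap (integers K) B π ^ 1 ∣ ιC 1 := by
      rw [pow_one, ← Ideal.mem_span_singleton, htop]
      exact Submodule.mem_top
    have h8 := hιC.dvd 1 1 h7
    rw [pow_one] at h8
    exact not_dvd_one_curveAlgebra hm (by omega) hqA M.G_zero M.G_one hαβ h8
  have hz : ∀ t, aeval (fun s => ιC (curveCoord M.G s)) (M.G t) = 0 := fun t => by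
    have e : (aeval fun s => ιC (curveCoord M.G s)) = ιC.comp (aeval (curveCoord M.G)) := by
      ext s; simp
    rw [e, AlgHom.comp_apply, aeval_curveCoord_relation, map_zero]
  -- The universal point of the completed curve gives a point of R. It yields the map from the
  -- affinoid model back to the completed curve, so the model satisfies no relations beyond those of
  -- the curve.
  obtain ⟨g, hg, hg0, hg1, hg2⟩ : ∃ g : R →+* B,
      (∀ w, g (algebraMap (integers E) R w) = algebraMap (integers K) B (i w)) ∧
      g u = algebraMap (integers K) B (M.c 0) * ιC (curveCoord M.G 0) ∧
      g (T.φ (Pi.single 0 1)) = algebraMap (integers K) B π +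
        algebraMap (integers K) B (M.c 2) * ιC (curveCoord M.G 2) ∧
      g (T.φ (Pi.single 1 1)) = algebraMap (integers K) B (i ζ') * algebraMap (integers K) B π +
        (algebraMap (integers K) B (i ζ') ^ q * (algebraMap (integers K) B (M.c 2) *
          ιC (curveCoord M.G 2)) - algebraMap (integers K) B (M.c 1) * ιC (curveCoord M.G 1)) := by
    let _ : Algebra (integers E) B := ((algebraMap (integers K) B).comp i).toAlgebra
    obtain ⟨g, hg0, hg1, hg2⟩ := hT.exists_algHom_of_curve hp hqf hpW d hmF hϖ hW hF₀ hM hij h M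
      (B := B) (fun _ => rfl) hιC.complete hne hB hz
    exact ⟨g, fun w => g.commutes w, hg0, hg1, hg2⟩
  obtain ⟨θ, hθ⟩ := exists_isCompletionMap_affinoidFormalModel hi hm M hc hπc hπϖ hr
    (LevelDeformation.iterate_φ hM hϖm _) (LevelDeformation.iterate_φ hM hϖm _) hR hs hιC hB g hg
    hg0 hg1 hg2
  obtain ⟨h1, h2, h3⟩ := hθ.canonicalReduction hm hπne hqA M.G_zero M.G_one
  rw [artinSchreier_eq hp hqf hpκ M.α_mul_β] at h3
  exact ⟨h1, h2, h3⟩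

end LubinTate

end LubinTateCurve

namespace LubinTateCurve

/-! ### The theorem for the field generated by the torsion point. -/

section PrimitiveTorsion

variable {L L' : Type*} [Field L] [Field L'] {q k : ℕ} {ϖ x : L}

lemma isPrimitiveTorsion_map_iff (g : L →+* L') :
    IsPrimitiveTorsion q (g ϖ) k (g x) ↔ IsPrimitiveTorsion q ϖ k x := by
  have h : ∀ n, (fun y => y ^ (q ^ 2) + g ϖ * y)^[n] (g x) =
      g ((fun y => y ^ (q ^ 2) + ϖ * y)^[n] x) := fun n => (map_ltOpZero_iterate g ϖ x n).symm
  rw [IsPrimitiveTorsion, IsPrimitiveTorsion, h, h, map_eq_zero, Ne, map_eq_zero]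

end PrimitiveTorsion

end LubinTateCurve

set_option maxHeartbeats 1000000 in
open scoped TensorProduct in
open LubinTateCurve IsLocalRing in
theorem mainTheorem4 {p : ℕ} [Fact p.Prime] {F Fbar : Type u}
    -- a non-archimedean local field of characteristic `p`, and a separable closure
    [NontriviallyNormedField F] [IsUltrametricDist F] [ProperSpace F] [CharP F p]
    [NormedField Fbar] [NormedAlgebra F Fbar] [IsUltrametricDist Fbar] [IsSepClosure F Fbar]
    (q : ℕ) (hq : q = Nat.card (ResidueField (integers F)))
    (ϖ : integers F) (hϖ : Irreducible ϖ)
    -- the formal module of height two over the residue field of the completion of `F^ur`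
    (F₀ : FormalModule ((residue (integers (completedUnramified F Fbar))).comp
      (integersToCompletedUnramified F Fbar)))
    (hF₀ : F₀.HasStandardForm q ϖ (PowerSeries.X ^ (q ^ 2)))
    (k : ℕ) (hk : 2 ≤ k)
    -- the universal deformation with level structure, over `R = R(𝔭ᵏ)`, and the parameter `u`
    (R : Type u) [CommRing R] [IsLocalRing R] [Algebra (integers (completedUnramified F Fbar)) R]
    [IsCoefficientAlgebra (integers (completedUnramified F Fbar)) R]
    (T : LevelDeformation F₀ k R) (hT : T.IsUniversal) (u : R)
    (hu : T.M.HasStandardForm q ϖ (PowerSeries.X ^ (q ^ 2) + PowerSeries.C u * PowerSeries.X ^ q +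
      PowerSeries.C (algebraMap (integers (completedUnramified F Fbar)) R
        (integersToCompletedUnramified F Fbar ϖ)) * PowerSeries.X))
    -- the data of the point with complex multiplication
    (ζ : completedUnramified F Fbar) (hζ : ζ ^ (q ^ 2) = ζ) (hζ' : ζ ^ q ≠ ζ)
    (ϖk : Fbar) (hϖk : IsPrimitiveTorsion q (algebraMap F Fbar ϖ) k ϖk) :
    let K := extensionBy F Fbar ϖk
    let f : Fin 3 → K ⊗[integers (completedUnramified F Fbar)] R :=
      cmFunctions q (algebraMap (completedUnramified F Fbar) K ζ)
        (IntermediateField.AdjoinSimple.gen (completedUnramified F Fbar)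
          (ϖk : UniformSpace.Completion Fbar))
        u (T.φ (Pi.single 0 1)) (T.φ (Pi.single 1 1))
    -- `v(x) ≥ a` for the valuation with `v(ϖ) = 1` means `‖x‖ ≤ ‖ϖ‖ ^ a`
    let r : Fin 3 → ℝ := fun i => ‖(ϖ : F)‖ ^ cmValuations q k i
    -- the residue field of `K` is that of the completion of `F^ur`
    (∀ x : integers K, ∃ y : integers (completedUnramified F Fbar),
      ‖(x : K) - algebraMap (completedUnramified F Fbar) K y‖ < 1) ∧
    IsSmoothlyAlgebraizable (integers K) (affinoidPowerBounded f r) ∧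
    (∃ e : (affinoidPowerBounded f r ⧸ affinoidTopologicallyNilpotent f r) ≃ₐ[integers K]
        affinoidPowerBounded f r ⊗[integers K] ResidueField (integers K),
      ∀ a, e (Ideal.Quotient.mk _ a) = a ⊗ₜ 1) ∧
    Nonempty (affinoidPowerBounded f r ⊗[integers K] ResidueField (integers K) ≃ₐ[integers K]
      MvPolynomial (Fin 2) (ResidueField (integers K)) ⧸ Ideal.span
        {(MvPolynomial.X 0 ^ (q ^ 2) - MvPolynomial.X 0 -
          (MvPolynomial.X 1 ^ (q * (q + 1)) - MvPolynomial.X 1 ^ (q + 1)) ^ (q ^ (k - 1)) :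
            MvPolynomial (Fin 2) (ResidueField (integers K)))}) := by
  intro K f r
  have hp : p.Prime := Fact.out
  obtain ⟨g, hg, hqf⟩ := natCard_residueField (L := F) p
  have hq2 : 2 ≤ q := hq ▸ hqf ▸ hp.two_le.trans (Nat.le_self_pow (by omega) p)
  have hϖ0 := norm_uniformizer_pos hϖ
  have hϖ1 := norm_uniformizer_lt_one hϖ
  have hn : ∀ y : completedUnramified F Fbar,
      ‖algebraMap (completedUnramified F Fbar) (UniformSpace.Completion Fbar) y‖ = ‖y‖ :=
    fun _ => rfl
  have hj : ∀ a : F, ‖toCompletedUnramified F Fbar a‖ = ‖a‖ := norm_toCompletedUnramified F Fbar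
  have hE : ∀ z : completedUnramified F Fbar, z ≠ 0 → ∃ n : ℤ, ‖z‖ = ‖(ϖ : F)‖ ^ n :=
    fun z hz => exists_zpow_norm_eq_completedUnramified p hϖ z hz
  have hE' : ∀ z : completedUnramified F Fbar, z ≠ 0 →
      ∃ n : ℤ, ‖z‖ = ‖toCompletedUnramified F Fbar ϖ‖ ^ n := by rwa [hj]
  have hx : IsPrimitiveTorsion q (algebraMap (completedUnramified F Fbar)
      (UniformSpace.Completion Fbar) (toCompletedUnramified F Fbar ϖ)) k
      (ϖk : UniformSpace.Completion Fbar) :=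
    (isPrimitiveTorsion_map_iff
      (UniformSpace.Completion.coeRingHom : Fbar →+* UniformSpace.Completion Fbar)).2 hϖk
  refine ⟨fun x => ?_, ?_⟩
  -- The value group of E is generated by ‖ϖ‖, so the torsion extension is totally ramified and has
  -- no new residues.
  · obtain ⟨y, hy, hxy⟩ := exists_norm_sub_lt_one_totallyRamified hn hq2 (by omega) (by rwa [hj])
      (by rwa [hj]) hE' hx (x : K).2 ((mem_integers _).1 x.2)
    exact ⟨⟨y, (mem_integers _).2 hy⟩, hxy⟩
  · refine hT.canonicalReduction (K := extensionBy F Fbar ϖk) (π := IntermediateField.AdjoinSimple.gen (completedUnramified F Fbar)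
      (ϖk : UniformSpace.Completion Fbar)) p hq hϖ hk (fun a => hj a) (fun _ => rfl) hE hF₀ hu hζ hζ' ?_ ?_
    · exact (isPrimitiveTorsion_map_iff (algebraMap K (UniformSpace.Completion Fbar))).1 hx
    · intro z hz
      exact exists_zpow_norm_eq_totallyRamified hn hq2 (by omega) (by rwa [hj]) (by rwa [hj]) hE'
        hx z.2 fun h => hz (Subtype.ext h)
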